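/- **Setting.** Fix $\alpha,\theta\in(0,1)$ with $\theta<1-\alpha$, $\beta\in(0,1-\alpha)$, $\varpi>0$, and constants $\rho_0,\rho_1,\rho_2,\dots$ bounded away from $0$ and from $\infty$. For $p\in\mathbb N$ let $n=\lfloor p^\theta\rfloor$. For $\mu\in\mathbb R^p$ the data are $$X_i=\tilde\ell_i\,\mu+Z_i,\qquad 1\le i\le n,$$ where $Z_i\sim N(0,I_p)$ and the labels $\ell_i\in\{1,-1\}$ are all independent, $\mathbb P(\ell_i=1)=\varpi/(1+\varpi)$, and $\tilde\ell_i=1$ if $\ell_i=1$, $\tilde\ell_i=-\varpi$ if $\ell_i=-1$. For real $r$ let $\mathcal U(\alpha,\beta,r)$ be the set of all $\mu\in\mathbb R^p$ for which there are $m=\lfloor p^{1-\alpha-\beta}\rfloor$ ordered, non-empty, disjoint intervals $I_1<\dots<I_m$ of coordinates with $|I_g|=\lfloor\rho_g p^\alpha\rfloor$, such that the distance between the last element of $I_g$ and the first element of $I_{g+1}$ exceeds $\rho_0\log(p)\,p^\alpha$, $\mu$ is constant on each $I_g$ with value $\pm p^{-r}$, and $\mu_j=0$ outside the intervals. A clustering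 procedure is a (possibly randomized) measurable map $\hat\ell$ from the data to $\{1,-1\}^n$; its risk is $$\operatorname{Hamm}_{\rm clu}(\hat\ell;\mu,\varpi)=\inf_{s=\pm1}\,n^{-1}\,\mathbb E\,\bigl|\{i:\hat\ell_i\ne s\,\ell_i\}\bigr| .$$ Define $$\eta^{\rm clu}_{\theta,\alpha}(\beta)=\begin{cases}(1+\theta+\alpha-2\beta)/4,&\beta\le(1-\theta-\alpha)/2,\\(\theta+\alpha)/2,&(1-\theta-\alpha)/2<\beta\le1-\theta-\alpha,\\(1-\beta)/2,&1-\theta-\alpha<\beta<1-\alpha,\end{cases}$$ $$\tilde\eta^{\rm clu}_{\theta,\alpha}(\beta)=\begin{cases}(1+\theta+\alpha-2\beta)/4,&\beta\le(1-\alpha)/2,\\\theta/4+\alpha/2,&(1-\alpha)/2<\beta\le1-\theta/2-\alpha,\\(1-\beta)/2,&1-\theta/2-\alpha<\beta<1-\alpha.\end{cases}$$ **Polynomial time.** Algorithms are programs for a randomized real random-access machine: index registers with addition and truncated subtraction, arrays of reals with finitely many real constants, $+,-,\times,\div,\sqrt{\ }$ and comparisons, draws of independent $N(0,1)$ numbers,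 conditionals and while-loops, each step at unit cost. An algorithm is polynomial-time if it is one program which, on every input, halts within a number of steps that is polynomial in $n+p$. **Low-degree conjecture.** For parameters as above and $0<r<1$, let $\mathbb P_0$ be the law of $n$ independent $N(0,I_p)$ vectors, and let $\mathbb P_1$ be the law of $n$ vectors that, given $\mu$ drawn uniformly from the finite set $\mathcal U(\alpha,\beta,r)$, are independent with law $\frac{\varpi}{1+\varpi}N(\mu,I_p)+\frac1{1+\varpi}N(-\varpi\mu,I_p)$. Let $\Lambda=d\mathbb P_1/d\mathbb P_0$, and let $\Lambda_{(D)}$ be its orthogonal projection in $L^2(\mathbb P_0)$ onto the polynomials of degree at most $D=(\log p)^{1.01}$. The conjecture says that for all such parameters, if $\mathbb E_0\Lambda_{(D)}^2\to1$ as $p\to\infty$, then $\mathbb P_1(\text{reject})-\mathbb P_0(\text{reject})\to0$ for every polynomial-time (possibly randomized) test. **Theorem.** (1) If $r>\eta^{\rm clu}_{\theta,\alpha}(\beta)$, then for every sequence of clustering procedures $\hat\ell=\hat\ell^{(p)}$, $$\liminf_{p\to\infty}\ \sup_{\mu\in\mathcal U(\alpha,\beta,r)}\operatorname{Hamm}_{\rm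 clu}(\hat\ell;\mu,\varpi)\ \ge\ \frac{\min\{1,\varpi\}}{1+\varpi}.$$ (2) Assume the low-degree conjecture above. If $r>\tilde\eta^{\rm clu}_{\theta,\alpha}(\beta)$, then the same inequality holds for every polynomial-time clustering procedure $\hat\ell$. -/

import Mathlib

open MeasureTheory ProbabilityTheory Filter Topology

noncomputable section

namespace BlockClustering

/-! # The block signal class -/

/-- `μ ∈ ℝ^p` is constant, equal to `± τ`, on each of `m` ordered non-empty blocks
`{j g, …, j g + len g - 1}` of coordinates and vanishes elsewhere; the distance between the last
element of a block and the first element of the next one is larger than `gap`. (The coordinates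
are numbered from `0`.) -/
def IsBlockSignal {p : ℕ} (m : ℕ) (len : Fin m → ℕ) (gap τ : ℝ) (μ : Fin p → ℝ) : Prop :=
  ∃ (j : Fin m → ℕ) (t : Fin m → ℝ),
    (∀ g, 0 < len g ∧ j g + len g ≤ p) ∧
    (∀ g g' : Fin m, (g' : ℕ) = g + 1 →
      j g + len g ≤ j g' ∧ gap < (j g' : ℝ) - ((j g : ℝ) + (len g : ℝ) - 1)) ∧
    (∀ g, |t g| = τ) ∧
    (∀ g, ∀ k : Fin p, j g ≤ k → (k : ℕ) < j g + len g → μ k = t g) ∧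
    (∀ k : Fin p, (∀ g, ¬ (j g ≤ k ∧ (k : ℕ) < j g + len g)) → μ k = 0)

/-- The class `𝒰(α, β, r)` in dimension `p`: `⌊p^(1-α-β)⌋` blocks, the `g`-th of size
`⌊ρ_g p^α⌋` (`g = 1, 2, …`), signal strength `p^(-r)`, separation `ρ_0 log(p) p^α`. -/
def signalClass (ρ : ℕ → ℝ) (α β r : ℝ) (p : ℕ) : Set (Fin p → ℝ) :=
  {μ | IsBlockSignal ⌊(p : ℝ) ^ (1 - α - β)⌋₊
    (fun g => ⌊ρ ((g : ℕ) + 1) * (p : ℝ) ^ α⌋₊)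
    (ρ 0 * Real.log p * (p : ℝ) ^ α) ((p : ℝ) ^ (-r)) μ}

/-- The sample size `n = p^θ`, rounded down. -/
def sampleSize (θ : ℝ) (p : ℕ) : ℕ := ⌊(p : ℝ) ^ θ⌋₊

/-! # The model and the clustering risk -/

/-- An `n × p` data matrix; row `i` is the observation `X_i`. -/
abbrev Data (n p : ℕ) : Type := Fin n → Fin p → ℝ

/-- External randomness available to a randomized procedure. -/
abbrev Seed : Type := ℕ → ℝ

/-- The seed is a sequence of independent standard normal variables. -/
def seedLaw : Measure Seed := Measure.infinitePi fun _ : ℕ => gaussianReal 0 1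

/-- The Gaussian distribution `N(μ, I_p)`. -/
def gaussianVec {p : ℕ} (μ : Fin p → ℝ) : Measure (Fin p → ℝ) :=
  Measure.pi fun j => gaussianReal (μ j) 1

/-- The law of a label `ℓ_i ∈ {1, -1}`: it is `1` with probability `ϖ / (1 + ϖ)`. -/
def labelLaw (ϖ : ℝ) : Measure ℤˣ :=
  ENNReal.ofReal (ϖ / (1 + ϖ)) • Measure.dirac 1 + ENNReal.ofReal (1 / (1 + ϖ)) • Measure.dirac (-1)

/-- The generalized label: `1` for the label `1` and `-ϖ` for the label `-1`. -/
def genLabel (ϖ : ℝ) (l : ℤˣ) : ℝ := if l = 1 then 1 else -ϖ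

/-- The observations `X_i = genLabel(ℓ_i) μ + Z_i`. -/
def observe {n p : ℕ} (ϖ : ℝ) (μ : Fin p → ℝ) (l : Fin n → ℤˣ) (Z : Data n p) : Data n p :=
  fun i j => genLabel ϖ (l i) * μ j + Z i j

/-- The joint law of labels, standard Gaussian noise and the seed (all independent). -/
def modelLaw (n p : ℕ) (ϖ : ℝ) : Measure (((Fin n → ℤˣ) × Data n p) × Seed) :=
  ((Measure.pi fun _ : Fin n => labelLaw ϖ).prod
    (Measure.pi fun _ : Fin n => gaussianVec (0 : Fin p → ℝ))).prod seedLaw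

/-- A (possibly randomized) clustering procedure, before any measurability requirement. -/
abbrev Clustering (n p : ℕ) : Type := Data n p → Seed → Fin n → ℤˣ

/-- The clustering risk `inf_{s = ± 1} n⁻¹ 𝔼 |{i : ℓ̂_i ≠ s ℓ_i}|`. -/
def hammClu {n p : ℕ} (ϖ : ℝ) (μ : Fin p → ℝ) (ell : Clustering n p) : ℝ :=
  ⨅ s : ℤˣ, (n : ℝ)⁻¹ * ∫ w, ((Finset.univ.filter fun i : Fin n =>
    ell (observe ϖ μ w.1.1 w.1.2) w.2 i ≠ s * w.1.1 i).card : ℝ) ∂(modelLaw n p ϖ)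

/-- The worst-case clustering risk over `𝒰(α, β, r)`. -/
def worstRisk {n p : ℕ} (ρ : ℕ → ℝ) (α β r ϖ : ℝ) (ell : Clustering n p) : ℝ :=
  ⨆ μ : signalClass ρ α β r p, hammClu ϖ μ.1 ell

/-! # The boundaries -/

/-- The statistical boundary `η^clu` (continuous in `β`). -/
def etaClu (θ α β : ℝ) : ℝ :=
  if β ≤ (1 - θ - α) / 2 then (1 + θ + α - 2 * β) / 4
  else if β ≤ 1 - θ - α then (θ + α) / 2
  else (1 - β) / 2

/-- The computational boundary `η̃^clu` (continuous in `β`). -/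
def etaCluComp (θ α β : ℝ) : ℝ :=
  if β ≤ (1 - α) / 2 then (1 + θ + α - 2 * β) / 4
  else if β ≤ 1 - θ / 2 - α then θ / 4 + α / 2
  else (1 - β) / 2

/-! # Polynomial time: a randomized real random-access machine with a step count -/

/-- A memory cell, addressed by the literal name of a two-dimensional array and by the names of two
index registers, which hold the row and the column. -/
structure Cell where
  arr : ℕ
  row : ℕ
  col : ℕ

/-- Memory: natural-number index registers, two-dimensional arrays of reals, and the number of
random numbers drawn so far. -/
structure RamState where
  idx : ℕ → ℕ
  mem : ℕ → ℕ → ℕ → ℝ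
  pos : ℕ

/-- Elementary tests: comparison of two index registers, comparison of two real cells. -/
inductive RamTest where
  | idxLt (a b : ℕ)
  | realLt (x y : Cell)

/-- Programs. In each assignment the first argument is the target. Index registers admit only
addition and truncated subtraction, so that they stay exponentially bounded. A program may use
finitely many real constants. There is no rounding instruction. -/
inductive RamProg where
  | idxConst (a k : ℕ)
  | idxAdd (a b c : ℕ)
  | idxSub (a b c : ℕ)
  | realConst (x : Cell) (v : ℝ)
  | realOfIdx (x : Cell) (a : ℕ)
  | realAdd (x y z : Cell)
  | realSub (x y z : Cell)
  | realMul (x y z : Cell)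
  | realDiv (x y z : Cell)
  | realSqrt (x y : Cell)
  | draw (x : Cell)
  | seq (c d : RamProg)
  | cond (b : RamTest) (c d : RamProg)
  | loop (b : RamTest) (c : RamProg)

/-- The content of a cell. -/
def RamState.read (s : RamState) (x : Cell) : ℝ := s.mem x.arr (s.idx x.row) (s.idx x.col)

/-- Write `v` into a cell. -/
def RamState.write (s : RamState) (x : Cell) (v : ℝ) : RamState :=
  { s with
    mem := fun a i k =>
      if a = x.arr ∧ i = s.idx x.row ∧ k = s.idx x.col then v else s.mem a i k }

/-- Write `k` into the index register `a`. -/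
def RamState.setIdx (s : RamState) (a k : ℕ) : RamState :=
  { s with idx := Function.update s.idx a k }

/-- The truth of a test. -/
def RamTest.Holds (s : RamState) : RamTest → Prop
  | .idxLt a b => s.idx a < s.idx b
  | .realLt x y => s.read x < s.read y

open Classical in
/-- One step of the machine with random numbers `ω`. A configuration is the list of the programs
still to be executed, together with the memory; the machine has halted when the list is empty. -/
def ramStep (ω : Seed) : List RamProg × RamState → List RamProg × RamState
  | ([], s) => ([], s)
  | (.idxConst a k :: K, s) => (K, s.setIdx a k)
  | (.idxAdd a b c :: K, s) => (K, s.setIdx a (s.idx b + s.idx c))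
  | (.idxSub a b c :: K, s) => (K, s.setIdx a (s.idx b - s.idx c))
  | (.realConst x v :: K, s) => (K, s.write x v)
  | (.realOfIdx x a :: K, s) => (K, s.write x (s.idx a))
  | (.realAdd x y z :: K, s) => (K, s.write x (s.read y + s.read z))
  | (.realSub x y z :: K, s) => (K, s.write x (s.read y - s.read z))
  | (.realMul x y z :: K, s) => (K, s.write x (s.read y * s.read z))
  | (.realDiv x y z :: K, s) => (K, s.write x (s.read y / s.read z))
  | (.realSqrt x y :: K, s) => (K, s.write x (Real.sqrt (s.read y)))
  | (.draw x :: K, s) => (K, { s.write x (ω s.pos) with pos := s.pos + 1 })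
  | (.seq c d :: K, s) => (c :: d :: K, s)
  | (.cond b c d :: K, s) => if b.Holds s then (c :: K, s) else (d :: K, s)
  | (.loop b c :: K, s) => if b.Holds s then (c :: .loop b c :: K, s) else (K, s)

/-- The initial memory: `n` and `p` in the index registers `0` and `1`, the data in the array `0`,
zeros everywhere else. -/
def ramInit {n p : ℕ} (x : Data n p) : RamState where
  idx := fun a => if a = 0 then n else if a = 1 then p else 0
  mem := fun a i k =>
    if h : a = 0 ∧ i < n ∧ k < p then x ⟨i, h.2.1⟩ ⟨k, h.2.2⟩ else 0
  pos := 0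

/-- The configuration after `T` steps of the program `c` on the data `x`. -/
def ramRun {n p : ℕ} (c : RamProg) (x : Data n p) (ω : Seed) (T : ℕ) :
    List RamProg × RamState :=
  (ramStep ω)^[T] ([c], ramInit x)

open Classical in
/-- One program computes the procedures `ell p` for all `p`, and on every input it halts within a
number of steps that is polynomial in the sample size and the dimension. The label `i` is the sign
of the entry `(i, 0)` of the array `1`. -/
def PolyTimeClustering (n : ℕ → ℕ) (ell : (p : ℕ) → Clustering (n p) p) : Prop :=
  ∃ (c : RamProg) (C k : ℕ), ∀ (p : ℕ) (x : Data (n p) p) (ω : Seed),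
    (ramRun c x ω (C * (n p + p + 1) ^ k)).1 = [] ∧
    ∀ i : Fin (n p), ell p x ω i =
      if 0 < (ramRun c x ω (C * (n p + p + 1) ^ k)).2.mem 1 i 0 then 1 else -1

/-- The same for a family of (possibly randomized) tests, given by their rejection regions: the test
rejects when the entry `(0, 0)` of the array `1` is positive. -/
def PolyTimeTest (n : ℕ → ℕ) (R : (p : ℕ) → Set (Data (n p) p × Seed)) : Prop :=
  ∃ (c : RamProg) (C k : ℕ), ∀ (p : ℕ) (x : Data (n p) p) (ω : Seed),
    (ramRun c x ω (C * (n p + p + 1) ^ k)).1 = [] ∧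
    ((x, ω) ∈ R p ↔ 0 < (ramRun c x ω (C * (n p + p + 1) ^ k)).2.mem 1 0 0)

/-! # The testing problem and the low-degree conjecture -/

/-- The null law `P_0`: the observations are independent with law `N(0, I_p)`. -/
def nullLaw (n p : ℕ) : Measure (Data n p) :=
  Measure.pi fun _ : Fin n => gaussianVec (0 : Fin p → ℝ)

/-- The observations are independent with law
`ϖ / (1 + ϖ) N(μ, I_p) + 1 / (1 + ϖ) N(-ϖ μ, I_p)`. -/
def mixtureLaw (n : ℕ) {p : ℕ} (ϖ : ℝ) (μ : Fin p → ℝ) : Measure (Data n p) :=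
  Measure.pi fun _ : Fin n =>
    ENNReal.ofReal (ϖ / (1 + ϖ)) • gaussianVec μ +
      ENNReal.ofReal (1 / (1 + ϖ)) • gaussianVec (-ϖ • μ)

/-- The alternative law `P_1`: the mean vector `μ` is drawn uniformly from the (finite) class
`𝒰(α, β, r)`. -/
def altLaw (n p : ℕ) (ρ : ℕ → ℝ) (α β r ϖ : ℝ) : Measure (Data n p) :=
  ((signalClass ρ α β r p).ncard : ENNReal)⁻¹ •
    Measure.sum fun μ : signalClass ρ α β r p => mixtureLaw n ϖ μ.1

/-- Evaluation of a polynomial in the `n p` entries of the data matrix. -/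
def polyEval {n p : ℕ} (x : Data n p) (q : MvPolynomial (Fin n × Fin p) ℝ) : ℝ :=
  MvPolynomial.eval (fun a => x a.1 a.2) q

/-- `q` is the orthogonal projection, in `L²(P)`, of `Λ` onto the polynomials of degree at most
`D`. -/
def IsLowDegreeProjection {n p : ℕ} (P : Measure (Data n p)) (Λ : Data n p → ℝ) (D : ℝ)
    (q : MvPolynomial (Fin n × Fin p) ℝ) : Prop :=
  (q.totalDegree : ℝ) ≤ D ∧
  ∀ f : MvPolynomial (Fin n × Fin p) ℝ, (f.totalDegree : ℝ) ≤ D →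
    ∫ x, (Λ x - polyEval x q) * polyEval x f ∂P = 0

/-- `𝔼_0 Λ_{(D)}² = 1 + o(1)` as `p → ∞`, with `Λ = dP_1 / dP_0` and `D = (log p)^1.01`. -/
def LowDegreeNormTendsToOne (n : ℕ → ℕ) (P₀ P₁ : (p : ℕ) → Measure (Data (n p) p)) : Prop :=
  ∃ q : (p : ℕ) → MvPolynomial (Fin (n p) × Fin p) ℝ,
    (∀ p, IsLowDegreeProjection (P₀ p) (fun x => ((P₁ p).rnDeriv (P₀ p) x).toReal)
      (Real.log p ^ (1.01 : ℝ)) (q p)) ∧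
    Tendsto (fun p => ∫ x, polyEval x (q p) ^ 2 ∂(P₀ p)) atTop (𝓝 1)

/-- No polynomial-time (randomized) test does asymptotically better than a test that ignores the
data: its power minus its size tends to zero. -/
def PolyTimeIndistinguishable (n : ℕ → ℕ) (P₀ P₁ : (p : ℕ) → Measure (Data (n p) p)) : Prop :=
  ∀ R : (p : ℕ) → Set (Data (n p) p × Seed), PolyTimeTest n R →
    Tendsto (fun p => ((P₁ p).prod seedLaw).real (R p) - ((P₀ p).prod seedLaw).real (R p))
      atTop (𝓝 0)

/-- The low-degree polynomial conjecture for the testing problem of pure noise against the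
two-component mixture with block signals. -/
def LowDegreeConjecture : Prop :=
  ∀ (θ α β r ϖ : ℝ) (ρ : ℕ → ℝ),
    0 < α → 0 < θ → θ < 1 - α → 0 < β → β < 1 - α → 0 < r → r < 1 → 0 < ϖ →
    (∃ a b : ℝ, 0 < a ∧ ∀ g, a ≤ ρ g ∧ ρ g ≤ b) →
    LowDegreeNormTendsToOne (sampleSize θ) (fun p => nullLaw (sampleSize θ p) p)
      (fun p => altLaw (sampleSize θ p) p ρ α β r ϖ) →
    PolyTimeIndistinguishable (sampleSize θ) (fun p => nullLaw (sampleSize θ p) p)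
      (fun p => altLaw (sampleSize θ p) p ρ α β r ϖ)

end BlockClustering

end

open MeasureTheory ProbabilityTheory Filter Topology

noncomputable section

namespace BlockClustering

/-! The alignment A of a procedure is the mean of the products of assigned and true labels, and the
risk is (1 - |A|)/2. The mean of a label is (ϖ - 1)/(1 + ϖ), and min(1, ϖ)/(1 + ϖ) = (1 - |ϖ - 1|/(1
+ ϖ))/2. So it suffices to find in the class, for large p, a signal μ with |A| ≤ |ϖ - 1|/(1 + ϖ) +
ε. If r > (1 - β)/2, the norm of every μ in the class tends to 0, and an observation tells nothing
about its own label even if all other labels are known (`le_liminf_worstRisk_of_weak`). If r ≤ (1 -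
β)/2, the procedure is turned into a test of pure noise against a random signal of the slightly
larger strength p^(-r'), r' = r - 2^(-κ). The test draws a random pair i < j, discards row j, puts t
and u times two noisy copies of row i into rows i and j, scales everything by p^(-2^(-κ)), adds
fresh noise up to unit variance, and rejects if the procedure gives rows i and j the same label.
Pure noise stays pure noise. Under the alternative the result is data of strength p^(-r), in which
the means of rows i and j are t and u times the mean that row i should have. Let F(s, t) be the
excess of the agreement probability over the null, for a random pair of rows with means sμ and tμ.
If power minus size tends to 0 for all t, u, then ϖ F(t, u) + F(-ϖt, -ϖu) → 0. For ϖ ≠ 1 iteration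
of this relation contracts and gives F → 0; for ϖ = 1 the relation itself is enough to kill the
signed sum of the F(s, t) over the two generalized labels (`tendsto_sum_signOf_mul`). That signed
sum bounds the excess of the mean of A² over the squared mean label (`exists_sq_alignment_le`), and
the risk bound follows (`le_liminf_worstRisk_of_tests`). It remains to see that the two laws cannot
be told apart at r'. The second moment of the likelihood ratio is the sum over d of E⟨l, l'⟩^d E⟨μ,
μ'⟩^d / d!, for independent copies of the generalized labels and of the signal. Odd terms vanish by
symmetry. The labels are centred and bounded, so ⟨l, l'⟩ is sub-Gaussian with variance of order n;
the signals overlap in about λ = p^(1-α-2β) blocks, each contributing at most a multiple of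
p^(α-2r') with a random sign. Hence the term of degree 2k is at most 4 (C n p^(2α-4r') (λ + min(k,
n)))^k (`moment_term_le`, `eventually_sum_chiTerm`). Summing over all degrees needs r' >
(1+θ+α-2β)/4 and r' > (θ+α)/2, which gives total variation tending to 0 and part (1). For degrees up
to (log p)^1.01 the second condition weakens to r' > θ/4 + α/2; the truncated series is the squared
norm of the low-degree projection, by the orthogonality of directional Hermite polynomials
(`lowDegreeNormTendsToOne`). For r ≤ (1-β)/2 these conditions are what the boundaries say. Part (2)
also needs the test to run in polynomial time on the machine (`polyTimeTest_plantTest`). -/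

/-! # Counting block configurations -/

/-- The number of elements of `W` below `x`. -/
def rankIn (W : Finset ℕ) (x : ℕ) : ℕ := (W.filter (· < x)).card

/-- The set `W`, with its element of rank `g` moved to the right by `c g`. -/
def shiftedSet (c : ℕ → ℕ) (W : Finset ℕ) : Finset ℕ := W.image fun x => x + c (rankIn W x)

theorem rankIn_mono (W : Finset ℕ) : Monotone (rankIn W) := fun x y h =>
  Finset.card_le_card fun z hz => by
    simp only [Finset.mem_filter] at hz ⊢
    exact ⟨hz.1, hz.2.trans_le h⟩

theorem shift_strictMono {c : ℕ → ℕ} (hc : Monotone c) (W : Finset ℕ) :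
    StrictMono fun x => x + c (rankIn W x) := fun _ _ h =>
  add_lt_add_of_lt_of_le h (hc (rankIn_mono W h.le))

/-- The set can be rebuilt from left to right. At the first place x where the two sets differ, say x
only in the first, all ranks up to x agree. Equality of the remainders forces the shifted x into B,
so it is the shifted image of some y in the second set; strict monotonicity of the shifts excludes y
< x and y > x, and y = x is excluded by the choice of x. -/
theorem eq_of_remainder_eq {c : ℕ → ℕ} (hc : Monotone c) {B W₁ W₂ : Finset ℕ}
    (h₁ : B ⊆ shiftedSet c W₁) (h₂ : B ⊆ shiftedSet c W₂)
    (h : W₁.filter (fun x => x + c (rankIn W₁ x) ∉ B) =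
      W₂.filter (fun x => x + c (rankIn W₂ x) ∉ B)) : W₁ ⊆ W₂ := by
  by_contra hne
  -- the first place at which the two sets differ
  have hex : ∃ x, ¬ (x ∈ W₁ ↔ x ∈ W₂) := by
    by_contra hall
    push Not at hall
    exact hne fun x hx => (hall x).1 hx
  classical
  have key : ∀ {V₁ V₂ : Finset ℕ} {x : ℕ}, B ⊆ shiftedSet c V₂ →
      V₁.filter (fun x => x + c (rankIn V₁ x) ∉ B) =
        V₂.filter (fun x => x + c (rankIn V₂ x) ∉ B) →
      (∀ y < x, (y ∈ V₁ ↔ y ∈ V₂)) → x ∈ V₁ → x ∉ V₂ → False := by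
    intro V₁ V₂ x hV₂ hV hlt hx₁ hx₂
    have hb : x + c (rankIn V₁ x) ∈ B := by
      by_contra hb
      have : x ∈ V₁.filter (fun x => x + c (rankIn V₁ x) ∉ B) :=
        Finset.mem_filter.2 ⟨hx₁, hb⟩
      rw [hV] at this
      exact hx₂ (Finset.mem_filter.1 this).1
    have hrank : ∀ y ≤ x, rankIn V₁ y = rankIn V₂ y := by
      intro y hy
      unfold rankIn
      congr 1
      ext z
      simp only [Finset.mem_filter]
      constructor
      · rintro ⟨h1, h2⟩
        exact ⟨(hlt z (h2.trans_le hy)).1 h1, h2⟩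
      · rintro ⟨h1, h2⟩
        exact ⟨(hlt z (h2.trans_le hy)).2 h1, h2⟩
    obtain ⟨y, hy, hyb⟩ := Finset.mem_image.1 (hV₂ hb)
    rcases lt_trichotomy y x with hyx | hyx | hyx
    · rw [← hrank y hyx.le] at hyb
      exact absurd hyb (ne_of_lt (shift_strictMono hc V₁ hyx))
    · exact hx₂ (hyx ▸ hy)
    · rw [hrank x le_rfl] at hyb
      exact absurd hyb (ne_of_gt (shift_strictMono hc V₂ hyx))
  have hmin := Nat.find_spec hex
  have hlt : ∀ y < Nat.find hex, (y ∈ W₁ ↔ y ∈ W₂) := fun y hy => by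
    simpa using Nat.find_min hex hy
  by_cases hx : Nat.find hex ∈ W₁
  · exact key h₂ h hlt hx fun hx' => hmin ⟨fun _ => hx', fun _ => hx⟩
  · have hx' : Nat.find hex ∈ W₂ := by
      by_contra hx'
      exact hmin ⟨fun h => absurd h hx, fun h => absurd h hx'⟩
    exact key h₁ h.symm (fun y hy => (hlt y hy).symm) hx' hx

/-- Exactly |B| elements of W are shifted into B. The map that keeps the other m - |B| elements is
injective by `eq_of_remainder_eq`, even though the shifts depend on the ranks. -/
theorem card_shiftedSet_superset_le {c : ℕ → ℕ} (hc : Monotone c) (M m : ℕ) (B : Finset ℕ) :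
    (((Finset.range M).powersetCard m).filter (B ⊆ shiftedSet c ·)).card ≤
      M.choose (m - B.card) := by
  classical
  rw [← Finset.card_range M, ← Finset.card_powersetCard, Finset.card_range]
  refine Finset.card_le_card_of_injOn
    (fun W => W.filter fun x => x + c (rankIn W x) ∉ B) ?_ ?_
  · intro W hW
    simp only [Finset.coe_filter, Finset.mem_powersetCard, Set.mem_ofPred_eq] at hW
    obtain ⟨⟨hsub, hcard⟩, hB⟩ := hW
    simp only [Finset.mem_coe, Finset.mem_powersetCard]
    refine ⟨(Finset.filter_subset _ _).trans hsub, ?_⟩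
    have h1 : (W.filter fun x => x + c (rankIn W x) ∈ B).card = B.card := by
      rw [← Finset.card_image_of_injective _ (shift_strictMono hc W).injective]
      congr 1
      ext b
      simp only [Finset.mem_image, Finset.mem_filter]
      constructor
      · rintro ⟨x, ⟨-, hx⟩, rfl⟩
        exact hx
      · intro hb
        obtain ⟨x, hx, rfl⟩ := Finset.mem_image.1 (hB hb)
        exact ⟨x, ⟨hx, hb⟩, rfl⟩
    have h2 := Finset.card_filter_add_card_filter_not (s := W)
      (fun x => x + c (rankIn W x) ∈ B)
    omega
  · intro W₁ h₁ W₂ h₂ h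
    simp only [Finset.coe_filter, Set.mem_ofPred_eq] at h₁ h₂
    exact Finset.Subset.antisymm (eq_of_remainder_eq hc h₁.2 h₂.2 h)
      (eq_of_remainder_eq hc h₂.2 h₁.2 h.symm)

/-- Each step uses C(M, j-1)/C(M, j) = j/(M-j+1) ≤ m/(M-m+1) for j ≤ m. Together with
`card_shiftedSet_superset_le` a uniformly random shifted set contains a given k-set with probability
at most (m/(M-m+1))^k, as if its elements were independent. -/
theorem choose_sub_mul_pow_le {M m : ℕ} (hm : m ≤ M) (k : ℕ) (hk : k ≤ m) :
    M.choose (m - k) * (M - m + 1) ^ k ≤ M.choose m * m ^ k := by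
  induction k with
  | zero => simp
  | succ k ih =>
    have h1 := ih (by omega)
    have h2 : M.choose (m - (k + 1)) * (M - m + 1) ≤ M.choose (m - k) * m := by
      have h3 := Nat.choose_succ_right_eq M (m - (k + 1))
      have h4 : m - (k + 1) + 1 = m - k := by omega
      rw [h4] at h3
      calc M.choose (m - (k + 1)) * (M - m + 1)
          ≤ M.choose (m - (k + 1)) * (M - (m - (k + 1))) := by gcongr; omega
        _ = M.choose (m - k) * (m - k) := h3.symm
        _ ≤ _ := by gcongr; omega
    calc M.choose (m - (k + 1)) * (M - m + 1) ^ (k + 1)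
        = (M.choose (m - (k + 1)) * (M - m + 1)) * (M - m + 1) ^ k := by ring
      _ ≤ (M.choose (m - k) * m) * (M - m + 1) ^ k := by gcongr
      _ = (M.choose (m - k) * (M - m + 1) ^ k) * m := by ring
      _ ≤ (M.choose m * m ^ k) * m := by gcongr
      _ = _ := by ring

/-- Exponential moments of the number of elements of a uniformly distributed shifted set that
belong to a given finite set. -/
theorem sum_pow_card_inter_shiftedSet_le {c : ℕ → ℕ} (hc : Monotone c) {M m : ℕ} (hm : m ≤ M)
    (T : Finset ℕ) {z : ℝ} (hz : 0 ≤ z) :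
    ∑ W ∈ (Finset.range M).powersetCard m, (1 + z) ^ (T ∩ shiftedSet c W).card ≤
      M.choose m * Real.exp (z * (m / (M - m + 1)) * T.card) := by
  classical
  have hMm : (0 : ℝ) < (M : ℝ) - m + 1 := by
    have : (m : ℝ) ≤ M := by exact_mod_cast hm
    linarith
  set q : ℝ := m / (M - m + 1) with hq
  have hq0 : 0 ≤ q := by positivity
  -- Expanding over subsets reduces the exponential moment to the inclusion counts of `hcount`.
  have hexp : ∀ A : Finset ℕ, (1 + z) ^ A.card = ∑ B ∈ A.powerset, z ^ B.card := by
    intro A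
    have := Finset.prod_add (fun _ : ℕ => z) (fun _ => (1 : ℝ)) A
    simp only [Finset.prod_const, one_pow, mul_one] at this
    rw [add_comm, this]
  have hcount : ∀ B : Finset ℕ,
      ((((Finset.range M).powersetCard m).filter (B ⊆ shiftedSet c ·)).card : ℝ) ≤
        M.choose m * q ^ B.card := by
    intro B
    by_cases hB : B.card ≤ m
    · have h1 := card_shiftedSet_superset_le hc M m B
      have h2 := choose_sub_mul_pow_le hm B.card hB
      have h3 : (M.choose (m - B.card) : ℝ) * ((M : ℝ) - m + 1) ^ B.card ≤
          M.choose m * (m : ℝ) ^ B.card := by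
        have : ((M - m + 1 : ℕ) : ℝ) = (M : ℝ) - m + 1 := by push_cast [hm]; ring
        rw [← this]
        exact_mod_cast h2
      calc _ ≤ (M.choose (m - B.card) : ℝ) := by exact_mod_cast h1
        _ ≤ M.choose m * (m : ℝ) ^ B.card / ((M : ℝ) - m + 1) ^ B.card := by
            rwa [le_div_iff₀ (by positivity)]
        _ = _ := by rw [hq, div_pow]; ring
    -- A set with more than m elements lies in no shifted set; the truncated difference m - |B|
    -- would only give the bound 1 here.
    · have : (((Finset.range M).powersetCard m).filter (B ⊆ shiftedSet c ·)) = ∅ := by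
        rw [Finset.filter_eq_empty_iff]
        intro W hW hBW
        have h1 := Finset.card_le_card hBW
        have h2 : (shiftedSet c W).card ≤ W.card := Finset.card_image_le
        rw [Finset.mem_powersetCard] at hW
        omega
      rw [this]
      simp only [Finset.card_empty, Nat.cast_zero]
      positivity
  calc ∑ W ∈ (Finset.range M).powersetCard m, (1 + z) ^ (T ∩ shiftedSet c W).card
      = ∑ W ∈ (Finset.range M).powersetCard m, ∑ B ∈ T.powerset,
          if B ⊆ shiftedSet c W then z ^ B.card else 0 := by
        refine Finset.sum_congr rfl fun W _ => ?_
        rw [hexp, ← Finset.sum_filter]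
        refine Finset.sum_congr ?_ fun _ _ => rfl
        ext B
        simp only [Finset.mem_powerset, Finset.mem_filter, Finset.subset_inter_iff]
    _ = ∑ B ∈ T.powerset, z ^ B.card *
          (((Finset.range M).powersetCard m).filter (B ⊆ shiftedSet c ·)).card := by
        rw [Finset.sum_comm]
        refine Finset.sum_congr rfl fun B _ => ?_
        rw [← Finset.sum_filter, Finset.sum_const, nsmul_eq_mul, mul_comm]
    _ ≤ ∑ B ∈ T.powerset, z ^ B.card * (M.choose m * q ^ B.card) := by
        gcongr with B _
        exact hcount B
    _ = M.choose m * ∑ B ∈ T.powerset, (z * q) ^ B.card := by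
        rw [Finset.mul_sum]
        refine Finset.sum_congr rfl fun B _ => ?_
        rw [mul_pow]; ring
    _ = M.choose m * (1 + z * q) ^ T.card := by
        congr 1
        have := Finset.prod_add (fun _ : ℕ => z * q) (fun _ => (1 : ℝ)) T
        simp only [Finset.prod_const, one_pow, mul_one] at this
        rw [add_comm, this]
    _ ≤ M.choose m * Real.exp (z * q * T.card) := by
        gcongr
        rw [mul_comm (z * q), Real.exp_nat_mul]
        gcongr
        rw [add_comm]
        exact Real.add_one_le_exp _

/-! # Parametrization of the block signals -/

/-- Increasing enumeration of a set with `m` elements. -/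
def enumOf (m : ℕ) (W : Finset ℕ) (g : Fin m) : ℕ :=
  if h : W.card = m then W.orderEmbOfFin h g else 0

/-- The shift of the block `g` forced by the preceding blocks and gaps. -/
def blockOffset (len : ℕ → ℕ) (G g : ℕ) : ℕ := ∑ h ∈ Finset.range g, (G + len h - 1)

theorem blockOffset_mono (len : ℕ → ℕ) (G : ℕ) : Monotone (blockOffset len G) := by
  refine monotone_nat_of_le_succ fun g => ?_
  rw [blockOffset, blockOffset, Finset.sum_range_succ]
  exact Nat.le_add_right _ _

/-- The first coordinates of the blocks that belong to the set `W`. -/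
def blockStart (len : ℕ → ℕ) (G m : ℕ) (W : Finset ℕ) (g : Fin m) : ℕ :=
  enumOf m W g + blockOffset len G g

/-- Admissible first coordinates of blocks. -/
def IsConfig (len : ℕ → ℕ) (G m p : ℕ) (j : Fin m → ℕ) : Prop :=
  (∀ g g' : Fin m, (g' : ℕ) = g + 1 → j g + (G + len g) ≤ j g') ∧ ∀ g, j g + len g ≤ p

/-- The signal with blocks at `j` and signs `t`. -/
def blockSignal (len : ℕ → ℕ) (τ : ℝ) {m : ℕ} (p : ℕ) (j : Fin m → ℕ) (t : Fin m → ℤˣ) :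
    Fin p → ℝ :=
  fun k => ∑ g, if j g ≤ k ∧ (k : ℕ) < j g + len g then τ * ((t g : ℤ) : ℝ) else 0

section
variable {len : ℕ → ℕ} {G m p : ℕ} {j : Fin m → ℕ}

theorem IsConfig.le_of_lt (hj : IsConfig len G m p j) {g g' : Fin m} (h : g < g') :
    j g + (G + len g) ≤ j g' := by
  obtain ⟨g, hg⟩ := g
  obtain ⟨g', hg'⟩ := g'
  simp only [Fin.mk_lt_mk] at h
  induction g' with
  | zero => omega
  | succ k ih =>
    rcases Nat.lt_succ_iff_lt_or_eq.1 h with h | h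
    · have h1 := ih (by omega) h
      have h2 := hj.1 ⟨k, by omega⟩ ⟨k + 1, hg'⟩ rfl
      omega
    · subst h
      exact hj.1 ⟨g, hg⟩ ⟨g + 1, hg'⟩ rfl

theorem IsConfig.eq_of_mem (hj : IsConfig len G m p j) {g g' : Fin m} {k : ℕ}
    (h : j g ≤ k ∧ k < j g + len g) (h' : j g' ≤ k ∧ k < j g' + len g') : g = g' := by
  rcases lt_trichotomy g g' with hlt | hlt | hlt
  · have := hj.le_of_lt hlt
    omega
  · exact hlt
  · have := hj.le_of_lt hlt
    omega

theorem blockSignal_of_mem (hj : IsConfig len G m p j) (τ : ℝ) (t : Fin m → ℤˣ) {g : Fin m}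
    {k : Fin p} (h : j g ≤ k ∧ (k : ℕ) < j g + len g) :
    blockSignal len τ p j t k = τ * ((t g : ℤ) : ℝ) := by
  rw [blockSignal, Finset.sum_eq_single g, if_pos h]
  · intro g' _ hne
    rw [if_neg]
    exact fun h' => hne (hj.eq_of_mem h' h)
  · exact fun h => absurd (Finset.mem_univ _) h

theorem blockSignal_of_notMem (τ : ℝ) (t : Fin m → ℤˣ)
    {k : Fin p} (h : ∀ g, ¬ (j g ≤ k ∧ (k : ℕ) < j g + len g)) :
    blockSignal len τ p j t k = 0 := by
  rw [blockSignal]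
  exact Finset.sum_eq_zero fun g _ => if_neg (h g)

theorem abs_intUnit (s : ℤˣ) : |((s : ℤ) : ℝ)| = 1 := by
  rcases Int.units_eq_one_or s with rfl | rfl <;> simp

theorem isBlockSignal_blockSignal {gap τ : ℝ} (hτ : 0 ≤ τ)
    (hlen : ∀ g, 0 < len g) (hj : IsConfig len ⌊gap⌋₊ m p j) (t : Fin m → ℤˣ) :
    IsBlockSignal m (fun g => len g) gap τ (blockSignal len τ p j t) := by
  refine ⟨j, fun g => τ * ((t g : ℤ) : ℝ), fun g => ⟨hlen g, hj.2 g⟩, fun g g' h => ?_,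
    fun g => ?_, fun g k h1 h2 => blockSignal_of_mem hj τ t ⟨h1, h2⟩,
    fun k h => blockSignal_of_notMem τ t h⟩
  · have h1 := hj.1 g g' h
    refine ⟨by beta_reduce; omega, ?_⟩
    -- The distance starts at the last element of the block, one before j g + len g. This one unit
    -- turns the strict bound by `gap` into a non-strict bound by its integer part.
    have h2 := Nat.lt_floor_add_one gap
    have h3 : ((j g : ℝ) + (⌊gap⌋₊ + len g)) ≤ j g' := by exact_mod_cast h1
    linarith
  · rw [abs_mul, abs_intUnit, mul_one, abs_of_nonneg hτ]

theorem IsBlockSignal.exists_config {gap τ : ℝ} {μ : Fin p → ℝ} (hgap : 0 ≤ gap)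
    (h : IsBlockSignal m (fun g => len g) gap τ μ) :
    ∃ (j : Fin m → ℕ) (t : Fin m → ℤˣ), IsConfig len ⌊gap⌋₊ m p j ∧
      μ = blockSignal len τ p j t := by
  obtain ⟨j, t, h1, h2, h3, h4, h5⟩ := h
  have hj : IsConfig len ⌊gap⌋₊ m p j := by
    refine ⟨fun g g' hg => ?_, fun g => (h1 g).2⟩
    obtain ⟨h6, h7⟩ := h2 g g' hg
    have h8 := Nat.floor_le hgap
    have h9 : (⌊gap⌋₊ : ℝ) + (j g + len g) < j g' + 1 := by linarith
    have h10 : ⌊gap⌋₊ + (j g + len g) < j g' + 1 := by exact_mod_cast h9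
    omega
  refine ⟨j, fun g => if t g = τ then 1 else -1, hj, ?_⟩
  funext k
  by_cases hk : ∃ g, j g ≤ k ∧ (k : ℕ) < j g + len g
  · obtain ⟨g, hg⟩ := hk
    rw [blockSignal_of_mem hj _ _ hg, h4 g k hg.1 hg.2]
    have := h3 g
    split_ifs with ht
    · simp [ht]
    · rcases abs_eq (this ▸ abs_nonneg _) |>.1 this with h | h
      · exact absurd h ht
      · simp [h]
  · push Not at hk
    rw [h5 k fun g hg => absurd hg.2 (not_lt.2 (hk g hg.1)),
      blockSignal_of_notMem _ _ fun g hg => absurd hg.2 (not_lt.2 (hk g hg.1))]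

theorem blockSignal_ne_zero_iff (hj : IsConfig len G m p j) {τ : ℝ} (hτ : 0 < τ)
    (t : Fin m → ℤˣ) (k : Fin p) :
    blockSignal len τ p j t k ≠ 0 ↔ ∃ g, j g ≤ k ∧ (k : ℕ) < j g + len g := by
  constructor
  · intro h
    by_contra hk
    push Not at hk
    exact h (blockSignal_of_notMem _ _ fun g hg => absurd hg.2 (not_lt.2 (hk g hg.1)))
  · rintro ⟨g, hg⟩
    rw [blockSignal_of_mem hj _ _ hg]
    have : ((t g : ℤ) : ℝ) ≠ 0 := by
      rcases Int.units_eq_one_or (t g) with h | h <;> simp [h]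
    positivity

/-- The coordinate j g lies in the support, hence in some block of the second configuration. An
earlier block is impossible, since it is also a block of the first configuration and ends before j
g; the block g itself or a later one starts at j' g or beyond. -/
theorem start_le_of_blockSignal_eq {j' : Fin m → ℕ} {t t' : Fin m → ℤˣ} {τ : ℝ} (hτ : 0 < τ)
    (hlen : ∀ g, 0 < len g) (hj : IsConfig len G m p j) (hj' : IsConfig len G m p j')
    (h : blockSignal len τ p j t = blockSignal len τ p j' t') (g : Fin m)
    (ih : ∀ g' < g, j g' = j' g') : j' g ≤ j g := by
  have hlt : j g < p := by
    have := hj.2 g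
    have := hlen g
    omega
  have h1 := (blockSignal_ne_zero_iff hj hτ t ⟨j g, hlt⟩).2 ⟨g, le_rfl, by
    have := hlen g
    simp only
    omega⟩
  rw [h, blockSignal_ne_zero_iff hj' hτ] at h1
  obtain ⟨g', hg', hg''⟩ := h1
  simp only at hg' hg''
  rcases lt_trichotomy g' g with hlt | rfl | hlt
  · have := hj.le_of_lt hlt
    have := ih g' hlt
    omega
  · exact hg'
  · have := hj'.le_of_lt hlt
    omega

/-- Signals correspond one to one to positions and signs. Under the uniform law on the class the
signs are therefore independent fair coins, independent of the positions. -/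
theorem blockSignal_injective {j' : Fin m → ℕ} {t t' : Fin m → ℤˣ} {τ : ℝ} (hτ : 0 < τ)
    (hlen : ∀ g, 0 < len g) (hj : IsConfig len G m p j) (hj' : IsConfig len G m p j')
    (h : blockSignal len τ p j t = blockSignal len τ p j' t') : j = j' ∧ t = t' := by
  have hjj : ∀ g, j g = j' g := by
    intro g
    induction g using WellFoundedLT.induction with
    | ind g ih =>
      exact le_antisymm (start_le_of_blockSignal_eq hτ hlen hj' hj h.symm g
        fun g' hg' => (ih g' hg').symm) (start_le_of_blockSignal_eq hτ hlen hj hj' h g ih)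
  obtain rfl : j = j' := funext hjj
  refine ⟨rfl, funext fun g => ?_⟩
  have hlt : j g < p := by
    have := hj.2 g
    have := hlen g
    omega
  have hmem : j g ≤ (⟨j g, hlt⟩ : Fin p) ∧ ((⟨j g, hlt⟩ : Fin p) : ℕ) < j g + len g :=
    ⟨le_rfl, by have := hlen g; simp only; omega⟩
  have h1 := congrFun h ⟨j g, hlt⟩
  rw [blockSignal_of_mem hj _ _ hmem, blockSignal_of_mem hj _ _ hmem] at h1
  have h2 := mul_left_cancel₀ hτ.ne' h1
  exact Units.ext (by exact_mod_cast h2)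

theorem enumOf_strictMono {W : Finset ℕ} (hW : W.card = m) : StrictMono (enumOf m W) := by
  intro g g' h
  simp only [enumOf, dif_pos hW]
  exact (W.orderEmbOfFin hW).strictMono h

theorem enumOf_mem {W : Finset ℕ} (hW : W.card = m) (g : Fin m) : enumOf m W g ∈ W := by
  simp only [enumOf, dif_pos hW]
  exact W.orderEmbOfFin_mem hW g

theorem image_enumOf {W : Finset ℕ} (hW : W.card = m) : Finset.univ.image (enumOf m W) = W := by
  refine Finset.eq_of_subset_of_card_le ?_ ?_
  · intro x hx
    obtain ⟨g, -, rfl⟩ := Finset.mem_image.1 hx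
    exact enumOf_mem hW g
  · rw [Finset.card_image_of_injective _ (enumOf_strictMono hW).injective]
    simp [hW]

theorem rankIn_enumOf {W : Finset ℕ} (hW : W.card = m) (g : Fin m) :
    rankIn W (enumOf m W g) = g := by
  have : W.filter (· < enumOf m W g) = (Finset.univ.filter (· < g)).image (enumOf m W) := by
    ext x
    simp only [Finset.mem_filter, Finset.mem_image, Finset.mem_univ, true_and]
    constructor
    · rintro ⟨hx, hlt⟩
      rw [← image_enumOf hW] at hx
      obtain ⟨g', -, rfl⟩ := Finset.mem_image.1 hx
      exact ⟨g', (enumOf_strictMono hW).lt_iff_lt.1 hlt, rfl⟩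
    · rintro ⟨g', hg', rfl⟩
      exact ⟨enumOf_mem hW g', enumOf_strictMono hW hg'⟩
  rw [rankIn, this, Finset.card_image_of_injective _ (enumOf_strictMono hW).injective]
  have h2 : Finset.univ.filter (· < g) = Finset.Iio g := by ext; simp
  rw [h2, Fin.card_Iio]

/-- This connects the counting lemmas with the block signals: the blocks of a random signal start at
the elements of a random shifted set. -/
theorem shiftedSet_blockOffset {W : Finset ℕ} (hW : W.card = m) :
    shiftedSet (blockOffset len G) W = Finset.univ.image (blockStart len G m W) := by
  conv_lhs => rw [shiftedSet, ← image_enumOf hW]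
  rw [Finset.image_image]
  refine Finset.image_congr fun g _ => ?_
  simp only [Function.comp, blockStart]
  rw [image_enumOf hW, rankIn_enumOf hW]

/-- Consecutive elements of W differ by at least 1, and the offset adds G + len g - 1, so
consecutive starts differ by at least G + len g. The equation `hM` counts the free places: the
largest possible element M - 1 of W lets the last block end exactly at p. -/
theorem isConfig_blockStart (hlen : ∀ g, 0 < len g) {M : ℕ} (hm : 0 < m)
    (hM : M + blockOffset len G (m - 1) + len (m - 1) = p + 1) {W : Finset ℕ}
    (hW : W ∈ (Finset.range M).powersetCard m) : IsConfig len G m p (blockStart len G m W) := by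
  rw [Finset.mem_powersetCard] at hW
  obtain ⟨hsub, hcard⟩ := hW
  have hstep : ∀ g g' : Fin m, (g' : ℕ) = g + 1 →
      blockStart len G m W g + (G + len g) ≤ blockStart len G m W g' := by
    intro g g' h
    have h1 : enumOf m W g < enumOf m W g' :=
      enumOf_strictMono hcard (Fin.lt_def.2 (by omega))
    have h2 : blockOffset len G g' = blockOffset len G g + (G + len g - 1) := by
      rw [h, blockOffset, Finset.sum_range_succ, blockOffset]
    have h3 := hlen g
    simp only [blockStart]
    omega
  refine ⟨hstep, fun g => ?_⟩
  have hlast : blockStart len G m W ⟨m - 1, by omega⟩ + len (m - 1) ≤ p := by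
    have := Finset.mem_range.1 (hsub (enumOf_mem hcard ⟨m - 1, by omega⟩))
    simp only [blockStart]
    omega
  rcases Nat.lt_or_ge g (m - 1) with h | h
  · have h1 : blockStart len G m W ⟨g + 1, by omega⟩ ≤ blockStart len G m W ⟨m - 1, by omega⟩ := by
      simp only [blockStart]
      exact add_le_add ((enumOf_strictMono hcard).monotone (Fin.mk_le_mk.2 (by omega)))
        (blockOffset_mono len G (by omega))
    have h2 := hstep g ⟨g + 1, by omega⟩ rfl
    omega
  · have h1 : g = ⟨m - 1, by omega⟩ := Fin.ext (show (g : ℕ) = m - 1 by omega)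
    rw [h1]
    exact hlast

theorem blockStart_injOn {M : ℕ} {W W' : Finset ℕ}
    (hW : W ∈ (Finset.range M).powersetCard m) (hW' : W' ∈ (Finset.range M).powersetCard m)
    (h : blockStart len G m W = blockStart len G m W') : W = W' := by
  rw [Finset.mem_powersetCard] at hW hW'
  have h1 : enumOf m W = enumOf m W' := by
    funext g
    have := congrFun h g
    simp only [blockStart] at this
    omega
  rw [← image_enumOf hW.2, h1, image_enumOf hW'.2]

/-- Subtracting the offsets from the starts leaves a strictly increasing sequence below M, because
the required distance G + len g is one more than the increment of the offset. The truncated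
subtraction loses nothing, by `hoff`. -/
theorem IsConfig.exists_blockStart (hlen : ∀ g, 0 < len g) {M : ℕ} (hm : 0 < m)
    (hM : M + blockOffset len G (m - 1) + len (m - 1) = p + 1) (hj : IsConfig len G m p j) :
    ∃ W ∈ (Finset.range M).powersetCard m, j = blockStart len G m W := by
  have hoff : ∀ g : ℕ, ∀ hg : g < m, blockOffset len G g ≤ j ⟨g, hg⟩ := by
    intro g
    induction g with
    | zero => intro _; simp [blockOffset]
    | succ k ih =>
      intro hg
      have h1 := ih (by omega)
      have h2 := hj.1 ⟨k, by omega⟩ ⟨k + 1, hg⟩ rfl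
      rw [blockOffset, Finset.sum_range_succ, ← blockOffset]
      simp only at h2
      omega
  set w : Fin m → ℕ := fun g => j g - blockOffset len G g with hw
  have hwm : StrictMono w := by
    obtain ⟨k, rfl⟩ : ∃ k, m = k + 1 := ⟨m - 1, by omega⟩
    rw [Fin.strictMono_iff_lt_succ]
    intro g
    have h1 := hj.1 g.castSucc g.succ (by simp)
    have h2 := hoff g (by omega)
    have h3 : blockOffset len G (g + 1 : ℕ) = blockOffset len G g + (G + len g - 1) := by
      rw [blockOffset, Finset.sum_range_succ, blockOffset]
    have h4 := hlen g
    have h5 := hoff (g + 1) (by omega)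
    simp only [hw, Fin.val_succ, Fin.val_castSucc] at h1 ⊢
    have h6 : j ⟨(g : ℕ), by omega⟩ = j g.castSucc := rfl
    have h7 : j ⟨(g : ℕ) + 1, by omega⟩ = j g.succ := rfl
    omega
  have hcard : (Finset.univ.image w).card = m := by
    rw [Finset.card_image_of_injective _ hwm.injective]
    simp
  refine ⟨Finset.univ.image w, Finset.mem_powersetCard.2 ⟨?_, hcard⟩, ?_⟩
  · intro x hx
    obtain ⟨g, -, rfl⟩ := Finset.mem_image.1 hx
    have h1 : w g ≤ w ⟨m - 1, by omega⟩ := hwm.monotone (Fin.le_def.2 (by simp only; omega))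
    have h2 := hj.2 ⟨m - 1, by omega⟩
    have h3 := hoff (m - 1) (by omega)
    have h4 := hlen (m - 1)
    simp only [hw] at h1 h2 h3 ⊢
    rw [Finset.mem_range]
    omega
  · have h1 := Finset.orderEmbOfFin_unique hcard
      (fun g => Finset.mem_image_of_mem w (Finset.mem_univ g)) hwm
    funext g
    simp only [blockStart, enumOf, dif_pos hcard]
    rw [← h1]
    have : _ ≤ j g := hoff g g.2
    simp only [hw]
    omega

/-- A sum over all block signals is a sum over the admissible positions and the signs. -/
theorem sum_isBlockSignal {gap τ : ℝ} (hgap : 0 ≤ gap) (hτ : 0 < τ) (hlen : ∀ g, 0 < len g)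
    {M : ℕ} (hm : 0 < m) (hM : M + blockOffset len ⌊gap⌋₊ (m - 1) + len (m - 1) = p + 1)
    {S : Finset (Fin p → ℝ)} (hS : ∀ μ, μ ∈ S ↔ IsBlockSignal m (fun g => len g) gap τ μ)
    (F : (Fin p → ℝ) → ℝ) :
    ∑ μ ∈ S, F μ = ∑ W ∈ (Finset.range M).powersetCard m, ∑ t : Fin m → ℤˣ,
      F (blockSignal len τ p (blockStart len ⌊gap⌋₊ m W) t) := by
  rw [← Finset.sum_product']
  symm
  refine Finset.sum_bij
    (fun a _ => blockSignal len τ p (blockStart len ⌊gap⌋₊ m a.1) a.2) ?_ ?_ ?_ ?_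
  · intro a ha
    rw [Finset.mem_product] at ha
    exact (hS _).2 (isBlockSignal_blockSignal hτ.le hlen
      (isConfig_blockStart hlen hm hM ha.1) a.2)
  · intro a ha b hb h
    rw [Finset.mem_product] at ha hb
    obtain ⟨h1, h2⟩ := blockSignal_injective hτ hlen (isConfig_blockStart hlen hm hM ha.1)
      (isConfig_blockStart hlen hm hM hb.1) h
    exact Prod.ext (blockStart_injOn ha.1 hb.1 h1) h2
  · intro μ hμ
    obtain ⟨j, t, hj, rfl⟩ := ((hS μ).1 hμ).exists_config hgap
    obtain ⟨W, hW, rfl⟩ := hj.exists_blockStart hlen hm hM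
    exact ⟨(W, t), Finset.mem_product.2 ⟨hW, Finset.mem_univ _⟩, rfl⟩
  · intro a _
    rfl

end

/-! # Exponential moments of inner products of block signals -/

theorem sum_signs_exp {m : ℕ} (b : Fin m → ℝ) :
    ∑ t : Fin m → ℤˣ, Real.exp (∑ g, ((t g : ℤ) : ℝ) * b g) = ∏ g, (2 * Real.cosh (b g)) := by
  have h : ∀ g, 2 * Real.cosh (b g) = ∑ s : ℤˣ, Real.exp (((s : ℤ) : ℝ) * b g) := by
    intro g
    rw [Real.cosh_eq, UnitsInt.univ, Finset.sum_pair (by decide)]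
    simp
    ring
  simp_rw [h, Finset.prod_univ_sum, Fintype.piFinset_univ, Real.exp_sum]

section
variable {len : ℕ → ℕ} {m p : ℕ} {gap τ : ℝ} {μ : Fin p → ℝ}

theorem IsBlockSignal.abs_le {len : Fin m → ℕ} (hτ : 0 ≤ τ) (h : IsBlockSignal m len gap τ μ)
    (k : Fin p) : |μ k| ≤ τ := by
  obtain ⟨j, t, h1, h2, h3, h4, h5⟩ := h
  by_cases hk : ∃ g, j g ≤ k ∧ (k : ℕ) < j g + len g
  · obtain ⟨g, hg⟩ := hk
    rw [h4 g k hg.1 hg.2, h3 g]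
  · push Not at hk
    rw [h5 k fun g hg => absurd hg.2 (not_lt.2 (hk g hg.1))]
    simpa using hτ

/-- Summing over the independent signs gives a factor 2 cosh(s τ A g) per block, where A g is the
sum of μ over the block. Here |A g| ≤ τ L and cosh y ≤ exp(y²/2); a block that starts outside T
misses the support of μ, and its cosh is 1. -/
theorem sum_signs_exp_inner_le {L : ℕ} (hL : ∀ g, len g ≤ L) (hτ : 0 ≤ τ) (s : ℝ)
    {T : Finset ℕ} (hμ : ∀ k, |μ k| ≤ τ)
    (hT : ∀ (k : Fin p) (j : ℕ), μ k ≠ 0 → j ≤ k → (k : ℕ) < j + L → j ∈ T) (j : Fin m → ℕ) :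
    ∑ t : Fin m → ℤˣ, Real.exp (s * ∑ k, blockSignal len τ p j t k * μ k) ≤
      2 ^ m * Real.exp ((s * τ ^ 2 * L) ^ 2 / 2) ^ (Finset.univ.filter fun g => j g ∈ T).card := by
  set A : Fin m → ℝ := fun g => ∑ k : Fin p, if j g ≤ k ∧ (k : ℕ) < j g + len g then μ k else 0
    with hA
  have hin : ∀ t : Fin m → ℤˣ, s * ∑ k, blockSignal len τ p j t k * μ k =
      ∑ g, ((t g : ℤ) : ℝ) * (s * τ * A g) := by
    intro t
    simp only [blockSignal, hA, Finset.sum_mul, Finset.mul_sum]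
    rw [Finset.sum_comm]
    refine Finset.sum_congr rfl fun g _ => Finset.sum_congr rfl fun k _ => ?_
    split_ifs <;> ring
  simp_rw [hin, sum_signs_exp]
  have hAle : ∀ g, |A g| ≤ τ * L := by
    intro g
    calc |A g| ≤ ∑ k : Fin p, |if j g ≤ k ∧ (k : ℕ) < j g + len g then μ k else 0| :=
          Finset.abs_sum_le_sum_abs _ _
      _ ≤ ∑ k : Fin p, if j g ≤ k ∧ (k : ℕ) < j g + len g then τ else 0 := by
          refine Finset.sum_le_sum fun k _ => ?_
          split_ifs
          · exact hμ k
          · simp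
      _ = τ * (Finset.univ.filter fun k : Fin p =>
            j g ≤ k ∧ (k : ℕ) < j g + len g).card := by
          rw [← Finset.sum_filter, Finset.sum_const, nsmul_eq_mul, mul_comm]
      _ ≤ τ * L := by
          refine mul_le_mul_of_nonneg_left ?_ hτ
          have h1 : (Finset.univ.filter fun k : Fin p =>
              j g ≤ k ∧ (k : ℕ) < j g + len g).card ≤ (Finset.Ico (j g) (j g + len g)).card := by
            refine Finset.card_le_card_of_injOn (fun k => (k : ℕ)) ?_ ?_
            · intro k hk
              simpa using hk
            · exact fun a _ b _ h => Fin.ext h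
          rw [Nat.card_Ico] at h1
          have h2 := hL g
          exact_mod_cast (by omega : _ ≤ L)
  have hAz : ∀ g, j g ∉ T → A g = 0 := by
    intro g hg
    refine Finset.sum_eq_zero fun k _ => ?_
    split_ifs with hk
    · by_contra hne
      exact hg (hT k (j g) hne hk.1 (hk.2.trans_le (by have := hL g; omega)))
    · rfl
  calc ∏ g, 2 * Real.cosh (s * τ * A g)
      ≤ ∏ g, 2 * (if j g ∈ T then Real.exp ((s * τ ^ 2 * L) ^ 2 / 2) else 1) := by
        refine Finset.prod_le_prod (fun g _ => by positivity) fun g _ => ?_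
        refine mul_le_mul_of_nonneg_left ?_ (by norm_num)
        split_ifs with hg
        · refine (Real.cosh_le_exp_half_sq _).trans (Real.exp_le_exp.2 ?_)
          have h1 : |s * τ * A g| ≤ |s * τ ^ 2 * L| := by
            rw [abs_mul, abs_mul, abs_mul, abs_mul, abs_pow, sq, abs_of_nonneg hτ, Nat.abs_cast]
            calc |s| * τ * |A g| ≤ |s| * τ * (τ * L) := by gcongr; exact hAle g
              _ = _ := by ring
          have h2 := sq_le_sq.2 h1
          linarith
        · rw [hAz g hg]
          simp
    _ = _ := by
        rw [Finset.prod_mul_distrib, Finset.prod_const, Finset.card_univ, Fintype.card_fin,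
          Finset.prod_ite, Finset.prod_const, Finset.prod_const_one, mul_one]

/-- A window of length L that meets the block at j g must start in [j g + 1 - L, j g + L), which has
at most 2L elements. -/
theorem IsBlockSignal.exists_cover {L : ℕ} (hL : ∀ g, len g ≤ L)
    (h : IsBlockSignal m (fun g => len g) gap τ μ) :
    ∃ T : Finset ℕ, T.card ≤ 2 * L * m ∧
      ∀ (k : Fin p) (j : ℕ), μ k ≠ 0 → j ≤ k → (k : ℕ) < j + L → j ∈ T := by
  obtain ⟨j, t, h1, h2, h3, h4, h5⟩ := h
  refine ⟨Finset.univ.biUnion fun g => Finset.Ico (j g + 1 - L) (j g + L), ?_, ?_⟩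
  · refine (Finset.card_biUnion_le_card_mul _ _ (2 * L) fun g _ => ?_).trans ?_
    · rw [Nat.card_Ico]
      omega
    · simp [mul_comm]
  · intro k i hk hik hki
    have : ∃ g, j g ≤ k ∧ (k : ℕ) < j g + len g := by
      by_contra hno
      push Not at hno
      exact hk (h5 k fun g hg => absurd hg.2 (not_lt.2 (hno g hg.1)))
    obtain ⟨g, hg1, hg2⟩ := this
    simp only [Finset.mem_biUnion, Finset.mem_univ, true_and, Finset.mem_Ico]
    have := hL g
    exact ⟨g, by omega, by omega⟩

/-- Exponential moments of the inner product of a uniformly distributed block signal with a fixed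
one. -/
theorem sum_exp_inner_le (hgap : 0 ≤ gap) (hτ : 0 < τ) (hlen : ∀ g, 0 < len g)
    {M : ℕ} (hm : 0 < m) (hM : M + blockOffset len ⌊gap⌋₊ (m - 1) + len (m - 1) = p + 1)
    (hmM : m ≤ M) {L : ℕ} (hL : ∀ g, len g ≤ L) {S : Finset (Fin p → ℝ)}
    (hS : ∀ μ, μ ∈ S ↔ IsBlockSignal m (fun g => len g) gap τ μ)
    (hμ : IsBlockSignal m (fun g => len g) gap τ μ) (s : ℝ) :
    ∑ ν ∈ S, Real.exp (s * ∑ k, ν k * μ k) ≤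
      S.card * Real.exp ((Real.exp ((s * τ ^ 2 * L) ^ 2 / 2) - 1) * (m / (M - m + 1)) *
        (2 * L * m)) := by
  obtain ⟨T, hTc, hT⟩ := hμ.exists_cover hL
  have hMm : (0 : ℝ) < (M : ℝ) - m + 1 := by
    have : (m : ℝ) ≤ M := by exact_mod_cast hmM
    linarith
  have hcard : (S.card : ℝ) = M.choose m * 2 ^ m := by
    have := sum_isBlockSignal hgap hτ hlen hm hM hS fun _ => 1
    simpa using this
  have hz : 0 ≤ Real.exp ((s * τ ^ 2 * L) ^ 2 / 2) - 1 := by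
    have := Real.add_one_le_exp ((s * τ ^ 2 * L) ^ 2 / 2)
    have : 0 ≤ (s * τ ^ 2 * L) ^ 2 / 2 := by positivity
    linarith
  rw [sum_isBlockSignal hgap hτ hlen hm hM hS, hcard]
  calc _ ≤ ∑ W ∈ (Finset.range M).powersetCard m,
        2 ^ m * (1 + (Real.exp ((s * τ ^ 2 * L) ^ 2 / 2) - 1)) ^
          (T ∩ shiftedSet (blockOffset len ⌊gap⌋₊) W).card := by
        refine Finset.sum_le_sum fun W hW => ?_
        have hc := isConfig_blockStart hlen hm hM hW
        have hinj : Function.Injective (blockStart len ⌊gap⌋₊ m W) := by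
          intro g g' h
          exact hc.eq_of_mem ⟨le_rfl, by have := hlen g; omega⟩
            ⟨h.ge, by have := hlen g'; omega⟩
        refine (sum_signs_exp_inner_le hL hτ.le s (hμ.abs_le hτ.le) hT _).trans (le_of_eq ?_)
        rw [add_sub_cancel]
        congr 2
        -- The starts are distinct, so the number of blocks that start in T is the size of the
        -- intersection of T with the shifted set.
        rw [shiftedSet_blockOffset (Finset.mem_powersetCard.1 hW).2,
          ← Finset.card_image_of_injective _ hinj]
        congr 1
        ext x
        simp only [Finset.mem_image, Finset.mem_filter, Finset.mem_univ, true_and,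
          Finset.mem_inter]
        constructor
        · rintro ⟨g, hg, rfl⟩
          exact ⟨hg, g, rfl⟩
        · rintro ⟨hx, g, rfl⟩
          exact ⟨g, hx, rfl⟩
    _ ≤ 2 ^ m * (M.choose m * Real.exp ((Real.exp ((s * τ ^ 2 * L) ^ 2 / 2) - 1) *
          (m / (M - m + 1)) * T.card)) := by
        rw [← Finset.mul_sum]
        gcongr
        exact sum_pow_card_inter_shiftedSet_le (blockOffset_mono _ _) hmM T hz
    _ ≤ 2 ^ m * (M.choose m * Real.exp ((Real.exp ((s * τ ^ 2 * L) ^ 2 / 2) - 1) *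
          (m / (M - m + 1)) * (2 * L * m))) := by
        have : (T.card : ℝ) ≤ 2 * L * m := by exact_mod_cast hTc
        gcongr
    _ = _ := by ring

end

/-! # Moments of inner products -/

/-- One term of the exponential series of |σ v| is at most the whole series. The parameter σ is free
and is later chosen according to k, which converts exponential moments into moments. -/
theorem even_pow_le_exp (v : ℝ) {σ : ℝ} (hσ : 0 < σ) (k : ℕ) :
    v ^ (2 * k) ≤ (2 * k).factorial * (σ⁻¹) ^ (2 * k) * (Real.exp (σ * v) + Real.exp (-σ * v)) := by
  have h1 : (|σ * v|) ^ (2 * k) / (2 * k).factorial ≤ Real.exp |σ * v| :=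
    Real.pow_div_factorial_le_exp _ (abs_nonneg _) _
  have h2 : Real.exp |σ * v| ≤ Real.exp (σ * v) + Real.exp (-σ * v) := by
    rcases abs_choice (σ * v) with h | h <;> rw [h]
    · linarith [Real.exp_pos (-σ * v)]
    · rw [← neg_mul]
      linarith [Real.exp_pos (σ * v)]
  have h3 : (|σ * v|) ^ (2 * k) = σ ^ (2 * k) * v ^ (2 * k) := by
    rw [Even.pow_abs (even_two_mul k), mul_pow]
  rw [h3, div_le_iff₀ (by positivity)] at h1
  have h4 : 0 < σ ^ (2 * k) := by positivity
  calc v ^ (2 * k) = (σ⁻¹) ^ (2 * k) * (σ ^ (2 * k) * v ^ (2 * k)) := by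
        rw [inv_pow, inv_mul_cancel_left₀ h4.ne']
    _ ≤ (σ⁻¹) ^ (2 * k) * ((Real.exp (σ * v) + Real.exp (-σ * v)) * (2 * k).factorial) := by
        refine mul_le_mul_of_nonneg_left (h1.trans ?_) (by positivity)
        gcongr
    _ = _ := by ring

theorem exp_sub_one_le_two_mul {y : ℝ} (h0 : 0 ≤ y) (h1 : y ≤ 1) : Real.exp y - 1 ≤ 2 * y := by
  have := Real.abs_exp_sub_one_sub_id_le (x := y) (by rwa [abs_of_nonneg h0])
  have := (abs_le.1 this).2
  nlinarith

/-- This yields sub-Gaussian bounds for bounded centred variables: the linear term disappears in the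
mean. -/
theorem exp_le_add_exp_sq (y : ℝ) : Real.exp y ≤ y + Real.exp (y ^ 2) := by
  have h1 := Real.add_one_le_exp (y ^ 2)
  by_cases hy : |y| ≤ 1
  · have := (abs_le.1 (Real.abs_exp_sub_one_sub_id_le hy)).2
    linarith
  · push Not at hy
    rcases lt_abs.1 hy with h | h
    · have : Real.exp y ≤ Real.exp (y ^ 2) := Real.exp_le_exp.2 (by nlinarith)
      linarith
    · have : Real.exp y ≤ 1 := Real.exp_le_one_iff.2 (by linarith)
      nlinarith

/-! ### Centred labels and the moments of their inner products. -/

/-- The probability of a label. -/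
def labelWeight (ϖ : ℝ) (l : ℤˣ) : ℝ := if l = 1 then ϖ / (1 + ϖ) else 1 / (1 + ϖ)

/-- The probability of a vector of labels. -/
def labelsWeight {n : ℕ} (ϖ : ℝ) (l : Fin n → ℤˣ) : ℝ := ∏ i, labelWeight ϖ (l i)

theorem sum_intUnits (f : ℤˣ → ℝ) : ∑ s, f s = f 1 + f (-1) := by
  rw [UnitsInt.univ, Finset.sum_pair (by decide)]

section
variable {ϖ : ℝ}

theorem labelWeight_one (ϖ : ℝ) : labelWeight ϖ 1 = ϖ / (1 + ϖ) := if_pos rfl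

theorem labelWeight_neg_one (ϖ : ℝ) : labelWeight ϖ (-1) = 1 / (1 + ϖ) := if_neg (by decide)

theorem genLabel_one (ϖ : ℝ) : genLabel ϖ 1 = 1 := if_pos rfl

theorem genLabel_neg_one (ϖ : ℝ) : genLabel ϖ (-1) = -ϖ := if_neg (by decide)

theorem labelWeight_nonneg (hϖ : 0 < ϖ) (l : ℤˣ) : 0 ≤ labelWeight ϖ l := by
  rw [labelWeight]
  split_ifs <;> positivity

theorem labelsWeight_nonneg {n : ℕ} (hϖ : 0 < ϖ) (l : Fin n → ℤˣ) : 0 ≤ labelsWeight ϖ l :=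
  Finset.prod_nonneg fun _ _ => labelWeight_nonneg hϖ _

theorem sum_labelWeight (hϖ : 0 < ϖ) : ∑ s, labelWeight ϖ s = 1 := by
  rw [sum_intUnits, labelWeight_one, labelWeight_neg_one]
  field_simp
  ring

theorem sum_labelWeight_mul_genLabel (hϖ : 0 < ϖ) : ∑ s, labelWeight ϖ s * genLabel ϖ s = 0 := by
  rw [sum_intUnits, labelWeight_one, labelWeight_neg_one, genLabel_one, genLabel_neg_one]
  field_simp
  ring

theorem abs_genLabel_le (hϖ : 0 < ϖ) (s : ℤˣ) : |genLabel ϖ s| ≤ 1 + ϖ := by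
  rw [genLabel]
  split_ifs
  · rw [abs_one]; linarith
  · rw [abs_neg, abs_of_pos hϖ]; linarith

theorem sum_prod_labelWeight {n : ℕ} (f : Fin n → ℤˣ → ℝ) :
    ∑ l : Fin n → ℤˣ, labelsWeight ϖ l * ∏ i, f i (l i) =
      ∏ i, ∑ s, labelWeight ϖ s * f i s := by
  simp_rw [Finset.prod_univ_sum, Fintype.piFinset_univ, labelsWeight, Finset.prod_mul_distrib]

theorem sum_labelsWeight {n : ℕ} (hϖ : 0 < ϖ) : ∑ l : Fin n → ℤˣ, labelsWeight ϖ l = 1 := by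
  have := sum_prod_labelWeight (ϖ := ϖ) (n := n) fun _ _ => 1
  simpa only [Finset.prod_const_one, mul_one, sum_labelWeight hϖ] using this

/-- Moments of the inner product of two independent vectors of generalized labels. -/
def labelMoment (ϖ : ℝ) (n d : ℕ) : ℝ :=
  ∑ l : Fin n → ℤˣ, ∑ l' : Fin n → ℤˣ, labelsWeight ϖ l * labelsWeight ϖ l' *
    (∑ i, genLabel ϖ (l i) * genLabel ϖ (l' i)) ^ d

theorem labelMoment_nonneg (hϖ : 0 < ϖ) (n k : ℕ) : 0 ≤ labelMoment ϖ n (2 * k) :=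
  Finset.sum_nonneg fun _ _ => Finset.sum_nonneg fun _ _ =>
    mul_nonneg (mul_nonneg (labelsWeight_nonneg hϖ _) (labelsWeight_nonneg hϖ _))
      ((even_two_mul k).pow_nonneg _)

theorem labelMoment_zero (hϖ : 0 < ϖ) (n : ℕ) : labelMoment ϖ n 0 = 1 := by
  simp only [labelMoment, pow_zero, mul_one, ← Finset.mul_sum, sum_labelsWeight hϖ]

theorem abs_genLabel_mul_le (hϖ : 0 < ϖ) (s s' : ℤˣ) :
    |genLabel ϖ s * genLabel ϖ s'| ≤ (1 + ϖ) ^ 2 := by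
  rw [abs_mul, sq]
  exact mul_le_mul (abs_genLabel_le hϖ s) (abs_genLabel_le hϖ s') (abs_nonneg _) (by positivity)

/-- This crude bound replaces the sub-Gaussian one when k ≥ n; it is the source of min(k, n) in
`moment_term_le`. -/
theorem labelMoment_le_pow (hϖ : 0 < ϖ) (n k : ℕ) :
    labelMoment ϖ n (2 * k) ≤ ((1 + ϖ) ^ 2 * n) ^ (2 * k) := by
  have h : ∀ l l' : Fin n → ℤˣ, (∑ i, genLabel ϖ (l i) * genLabel ϖ (l' i)) ^ (2 * k) ≤
      ((1 + ϖ) ^ 2 * n) ^ (2 * k) := by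
    intro l l'
    rw [← Even.pow_abs (even_two_mul k)]
    refine pow_le_pow_left₀ (abs_nonneg _) ((Finset.abs_sum_le_sum_abs _ _).trans ?_) _
    refine (Finset.sum_le_card_nsmul _ _ _ fun i _ => abs_genLabel_mul_le hϖ _ _).trans ?_
    simp [mul_comm]
  calc labelMoment ϖ n (2 * k) ≤ ∑ l : Fin n → ℤˣ, ∑ l' : Fin n → ℤˣ,
        labelsWeight ϖ l * labelsWeight ϖ l' * ((1 + ϖ) ^ 2 * n) ^ (2 * k) := by
        refine Finset.sum_le_sum fun l _ => Finset.sum_le_sum fun l' _ => ?_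
        exact mul_le_mul_of_nonneg_left (h l l')
          (mul_nonneg (labelsWeight_nonneg hϖ _) (labelsWeight_nonneg hϖ _))
    _ = _ := by
        simp only [← Finset.sum_mul, ← Finset.mul_sum, sum_labelsWeight hϖ, mul_one, one_mul]

/-- Given the second vector of labels, the summands are independent, bounded by (1+ϖ)² and centred,
since the weights make the generalized label have mean 0. `exp_le_add_exp_sq` then bounds each
factor. -/
theorem sum_exp_genLabel_le (hϖ : 0 < ϖ) (n : ℕ) (s : ℝ) :
    ∑ l : Fin n → ℤˣ, ∑ l' : Fin n → ℤˣ, labelsWeight ϖ l * labelsWeight ϖ l' *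
      Real.exp (s * ∑ i, genLabel ϖ (l i) * genLabel ϖ (l' i)) ≤
        Real.exp (n * (s * (1 + ϖ) ^ 2) ^ 2) := by
  have h1 : ∀ s' : ℤˣ, ∑ a, labelWeight ϖ a * Real.exp (s * (genLabel ϖ a * genLabel ϖ s')) ≤
      Real.exp ((s * (1 + ϖ) ^ 2) ^ 2) := by
    intro b
    calc ∑ a, labelWeight ϖ a * Real.exp (s * (genLabel ϖ a * genLabel ϖ b))
        ≤ ∑ a, labelWeight ϖ a * (s * genLabel ϖ b * genLabel ϖ a +
            Real.exp ((s * (1 + ϖ) ^ 2) ^ 2)) := by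
          refine Finset.sum_le_sum fun a _ =>
            mul_le_mul_of_nonneg_left ?_ (labelWeight_nonneg hϖ a)
          refine (exp_le_add_exp_sq _).trans (add_le_add (le_of_eq (by ring)) ?_)
          refine Real.exp_le_exp.2 (sq_le_sq.2 ?_)
          rw [abs_mul, abs_mul s ((1 + ϖ) ^ 2), abs_of_nonneg (by positivity : 0 ≤ (1 + ϖ) ^ 2)]
          gcongr
          exact abs_genLabel_mul_le hϖ a b
      _ = s * genLabel ϖ b * (∑ a, labelWeight ϖ a * genLabel ϖ a) +
          (∑ a, labelWeight ϖ a) * Real.exp ((s * (1 + ϖ) ^ 2) ^ 2) := by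
          rw [Finset.mul_sum, Finset.sum_mul, ← Finset.sum_add_distrib]
          exact Finset.sum_congr rfl fun a _ => by ring
      _ = _ := by rw [sum_labelWeight_mul_genLabel hϖ, sum_labelWeight hϖ]; ring
  rw [Finset.sum_comm]
  calc _ = ∑ l' : Fin n → ℤˣ, labelsWeight ϖ l' *
        ∏ i, ∑ a, labelWeight ϖ a * Real.exp (s * (genLabel ϖ a * genLabel ϖ (l' i))) := by
        refine Finset.sum_congr rfl fun l' _ => ?_
        rw [← sum_prod_labelWeight (ϖ := ϖ)
          (fun i a => Real.exp (s * (genLabel ϖ a * genLabel ϖ (l' i)))), Finset.mul_sum]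
        refine Finset.sum_congr rfl fun l _ => ?_
        rw [Finset.mul_sum, Real.exp_sum]
        ring
    _ ≤ ∑ l' : Fin n → ℤˣ, labelsWeight ϖ l' * Real.exp (n * (s * (1 + ϖ) ^ 2) ^ 2) := by
        refine Finset.sum_le_sum fun l' _ =>
          mul_le_mul_of_nonneg_left ?_ (labelsWeight_nonneg hϖ l')
        refine (Finset.prod_le_prod (fun i _ => ?_) fun i _ => h1 (l' i)).trans (le_of_eq ?_)
        · exact Finset.sum_nonneg fun a _ =>
            mul_nonneg (labelWeight_nonneg hϖ a) (Real.exp_pos _).le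
        · rw [Finset.prod_const, Finset.card_univ, Fintype.card_fin, Real.exp_nat_mul]
    _ = _ := by rw [← Finset.sum_mul, sum_labelsWeight hϖ, one_mul]

theorem labelMoment_le (hϖ : 0 < ϖ) {n k : ℕ} (hn : 0 < n) (hk : 0 < k) :
    labelMoment ϖ n (2 * k) ≤
      2 * (2 * k).factorial * (Real.exp 1 * (1 + ϖ) ^ 4 * n / k) ^ k := by
  -- With this s the exponent n (s (1+ϖ)²)² equals k, so the exponential moments cost only a factor
  -- e^k.
  set s : ℝ := Real.sqrt (k / n) / (1 + ϖ) ^ 2 with hs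
  have hs0 : 0 < s := by positivity
  have hs2 : n * (s * (1 + ϖ) ^ 2) ^ 2 = k := by
    rw [hs, div_mul_cancel₀ _ (by positivity), Real.sq_sqrt (by positivity)]
    field_simp
  have hsi : (s⁻¹) ^ (2 * k) = ((1 + ϖ) ^ 4 * n / k) ^ k := by
    rw [pow_mul, hs, inv_div, div_pow, Real.sq_sqrt (by positivity), ← pow_mul]
    congr 1
    field_simp
  have h1 := sum_exp_genLabel_le hϖ n s
  have h2 := sum_exp_genLabel_le hϖ n (-s)
  have h3 : n * (-s * (1 + ϖ) ^ 2) ^ 2 = n * (s * (1 + ϖ) ^ 2) ^ 2 := by ring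
  rw [h3] at h2
  calc labelMoment ϖ n (2 * k) ≤ ∑ l : Fin n → ℤˣ, ∑ l' : Fin n → ℤˣ,
        labelsWeight ϖ l * labelsWeight ϖ l' * ((2 * k).factorial * (s⁻¹) ^ (2 * k) *
          (Real.exp (s * ∑ i, genLabel ϖ (l i) * genLabel ϖ (l' i)) +
            Real.exp (-s * ∑ i, genLabel ϖ (l i) * genLabel ϖ (l' i)))) := by
        refine Finset.sum_le_sum fun l _ => Finset.sum_le_sum fun l' _ => ?_
        exact mul_le_mul_of_nonneg_left (even_pow_le_exp _ hs0 k)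
          (mul_nonneg (labelsWeight_nonneg hϖ _) (labelsWeight_nonneg hϖ _))
    _ = (2 * k).factorial * (s⁻¹) ^ (2 * k) *
        ((∑ l : Fin n → ℤˣ, ∑ l' : Fin n → ℤˣ, labelsWeight ϖ l * labelsWeight ϖ l' *
          Real.exp (s * ∑ i, genLabel ϖ (l i) * genLabel ϖ (l' i))) +
        ∑ l : Fin n → ℤˣ, ∑ l' : Fin n → ℤˣ, labelsWeight ϖ l * labelsWeight ϖ l' *
          Real.exp (-s * ∑ i, genLabel ϖ (l i) * genLabel ϖ (l' i))) := by
        rw [← Finset.sum_add_distrib, Finset.mul_sum]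
        refine Finset.sum_congr rfl fun l _ => ?_
        rw [← Finset.sum_add_distrib, Finset.mul_sum]
        exact Finset.sum_congr rfl fun l' _ => by ring
    _ ≤ (2 * k).factorial * (s⁻¹) ^ (2 * k) * (Real.exp k + Real.exp k) := by
        rw [hs2] at h1 h2
        gcongr
    _ = _ := by
        rw [hsi, ← mul_one (k : ℝ), Real.exp_nat_mul, mul_one,
          show Real.exp 1 * (1 + ϖ) ^ 4 * n / k = Real.exp 1 * ((1 + ϖ) ^ 4 * n / k) by ring,
          mul_pow (Real.exp 1)]
        ring

end

/-- Moments of the inner product of two independent uniformly distributed elements of `S`. -/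
def signalMoment {p : ℕ} (S : Finset (Fin p → ℝ)) (d : ℕ) : ℝ :=
  (S.card : ℝ)⁻¹ * ∑ μ ∈ S, (S.card : ℝ)⁻¹ * ∑ ν ∈ S, (∑ k, ν k * μ k) ^ d

theorem signalMoment_nonneg {p : ℕ} (S : Finset (Fin p → ℝ)) (k : ℕ) :
    0 ≤ signalMoment S (2 * k) :=
  mul_nonneg (by positivity) (Finset.sum_nonneg fun _ _ => mul_nonneg (by positivity)
    (Finset.sum_nonneg fun _ _ => (even_two_mul k).pow_nonneg _))

theorem signalMoment_zero {p : ℕ} {S : Finset (Fin p → ℝ)} (hS : S.Nonempty) :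
    signalMoment S 0 = 1 := by
  have : (S.card : ℝ) ≠ 0 := by exact_mod_cast hS.card_pos.ne'
  simp [signalMoment, this]

/-- The reflection ν ↦ -ν permutes S and changes the sign of odd powers. -/
theorem signalMoment_odd {p : ℕ} {S : Finset (Fin p → ℝ)} (hS : ∀ μ ∈ S, -μ ∈ S) {d : ℕ}
    (hd : Odd d) : signalMoment S d = 0 := by
  have h : ∀ μ : Fin p → ℝ, ∑ ν ∈ S, (∑ k, ν k * μ k) ^ d = 0 := by
    intro μ
    have h1 : ∑ ν ∈ S, (∑ k, ν k * μ k) ^ d = ∑ ν ∈ S, (∑ k, (-ν) k * μ k) ^ d :=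
      Finset.sum_nbij' (fun ν => -ν) (fun ν => -ν) hS hS (fun _ _ => neg_neg _)
        (fun _ _ => neg_neg _) fun ν _ => by simp
    have h2 : ∀ ν : Fin p → ℝ, (∑ k, (-ν) k * μ k) ^ d = -(∑ k, ν k * μ k) ^ d := by
      intro ν
      rw [← hd.neg_pow]
      simp
    simp_rw [h2, Finset.sum_neg_distrib] at h1
    linarith
  simp [signalMoment, h]

section
variable {len : ℕ → ℕ} {m p : ℕ} {gap τ : ℝ} {μ : Fin p → ℝ}

/-- The number `lam` bounds the mean number of blocks of a random signal that can meet a fixed one,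
and each such block contributes at most τ² L with a random sign. While k is below `lam` the inner
product has Gaussian moments; for larger k the rare event of many overlaps dominates, whence lam +
k. -/
theorem signalMoment_le (hgap : 0 ≤ gap) (hτ : 0 < τ) (hlen : ∀ g, 0 < len g)
    {M : ℕ} (hm : 0 < m) (hM : M + blockOffset len ⌊gap⌋₊ (m - 1) + len (m - 1) = p + 1)
    (hmM : m ≤ M) {L : ℕ} (hL : ∀ g, len g ≤ L) {S : Finset (Fin p → ℝ)}
    (hS : ∀ μ, μ ∈ S ↔ IsBlockSignal m (fun g => len g) gap τ μ) {lam : ℝ}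
    (hlam : (m : ℝ) / (M - m + 1) * (2 * L * m) ≤ lam) {k : ℕ} (hk : 0 < k) :
    signalMoment S (2 * k) ≤
      2 * (2 * k).factorial * (Real.exp 1 * (lam + k) * (τ ^ 2 * L) ^ 2 / k) ^ k := by
  have hL0 : 0 < L := (hlen 0).trans_le (hL 0)
  have hMm : (0 : ℝ) < (M : ℝ) - m + 1 := by
    have : (m : ℝ) ≤ M := by exact_mod_cast hmM
    linarith
  have hlam0 : 0 ≤ lam := le_trans (by positivity) hlam
  have hk0 : (0 : ℝ) < k := by exact_mod_cast hk
  -- The value y of (s τ² L)²/2 is kept below 1, so that e^y - 1 ≤ 2y, and small enough that 2 y lam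
  -- ≤ k. The exponent in `sum_exp_inner_le` is then at most k, and s^(-2k) e^k has the claimed
  -- form.
  set y : ℝ := k / (lam + k) / 2 with hy
  have hy0 : 0 ≤ y := by positivity
  have hy1 : y ≤ 1 := by
    have : (k : ℝ) / (lam + k) ≤ 1 := by
      rw [div_le_one (by positivity)]
      linarith
    rw [hy]
    linarith
  have hyl : 2 * y * lam ≤ k := by
    rw [hy]
    have : 2 * (k / (lam + k) / 2) * lam = k * (lam / (lam + k)) := by field_simp
    rw [this]
    have : lam / (lam + k) ≤ 1 := by
      rw [div_le_one (by positivity)]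
      linarith
    nlinarith
  set s : ℝ := Real.sqrt (k / (lam + k)) / (τ ^ 2 * L) with hs
  have hs0 : 0 < s := by positivity
  have hs2 : (s * τ ^ 2 * L) ^ 2 / 2 = y := by
    rw [mul_assoc, hs, div_mul_cancel₀ _ (by positivity), Real.sq_sqrt (by positivity)]
  have hsi : (s⁻¹) ^ (2 * k) = ((lam + k) * (τ ^ 2 * L) ^ 2 / k) ^ k := by
    rw [pow_mul, hs, inv_div, div_pow, Real.sq_sqrt (by positivity)]
    congr 1
    field_simp
  have hexp : ∀ μ ∈ S, ∀ σ : ℝ, σ ^ 2 = s ^ 2 →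
      ∑ ν ∈ S, Real.exp (σ * ∑ k, ν k * μ k) ≤ S.card * Real.exp k := by
    intro μ hμ σ hσ
    refine (sum_exp_inner_le hgap hτ hlen hm hM hmM hL hS ((hS μ).1 hμ) σ).trans ?_
    have h1 : (σ * τ ^ 2 * L) ^ 2 / 2 = y := by
      rw [← hs2, mul_pow, mul_pow, hσ]
      ring
    rw [h1]
    gcongr
    have h2 := exp_sub_one_le_two_mul hy0 hy1
    have h3 : 0 ≤ Real.exp y - 1 := by
      have := Real.add_one_le_exp y
      linarith
    calc (Real.exp y - 1) * (m / (M - m + 1)) * (2 * L * m)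
        = (Real.exp y - 1) * (m / (M - m + 1) * (2 * L * m)) := by ring
      _ ≤ (2 * y) * lam := by gcongr
      _ ≤ k := hyl
  have hin : ∀ μ ∈ S, (S.card : ℝ)⁻¹ * ∑ ν ∈ S, (∑ k, ν k * μ k) ^ (2 * k) ≤
      2 * (2 * k).factorial * (Real.exp 1 * (lam + k) * (τ ^ 2 * L) ^ 2 / k) ^ k := by
    intro μ hμ
    have hc : (0 : ℝ) < S.card := by exact_mod_cast Finset.card_pos.2 ⟨μ, hμ⟩
    rw [inv_mul_le_iff₀ hc]
    calc ∑ ν ∈ S, (∑ k, ν k * μ k) ^ (2 * k)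
        ≤ ∑ ν ∈ S, (2 * k).factorial * (s⁻¹) ^ (2 * k) *
          (Real.exp (s * ∑ k, ν k * μ k) + Real.exp (-s * ∑ k, ν k * μ k)) :=
          Finset.sum_le_sum fun ν _ => even_pow_le_exp _ hs0 k
      _ = (2 * k).factorial * (s⁻¹) ^ (2 * k) *
          (∑ ν ∈ S, Real.exp (s * ∑ k, ν k * μ k) +
            ∑ ν ∈ S, Real.exp (-s * ∑ k, ν k * μ k)) := by
          rw [← Finset.sum_add_distrib, Finset.mul_sum]
      _ ≤ (2 * k).factorial * (s⁻¹) ^ (2 * k) *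
          (S.card * Real.exp k + S.card * Real.exp k) := by
          gcongr
          · exact hexp μ hμ s rfl
          · exact hexp μ hμ (-s) (neg_sq s)
      _ = _ := by
          rw [hsi, ← mul_one (k : ℝ), Real.exp_nat_mul, mul_one,
            show Real.exp 1 * (lam + k) * (τ ^ 2 * L) ^ 2 / k =
              Real.exp 1 * ((lam + k) * (τ ^ 2 * L) ^ 2 / k) by ring, mul_pow (Real.exp 1)]
          ring
  rw [signalMoment]
  by_cases hne : S.Nonempty
  · have hc : (0 : ℝ) < S.card := by exact_mod_cast hne.card_pos
    rw [inv_mul_le_iff₀ hc]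
    refine (Finset.sum_le_card_nsmul _ _ _ hin).trans (le_of_eq ?_)
    rw [nsmul_eq_mul]
  · rw [Finset.not_nonempty_iff_eq_empty.1 hne]
    simp only [Finset.card_empty, Nat.cast_zero, inv_zero, zero_mul]
    positivity

theorem factorial_two_mul_le (k : ℕ) : ((2 * k).factorial : ℝ) ≤ (4 * (k : ℝ) ^ 2) ^ k := by
  have : ((2 * k).factorial : ℝ) ≤ ((2 * k : ℕ) : ℝ) ^ (2 * k) := by
    exact_mod_cast Nat.factorial_le_pow (2 * k)
  refine this.trans (le_of_eq ?_)
  rw [pow_mul]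
  congr 1
  push_cast
  ring

/-- The contribution of degree `2 k` to the second moment of the likelihood ratio. -/
theorem moment_term_le {ϖ a lam x : ℝ} (hϖ : 0 < ϖ) {n : ℕ} (hn : 0 < n) {k : ℕ} (hk : 0 < k)
    (hlam : 0 ≤ lam)
    (ha0 : 0 ≤ a) (ha : a ≤ 2 * (2 * k).factorial * (Real.exp 1 * (lam + k) * x ^ 2 / k) ^ k) :
    labelMoment ϖ n (2 * k) * a / (2 * k).factorial ≤
      4 * (4 * Real.exp 1 ^ 2 * (1 + ϖ) ^ 4 * n * x ^ 2 * (lam + min k n)) ^ k := by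
  have hk0 : (0 : ℝ) < k := by exact_mod_cast hk
  have hn0 : (0 : ℝ) < n := by exact_mod_cast hn
  have hf : (0 : ℝ) < (2 * k).factorial := by positivity
  rw [div_le_iff₀ hf]
  rcases le_total k n with hkn | hkn
  -- For k ≤ n both sub-Gaussian bounds are used. Of the two factors (2k)! one is divided out, and
  -- the other is at most (4k²)^k, which cancels the two denominators k^k.
  · rw [min_eq_left (by exact_mod_cast hkn)]
    calc labelMoment ϖ n (2 * k) * a
        ≤ (2 * (2 * k).factorial * (Real.exp 1 * (1 + ϖ) ^ 4 * n / k) ^ k) *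
          (2 * (2 * k).factorial * (Real.exp 1 * (lam + k) * x ^ 2 / k) ^ k) :=
          mul_le_mul (labelMoment_le hϖ hn hk) ha ha0 (by positivity)
      _ = 4 * ((2 * k).factorial * ((Real.exp 1 * (1 + ϖ) ^ 4 * n / k) *
          (Real.exp 1 * (lam + k) * x ^ 2 / k)) ^ k) * (2 * k).factorial := by
          rw [mul_pow (Real.exp 1 * (1 + ϖ) ^ 4 * n / k)]
          ring
      _ ≤ 4 * ((4 * (k : ℝ) ^ 2) ^ k * ((Real.exp 1 * (1 + ϖ) ^ 4 * n / k) *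
          (Real.exp 1 * (lam + k) * x ^ 2 / k)) ^ k) * (2 * k).factorial := by
          gcongr
          exact factorial_two_mul_le k
      _ = _ := by
          rw [← mul_pow]
          congr 3
          field_simp
  -- For k ≥ n the crude bound for the labels has no factorial; what remains is n (lam + k)/k ≤ lam
  -- + n.
  · rw [min_eq_right (by exact_mod_cast hkn)]
    calc labelMoment ϖ n (2 * k) * a
        ≤ (((1 + ϖ) ^ 2 * n) ^ (2 * k)) *
          (2 * (2 * k).factorial * (Real.exp 1 * (lam + k) * x ^ 2 / k) ^ k) :=
          mul_le_mul (labelMoment_le_pow hϖ n k) ha ha0 (by positivity)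
      _ = 2 * (((1 + ϖ) ^ 2 * n) ^ 2 * (Real.exp 1 * (lam + k) * x ^ 2 / k)) ^ k *
          (2 * k).factorial := by
          rw [pow_mul, mul_pow _ (Real.exp 1 * (lam + k) * x ^ 2 / k)]
          ring
      _ ≤ 4 * (4 * Real.exp 1 ^ 2 * (1 + ϖ) ^ 4 * n * x ^ 2 * (lam + n)) ^ k *
          (2 * k).factorial := by
          have h1 : (n : ℝ) * (lam + k) / k ≤ lam + n := by
            rw [div_le_iff₀ hk0]
            have : (n : ℝ) ≤ k := by exact_mod_cast hkn
            nlinarith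
          have he : (1 : ℝ) ≤ Real.exp 1 := Real.one_le_exp (by norm_num)
          have h2 : ((1 + ϖ) ^ 2 * (n : ℝ)) ^ 2 * (Real.exp 1 * (lam + k) * x ^ 2 / k) ≤
              4 * Real.exp 1 ^ 2 * (1 + ϖ) ^ 4 * n * x ^ 2 * (lam + n) := by
            calc ((1 + ϖ) ^ 2 * (n : ℝ)) ^ 2 * (Real.exp 1 * (lam + k) * x ^ 2 / k)
                = Real.exp 1 * ((1 + ϖ) ^ 4 * n * x ^ 2) * (n * (lam + k) / k) := by ring
              _ ≤ (4 * Real.exp 1 ^ 2) * ((1 + ϖ) ^ 4 * n * x ^ 2) * (lam + n) := by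
                gcongr
                nlinarith
              _ = _ := by ring
          gcongr
          norm_num

end

/-! # The signal class for large dimension -/

theorem signalClass_finite (ρ : ℕ → ℝ) (α β r : ℝ) (p : ℕ) : (signalClass ρ α β r p).Finite := by
  have h : (Set.univ.pi fun _ : Fin p =>
      ({0, (p : ℝ) ^ (-r), -(p : ℝ) ^ (-r)} : Set ℝ)).Finite :=
    Set.Finite.pi fun _ => Set.toFinite _
  refine h.subset fun μ hμ k _ => ?_
  obtain ⟨j, t, h1, h2, h3, h4, h5⟩ := hμ
  by_cases hk : ∃ g, j g ≤ k ∧ (k : ℕ) < j g + ⌊ρ ((g : ℕ) + 1) * (p : ℝ) ^ α⌋₊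
  · obtain ⟨g, hg⟩ := hk
    rw [h4 g k hg.1 hg.2]
    have h6 := h3 g
    rcases (abs_eq (h6 ▸ abs_nonneg _)).1 h6 with h | h <;> simp [h]
  · push Not at hk
    simp [h5 k fun g hg => absurd hg.2 (not_lt.2 (hk g hg.1))]

/-- The signal class as a finite set. -/
def signalSet (ρ : ℕ → ℝ) (α β r : ℝ) (p : ℕ) : Finset (Fin p → ℝ) :=
  (signalClass_finite ρ α β r p).toFinset

theorem mem_signalSet {ρ : ℕ → ℝ} {α β r : ℝ} {p : ℕ} {μ : Fin p → ℝ} :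
    μ ∈ signalSet ρ α β r p ↔ μ ∈ signalClass ρ α β r p := by
  simp [signalSet]

theorem neg_mem_signalSet {ρ : ℕ → ℝ} {α β r : ℝ} {p : ℕ} {μ : Fin p → ℝ}
    (h : μ ∈ signalSet ρ α β r p) : -μ ∈ signalSet ρ α β r p := by
  rw [mem_signalSet] at h ⊢
  obtain ⟨j, t, h1, h2, h3, h4, h5⟩ := h
  exact ⟨j, fun g => -t g, h1, h2, fun g => by rw [abs_neg, h3 g],
    fun g k h6 h7 => by rw [Pi.neg_apply, h4 g k h6 h7],
    fun k h6 => by rw [Pi.neg_apply, h5 k h6, neg_zero]⟩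

/-- Scaling a block signal. -/
theorem IsBlockSignal.smul {p m : ℕ} {len : Fin m → ℕ} {gap τ : ℝ} {μ : Fin p → ℝ}
    (h : IsBlockSignal m len gap τ μ) {a : ℝ} (ha : 0 ≤ a) :
    IsBlockSignal m len gap (a * τ) (a • μ) := by
  obtain ⟨j, t, h1, h2, h3, h4, h5⟩ := h
  exact ⟨j, fun g => a * t g, h1, h2, fun g => by rw [abs_mul, h3 g, abs_of_nonneg ha],
    fun g k h6 h7 => by rw [Pi.smul_apply, h4 g k h6 h7, smul_eq_mul],
    fun k h6 => by rw [Pi.smul_apply, h5 k h6, smul_zero]⟩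

theorem smul_mem_signalSet {ρ : ℕ → ℝ} {α β r r' : ℝ} {p : ℕ} (hp : 0 < p) {μ : Fin p → ℝ}
    (h : μ ∈ signalSet ρ α β r' p) : (p : ℝ) ^ (r' - r) • μ ∈ signalSet ρ α β r p := by
  rw [mem_signalSet] at h ⊢
  have hp0 : (0 : ℝ) < p := by exact_mod_cast hp
  have h1 := IsBlockSignal.smul h (Real.rpow_nonneg hp0.le (r' - r))
  rw [← Real.rpow_add hp0] at h1
  have h2 : r' - r + -r' = -r := by ring
  rw [h2] at h1
  exact h1

/-- Averages over the classes of two signal strengths are related by scaling. -/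
theorem sum_signalSet_smul {ρ : ℕ → ℝ} {α β r r' : ℝ} {p : ℕ} (hp : 0 < p)
    (F : (Fin p → ℝ) → ℝ) :
    ∑ μ ∈ signalSet ρ α β r' p, F ((p : ℝ) ^ (r' - r) • μ) = ∑ μ ∈ signalSet ρ α β r p, F μ := by
  have hp0 : (0 : ℝ) < p := by exact_mod_cast hp
  have hcancel : ∀ s t : ℝ, (p : ℝ) ^ (s - t) * (p : ℝ) ^ (t - s) = 1 := by
    intro s t
    rw [← Real.rpow_add hp0]
    simp
  refine Finset.sum_nbij' (fun μ => (p : ℝ) ^ (r' - r) • μ) (fun μ => (p : ℝ) ^ (r - r') • μ)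
    (fun μ h => smul_mem_signalSet hp h) (fun μ h => smul_mem_signalSet hp h) ?_ ?_ ?_
  · intro μ _
    rw [smul_smul, hcancel, one_smul]
  · intro μ _
    rw [smul_smul, hcancel, one_smul]
  · intro μ _
    rfl

theorem card_signalSet_eq {ρ : ℕ → ℝ} {α β : ℝ} (r r' : ℝ) {p : ℕ} (hp : 0 < p) :
    ((signalSet ρ α β r' p).card : ℝ) = (signalSet ρ α β r p).card := by
  simpa using sum_signalSet_smul (ρ := ρ) (α := α) (β := β) (r := r) (r' := r') hp fun _ => 1

theorem tendsto_natCast_rpow_neg {c : ℝ} (hc : c < 0) :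
    Tendsto (fun p : ℕ => (p : ℝ) ^ c) atTop (𝓝 0) := by
  have := (tendsto_rpow_neg_atTop (neg_pos.2 hc)).comp tendsto_natCast_atTop_atTop
  simpa [Function.comp_def] using this

theorem tendsto_natCast_rpow_mul_log {c : ℝ} (hc : c < 0) (s : ℝ) :
    Tendsto (fun p : ℕ => (p : ℝ) ^ c * Real.log p ^ s) atTop (𝓝 0) := by
  have h := (isLittleO_log_rpow_rpow_atTop s (neg_pos.2 hc)).tendsto_div_nhds_zero.comp
    tendsto_natCast_atTop_atTop
  refine h.congr' ?_
  filter_upwards [eventually_gt_atTop 0] with p hp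
  have hp0 : (0 : ℝ) < p := by exact_mod_cast hp
  simp only [Function.comp]
  rw [Real.rpow_neg hp0.le, div_inv_eq_mul, mul_comm]

section
variable {α β a b : ℝ} {ρ : ℕ → ℝ}

/-- Room for the blocks: the parametrization of the class in large dimension. -/
theorem eventually_exists_parametrization (hα : 0 < α) (hβ : 0 < β) (hβα : β < 1 - α) (ha : 0 < a)
    (hρ : ∀ g, a ≤ ρ g ∧ ρ g ≤ b) :
    ∀ᶠ p : ℕ in atTop, ∃ M : ℕ, 0 < ⌊(p : ℝ) ^ (1 - α - β)⌋₊ ∧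
      (∀ g : ℕ, 0 < ⌊ρ (g + 1) * (p : ℝ) ^ α⌋₊) ∧
      M + blockOffset (fun g => ⌊ρ (g + 1) * (p : ℝ) ^ α⌋₊)
        ⌊ρ 0 * Real.log p * (p : ℝ) ^ α⌋₊ (⌊(p : ℝ) ^ (1 - α - β)⌋₊ - 1) +
        ⌊ρ (⌊(p : ℝ) ^ (1 - α - β)⌋₊ - 1 + 1 : ℕ) * (p : ℝ) ^ α⌋₊ = p + 1 ∧
      ⌊(p : ℝ) ^ (1 - α - β)⌋₊ ≤ M ∧
      (⌊(p : ℝ) ^ (1 - α - β)⌋₊ : ℝ) / (M - ⌊(p : ℝ) ^ (1 - α - β)⌋₊ + 1) *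
        (2 * ⌊b * (p : ℝ) ^ α⌋₊ * ⌊(p : ℝ) ^ (1 - α - β)⌋₊) ≤ 4 * b * (p : ℝ) ^ (1 - α - 2 * β) := by
  have hb : 0 < b := ha.trans_le ((hρ 0).1.trans (hρ 0).2)
  have e1 : ∀ᶠ p : ℕ in atTop, (p : ℝ) ^ (-(1 - α - β)) ≤ 1 :=
    (tendsto_natCast_rpow_neg (by linarith)).eventually (eventually_le_nhds one_pos)
  have e2 : ∀ᶠ p : ℕ in atTop, (p : ℝ) ^ (-α) ≤ a :=
    (tendsto_natCast_rpow_neg (by linarith)).eventually (eventually_le_nhds ha)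
  have e3 : ∀ᶠ p : ℕ in atTop, b * ((p : ℝ) ^ (-β) * Real.log p ^ (1 : ℝ)) ≤ 1 / 8 := by
    have := (tendsto_natCast_rpow_mul_log (c := -β) (by linarith) 1).const_mul b
    rw [mul_zero] at this
    exact this.eventually (eventually_le_nhds (by norm_num))
  have e4 : ∀ᶠ p : ℕ in atTop, b * (p : ℝ) ^ (-β) ≤ 1 / 8 := by
    have := (tendsto_natCast_rpow_neg (c := -β) (by linarith)).const_mul b
    rw [mul_zero] at this
    exact this.eventually (eventually_le_nhds (by norm_num))
  have e5 : ∀ᶠ p : ℕ in atTop, b * (p : ℝ) ^ (α - 1) ≤ 1 / 8 := by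
    have := (tendsto_natCast_rpow_neg (c := α - 1) (by linarith)).const_mul b
    rw [mul_zero] at this
    exact this.eventually (eventually_le_nhds (by norm_num))
  have e6 : ∀ᶠ p : ℕ in atTop, (p : ℝ) ^ (-α - β) ≤ 1 / 8 :=
    (tendsto_natCast_rpow_neg (by linarith)).eventually (eventually_le_nhds (by norm_num))
  filter_upwards [e1, e2, e3, e4, e5, e6, eventually_gt_atTop 0] with p h1 h2 h3 h4 h5 h6 hp
  have hp0 : (0 : ℝ) < p := by exact_mod_cast hp
  have hp1 : (1 : ℝ) ≤ p := by exact_mod_cast hp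
  have hlog : 0 ≤ Real.log p := Real.log_nonneg hp1
  set m : ℕ := ⌊(p : ℝ) ^ (1 - α - β)⌋₊ with hm
  have hpα : 0 < (p : ℝ) ^ α := Real.rpow_pos_of_pos hp0 _
  have hmle : (m : ℝ) ≤ (p : ℝ) ^ (1 - α - β) := Nat.floor_le (Real.rpow_nonneg hp0.le _)
  have hm0 : 0 < m := by
    rw [hm, Nat.floor_pos]
    rw [Real.rpow_neg hp0.le] at h1
    exact (inv_le_one₀ (Real.rpow_pos_of_pos hp0 _)).1 h1
  have hlen0 : ∀ g : ℕ, 0 < ⌊ρ (g + 1) * (p : ℝ) ^ α⌋₊ := by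
    intro g
    rw [Nat.floor_pos]
    rw [Real.rpow_neg hp0.le, inv_le_iff_one_le_mul₀ hpα] at h2
    exact h2.trans (mul_le_mul_of_nonneg_right (hρ _).1 hpα.le)
  have hlenle : ∀ g : ℕ, (⌊ρ (g + 1) * (p : ℝ) ^ α⌋₊ : ℝ) ≤ b * (p : ℝ) ^ α := fun g =>
    (Nat.floor_le (mul_nonneg (ha.le.trans (hρ _).1) hpα.le)).trans
      (mul_le_mul_of_nonneg_right (hρ _).2 hpα.le)
  have hgaple : (⌊ρ 0 * Real.log p * (p : ℝ) ^ α⌋₊ : ℝ) ≤ b * Real.log p * (p : ℝ) ^ α := by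
    refine (Nat.floor_le (by have : 0 < ρ 0 := ha.trans_le (hρ 0).1; positivity)).trans ?_
    have := (hρ 0).2
    gcongr
  -- The blocks and gaps before the last block take at most m (b log p + b) p^α = p · O(p^(-β) log
  -- p) places, a small fraction of p because β > 0.
  have hoff : (blockOffset (fun g => ⌊ρ (g + 1) * (p : ℝ) ^ α⌋₊)
      ⌊ρ 0 * Real.log p * (p : ℝ) ^ α⌋₊ (m - 1) : ℝ) ≤ p / 4 := by
    have h7 : (blockOffset (fun g => ⌊ρ (g + 1) * (p : ℝ) ^ α⌋₊)
        ⌊ρ 0 * Real.log p * (p : ℝ) ^ α⌋₊ (m - 1) : ℝ) ≤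
        (m - 1 : ℕ) * (b * Real.log p * (p : ℝ) ^ α + b * (p : ℝ) ^ α) := by
      rw [blockOffset]
      push_cast
      refine (Finset.sum_le_card_nsmul _ _ (b * Real.log p * (p : ℝ) ^ α + b * (p : ℝ) ^ α)
        fun g _ => ?_).trans (le_of_eq ?_)
      · have h8 : ((⌊ρ 0 * Real.log p * (p : ℝ) ^ α⌋₊ + ⌊ρ ((g : ℕ) + 1) * (p : ℝ) ^ α⌋₊ - 1 : ℕ) : ℝ)
            ≤ ((⌊ρ 0 * Real.log p * (p : ℝ) ^ α⌋₊ + ⌊ρ ((g : ℕ) + 1) * (p : ℝ) ^ α⌋₊ : ℕ) : ℝ) := by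
          exact_mod_cast Nat.sub_le _ _
        refine h8.trans ?_
        push_cast
        exact add_le_add hgaple (hlenle g)
      · rw [Finset.card_range, nsmul_eq_mul]
    have h8 : ((m - 1 : ℕ) : ℝ) ≤ (p : ℝ) ^ (1 - α - β) := by
      refine le_trans ?_ hmle
      exact_mod_cast Nat.sub_le _ _
    have h9 : (p : ℝ) ^ (1 - α - β) * (p : ℝ) ^ α = p * (p : ℝ) ^ (-β) := by
      rw [← Real.rpow_add hp0, ← Real.rpow_one_add' hp0.le (by linarith)]
      congr 1
      ring
    rw [Real.rpow_one] at h3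
    calc _ ≤ ((m - 1 : ℕ) : ℝ) * (b * Real.log p * (p : ℝ) ^ α + b * (p : ℝ) ^ α) := h7
      _ ≤ (p : ℝ) ^ (1 - α - β) * (b * Real.log p * (p : ℝ) ^ α + b * (p : ℝ) ^ α) := by
          gcongr
      _ = ((p : ℝ) ^ (1 - α - β) * (p : ℝ) ^ α) * (b * Real.log p + b) := by ring
      _ = p * (b * ((p : ℝ) ^ (-β) * Real.log p) + b * (p : ℝ) ^ (-β)) := by rw [h9]; ring
      _ ≤ p * (1 / 8 + 1 / 8) := by gcongr
      _ = p / 4 := by ring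
  have hlast : (⌊ρ (m - 1 + 1 : ℕ) * (p : ℝ) ^ α⌋₊ : ℝ) ≤ p / 8 := by
    refine (hlenle (m - 1)).trans ?_
    have h9 : (p : ℝ) ^ α = p * (p : ℝ) ^ (α - 1) := by
      rw [← Real.rpow_one_add' hp0.le (by linarith)]
      congr 1
      ring
    rw [h9]
    calc b * (p * (p : ℝ) ^ (α - 1)) = p * (b * (p : ℝ) ^ (α - 1)) := by ring
      _ ≤ p * (1 / 8) := by gcongr
      _ = _ := by ring
  have hmp : (m : ℝ) ≤ p / 8 := by
    refine hmle.trans ?_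
    have h9 : (p : ℝ) ^ (1 - α - β) = p * (p : ℝ) ^ (-α - β) := by
      rw [← Real.rpow_one_add' hp0.le (by linarith)]
      congr 1
      ring
    rw [h9]
    calc p * (p : ℝ) ^ (-α - β) ≤ p * (1 / 8) := by gcongr
      _ = _ := by ring
  set o := blockOffset (fun g => ⌊ρ (g + 1) * (p : ℝ) ^ α⌋₊)
      ⌊ρ 0 * Real.log p * (p : ℝ) ^ α⌋₊ (m - 1) with ho
  set l := ⌊ρ (m - 1 + 1 : ℕ) * (p : ℝ) ^ α⌋₊ with hl
  have hle : o + l + m ≤ p := by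
    have : (o : ℝ) + l + m ≤ p := by linarith
    exact_mod_cast this
  -- M is dictated by the equation between M, the offset and the last length; `hle` makes the
  -- subtractions genuine and leaves M ≥ m.
  refine ⟨p + 1 - o - l, hm0, hlen0, by omega, by omega, ?_⟩
  have hM : ((p + 1 - o - l : ℕ) : ℝ) = p + 1 - o - l := by
    rw [Nat.cast_sub (by omega), Nat.cast_sub (by omega)]
    push_cast
    ring
  rw [hM]
  -- At most p/4 + p/8 + p/8 places are used up, so the denominator M - m + 1 is at least p/2.
  have hden : (p : ℝ) / 2 ≤ p + 1 - o - l - m + 1 := by linarith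
  have hL : (⌊b * (p : ℝ) ^ α⌋₊ : ℝ) ≤ b * (p : ℝ) ^ α := Nat.floor_le (by positivity)
  calc (m : ℝ) / ((p : ℝ) + 1 - o - l - m + 1) * (2 * ⌊b * (p : ℝ) ^ α⌋₊ * m)
      ≤ (p : ℝ) ^ (1 - α - β) / (p / 2) * (2 * (b * (p : ℝ) ^ α) * (p : ℝ) ^ (1 - α - β)) := by
        gcongr
    _ = 4 * b * ((p : ℝ) ^ (1 - α - β) * (p : ℝ) ^ α * (p : ℝ) ^ (1 - α - β) *
          (p : ℝ) ^ (-1 : ℝ)) := by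
        rw [Real.rpow_neg_one]
        field_simp
        norm_num
    _ = _ := by
        rw [← Real.rpow_add hp0, ← Real.rpow_add hp0, ← Real.rpow_add hp0]
        congr 2
        ring

theorem eventually_signalSet_nonempty (hα : 0 < α) (hβ : 0 < β) (hβα : β < 1 - α) (ha : 0 < a)
    (hρ : ∀ g, a ≤ ρ g ∧ ρ g ≤ b) (r : ℝ) :
    ∀ᶠ p : ℕ in atTop, (signalSet ρ α β r p).Nonempty := by
  filter_upwards [eventually_exists_parametrization hα hβ hβα ha hρ, eventually_gt_atTop 0] with
    p ⟨M, hm, hlen, hM, hmM, _⟩ hp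
  have hp0 : (0 : ℝ) < p := by exact_mod_cast hp
  obtain ⟨W, hW⟩ : ((Finset.range M).powersetCard ⌊(p : ℝ) ^ (1 - α - β)⌋₊).Nonempty :=
    Finset.powersetCard_nonempty.2 (by simpa using hmM)
  exact ⟨_, mem_signalSet.2 (isBlockSignal_blockSignal
    (len := fun g => ⌊ρ (g + 1) * (p : ℝ) ^ α⌋₊) (Real.rpow_nonneg hp0.le (-r)) hlen
    (isConfig_blockStart hlen hm hM hW) fun _ => 1)⟩

/-- In powers of p, the mean number of overlaps is m² L / p, of order p^(1-α-2β), and the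
contribution τ² L of one overlap is of order p^(α-2r). -/
theorem eventually_signalMoment_le (hα : 0 < α) (hβ : 0 < β) (hβα : β < 1 - α) (ha : 0 < a)
    (hρ : ∀ g, a ≤ ρ g ∧ ρ g ≤ b) (r : ℝ) :
    ∀ᶠ p : ℕ in atTop, ∀ k : ℕ, 0 < k → signalMoment (signalSet ρ α β r p) (2 * k) ≤
      2 * (2 * k).factorial * (Real.exp 1 * (4 * b * (p : ℝ) ^ (1 - α - 2 * β) + k) *
        (b * (p : ℝ) ^ (α - 2 * r)) ^ 2 / k) ^ k := by
  have hb : 0 < b := ha.trans_le ((hρ 0).1.trans (hρ 0).2)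
  filter_upwards [eventually_exists_parametrization hα hβ hβα ha hρ, eventually_gt_atTop 0] with
    p ⟨M, hm, hlen, hM, hmM, hlam⟩ hp k hk
  have hp0 : (0 : ℝ) < p := by exact_mod_cast hp
  have hp1 : (1 : ℝ) ≤ p := by exact_mod_cast hp
  have hgap : 0 ≤ ρ 0 * Real.log p * (p : ℝ) ^ α := by
    have : 0 < ρ 0 := ha.trans_le (hρ 0).1
    have := Real.log_nonneg hp1
    positivity
  have hL : ∀ g : ℕ, ⌊ρ (g + 1) * (p : ℝ) ^ α⌋₊ ≤ ⌊b * (p : ℝ) ^ α⌋₊ := fun g =>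
    Nat.floor_le_floor (mul_le_mul_of_nonneg_right (hρ _).2 (Real.rpow_nonneg hp0.le _))
  refine (signalMoment_le (len := fun g => ⌊ρ (g + 1) * (p : ℝ) ^ α⌋₊) hgap
    (Real.rpow_pos_of_pos hp0 (-r)) hlen hm hM hmM hL (fun μ => mem_signalSet) hlam hk).trans ?_
  have hx : ((p : ℝ) ^ (-r)) ^ 2 * (⌊b * (p : ℝ) ^ α⌋₊ : ℝ) ≤ b * (p : ℝ) ^ (α - 2 * r) := by
    calc ((p : ℝ) ^ (-r)) ^ 2 * (⌊b * (p : ℝ) ^ α⌋₊ : ℝ)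
        ≤ ((p : ℝ) ^ (-r)) ^ 2 * (b * (p : ℝ) ^ α) := by
          gcongr
          exact Nat.floor_le (by positivity)
      _ = b * ((p : ℝ) ^ (-r * 2) * (p : ℝ) ^ α) := by
          rw [Real.rpow_mul hp0.le, Real.rpow_two]
          ring
      _ = _ := by
          rw [← Real.rpow_add hp0]
          congr 2
          ring
  gcongr

/-! ### The second moment of the likelihood ratio, degree by degree. -/

/-- The contribution of degree `d` to the second moment of the likelihood ratio. -/
def chiTerm (ϖ : ℝ) (n : ℕ) {p : ℕ} (S : Finset (Fin p → ℝ)) (d : ℕ) : ℝ :=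
  labelMoment ϖ n d * signalMoment S d / d.factorial

/-- Since ε ≤ 1/4, the even term 4 ε^k is at most 4 ε (1/2)^(2k-2). All positive degrees are thus
dominated by one geometric series of ratio 1/2, started at degree 2, with sum at most 8 ε. -/
theorem sum_range_le_of_even {t : ℕ → ℝ} {ε : ℝ} (hε0 : 0 ≤ ε) (hε : ε ≤ 1 / 4) {N : ℕ}
    (h0 : t 0 = 1) (hodd : ∀ d, Odd d → t d = 0)
    (hle : ∀ k, 0 < k → 2 * k < N → t (2 * k) ≤ 4 * ε ^ k) :
    ∑ d ∈ Finset.range N, t d ≤ 1 + 8 * ε := by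
  set σ := Real.sqrt ε with hσ
  have hσ0 : 0 ≤ σ := Real.sqrt_nonneg _
  have hσ2 : σ ^ 2 = ε := Real.sq_sqrt hε0
  have hσ1 : σ ≤ 1 / 2 := by
    rw [hσ, Real.sqrt_le_left (by norm_num)]
    norm_num
    linarith
  have key : ∀ i < N, t i ≤ if i = 0 then 1 else if i = 1 then 0 else 4 * ε * (1 / 2) ^ (i - 2) := by
    intro i hi
    rcases Nat.even_or_odd i with he | ho
    · obtain ⟨k, rfl⟩ := he.two_dvd
      rcases Nat.eq_zero_or_pos k with rfl | hk
      · simp [h0]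
      · rw [if_neg (by omega), if_neg (by omega)]
        refine (hle k hk hi).trans ?_
        obtain ⟨j, rfl⟩ : ∃ j, k = j + 1 := ⟨k - 1, by omega⟩
        have : 2 * (j + 1) - 2 = 2 * j := by omega
        rw [this, pow_succ, pow_mul]
        have h2 : ε ^ j ≤ ((1 / 2 : ℝ) ^ 2) ^ j := pow_le_pow_left₀ hε0 (by linarith) _
        nlinarith
    · rw [hodd i ho]
      have : i ≠ 0 := by rintro rfl; simp at ho
      rw [if_neg this]
      split_ifs
      · exact le_rfl
      · positivity
  refine (Finset.sum_le_sum fun i hi => key i (Finset.mem_range.1 hi)).trans ?_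
  have hnn : ∀ i : ℕ, 0 ≤ if i = 0 then (1 : ℝ) else if i = 1 then 0 else
      4 * ε * (1 / 2) ^ (i - 2) := by
    intro i
    split_ifs <;> positivity
  refine (Finset.sum_le_sum_of_subset_of_nonneg (Finset.range_mono (by omega : N ≤ N + 2))
    fun i _ _ => hnn i).trans ?_
  rw [Finset.sum_range_succ', Finset.sum_range_succ']
  have : ∑ i ∈ Finset.range N, (if i + 1 + 1 = 0 then (1 : ℝ) else if i + 1 + 1 = 1 then 0 else
      4 * ε * (1 / 2) ^ (i + 1 + 1 - 2)) = 4 * ε * ∑ i ∈ Finset.range N, (1 / 2) ^ i := by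
    rw [Finset.mul_sum]
    refine Finset.sum_congr rfl fun i _ => ?_
    rw [if_neg (by omega), if_neg (by omega)]
    rfl
  rw [this]
  have := sum_geometric_two_le N
  simp only [zero_add, if_true, one_ne_zero, if_false]
  nlinarith

variable {θ ϖ r : ℝ}

theorem sampleSize_le (θ : ℝ) (p : ℕ) : (sampleSize θ p : ℝ) ≤ (p : ℝ) ^ θ :=
  Nat.floor_le (Real.rpow_nonneg (Nat.cast_nonneg p) _)

theorem sampleSize_pos (hθ : 0 < θ) {p : ℕ} (hp : 0 < p) : 0 < sampleSize θ p := by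
  rw [sampleSize, Nat.floor_pos]
  exact Real.one_le_rpow (by exact_mod_cast hp) hθ.le

/-- Partial sums of the second moment of the likelihood ratio are close to one, provided that a
bound `w` on the degree, or on the sample size, is not too large. -/
theorem eventually_sum_chiTerm (hα : 0 < α) (hβ : 0 < β) (hβα : β < 1 - α) (ha : 0 < a)
    (hρ : ∀ g, a ≤ ρ g ∧ ρ g ≤ b) (hθ : 0 < θ) (hϖ : 0 < ϖ)
    (hr : (1 + θ + α - 2 * β) / 4 < r) {w : ℕ → ℝ} (hw0 : ∀ p, 0 ≤ w p)
    (hw : Tendsto (fun p : ℕ => (p : ℝ) ^ (θ + 2 * α - 4 * r) * w p) atTop (𝓝 0))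
    {ε : ℝ} (hε : 0 < ε) :
    ∀ᶠ p : ℕ in atTop, ∀ N : ℕ, 0 < N →
      (∀ k : ℕ, 2 * k < N → ((min k (sampleSize θ p) : ℕ) : ℝ) ≤ w p) →
      1 ≤ ∑ d ∈ Finset.range N, chiTerm ϖ (sampleSize θ p) (signalSet ρ α β r p) d ∧
      ∑ d ∈ Finset.range N, chiTerm ϖ (sampleSize θ p) (signalSet ρ α β r p) d ≤ 1 + ε := by
  have hb : 0 < b := ha.trans_le ((hρ 0).1.trans (hρ 0).2)
  set C : ℝ := 4 * Real.exp 1 ^ 2 * (1 + ϖ) ^ 4 * b ^ 2 with hC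
  have hC0 : 0 < C := by positivity
  -- The two summands are the orders of n (τ²L)² λ and n (τ²L)² w. The exponent of the first, 1 + θ
  -- + α - 2β - 4r, is negative by `hr`; the second tends to 0 by `hw`.
  have hlim : Tendsto (fun p : ℕ => C * (4 * b * (p : ℝ) ^ (θ + 2 * α - 4 * r + (1 - α - 2 * β)) +
      (p : ℝ) ^ (θ + 2 * α - 4 * r) * w p)) atTop (𝓝 0) := by
    have h1 := (tendsto_natCast_rpow_neg (c := θ + 2 * α - 4 * r + (1 - α - 2 * β))
      (by linarith)).const_mul (4 * b)
    have := (h1.add hw).const_mul C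
    simpa using this
  have hmin : 0 < min (1 / 4) (ε / 8) := by positivity
  filter_upwards [hlim.eventually (eventually_le_nhds hmin),
    eventually_signalMoment_le hα hβ hβα ha hρ r, eventually_signalSet_nonempty hα hβ hβα ha hρ r,
    eventually_gt_atTop 0] with p h1 h2 h3 hp N hN hwN
  have hp0 : (0 : ℝ) < p := by exact_mod_cast hp
  have hn := sampleSize_pos hθ hp
  set e : ℝ := C * (4 * b * (p : ℝ) ^ (θ + 2 * α - 4 * r + (1 - α - 2 * β)) +
      (p : ℝ) ^ (θ + 2 * α - 4 * r) * w p) with he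
  have he0 : 0 ≤ e := by
    have := hw0 p
    positivity
  have ht0 : chiTerm ϖ (sampleSize θ p) (signalSet ρ α β r p) 0 = 1 := by
    simp [chiTerm, labelMoment_zero hϖ, signalMoment_zero h3]
  have hodd : ∀ d, Odd d → chiTerm ϖ (sampleSize θ p) (signalSet ρ α β r p) d = 0 := by
    intro d hd
    simp [chiTerm, signalMoment_odd (fun μ hμ => neg_mem_signalSet hμ) hd]
  have hnn : ∀ d, 0 ≤ chiTerm ϖ (sampleSize θ p) (signalSet ρ α β r p) d := by
    intro d
    rcases Nat.even_or_odd d with hd | hd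
    · obtain ⟨k, rfl⟩ := hd.two_dvd
      have := labelMoment_nonneg hϖ (sampleSize θ p) k
      have := signalMoment_nonneg (signalSet ρ α β r p) k
      rw [chiTerm]
      positivity
    · exact (hodd d hd).ge
  constructor
  · calc (1 : ℝ) = ∑ d ∈ {0}, chiTerm ϖ (sampleSize θ p) (signalSet ρ α β r p) d := by
          simp [ht0]
      _ ≤ _ := Finset.sum_le_sum_of_subset_of_nonneg (by simpa using hN) fun d _ _ => hnn d
  · have := sum_range_le_of_even he0 (h1.trans (min_le_left _ _)) (N := N) ht0 hodd ?_
    · have := h1.trans (min_le_right _ _)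
      linarith
    · intro k hk hkN
      refine (moment_term_le (lam := 4 * b * (p : ℝ) ^ (1 - α - 2 * β)) hϖ hn hk (by positivity)
        (signalMoment_nonneg _ k) (h2 k hk)).trans ?_
      have hx : (sampleSize θ p : ℝ) * (b * (p : ℝ) ^ (α - 2 * r)) ^ 2 ≤
          b ^ 2 * (p : ℝ) ^ (θ + 2 * α - 4 * r) := by
        calc (sampleSize θ p : ℝ) * (b * (p : ℝ) ^ (α - 2 * r)) ^ 2
            ≤ (p : ℝ) ^ θ * (b * (p : ℝ) ^ (α - 2 * r)) ^ 2 := by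
              gcongr
              exact sampleSize_le θ p
          _ = b ^ 2 * ((p : ℝ) ^ θ * (p : ℝ) ^ ((α - 2 * r) * 2)) := by
              rw [Real.rpow_mul hp0.le, Real.rpow_two]
              ring
          _ = _ := by
              rw [← Real.rpow_add hp0]
              congr 2
              ring
      have hmn : 0 ≤ ((min k (sampleSize θ p) : ℕ) : ℝ) := by positivity
      gcongr
      calc 4 * Real.exp 1 ^ 2 * (1 + ϖ) ^ 4 * (sampleSize θ p) * (b * (p : ℝ) ^ (α - 2 * r)) ^ 2 *
            (4 * b * (p : ℝ) ^ (1 - α - 2 * β) + ((min k (sampleSize θ p) : ℕ) : ℝ))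
          = 4 * Real.exp 1 ^ 2 * (1 + ϖ) ^ 4 * ((sampleSize θ p) *
            (b * (p : ℝ) ^ (α - 2 * r)) ^ 2) *
            (4 * b * (p : ℝ) ^ (1 - α - 2 * β) + ((min k (sampleSize θ p) : ℕ) : ℝ)) := by ring
        _ ≤ 4 * Real.exp 1 ^ 2 * (1 + ϖ) ^ 4 * (b ^ 2 * (p : ℝ) ^ (θ + 2 * α - 4 * r)) *
            (4 * b * (p : ℝ) ^ (1 - α - 2 * β) + w p) := by
            gcongr
            exact hwN k hkN
        _ = e := by
            rw [he, hC, Real.rpow_add hp0 _ (1 - α - 2 * β)]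
            ring

end

/-! # Gaussian shifts -/

/-- The product density restricted to a box is a product of functions of separate coordinates, and
under a product measure its integral factorizes. -/
theorem pi_withDensity {ι α : Type*} [Fintype ι] [MeasurableSpace α] (μ : ι → Measure α)
    [∀ i, IsProbabilityMeasure (μ i)] {f : ι → α → ENNReal} (hf : ∀ i, Measurable (f i))
    [∀ i, SigmaFinite ((μ i).withDensity (f i))] :
    Measure.pi (fun i => (μ i).withDensity (f i)) =
      (Measure.pi μ).withDensity fun x => ∏ i, f i (x i) := by
  refine Measure.pi_eq fun s hs => ?_
  rw [withDensity_apply _ (MeasurableSet.univ_pi hs),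
    ← lintegral_indicator (MeasurableSet.univ_pi hs)]
  have e : ∀ x : ι → α, (Set.univ.pi s).indicator (fun x => ∏ i, f i (x i)) x =
      ∏ i, (s i).indicator (f i) (x i) := by
    intro x
    classical
    by_cases hx : x ∈ Set.univ.pi s
    · rw [Set.indicator_of_mem hx]
      exact Finset.prod_congr rfl fun i _ => by
        rw [Set.indicator_of_mem (hx i (Set.mem_univ i))]
    · rw [Set.indicator_of_notMem hx]
      simp only [Set.mem_pi, Set.mem_univ, true_implies, not_forall] at hx
      obtain ⟨i, hi⟩ := hx
      exact (Finset.prod_eq_zero (Finset.mem_univ i) (Set.indicator_of_notMem hi _)).symm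
  simp only [e]
  have hm : ∀ i, Measurable ((s i).indicator (f i)) := fun i => (hf i).indicator (hs i)
  rw [lintegral_prod_eq_prod_lintegral_of_indepFun Finset.univ
    (fun i (x : ι → α) => (s i).indicator (f i) (x i))
    (iIndepFun_pi fun i => (hm i).aemeasurable) fun i => (hm i).comp (measurable_pi_apply i)]
  refine Finset.prod_congr rfl fun i _ => ?_
  rw [(measurePreserving_eval μ i).lintegral_comp (hm i), lintegral_indicator (hs i),
    withDensity_apply _ (hs i)]

theorem gaussianReal_eq_withDensity (m : ℝ) :
    gaussianReal m 1 = (gaussianReal 0 1).withDensity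
      fun x => ENNReal.ofReal (Real.exp (m * x - m ^ 2 / 2)) := by
  rw [gaussianReal_of_var_ne_zero _ one_ne_zero, gaussianReal_of_var_ne_zero _ one_ne_zero,
    ← withDensity_mul _ (measurable_gaussianPDF _ _) (by fun_prop)]
  congr 1
  funext x
  rw [Pi.mul_apply, gaussianPDF, gaussianPDF, ← ENNReal.ofReal_mul (gaussianPDFReal_nonneg _ _ _),
    gaussianPDFReal, gaussianPDFReal, mul_assoc (_⁻¹), ← Real.exp_add]
  congr 3
  simp
  ring

/-- The inner product of two data matrices. -/
def dataInner {n p : ℕ} (v x : Data n p) : ℝ := ∑ i, ∑ k, v i k * x i k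

/-- Independent observations, `X_i` with law `N(v_i, I_p)`. -/
def shiftLaw {n p : ℕ} (v : Data n p) : Measure (Data n p) := Measure.pi fun i => gaussianVec (v i)

/-- The likelihood ratio of `shiftLaw v`. -/
def shiftRatio {n p : ℕ} (v x : Data n p) : ℝ := Real.exp (dataInner v x - dataInner v v / 2)

section
variable {n p : ℕ}

instance (v : Fin p → ℝ) : IsProbabilityMeasure (gaussianVec v) := by
  unfold gaussianVec; infer_instance

instance (v : Data n p) : IsProbabilityMeasure (shiftLaw v) := by
  unfold shiftLaw; infer_instance

instance : IsProbabilityMeasure (nullLaw n p) := by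
  unfold nullLaw; infer_instance

instance : IsProbabilityMeasure seedLaw := by
  unfold seedLaw; infer_instance

theorem shiftLaw_zero : shiftLaw (0 : Data n p) = nullLaw n p := rfl

theorem measurable_dataInner (v : Data n p) : Measurable (dataInner v) := by
  unfold dataInner; fun_prop

theorem measurable_shiftRatio (v : Data n p) : Measurable (shiftRatio v) := by
  have := measurable_dataInner v
  unfold shiftRatio; fun_prop

theorem gaussianVec_eq_withDensity (v : Fin p → ℝ) :
    gaussianVec v = (gaussianVec 0).withDensity
      fun x => ∏ k, ENNReal.ofReal (Real.exp (v k * x k - v k ^ 2 / 2)) := by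
  unfold gaussianVec
  have h : ∀ k, SigmaFinite ((gaussianReal ((0 : Fin p → ℝ) k) 1).withDensity
      fun x => ENNReal.ofReal (Real.exp (v k * x - v k ^ 2 / 2))) := by
    intro k
    rw [Pi.zero_apply, ← gaussianReal_eq_withDensity]
    infer_instance
  refine Eq.trans ?_ (pi_withDensity (fun k => gaussianReal ((0 : Fin p → ℝ) k) 1)
    (f := fun k x => ENNReal.ofReal (Real.exp (v k * x - v k ^ 2 / 2))) (fun k => by fun_prop))
  congr 1
  funext k
  exact gaussianReal_eq_withDensity (v k)

theorem shiftLaw_eq_withDensity (v : Data n p) :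
    shiftLaw v = (nullLaw n p).withDensity fun x => ENNReal.ofReal (shiftRatio v x) := by
  unfold shiftLaw nullLaw
  have h : ∀ i, SigmaFinite ((gaussianVec (0 : Fin p → ℝ)).withDensity
      fun x => ∏ k, ENNReal.ofReal (Real.exp (v i k * x k - v i k ^ 2 / 2))) := by
    intro i
    rw [← gaussianVec_eq_withDensity]
    infer_instance
  have hm : ∀ i, Measurable fun x : Fin p → ℝ =>
      ∏ k, ENNReal.ofReal (Real.exp (v i k * x k - v i k ^ 2 / 2)) := fun i =>
    Finset.measurable_prod _ fun k _ => by fun_prop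
  rw [show (fun x : Data n p => ENNReal.ofReal (shiftRatio v x)) = fun x =>
      ∏ i, (fun i (x : Fin p → ℝ) =>
        ∏ k, ENNReal.ofReal (Real.exp (v i k * x k - v i k ^ 2 / 2))) i (x i) from ?_,
    ← pi_withDensity (fun _ => gaussianVec (0 : Fin p → ℝ)) hm]
  · congr 1
    funext i
    exact gaussianVec_eq_withDensity (v i)
  · funext x
    simp only
    rw [Finset.prod_congr rfl fun i _ => (ENNReal.ofReal_prod_of_nonneg
      fun k _ => (Real.exp_pos _).le).symm, ← ENNReal.ofReal_prod_of_nonneg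
      fun i _ => Finset.prod_nonneg fun k _ => (Real.exp_pos _).le]
    simp only [← Real.exp_sum]
    rw [shiftRatio, dataInner, dataInner, Finset.sum_div, ← Finset.sum_sub_distrib]
    congr 2
    refine Finset.sum_congr rfl fun i _ => ?_
    rw [Finset.sum_div, ← Finset.sum_sub_distrib]
    exact Finset.sum_congr rfl fun k _ => by ring

theorem shiftRatio_pos (v x : Data n p) : 0 < shiftRatio v x := Real.exp_pos _

theorem integral_shiftLaw (v : Data n p) (f : Data n p → ℝ) :
    ∫ x, f x ∂shiftLaw v = ∫ x, shiftRatio v x * f x ∂nullLaw n p := by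
  rw [shiftLaw_eq_withDensity,
    integral_withDensity_eq_integral_toReal_smul (measurable_shiftRatio v).ennreal_ofReal
      (ae_of_all _ fun x => ENNReal.ofReal_lt_top)]
  refine integral_congr_ae (ae_of_all _ fun x => ?_)
  simp only [ENNReal.toReal_ofReal (shiftRatio_pos v x).le, smul_eq_mul]

theorem integrable_shiftLaw_iff (v : Data n p) (f : Data n p → ℝ) :
    Integrable f (shiftLaw v) ↔ Integrable (fun x => shiftRatio v x * f x) (nullLaw n p) := by
  rw [shiftLaw_eq_withDensity, integrable_withDensity_iff_integrable_smul'
      (measurable_shiftRatio v).ennreal_ofReal (ae_of_all _ fun x => ENNReal.ofReal_lt_top)]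
  refine integrable_congr (ae_of_all _ fun x => ?_)
  simp only [ENNReal.toReal_ofReal (shiftRatio_pos v x).le, smul_eq_mul]

theorem integrable_shiftRatio (v : Data n p) : Integrable (shiftRatio v) (nullLaw n p) := by
  have := (integrable_shiftLaw_iff v fun _ => (1 : ℝ)).1 (integrable_const 1)
  simpa using this

theorem integral_shiftRatio (v : Data n p) : ∫ x, shiftRatio v x ∂nullLaw n p = 1 := by
  have := integral_shiftLaw v fun _ => (1 : ℝ)
  simpa using this.symm

theorem dataInner_add_left (u v x : Data n p) :
    dataInner (u + v) x = dataInner u x + dataInner v x := by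
  simp [dataInner, add_mul, Finset.sum_add_distrib]

theorem dataInner_comm (u v : Data n p) : dataInner u v = dataInner v u := by
  simp only [dataInner, mul_comm]

/-- By completing the square: the product of two likelihood ratios is again a likelihood ratio up to
the constant e^⟨u,v⟩. Its null expectation e^⟨u,v⟩ is the source of all second moment computations.
-/
theorem shiftRatio_mul (u v x : Data n p) :
    shiftRatio u x * shiftRatio v x = Real.exp (dataInner u v) * shiftRatio (u + v) x := by
  simp only [shiftRatio, ← Real.exp_add]
  congr 1
  rw [dataInner_add_left, dataInner_add_left u v (u + v), dataInner_comm u (u + v),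
    dataInner_comm v (u + v), dataInner_add_left, dataInner_add_left, dataInner_comm v u]
  ring

theorem integrable_shiftRatio_mul (u v : Data n p) :
    Integrable (fun x => shiftRatio u x * shiftRatio v x) (nullLaw n p) := by
  simp only [shiftRatio_mul]
  exact (integrable_shiftRatio _).const_mul _

theorem integral_shiftRatio_mul (u v : Data n p) :
    ∫ x, shiftRatio u x * shiftRatio v x ∂nullLaw n p = Real.exp (dataInner u v) := by
  simp only [shiftRatio_mul]
  rw [integral_const_mul, integral_shiftRatio, mul_one]

/-- A translation of the data translates the means. -/
theorem map_add_shiftLaw (u v : Data n p) :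
    (shiftLaw v).map (fun x => u + x) = shiftLaw (u + v) := by
  unfold shiftLaw gaussianVec
  have h1 : ∀ i, (Measure.pi fun k => gaussianReal (v i k) 1).map (fun x => u i + x) =
      Measure.pi fun k => gaussianReal ((u + v) i k) 1 := by
    intro i
    have := Measure.pi_map_pi (μ := fun k => gaussianReal (v i k) 1)
      (f := fun k x => u i k + x) fun k => by fun_prop
    simp only [gaussianReal_map_const_add] at this
    rw [show (fun x : Fin p → ℝ => u i + x) = fun x k => u i k + x k from rfl, this]
    congr 1
    funext k
    rw [add_comm]
    rfl
  have := Measure.pi_map_pi (μ := fun i => Measure.pi fun k => gaussianReal (v i k) 1)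
      (f := fun i x => u i + x) fun i => by fun_prop
  simp only [h1] at this
  exact this

/-! # Mixtures of shifts -/

theorem integral_sub_const_mul_add_const {Ω : Type*} [MeasurableSpace Ω] {P : Measure Ω}
    [IsProbabilityMeasure P] {f g : Ω → ℝ} (hf : Integrable f P) (hg : Integrable g P) (c d : ℝ) :
    ∫ x, (f x - c * g x + d) ∂P = ∫ x, f x ∂P - c * ∫ x, g x ∂P + d := by
  have h1 : Integrable (fun x => f x - c * g x) P := hf.sub (hg.const_mul c)
  rw [integral_add h1 (integrable_const d), integral_sub hf (hg.const_mul c), integral_const_mul]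
  simp

/-- A bound for the difference of the expectations of a bounded function under a mixture of shifts
and under the null law. -/
theorem abs_sum_integral_shiftLaw_sub_le {κ : Type*} (T : Finset κ) (c : κ → ℝ) (v : κ → Data n p)
    (hc1 : ∑ k ∈ T, c k = 1) {f : Data n p → ℝ} (hf : Measurable f) (hf1 : ∀ x, |f x| ≤ 1)
    {δ : ℝ} (hδ : ∑ k ∈ T, ∑ l ∈ T, c k * c l * Real.exp (dataInner (v k) (v l)) ≤ 1 + δ ^ 2)
    (hδ0 : 0 ≤ δ) :
    |∑ k ∈ T, c k * ∫ x, f x ∂shiftLaw (v k) - ∫ x, f x ∂nullLaw n p| ≤ δ := by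
  set h : Data n p → ℝ := fun x => ∑ k ∈ T, c k * shiftRatio (v k) x - 1 with hh
  have hsum : Integrable (fun x => ∑ k ∈ T, c k * shiftRatio (v k) x) (nullLaw n p) :=
    integrable_finsetSum _ fun k _ => (integrable_shiftRatio _).const_mul _
  have hI : Integrable h (nullLaw n p) := hsum.sub (integrable_const 1)
  have hsq : ∀ x, (∑ k ∈ T, c k * shiftRatio (v k) x) ^ 2 =
      ∑ k ∈ T, ∑ l ∈ T, c k * c l * (shiftRatio (v k) x * shiftRatio (v l) x) := by
    intro x
    rw [sq, Finset.sum_mul_sum]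
    exact Finset.sum_congr rfl fun k _ => Finset.sum_congr rfl fun l _ => by ring
  have hI2' : Integrable (fun x => (∑ k ∈ T, c k * shiftRatio (v k) x) ^ 2) (nullLaw n p) := by
    simp only [hsq]
    exact integrable_finsetSum _ fun k _ => integrable_finsetSum _ fun l _ =>
      (integrable_shiftRatio_mul _ _).const_mul _
  have h2 : ∀ x, h x ^ 2 = (∑ k ∈ T, c k * shiftRatio (v k) x) ^ 2 -
      2 * (∑ k ∈ T, c k * shiftRatio (v k) x) + 1 := by
    intro x; simp only [hh]; ring
  have hI2 : Integrable (fun x => h x ^ 2) (nullLaw n p) := by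
    simp only [h2]
    exact (hI2'.sub (hsum.const_mul 2)).add (integrable_const 1)
  have hE1 : ∫ x, ∑ k ∈ T, c k * shiftRatio (v k) x ∂nullLaw n p = 1 := by
    rw [integral_finsetSum _ fun k _ => (integrable_shiftRatio _).const_mul _]
    simp only [integral_const_mul, integral_shiftRatio, mul_one, hc1]
  have hE2 : ∫ x, h x ^ 2 ∂nullLaw n p ≤ δ ^ 2 := by
    simp only [h2]
    rw [integral_sub_const_mul_add_const hI2' hsum, hE1]
    simp only [hsq]
    rw [integral_finsetSum _ fun k _ => integrable_finsetSum _ fun l _ =>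
      (integrable_shiftRatio_mul _ _).const_mul _]
    rw [Finset.sum_congr rfl fun k _ => integral_finsetSum T fun l _ =>
      (integrable_shiftRatio_mul (v k) (v l)).const_mul (c k * c l)]
    simp only [integral_const_mul, integral_shiftRatio_mul]
    linarith
  have hfi : ∀ k, Integrable (fun x => shiftRatio (v k) x * f x) (nullLaw n p) := fun k =>
    (integrable_shiftLaw_iff _ _).1 (Integrable.of_bound hf.aestronglyMeasurable 1
      (ae_of_all _ hf1))
  have hf0 : Integrable f (nullLaw n p) :=
    Integrable.of_bound hf.aestronglyMeasurable 1 (ae_of_all _ hf1)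
  -- The difference of the expectations is the null expectation of h f, where h is the mixture
  -- likelihood ratio minus 1.
  have key : ∑ k ∈ T, c k * ∫ x, f x ∂shiftLaw (v k) - ∫ x, f x ∂nullLaw n p =
      ∫ x, h x * f x ∂nullLaw n p := by
    simp only [integral_shiftLaw, ← integral_const_mul]
    rw [← integral_finsetSum _ fun k _ => (hfi k).const_mul _, ← integral_sub
      (integrable_finsetSum _ fun k _ => (hfi k).const_mul _) hf0]
    refine integral_congr_ae (ae_of_all _ fun x => ?_)
    simp only [hh, sub_mul, one_mul, Finset.sum_mul, mul_assoc]
  rw [key]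
  have hle : |∫ x, h x * f x ∂nullLaw n p| ≤ ∫ x, |h x| ∂nullLaw n p := by
    refine (abs_integral_le_integral_abs).trans (integral_mono_of_nonneg
      (ae_of_all _ fun x => abs_nonneg _) hI.abs (ae_of_all _ fun x => ?_))
    simp only [abs_mul]
    exact mul_le_of_le_one_right (abs_nonneg _) (hf1 x)
  refine hle.trans ?_
  set A := ∫ x, |h x| ∂nullLaw n p with hA
  -- Nonnegativity of the variance of |h| is the Cauchy–Schwarz inequality (E|h|)² ≤ E h².
  have hvar : 0 ≤ ∫ x, (|h x| - A) ^ 2 ∂nullLaw n p := integral_nonneg fun x => sq_nonneg _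
  have hexp : ∀ x, (|h x| - A) ^ 2 = h x ^ 2 - 2 * A * |h x| + A ^ 2 := by
    intro x; rw [← sq_abs (h x)]; ring
  simp only [hexp] at hvar
  rw [integral_sub_const_mul_add_const hI2 hI.abs, ← hA] at hvar
  have : A ^ 2 ≤ δ ^ 2 := by nlinarith
  exact le_of_sq_le_sq this hδ0

end

/-! # The laws of the model as mixtures of shifts -/

instance : MeasurableSingletonClass ℤˣ where
  measurableSet_singleton a :=
    ⟨{(a : ℤ)}, measurableSet_singleton _, by ext b; simp [Units.ext_iff]⟩

/-- The matrix with rows `c_i μ`. -/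
def outer {n p : ℕ} (c : Fin n → ℝ) (μ : Fin p → ℝ) : Data n p := fun i k => c i * μ k

/-- The joint law of the observations with means `v` and the seed. -/
def obsLaw {n p : ℕ} (v : Data n p) : Measure (Data n p × Seed) := (shiftLaw v).prod seedLaw

section
variable {n p : ℕ} {ϖ : ℝ}

instance (v : Data n p) : IsProbabilityMeasure (obsLaw v) := by
  unfold obsLaw; infer_instance

theorem dataInner_outer (c d : Fin n → ℝ) (μ ν : Fin p → ℝ) :
    dataInner (outer c μ) (outer d ν) = (∑ i, c i * d i) * ∑ k, μ k * ν k := by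
  rw [Finset.sum_mul_sum]
  exact Finset.sum_congr rfl fun i _ => Finset.sum_congr rfl fun k _ => by
    simp only [outer]; ring

theorem labelLaw_eq_sum (ϖ : ℝ) :
    labelLaw ϖ = ∑ a : ℤˣ, ENNReal.ofReal (labelWeight ϖ a) • Measure.dirac a := by
  rw [labelLaw, show (Finset.univ : Finset ℤˣ) = {1, -1} from rfl,
    Finset.sum_pair (by decide), labelWeight_one, labelWeight_neg_one]

theorem labelLaw_singleton (ϖ : ℝ) (a : ℤˣ) :
    labelLaw ϖ {a} = ENNReal.ofReal (labelWeight ϖ a) := by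
  rw [labelLaw_eq_sum, Measure.finsetSum_apply]
  rw [Finset.sum_eq_single a]
  · simp
  · intro b _ hb
    simp [hb]
  · exact fun h => absurd (Finset.mem_univ a) h

theorem isProbabilityMeasure_labelLaw (hϖ : 0 < ϖ) : IsProbabilityMeasure (labelLaw ϖ) := by
  constructor
  rw [labelLaw_eq_sum, Measure.finsetSum_apply]
  simp only [Measure.smul_apply, measure_univ, smul_eq_mul, mul_one]
  rw [← ENNReal.ofReal_sum_of_nonneg fun a _ => labelWeight_nonneg hϖ a, sum_labelWeight hϖ,
    ENNReal.ofReal_one]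

/-- Expectations in the model. -/
theorem integral_modelLaw (hϖ : 0 < ϖ) (μ : Fin p → ℝ)
    (g : (Fin n → ℤˣ) → Data n p × Seed → ℝ) (hg : ∀ l, Measurable (g l)) {C : ℝ}
    (hC : ∀ l z, |g l z| ≤ C) :
    ∫ w, g w.1.1 (observe ϖ μ w.1.1 w.1.2, w.2) ∂modelLaw n p ϖ =
      ∑ l : Fin n → ℤˣ, labelsWeight ϖ l *
        ∫ z, g l z ∂obsLaw (outer (fun i => genLabel ϖ (l i)) μ) := by
  have := isProbabilityMeasure_labelLaw hϖ
  set h : (Fin n → ℤˣ) × (Data n p × Seed) → ℝ :=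
    fun w => g w.1 (observe ϖ μ w.1 w.2.1, w.2.2) with hh
  have hobs : ∀ l : Fin n → ℤˣ, observe ϖ μ l =
      fun Z => outer (fun i => genLabel ϖ (l i)) μ + Z := fun l => rfl
  have hshift : ∀ l : Fin n → ℤˣ, Measurable fun z : Data n p × Seed =>
      (observe ϖ μ l z.1, z.2) := by
    intro l
    rw [hobs]
    fun_prop
  have hm : Measurable h := by
    refine measurable_from_prod_countable_right fun l => ?_
    exact (hg l).comp (hshift l)
  have hmp := measurePreserving_prodAssoc (Measure.pi fun _ : Fin n => labelLaw ϖ)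
    (nullLaw n p) seedLaw
  have hI : Integrable h ((Measure.pi fun _ : Fin n => labelLaw ϖ).prod
      ((nullLaw n p).prod seedLaw)) :=
    Integrable.of_bound hm.aestronglyMeasurable C (ae_of_all _ fun w => hC _ _)
  have e1 : ∫ w, g w.1.1 (observe ϖ μ w.1.1 w.1.2, w.2) ∂modelLaw n p ϖ =
      ∫ w, h w ∂(Measure.pi fun _ : Fin n => labelLaw ϖ).prod ((nullLaw n p).prod seedLaw) :=
    hmp.integral_comp' (f := MeasurableEquiv.prodAssoc) h
  rw [e1, integral_prod _ hI]
  have hI' : Integrable (fun l => ∫ y, h (l, y) ∂(nullLaw n p).prod seedLaw)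
      (Measure.pi fun _ : Fin n => labelLaw ϖ) := hI.integral_prod_left
  rw [integral_fintype hI']
  refine Finset.sum_congr rfl fun l _ => ?_
  rw [smul_eq_mul]
  congr 1
  · rw [measureReal_def, Measure.pi_singleton]
    simp only [labelLaw_singleton]
    rw [← ENNReal.ofReal_prod_of_nonneg fun i _ => labelWeight_nonneg hϖ _]
    exact ENNReal.toReal_ofReal (labelsWeight_nonneg hϖ l)
  -- Given the labels, the data are the noise translated by the matrix of means, and the seed is
  -- untouched.
  · have hmap : ((nullLaw n p).prod seedLaw).map (fun z => (observe ϖ μ l z.1, z.2)) =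
        obsLaw (outer (fun i => genLabel ϖ (l i)) μ) := by
      have := Measure.map_prod_map (nullLaw n p) seedLaw
        (f := fun Z => outer (fun i => genLabel ϖ (l i)) μ + Z) (g := id) (by fun_prop)
        measurable_id
      rw [Measure.map_id, ← shiftLaw_zero, map_add_shiftLaw, add_zero] at this
      exact this.symm
    rw [← hmap, integral_map (hshift l).aemeasurable (hg l).aestronglyMeasurable]

/-- On boxes this is the expansion of a product of two-term sums over all label vectors: independent
mixtures form a mixture over the joint labels. -/
theorem mixtureLaw_eq_sum (hϖ : 0 < ϖ) (μ : Fin p → ℝ) :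
    mixtureLaw n ϖ μ = ∑ l : Fin n → ℤˣ, ENNReal.ofReal (labelsWeight ϖ l) •
      shiftLaw (outer (fun i => genLabel ϖ (l i)) μ) := by
  have e : ENNReal.ofReal (ϖ / (1 + ϖ)) • gaussianVec μ +
      ENNReal.ofReal (1 / (1 + ϖ)) • gaussianVec (-ϖ • μ) =
      ∑ a : ℤˣ, ENNReal.ofReal (labelWeight ϖ a) • gaussianVec (genLabel ϖ a • μ) := by
    rw [show (Finset.univ : Finset ℤˣ) = {1, -1} from rfl, Finset.sum_pair (by decide),
      labelWeight_one, labelWeight_neg_one, genLabel_one, genLabel_neg_one, one_smul]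
  unfold mixtureLaw
  rw [e]
  have hfin : ∀ a : ℤˣ, IsFiniteMeasure
      (ENNReal.ofReal (labelWeight ϖ a) • gaussianVec (genLabel ϖ a • μ)) := fun a =>
    Measure.smul_finite _ ENNReal.ofReal_ne_top
  refine Measure.pi_eq fun s hs => ?_
  simp only [Measure.finsetSum_apply, Measure.smul_apply, smul_eq_mul]
  rw [Finset.prod_univ_sum, Fintype.piFinset_univ]
  refine Finset.sum_congr rfl fun l _ => ?_
  rw [Finset.prod_mul_distrib, labelsWeight,
    ENNReal.ofReal_prod_of_nonneg fun i _ => labelWeight_nonneg hϖ _]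
  congr 1
  exact Measure.pi_pi _ _

variable {ρ : ℕ → ℝ} {α β r : ℝ}

/-- The index set of the shifts in the alternative law. -/
def altIndex (ρ : ℕ → ℝ) (α β r : ℝ) (n p : ℕ) : Finset ((Fin p → ℝ) × (Fin n → ℤˣ)) :=
  signalSet ρ α β r p ×ˢ Finset.univ

/-- The weights of the shifts in the alternative law. -/
def altWeight (ρ : ℕ → ℝ) (α β r ϖ : ℝ) {n p : ℕ} (k : (Fin p → ℝ) × (Fin n → ℤˣ)) : ℝ :=
  ((signalSet ρ α β r p).card : ℝ)⁻¹ * labelsWeight ϖ k.2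

/-- The shifts in the alternative law. -/
def altShift (ϖ : ℝ) {n p : ℕ} (k : (Fin p → ℝ) × (Fin n → ℤˣ)) : Data n p :=
  outer (fun i => genLabel ϖ (k.2 i)) k.1

theorem altWeight_nonneg (hϖ : 0 < ϖ) (k : (Fin p → ℝ) × (Fin n → ℤˣ)) :
    0 ≤ altWeight ρ α β r ϖ k :=
  mul_nonneg (by positivity) (labelsWeight_nonneg hϖ _)

theorem sum_altIndex (F : (Fin p → ℝ) × (Fin n → ℤˣ) → ℝ) :
    ∑ k ∈ altIndex ρ α β r n p, altWeight ρ α β r ϖ k * F k =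
      ((signalSet ρ α β r p).card : ℝ)⁻¹ * ∑ μ ∈ signalSet ρ α β r p,
        ∑ l, labelsWeight ϖ l * F (μ, l) := by
  rw [altIndex, Finset.sum_product, Finset.mul_sum]
  refine Finset.sum_congr rfl fun μ _ => ?_
  rw [Finset.mul_sum]
  exact Finset.sum_congr rfl fun l _ => by rw [altWeight]; ring

theorem sum_altWeight (hϖ : 0 < ϖ) (hS : (signalSet ρ α β r p).Nonempty) :
    ∑ k ∈ altIndex ρ α β r n p, altWeight ρ α β r ϖ k = 1 := by
  have := sum_altIndex (ρ := ρ) (α := α) (β := β) (r := r) (ϖ := ϖ) (n := n) (p := p) fun _ => 1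
  simp only [mul_one, sum_labelsWeight hϖ, Finset.sum_const, nsmul_eq_mul] at this
  rw [this]
  exact inv_mul_cancel₀ (Nat.cast_ne_zero.2 (Finset.card_pos.2 hS).ne')

theorem altLaw_eq_sum (hϖ : 0 < ϖ) :
    altLaw n p ρ α β r ϖ = ∑ k ∈ altIndex ρ α β r n p,
      ENNReal.ofReal (altWeight ρ α β r ϖ k) • shiftLaw (altShift ϖ k) := by
  have hcoe : signalClass ρ α β r p = ↑(signalSet ρ α β r p) := by
    ext μ; rw [Finset.mem_coe, mem_signalSet]
  have hsum : Measure.sum (fun μ : signalClass ρ α β r p => mixtureLaw n ϖ μ.1) =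
      ∑ μ ∈ signalSet ρ α β r p, mixtureLaw n ϖ μ := by
    rw [hcoe]
    exact Measure.sum_coe_finset (signalSet ρ α β r p) fun μ => mixtureLaw n ϖ μ
  have hcard : (signalClass ρ α β r p).ncard = (signalSet ρ α β r p).card := by
    rw [hcoe, Set.ncard_coe_finset]
  rw [altLaw, hsum, hcard, altIndex, Finset.sum_product, Finset.smul_sum]
  refine Finset.sum_congr rfl fun μ hμ => ?_
  rw [mixtureLaw_eq_sum hϖ, Finset.smul_sum]
  refine Finset.sum_congr rfl fun l _ => ?_
  have hpos : (0 : ℝ) < (signalSet ρ α β r p).card :=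
    Nat.cast_pos.2 (Finset.card_pos.2 ⟨μ, hμ⟩)
  rw [smul_smul, altWeight, ENNReal.ofReal_mul (by positivity), ENNReal.ofReal_inv_of_pos hpos,
    ENNReal.ofReal_natCast]
  rfl

theorem real_altLaw_prod_seedLaw (hϖ : 0 < ϖ) (R : Set (Data n p × Seed)) :
    ((altLaw n p ρ α β r ϖ).prod seedLaw).real R =
      ∑ k ∈ altIndex ρ α β r n p, altWeight ρ α β r ϖ k * (obsLaw (altShift ϖ k)).real R := by
  classical
  have key : ∀ T : Finset ((Fin p → ℝ) × (Fin n → ℤˣ)),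
      (∑ k ∈ T, ENNReal.ofReal (altWeight ρ α β r ϖ k) • shiftLaw (altShift ϖ k)).prod seedLaw =
      ∑ k ∈ T, ENNReal.ofReal (altWeight ρ α β r ϖ k) • obsLaw (altShift ϖ k) := by
    intro T
    induction T using Finset.induction_on with
    | empty => simp
    | insert k T hk ih =>
      have hfin : ∀ k : (Fin p → ℝ) × (Fin n → ℤˣ), IsFiniteMeasure
          (ENNReal.ofReal (altWeight ρ α β r ϖ k) • shiftLaw (altShift ϖ k : Data n p)) :=
        fun k => Measure.smul_finite _ ENNReal.ofReal_ne_top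
      rw [Finset.sum_insert hk, Finset.sum_insert hk, Measure.add_prod, ih, Measure.prod_smul_left]
      rfl
  rw [altLaw_eq_sum hϖ, key, measureReal_def, Measure.finsetSum_apply, ENNReal.toReal_sum]
  · refine Finset.sum_congr rfl fun k _ => ?_
    rw [Measure.smul_apply, smul_eq_mul, ENNReal.toReal_mul,
      ENNReal.toReal_ofReal (altWeight_nonneg hϖ k)]
    rfl
  · intro k _
    rw [Measure.smul_apply, smul_eq_mul]
    exact ENNReal.mul_ne_top ENNReal.ofReal_ne_top (measure_ne_top _ _)

/-- The likelihood ratio of the alternative. -/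
theorem altLaw_eq_withDensity (hϖ : 0 < ϖ) :
    altLaw n p ρ α β r ϖ = (nullLaw n p).withDensity fun x => ENNReal.ofReal
      (∑ k ∈ altIndex ρ α β r n p, altWeight ρ α β r ϖ k * shiftRatio (altShift ϖ k) x) := by
  rw [altLaw_eq_sum hϖ]
  ext s hs
  rw [withDensity_apply _ hs, Measure.finsetSum_apply]
  have : ∀ x, ENNReal.ofReal
      (∑ k ∈ altIndex ρ α β r n p, altWeight ρ α β r ϖ k * shiftRatio (altShift ϖ k) x) =
      ∑ k ∈ altIndex ρ α β r n p, ENNReal.ofReal (altWeight ρ α β r ϖ k) *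
        ENNReal.ofReal (shiftRatio (altShift ϖ k) x) := by
    intro x
    rw [ENNReal.ofReal_sum_of_nonneg fun k _ =>
      mul_nonneg (altWeight_nonneg hϖ k) (shiftRatio_pos _ _).le]
    exact Finset.sum_congr rfl fun k _ => ENNReal.ofReal_mul (altWeight_nonneg hϖ k)
  simp only [this]
  rw [lintegral_finsetSum _ fun k _ =>
    ((measurable_shiftRatio _).ennreal_ofReal.const_mul _)]
  refine Finset.sum_congr rfl fun k _ => ?_
  rw [lintegral_const_mul _ (measurable_shiftRatio _).ennreal_ofReal, Measure.smul_apply,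
    shiftLaw_eq_withDensity, withDensity_apply _ hs, smul_eq_mul]

theorem rnDeriv_altLaw (hϖ : 0 < ϖ) :
    (fun x => ((altLaw n p ρ α β r ϖ).rnDeriv (nullLaw n p) x).toReal) =ᵐ[nullLaw n p]
      fun x => ∑ k ∈ altIndex ρ α β r n p,
        altWeight ρ α β r ϖ k * shiftRatio (altShift ϖ k) x := by
  rw [altLaw_eq_withDensity hϖ]
  have hm : Measurable fun x => ENNReal.ofReal (∑ k ∈ altIndex ρ α β r n p,
      altWeight ρ α β r ϖ k * shiftRatio (altShift ϖ k) x) :=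
    (Finset.measurable_sum _ fun k _ => (measurable_shiftRatio _).const_mul _).ennreal_ofReal
  filter_upwards [Measure.rnDeriv_withDensity (nullLaw n p) hm] with x hx
  rw [hx, ENNReal.toReal_ofReal (Finset.sum_nonneg fun k _ =>
    mul_nonneg (altWeight_nonneg hϖ k) (shiftRatio_pos _ _).le)]

/-- The second moment of the likelihood ratio, as a finite sum of exponentials. -/
theorem sum_altWeight_mul_exp (f : ℝ → ℝ) :
    ∑ k ∈ altIndex ρ α β r n p, ∑ k' ∈ altIndex ρ α β r n p,
      altWeight ρ α β r ϖ k * altWeight ρ α β r ϖ k' * f (dataInner (altShift ϖ k : Data n p)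
        (altShift ϖ k')) =
      ((signalSet ρ α β r p).card : ℝ)⁻¹ * ∑ μ ∈ signalSet ρ α β r p,
        (((signalSet ρ α β r p).card : ℝ)⁻¹ * ∑ ν ∈ signalSet ρ α β r p,
          ∑ l : Fin n → ℤˣ, ∑ l' : Fin n → ℤˣ, labelsWeight ϖ l * labelsWeight ϖ l' *
            f ((∑ i, genLabel ϖ (l i) * genLabel ϖ (l' i)) * ∑ k, μ k * ν k)) := by
  have h1 : ∀ k : (Fin p → ℝ) × (Fin n → ℤˣ), ∑ k' ∈ altIndex ρ α β r n p,
      altWeight ρ α β r ϖ k * altWeight ρ α β r ϖ k' * f (dataInner (altShift ϖ k : Data n p)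
        (altShift ϖ k')) = altWeight ρ α β r ϖ k * (((signalSet ρ α β r p).card : ℝ)⁻¹ *
        ∑ ν ∈ signalSet ρ α β r p, ∑ l', labelsWeight ϖ l' *
          f ((∑ i, genLabel ϖ (k.2 i) * genLabel ϖ (l' i)) * ∑ j, k.1 j * ν j)) := by
    intro k
    rw [← sum_altIndex fun k' : (Fin p → ℝ) × (Fin n → ℤˣ) =>
      f ((∑ i, genLabel ϖ (k.2 i) * genLabel ϖ (k'.2 i)) * ∑ j, k.1 j * k'.1 j), Finset.mul_sum]
    exact Finset.sum_congr rfl fun k' _ => by rw [altShift, altShift, dataInner_outer, mul_assoc]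
  simp only [h1]
  rw [sum_altIndex]
  congr 1
  refine Finset.sum_congr rfl fun μ _ => ?_
  simp only [Finset.mul_sum]
  rw [Finset.sum_comm]
  refine Finset.sum_congr rfl fun ν _ => Finset.sum_congr rfl fun l _ =>
    Finset.sum_congr rfl fun l' _ => ?_
  ring

end

/-! # Runs of programs -/

/-- With random numbers `ω`, the program `c` leads from memory `s` to memory `s'` within `T` steps,
whatever remains to be executed afterwards. -/
def Runs (ω : Seed) (c : RamProg) (s s' : RamState) (T : ℕ) : Prop :=
  ∃ t ≤ T, ∀ K, (ramStep ω)^[t] (c :: K, s) = (K, s')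

section
variable {ω : Seed} {c d : RamProg} {b : RamTest} {s s' s'' : RamState} {T T' : ℕ}

theorem Runs.mono (h : Runs ω c s s' T) (hT : T ≤ T') : Runs ω c s s' T' := by
  obtain ⟨t, ht, h⟩ := h
  exact ⟨t, ht.trans hT, h⟩

theorem Runs.seq (h : Runs ω c s s' T) (h' : Runs ω d s' s'' T') :
    Runs ω (.seq c d) s s'' (T + T' + 1) := by
  obtain ⟨t, ht, h⟩ := h
  obtain ⟨t', ht', h'⟩ := h'
  refine ⟨t' + (t + 1), by omega, fun K => ?_⟩
  rw [Function.iterate_add_apply, Function.iterate_succ_apply, ramStep, h, h']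

theorem Runs.cond_true (hb : b.Holds s) (h : Runs ω c s s' T) :
    Runs ω (.cond b c d) s s' (T + 1) := by
  obtain ⟨t, ht, h⟩ := h
  refine ⟨t + 1, by omega, fun K => ?_⟩
  rw [Function.iterate_succ_apply, ramStep, if_pos hb, h]

theorem Runs.cond_false (hb : ¬ b.Holds s) (h : Runs ω d s s' T) :
    Runs ω (.cond b c d) s s' (T + 1) := by
  obtain ⟨t, ht, h⟩ := h
  refine ⟨t + 1, by omega, fun K => ?_⟩
  rw [Function.iterate_succ_apply, ramStep, if_neg hb, h]

theorem Runs.loop_done (hb : ¬ b.Holds s) : Runs ω (.loop b c) s s 1 := by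
  refine ⟨1, le_rfl, fun K => ?_⟩
  rw [Function.iterate_one, ramStep, if_neg hb]

theorem Runs.loop_step (hb : b.Holds s) (h : Runs ω c s s' T) (h' : Runs ω (.loop b c) s' s'' T') :
    Runs ω (.loop b c) s s'' (T + 1 + T') := by
  obtain ⟨t, ht, h⟩ := h
  obtain ⟨t', ht', h'⟩ := h'
  refine ⟨t' + (t + 1), by omega, fun K => ?_⟩
  rw [Function.iterate_add_apply, Function.iterate_succ_apply, ramStep, if_pos hb, h, h']

/-- The invariant I k describes the memory after k rounds. Each of the N rounds costs one step for
the test besides its body, and the final failing test costs one more. -/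
theorem Runs.loop_inv (I : ℕ → RamState → Prop) (N : ℕ)
    (hstep : ∀ k < N, ∀ s, I k s → b.Holds s ∧ ∃ s', Runs ω c s s' T ∧ I (k + 1) s')
    (hend : ∀ s, I N s → ¬ b.Holds s) (h0 : I 0 s) :
    ∃ s', Runs ω (.loop b c) s s' (N * (T + 1) + 1) ∧ I N s' := by
  have key : ∀ k ≤ N, ∀ s, I (N - k) s →
      ∃ s', Runs ω (.loop b c) s s' (k * (T + 1) + 1) ∧ I N s' := by
    intro k
    induction k with
    | zero =>
      intro _ s hs
      exact ⟨s, (Runs.loop_done (hend s hs)).mono (by omega), hs⟩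
    | succ k ih =>
      intro hk s hs
      obtain ⟨hb, s₁, h₁, hs₁⟩ := hstep _ (by omega) s hs
      rw [show N - (k + 1) + 1 = N - k by omega] at hs₁
      obtain ⟨s₂, h₂, hs₂⟩ := ih (by omega) s₁ hs₁
      exact ⟨s₂, (Runs.loop_step hb h₁ h₂).mono (by ring_nf; omega), hs₂⟩
  exact key N le_rfl s (by simpa using h0)

theorem iterate_ramStep_nil (ω : Seed) (s : RamState) (T : ℕ) :
    (ramStep ω)^[T] ([], s) = ([], s) := by
  induction T with
  | zero => rfl
  | succ T ih => rw [Function.iterate_succ_apply, ramStep, ih]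

theorem Runs.iterate_eq (h : Runs ω c s s' T) : (ramStep ω)^[T] ([c], s) = ([], s') := by
  obtain ⟨t, ht, h⟩ := h
  obtain ⟨k, rfl⟩ := Nat.exists_eq_add_of_le' ht
  rw [Function.iterate_add_apply, h, iterate_ramStep_nil]

theorem ramStep_append (ω : Seed) (c : RamProg) (K K₀ : List RamProg) (s : RamState) :
    ramStep ω (c :: (K ++ K₀), s) = ((ramStep ω (c :: K, s)).1 ++ K₀, (ramStep ω (c :: K, s)).2) := by
  cases c <;> simp only [ramStep, List.cons_append]
  all_goals split_ifs <;> rfl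

/-- A machine never looks below the programs it is executing, so a program that halts when run alone
hands over to any continuation. The handover may happen at a time t < T, since a halted machine
stands still. -/
theorem exists_iterate_append {K : List RamProg} (h : (ramStep ω)^[T] (K, s) = ([], s')) :
    ∃ t ≤ T, ∀ K₀, (ramStep ω)^[t] (K ++ K₀, s) = (K₀, s') := by
  induction T generalizing K s with
  | zero =>
    simp only [Function.iterate_zero, id, Prod.mk.injEq] at h
    obtain ⟨rfl, rfl⟩ := h
    exact ⟨0, le_rfl, fun _ => rfl⟩
  | succ T ih =>
    cases K with
    | nil =>
      rw [iterate_ramStep_nil, Prod.mk.injEq] at h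
      obtain ⟨-, rfl⟩ := h
      exact ⟨0, by omega, fun _ => rfl⟩
    | cons c K =>
      rw [Function.iterate_succ_apply] at h
      obtain ⟨t, ht, h'⟩ := ih (K := (ramStep ω (c :: K, s)).1) (s := (ramStep ω (c :: K, s)).2) h
      refine ⟨t + 1, by omega, fun K₀ => ?_⟩
      rw [Function.iterate_succ_apply, List.cons_append, ramStep_append, h']

/-! # Programs do not see registers and arrays whose names they do not use -/

/-- All array and register names in a cell are below `M`. -/
def Cell.Below (M : ℕ) (x : Cell) : Prop := x.arr < M ∧ x.row < M ∧ x.col < M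

/-- All names in a test are below `M`. -/
def RamTest.Below (M : ℕ) : RamTest → Prop
  | .idxLt a b => a < M ∧ b < M
  | .realLt x y => x.Below M ∧ y.Below M

/-- All names in a program are below `M`. -/
def RamProg.Below (M : ℕ) : RamProg → Prop
  | .idxConst a _ => a < M
  | .idxAdd a b c => a < M ∧ b < M ∧ c < M
  | .idxSub a b c => a < M ∧ b < M ∧ c < M
  | .realConst x _ => x.Below M
  | .realOfIdx x a => x.Below M ∧ a < M
  | .realAdd x y z => x.Below M ∧ y.Below M ∧ z.Below M
  | .realSub x y z => x.Below M ∧ y.Below M ∧ z.Below M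
  | .realMul x y z => x.Below M ∧ y.Below M ∧ z.Below M
  | .realDiv x y z => x.Below M ∧ y.Below M ∧ z.Below M
  | .realSqrt x y => x.Below M ∧ y.Below M
  | .draw x => x.Below M
  | .seq c d => c.Below M ∧ d.Below M
  | .cond b c d => b.Below M ∧ c.Below M ∧ d.Below M
  | .loop b c => b.Below M ∧ c.Below M

/-- A bound for the names in a cell. -/
def Cell.bound (x : Cell) : ℕ := x.arr + x.row + x.col + 1

theorem Cell.below_of_bound_le {x : Cell} {M : ℕ} (h : x.bound ≤ M) : x.Below M := by
  simp only [Cell.bound] at h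
  exact ⟨by omega, by omega, by omega⟩

/-- A bound for the names in a test. -/
def RamTest.bound : RamTest → ℕ
  | .idxLt a b => a + b + 1
  | .realLt x y => x.bound + y.bound

theorem RamTest.below_of_bound_le {b : RamTest} {M : ℕ} (h : b.bound ≤ M) : b.Below M := by
  cases b <;> simp only [RamTest.bound] at h
  · exact ⟨by omega, by omega⟩
  · exact ⟨Cell.below_of_bound_le (by omega), Cell.below_of_bound_le (by omega)⟩

/-- A bound for the names in a program. -/
def RamProg.bound : RamProg → ℕ
  | .idxConst a _ => a + 1
  | .idxAdd a b c => a + b + c + 1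
  | .idxSub a b c => a + b + c + 1
  | .realConst x _ => x.bound
  | .realOfIdx x a => x.bound + a + 1
  | .realAdd x y z => x.bound + y.bound + z.bound
  | .realSub x y z => x.bound + y.bound + z.bound
  | .realMul x y z => x.bound + y.bound + z.bound
  | .realDiv x y z => x.bound + y.bound + z.bound
  | .realSqrt x y => x.bound + y.bound
  | .draw x => x.bound
  | .seq c d => c.bound + d.bound
  | .cond b c d => b.bound + c.bound + d.bound
  | .loop b c => b.bound + c.bound

theorem RamProg.below_of_bound_le {c : RamProg} {M : ℕ} (h : c.bound ≤ M) : c.Below M := by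
  induction c with
  | idxConst a k => exact h
  | idxAdd a b c => simp only [bound] at h; exact ⟨by omega, by omega, by omega⟩
  | idxSub a b c => simp only [bound] at h; exact ⟨by omega, by omega, by omega⟩
  | realConst x v => exact Cell.below_of_bound_le h
  | realOfIdx x a => simp only [bound] at h; exact ⟨Cell.below_of_bound_le (by omega), by omega⟩
  | realAdd x y z | realSub x y z | realMul x y z | realDiv x y z =>
    simp only [bound] at h
    exact ⟨Cell.below_of_bound_le (by omega), Cell.below_of_bound_le (by omega),
      Cell.below_of_bound_le (by omega)⟩
  | realSqrt x y =>
    simp only [bound] at h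
    exact ⟨Cell.below_of_bound_le (by omega), Cell.below_of_bound_le (by omega)⟩
  | draw x => exact Cell.below_of_bound_le h
  | seq c d ihc ihd => simp only [bound] at h; exact ⟨ihc (by omega), ihd (by omega)⟩
  | cond b c d ihc ihd =>
    simp only [bound] at h
    exact ⟨RamTest.below_of_bound_le (by omega), ihc (by omega), ihd (by omega)⟩
  | loop b c ih =>
    simp only [bound] at h
    exact ⟨RamTest.below_of_bound_le (by omega), ih (by omega)⟩

/-- Two memories agree on the names below `M`, with the random numbers shifted by `q`; moreover the
index registers of the second memory with other names have the contents `v`. -/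
structure Agree (M q : ℕ) (v : ℕ → ℕ) (s s' : RamState) : Prop where
  idx : ∀ a < M, s'.idx a = s.idx a
  mem : ∀ a < M, ∀ i k, s'.mem a i k = s.mem a i k
  pos : s'.pos = q + s.pos
  frame : ∀ a, M ≤ a → s'.idx a = v a

variable {M q : ℕ} {v : ℕ → ℕ}

theorem Agree.read (h : Agree M q v s s') {x : Cell} (hx : x.Below M) : s'.read x = s.read x := by
  rw [RamState.read, RamState.read, h.mem _ hx.1, h.idx _ hx.2.1, h.idx _ hx.2.2]

theorem Agree.write (h : Agree M q v s s') {x : Cell} (hx : x.Below M) (r : ℝ) :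
    Agree M q v (s.write x r) (s'.write x r) where
  idx := h.idx
  mem a ha i k := by
    simp only [RamState.write]
    rw [h.idx _ hx.2.1, h.idx _ hx.2.2, h.mem a ha]
  pos := h.pos
  frame := h.frame

theorem Agree.setIdx (h : Agree M q v s s') {a : ℕ} (ha : a < M) (k : ℕ) :
    Agree M q v (s.setIdx a k) (s'.setIdx a k) where
  idx b hb := by
    simp only [RamState.setIdx, Function.update_apply]
    rw [h.idx b hb]
  mem := h.mem
  pos := h.pos
  frame b hb := by
    simp only [RamState.setIdx]
    rw [Function.update_of_ne (by omega), h.frame b hb]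

theorem Agree.holds (h : Agree M q v s s') (hb : b.Below M) : b.Holds s' ↔ b.Holds s := by
  cases b with
  | idxLt a b => simp only [RamTest.Holds, h.idx _ hb.1, h.idx _ hb.2]
  | realLt x y => simp only [RamTest.Holds, h.read hb.1, h.read hb.2]

/-- The second memory has already drawn q numbers from ω, while the first starts afresh on ω shifted
by q, so both draw the same values. Registers with names from M on are never written by programs
below M. -/
theorem Agree.step (h : Agree M q v s s') {K : List RamProg} (hK : ∀ c ∈ K, c.Below M) :
    (ramStep ω (K, s')).1 = (ramStep (fun i => ω (q + i)) (K, s)).1 ∧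
    (∀ c ∈ (ramStep ω (K, s')).1, c.Below M) ∧
    Agree M q v (ramStep (fun i => ω (q + i)) (K, s)).2 (ramStep ω (K, s')).2 := by
  cases K with
  | nil => exact ⟨rfl, hK, h⟩
  | cons c K =>
    have hc := hK c (by simp)
    have hK' : ∀ c ∈ K, c.Below M := fun d hd => hK d (by simp [hd])
    cases c with
    | idxConst a k => exact ⟨rfl, hK', h.setIdx hc k⟩
    | idxAdd a b c =>
      refine ⟨rfl, hK', ?_⟩
      simp only [ramStep]
      rw [h.idx _ hc.2.1, h.idx _ hc.2.2]
      exact h.setIdx hc.1 _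
    | idxSub a b c =>
      refine ⟨rfl, hK', ?_⟩
      simp only [ramStep]
      rw [h.idx _ hc.2.1, h.idx _ hc.2.2]
      exact h.setIdx hc.1 _
    | realConst x r => exact ⟨rfl, hK', h.write hc r⟩
    | realOfIdx x a =>
      refine ⟨rfl, hK', ?_⟩
      simp only [ramStep]
      rw [h.idx _ hc.2]
      exact h.write hc.1 _
    | realAdd x y z | realSub x y z | realMul x y z | realDiv x y z =>
      refine ⟨rfl, hK', ?_⟩
      simp only [ramStep]
      rw [h.read hc.2.1, h.read hc.2.2]
      exact h.write hc.1 _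
    | realSqrt x y =>
      refine ⟨rfl, hK', ?_⟩
      simp only [ramStep]
      rw [h.read hc.2]
      exact h.write hc.1 _
    | draw x =>
      refine ⟨rfl, hK', ?_⟩
      simp only [ramStep]
      rw [h.pos]
      have := h.write hc (ω (q + s.pos))
      exact ⟨this.idx, this.mem, by simp only; omega, this.frame⟩
    | seq c d =>
      refine ⟨rfl, fun e he => ?_, h⟩
      simp only [ramStep, List.mem_cons] at he
      rcases he with rfl | rfl | he
      · exact hc.1
      · exact hc.2
      · exact hK' e he
    | cond b c d =>
      by_cases hb : b.Holds s
      · simp only [ramStep, if_pos hb, if_pos ((h.holds hc.1).2 hb)]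
        exact ⟨trivial, List.forall_mem_cons.2 ⟨hc.2.1, hK'⟩, h⟩
      · simp only [ramStep, if_neg hb, if_neg (mt (h.holds hc.1).1 hb)]
        exact ⟨trivial, List.forall_mem_cons.2 ⟨hc.2.2, hK'⟩, h⟩
    | loop b c =>
      by_cases hb : b.Holds s
      · simp only [ramStep, if_pos hb, if_pos ((h.holds hc.1).2 hb)]
        exact ⟨trivial, List.forall_mem_cons.2 ⟨hc.2, List.forall_mem_cons.2 ⟨hc, hK'⟩⟩, h⟩
      · simp only [ramStep, if_neg hb, if_neg (mt (h.holds hc.1).1 hb)]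
        exact ⟨trivial, hK', h⟩

theorem Agree.iterate (h : Agree M q v s s') {K : List RamProg} (hK : ∀ c ∈ K, c.Below M) (T : ℕ) :
    ((ramStep ω)^[T] (K, s')).1 = ((ramStep fun i => ω (q + i))^[T] (K, s)).1 ∧
    Agree M q v ((ramStep fun i => ω (q + i))^[T] (K, s)).2 ((ramStep ω)^[T] (K, s')).2 := by
  induction T generalizing K s s' with
  | zero => exact ⟨rfl, h⟩
  | succ T ih =>
    obtain ⟨h1, h2, h3⟩ := h.step (ω := ω) hK
    rw [Function.iterate_succ_apply, Function.iterate_succ_apply]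
    have := ih h3 (K := (ramStep ω (K, s')).1) h2
    rw [h1] at this
    have h4 : ramStep ω (K, s') = ((ramStep (fun i => ω (q + i)) (K, s)).1, (ramStep ω (K, s')).2) :=
      Prod.ext h1 rfl
    rw [h4]
    exact this

/-- A halting program can be run on any memory that looks the same to it. -/
theorem Agree.exists_runs (h : Agree M q v s s') (hc : c.Below M)
    (hT : ((ramStep fun i => ω (q + i))^[T] ([c], s)).1 = []) :
    ∃ s'', Runs ω c s' s'' T ∧
      Agree M q v ((ramStep fun i => ω (q + i))^[T] ([c], s)).2 s'' := by
  obtain ⟨h1, h2⟩ := h.iterate (ω := ω) (K := [c]) (by simpa using hc) T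
  refine ⟨_, ?_, h2⟩
  rw [hT] at h1
  obtain ⟨t, ht, h3⟩ := exists_iterate_append (Prod.ext h1 rfl)
  exact ⟨t, ht, h3⟩

end

/-! # Measurability of the outcome of a program -/

section
variable {Ω : Type*} [MeasurableSpace Ω]

/-- A memory that depends measurably on a parameter. -/
structure MeasurableState (s : Ω → RamState) : Prop where
  idx : ∀ a, Measurable fun z => (s z).idx a
  mem : ∀ a i k, Measurable fun z => (s z).mem a i k
  pos : Measurable fun z => (s z).pos

/-- Addresses depend on the data but take countably many values. This makes indirect addressing and
the position in the seed measurable. -/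
theorem measurable_apply_of_countable {f : ℕ → Ω → ℝ} (hf : ∀ k, Measurable (f k)) {N : Ω → ℕ}
    (hN : Measurable N) : Measurable fun z => f (N z) z :=
  (measurable_from_prod_countable_right hf : Measurable fun w : ℕ × Ω => f w.1 w.2).comp
    (hN.prodMk measurable_id)

variable {s : Ω → RamState}

theorem MeasurableState.read (h : MeasurableState s) (x : Cell) :
    Measurable fun z => (s z).read x :=
  measurable_apply_of_countable (f := fun k z => (s z).mem x.arr ((s z).idx x.row) k)
    (fun k => measurable_apply_of_countable (f := fun i z => (s z).mem x.arr i k)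
      (fun i => h.mem x.arr i k) (h.idx x.row)) (h.idx x.col)

theorem MeasurableState.write (h : MeasurableState s) (x : Cell) {r : Ω → ℝ} (hr : Measurable r) :
    MeasurableState fun z => (s z).write x (r z) where
  idx := h.idx
  mem a i k := by
    simp only [RamState.write]
    refine Measurable.ite ?_ hr (h.mem a i k)
    refine (MeasurableSet.const _).inter (MeasurableSet.inter ?_ ?_)
    · exact measurableSet_eq_fun measurable_const (h.idx x.row)
    · exact measurableSet_eq_fun measurable_const (h.idx x.col)
  pos := h.pos

theorem MeasurableState.setIdx (h : MeasurableState s) (a : ℕ) {k : Ω → ℕ} (hk : Measurable k) :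
    MeasurableState fun z => (s z).setIdx a (k z) where
  idx b := by
    simp only [RamState.setIdx, Function.update_apply]
    by_cases hb : b = a
    · simpa [hb] using hk
    · simpa [hb] using h.idx b
  mem := h.mem
  pos := h.pos

theorem MeasurableState.measurableSet_holds (h : MeasurableState s) (b : RamTest) :
    MeasurableSet {z | b.Holds (s z)} := by
  cases b with
  | idxLt a b => exact measurableSet_lt (h.idx a) (h.idx b)
  | realLt x y => exact measurableSet_lt (h.read x) (h.read y)

theorem MeasurableState.ite {A : Set Ω} (hA : MeasurableSet A) [DecidablePred (· ∈ A)]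
    {s' : Ω → RamState} (h : MeasurableState s) (h' : MeasurableState s') :
    MeasurableState fun z => if z ∈ A then s z else s' z where
  idx a := by
    simp only [apply_ite RamState.idx, ite_apply]
    exact Measurable.ite hA (h.idx a) (h'.idx a)
  mem a i k := by
    simp only [apply_ite RamState.mem, ite_apply]
    exact Measurable.ite hA (h.mem a i k) (h'.mem a i k)
  pos := by
    simp only [apply_ite RamState.pos]
    exact Measurable.ite hA h.pos h'.pos

-- One instruction is peeled off at a time. Since the list of pending programs is a fixed parameter,
-- a branching instruction leads to two measurable continuations, which are glued along the
-- measurable set where the test holds.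
open Classical in
theorem MeasurableState.iterate {ω : Ω → Seed} (hω : ∀ k, Measurable fun z => ω z k)
    (h : MeasurableState s) (K : List RamProg) (T : ℕ) :
    MeasurableState fun z => ((ramStep (ω z))^[T] (K, s z)).2 := by
  induction T generalizing K s with
  | zero => exact h
  | succ T ih =>
    simp only [Function.iterate_succ_apply]
    cases K with
    | nil => simpa only [ramStep] using ih h []
    | cons c K =>
      cases c with
      | idxConst a k => exact ih (h.setIdx a measurable_const) K
      | idxAdd a b c => exact ih (h.setIdx a ((h.idx b).add (h.idx c))) K
      | idxSub a b c => exact ih (h.setIdx a ((h.idx b).sub (h.idx c))) K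
      | realConst x r => exact ih (h.write x measurable_const) K
      | realOfIdx x a =>
        exact ih (h.write x (measurable_from_top.comp (h.idx a))) K
      | realAdd x y z => exact ih (h.write x ((h.read y).add (h.read z))) K
      | realSub x y z => exact ih (h.write x ((h.read y).sub (h.read z))) K
      | realMul x y z => exact ih (h.write x ((h.read y).mul (h.read z))) K
      | realDiv x y z => exact ih (h.write x ((h.read y).div (h.read z))) K
      | realSqrt x y => exact ih (h.write x (h.read y).sqrt) K
      | draw x =>
        have hw := h.write x (measurable_apply_of_countable (f := fun k z => ω z k) hω h.pos)
        exact ih (s := fun z => { (s z).write x (ω z (s z).pos) with pos := (s z).pos + 1 })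
          ⟨hw.idx, hw.mem, h.pos.add_const 1⟩ K
      | seq c d => exact ih h (c :: d :: K)
      | cond b c d =>
        have := (ih h (c :: K)).ite (h.measurableSet_holds b) (ih h (d :: K))
        refine (congrArg MeasurableState (funext fun z => ?_)).mp this
        simp only [ramStep, Set.mem_ofPred_eq]
        split_ifs <;> rfl
      | loop b c =>
        have := (ih h (c :: .loop b c :: K)).ite (h.measurableSet_holds b) (ih h K)
        refine (congrArg MeasurableState (funext fun z => ?_)).mp this
        simp only [ramStep, Set.mem_ofPred_eq]
        split_ifs <;> rfl

end

theorem measurableState_ramInit {n p : ℕ} :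
    MeasurableState fun w : Data n p × Seed => ramInit w.1 where
  idx a := measurable_const
  mem a i k := by
    simp only [ramInit]
    split_ifs with h
    · exact (measurable_pi_apply _).comp ((measurable_pi_apply _).comp measurable_fst)
    · exact measurable_const
  pos := measurable_const

theorem PolyTimeClustering.measurable {n : ℕ → ℕ} {ell : (p : ℕ) → Clustering (n p) p}
    (h : PolyTimeClustering n ell) (p : ℕ) :
    Measurable fun w : Data (n p) p × Seed => ell p w.1 w.2 := by
  classical
  obtain ⟨c, C, k, h⟩ := h
  refine measurable_pi_iff.2 fun i => ?_
  have h1 : ∀ w : Data (n p) p × Seed, ell p w.1 w.2 i =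
      if 0 < (ramRun c w.1 w.2 (C * (n p + p + 1) ^ k)).2.mem 1 i 0 then 1 else -1 := by
    intro w
    rw [(h p w.1 w.2).2 i]
  simp_rw [h1]
  refine Measurable.ite (measurableSet_lt measurable_const ?_) measurable_const measurable_const
  exact (measurableState_ramInit.iterate (ω := fun w : Data (n p) p × Seed => w.2)
    (fun k => (measurable_pi_apply k).comp measurable_snd) [c] _).mem 1 i 0

/-! # The randomized test built from a clustering procedure -/

/-- Two random numbers in `{0, …, 2^k - 1}`, from `2 k` coin tosses. -/
def pairIdx (ω : Seed) : ℕ → ℕ × ℕ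
  | 0 => (0, 0)
  | k + 1 => (2 * (pairIdx ω k).1 + if 0 < ω (2 * k) then 1 else 0,
      2 * (pairIdx ω k).2 + if 0 < ω (2 * k + 1) then 1 else 0)

/-- The weight of the signal in row `k`. -/
def rowCoef (i j : ℕ) (t u a : ℝ) (k : ℕ) : ℝ := if k = j then u * a else if k = i then t * a else a

/-- The weight of the fresh noise in row `k`. -/
def rowNoise (i j : ℕ) (t u a : ℝ) (k : ℕ) : ℝ :=
  -- The copies x_i + ζ and x_i - ζ have variance 2 under the null, hence the factor 2; the fresh
  -- noise restores variance 1. The idle factor 1 in the last case lets one program compute all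
  -- weights, with a constant 2 or 1.
  if k = j then √(1 - 2 * (u * a * (u * a))) else if k = i then √(1 - 2 * (t * a * (t * a))) else
    √(1 - 1 * (a * a))

/-- Two noisy copies of row `i`, in rows `i` and `j`; the other rows are unchanged. -/
def splitRow (i j : ℕ) (x : ℕ → ℕ → ℝ) (ζ : ℕ → ℝ) (k l : ℕ) : ℝ :=
  if k = j then x i l - ζ l else if k = i then x i l + ζ l else x k l

/-- The data in which rows `i` and `j` are planted. -/
def plant (i j : ℕ) (t u a : ℝ) (x : ℕ → ℕ → ℝ) (ζ : ℕ → ℝ) (ξ : ℕ → ℕ → ℝ) (k l : ℕ) : ℝ :=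
  rowCoef i j t u a k * splitRow i j x ζ k l + rowNoise i j t u a k * ξ k l

/-- A data matrix, extended by zeros. -/
def extend {n p : ℕ} (x : Data n p) (i k : ℕ) : ℝ :=
  if h : i < n ∧ k < p then x ⟨i, h.1⟩ ⟨k, h.2⟩ else 0

/-- The planted data, with noise taken from the seed. -/
def plantSeed {n p : ℕ} (i j : ℕ) (t u a : ℝ) (x : Data n p) (ω : Seed) : Data n p :=
  -- The seed is read column by column, n + 1 numbers each: first the splitting noise of the column,
  -- then the fresh noise of its n rows. The program draws in this order.
  fun k l => plant i j t u a (extend x) (fun l => ω (l * (n + 1)))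
    (fun k l => ω (l * (n + 1) + 1 + k)) k l

/-- Scaling of the signal: `p ^ (-2 ^ (-κ))`. -/
def scaleFactor (κ p : ℕ) : ℝ := 1 / Real.sqrt^[κ] p

/-- The rejection region: the clustering procedure assigns the same label to the two planted
rows. -/
def plantTest {n p : ℕ} (ell : Clustering n p) (κ : ℕ) (t u : ℝ) : Set (Data n p × Seed) :=
  {w | ∃ (h : (pairIdx w.2 (Nat.clog 2 n)).1 < (pairIdx w.2 (Nat.clog 2 n)).2)
    (hn : (pairIdx w.2 (Nat.clog 2 n)).2 < n),
    ell (plantSeed (pairIdx w.2 (Nat.clog 2 n)).1 (pairIdx w.2 (Nat.clog 2 n)).2 t u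
        (scaleFactor κ p) w.1 fun m => w.2 (2 * Nat.clog 2 n + m))
      (fun m => w.2 (2 * Nat.clog 2 n + p * (n + 1) + m)) ⟨_, h.trans hn⟩ =
    ell (plantSeed (pairIdx w.2 (Nat.clog 2 n)).1 (pairIdx w.2 (Nat.clog 2 n)).2 t u
        (scaleFactor κ p) w.1 fun m => w.2 (2 * Nat.clog 2 n + m))
      (fun m => w.2 (2 * Nat.clog 2 n + p * (n + 1) + m)) ⟨_, hn⟩}

/-! # A program for the test -/

/-- The memory, up to scratch registers and scratch arrays: registers `0` and `1` hold `n` and `p`,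
the array `0` holds `f`, the registers `M, …, M + 3` hold `0, 1, i, j`. -/
structure Good (M n p : ℕ) (f : ℕ → ℕ → ℝ) (i j q : ℕ) (s : RamState) : Prop where
  low : ∀ a < M, s.idx a = if a = 0 then n else if a = 1 then p else 0
  arr : ∀ u v, s.mem 0 u v = f u v
  mem : ∀ a < M, a ≠ 0 → ∀ u v, s.mem a u v = 0
  r0 : s.idx M = 0
  r1 : s.idx (M + 1) = 1
  r2 : s.idx (M + 2) = i
  r3 : s.idx (M + 3) = j
  zero : s.mem (M + 1) 0 0 = 0
  pos : s.pos = q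

/-- One round of coin tosses. -/
def tossProg (M : ℕ) : RamProg :=
  .seq (.draw ⟨M, M, M⟩) <| .seq (.idxAdd (M + 2) (M + 2) (M + 2)) <|
  -- The entry (0, 0) of the array M + 1 stays untouched and serves as the constant 0 in
  -- comparisons.
  .seq (.cond (.realLt ⟨M + 1, M, M⟩ ⟨M, M, M⟩) (.idxAdd (M + 2) (M + 2) (M + 1))
    (.idxAdd (M + 2) (M + 2) M)) <|
  .seq (.draw ⟨M, M, M⟩) <| .seq (.idxAdd (M + 3) (M + 3) (M + 3)) <|
  .seq (.cond (.realLt ⟨M + 1, M, M⟩ ⟨M, M, M⟩) (.idxAdd (M + 3) (M + 3) (M + 1))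
    (.idxAdd (M + 3) (M + 3) M)) <|
  .idxAdd (M + 4) (M + 4) (M + 4)

section
variable {ω : Seed} {s s' : RamState} {M n p i j q : ℕ} {f : ℕ → ℕ → ℝ}

theorem Runs.idxConst (a k : ℕ) : Runs ω (.idxConst a k) s (s.setIdx a k) 1 :=
  ⟨1, le_rfl, fun _ => rfl⟩

theorem Runs.idxAdd (a b c : ℕ) :
    Runs ω (.idxAdd a b c) s (s.setIdx a (s.idx b + s.idx c)) 1 := ⟨1, le_rfl, fun _ => rfl⟩

theorem Runs.realConst (x : Cell) (v : ℝ) : Runs ω (.realConst x v) s (s.write x v) 1 :=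
  ⟨1, le_rfl, fun _ => rfl⟩

theorem Runs.realOfIdx (x : Cell) (a : ℕ) : Runs ω (.realOfIdx x a) s (s.write x (s.idx a)) 1 :=
  ⟨1, le_rfl, fun _ => rfl⟩

theorem Runs.realAdd (x y z : Cell) :
    Runs ω (.realAdd x y z) s (s.write x (s.read y + s.read z)) 1 := ⟨1, le_rfl, fun _ => rfl⟩

theorem Runs.realSub (x y z : Cell) :
    Runs ω (.realSub x y z) s (s.write x (s.read y - s.read z)) 1 := ⟨1, le_rfl, fun _ => rfl⟩

theorem Runs.realMul (x y z : Cell) :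
    Runs ω (.realMul x y z) s (s.write x (s.read y * s.read z)) 1 := ⟨1, le_rfl, fun _ => rfl⟩

theorem Runs.realDiv (x y z : Cell) :
    Runs ω (.realDiv x y z) s (s.write x (s.read y / s.read z)) 1 := ⟨1, le_rfl, fun _ => rfl⟩

theorem Runs.realSqrt (x y : Cell) :
    Runs ω (.realSqrt x y) s (s.write x (√(s.read y))) 1 := ⟨1, le_rfl, fun _ => rfl⟩

theorem Runs.draw (x : Cell) :
    Runs ω (.draw x) s { s.write x (ω s.pos) with pos := s.pos + 1 } 1 :=
  ⟨1, le_rfl, fun _ => rfl⟩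

/-- Writing into a scratch register. -/
theorem Good.setIdx (h : Good M n p f i j q s) {a : ℕ} (ha : M + 4 ≤ a) (k : ℕ) :
    Good M n p f i j q (s.setIdx a k) where
  low b hb := by simp only [RamState.setIdx]; rw [Function.update_of_ne (by omega), h.low b hb]
  arr := h.arr
  mem := h.mem
  r0 := by simp only [RamState.setIdx]; rw [Function.update_of_ne (by omega), h.r0]
  r1 := by simp only [RamState.setIdx]; rw [Function.update_of_ne (by omega), h.r1]
  r2 := by simp only [RamState.setIdx]; rw [Function.update_of_ne (by omega), h.r2]
  r3 := by simp only [RamState.setIdx]; rw [Function.update_of_ne (by omega), h.r3]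
  zero := h.zero
  pos := h.pos

theorem Good.setIdx2 (h : Good M n p f i j q s) (k : ℕ) :
    Good M n p f k j q (s.setIdx (M + 2) k) where
  low b hb := by simp only [RamState.setIdx]; rw [Function.update_of_ne (by omega), h.low b hb]
  arr := h.arr
  mem := h.mem
  r0 := by simp only [RamState.setIdx]; rw [Function.update_of_ne (by omega), h.r0]
  r1 := by simp only [RamState.setIdx]; rw [Function.update_of_ne (by omega), h.r1]
  r2 := by simp only [RamState.setIdx]; rw [Function.update_self]
  r3 := by simp only [RamState.setIdx]; rw [Function.update_of_ne (by omega), h.r3]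
  zero := h.zero
  pos := h.pos

theorem Good.setIdx3 (h : Good M n p f i j q s) (k : ℕ) :
    Good M n p f i k q (s.setIdx (M + 3) k) where
  low b hb := by simp only [RamState.setIdx]; rw [Function.update_of_ne (by omega), h.low b hb]
  arr := h.arr
  mem := h.mem
  r0 := by simp only [RamState.setIdx]; rw [Function.update_of_ne (by omega), h.r0]
  r1 := by simp only [RamState.setIdx]; rw [Function.update_of_ne (by omega), h.r1]
  r2 := by simp only [RamState.setIdx]; rw [Function.update_of_ne (by omega), h.r2]
  r3 := by simp only [RamState.setIdx]; rw [Function.update_self]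
  zero := h.zero
  pos := h.pos

/-- Writing into a scratch array. -/
theorem Good.write (h : Good M n p f i j q s) (hM : 1 ≤ M) {x : Cell} (hx : M ≤ x.arr)
    (hx' : x.arr ≠ M + 1) (r : ℝ) : Good M n p f i j q (s.write x r) where
  low := h.low
  arr u v := by simp only [RamState.write]; rw [if_neg (by omega), h.arr]
  mem a ha h0 u v := by simp only [RamState.write]; rw [if_neg (by omega), h.mem a ha h0]
  r0 := h.r0
  r1 := h.r1
  r2 := h.r2
  r3 := h.r3
  zero := by simp only [RamState.write]; rw [if_neg (by omega), h.zero]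
  pos := h.pos

/-- Writing into the array `0`. -/
theorem Good.write_arr (h : Good M n p f i j q s) (hM : 1 ≤ M) (row col : ℕ) (r : ℝ) :
    Good M n p (fun u v => if u = s.idx row ∧ v = s.idx col then r else f u v) i j q
      (s.write ⟨0, row, col⟩ r) where
  low := h.low
  arr u v := by
    simp only [RamState.write, true_and]
    rw [h.arr]
  mem a ha h0 u v := by simp only [RamState.write]; rw [if_neg (by omega), h.mem a ha h0]
  r0 := h.r0
  r1 := h.r1
  r2 := h.r2
  r3 := h.r3
  zero := by simp only [RamState.write]; rw [if_neg (by omega), h.zero]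
  pos := h.pos

theorem Good.draw (h : Good M n p f i j q s) (hM : 1 ≤ M) {x : Cell} (hx : M ≤ x.arr)
    (hx' : x.arr ≠ M + 1) (ω : Seed) :
    Good M n p f i j (q + 1) { s.write x (ω s.pos) with pos := s.pos + 1 } := by
  have h' := h.write hM hx hx' (ω s.pos)
  exact ⟨h'.low, h'.arr, h'.mem, h'.r0, h'.r1, h'.r2, h'.r3, h'.zero, by simp [h.pos]⟩

theorem exists_runs_toss (hM : 2 ≤ M) (h : Good M n p f i j q s) :
    ∃ s', Runs ω (tossProg M) s s' 15 ∧
      Good M n p f (2 * i + if 0 < ω q then 1 else 0) (2 * j + if 0 < ω (q + 1) then 1 else 0)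
        (q + 2) s' ∧ s'.idx (M + 4) = s.idx (M + 4) + s.idx (M + 4) := by
  classical
  -- the first coin toss
  have h1 := h.draw (by omega : 1 ≤ M) (x := ⟨M, M, M⟩) le_rfl (by simp) ω
  set s₁ : RamState := { s.write ⟨M, M, M⟩ (ω s.pos) with pos := s.pos + 1 } with hs₁
  have h2 := h1.setIdx2 (s₁.idx (M + 2) + s₁.idx (M + 2))
  set s₂ := s₁.setIdx (M + 2) (s₁.idx (M + 2) + s₁.idx (M + 2)) with hs₂
  have hz : ∀ s' : RamState, s'.idx M = 0 → s'.read ⟨M + 1, M, M⟩ = s'.mem (M + 1) 0 0 := by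
    intro s' h'
    simp [RamState.read, h']
  have hz' : ∀ s' : RamState, s'.idx M = 0 → s'.read ⟨M, M, M⟩ = s'.mem M 0 0 := by
    intro s' h'
    simp [RamState.read, h']
  have hr2 : s₂.mem M 0 0 = ω q := by
    simp [hs₂, hs₁, RamState.setIdx, RamState.write, h.r0, h.pos]
  have c1 : ∃ s₃, Runs ω (.cond (.realLt ⟨M + 1, M, M⟩ ⟨M, M, M⟩) (.idxAdd (M + 2) (M + 2) (M + 1))
      (.idxAdd (M + 2) (M + 2) M)) s₂ s₃ 2 ∧
      Good M n p f (2 * i + if 0 < ω q then 1 else 0) j (q + 1) s₃ ∧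
      s₃.idx (M + 4) = s.idx (M + 4) := by
    by_cases hω : 0 < ω q
    · refine ⟨_, Runs.cond_true ?_ (Runs.idxAdd _ _ _), ?_, ?_⟩
      · simpa only [RamTest.Holds, hz _ h2.r0, hz' _ h2.r0, h2.zero, hr2] using hω
      · have := h2.setIdx2 (s₂.idx (M + 2) + s₂.idx (M + 1))
        rw [if_pos hω]
        convert this using 1
        rw [h2.r1, h2.r2, h1.r2]
        ring
      · simp [RamState.setIdx, hs₂, hs₁, RamState.write]
    · refine ⟨_, Runs.cond_false ?_ (Runs.idxAdd _ _ _), ?_, ?_⟩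
      · simpa only [RamTest.Holds, hz _ h2.r0, hz' _ h2.r0, h2.zero, hr2] using hω
      · have := h2.setIdx2 (s₂.idx (M + 2) + s₂.idx M)
        rw [if_neg hω]
        convert this using 1
        rw [h2.r0, h2.r2, h1.r2]
        ring
      · simp [RamState.setIdx, hs₂, hs₁, RamState.write]
  obtain ⟨s₃, hrun₃, h3, h34⟩ := c1
  -- the second coin toss
  have h4 := h3.draw (by omega : 1 ≤ M) (x := ⟨M, M, M⟩) le_rfl (by simp) ω
  set s₄ : RamState := { s₃.write ⟨M, M, M⟩ (ω s₃.pos) with pos := s₃.pos + 1 } with hs₄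
  have h5 := h4.setIdx3 (s₄.idx (M + 3) + s₄.idx (M + 3))
  set s₅ := s₄.setIdx (M + 3) (s₄.idx (M + 3) + s₄.idx (M + 3)) with hs₅
  have hr5 : s₅.mem M 0 0 = ω (q + 1) := by
    simp [hs₅, hs₄, RamState.setIdx, RamState.write, h3.r0, h3.pos]
  have c2 : ∃ s₆, Runs ω (.cond (.realLt ⟨M + 1, M, M⟩ ⟨M, M, M⟩) (.idxAdd (M + 3) (M + 3) (M + 1))
      (.idxAdd (M + 3) (M + 3) M)) s₅ s₆ 2 ∧
      Good M n p f (2 * i + if 0 < ω q then 1 else 0) (2 * j + if 0 < ω (q + 1) then 1 else 0)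
        (q + 2) s₆ ∧ s₆.idx (M + 4) = s.idx (M + 4) := by
    by_cases hω : 0 < ω (q + 1)
    · refine ⟨_, Runs.cond_true ?_ (Runs.idxAdd _ _ _), ?_, ?_⟩
      · simpa only [RamTest.Holds, hz _ h5.r0, hz' _ h5.r0, h5.zero, hr5] using hω
      · have := h5.setIdx3 (s₅.idx (M + 3) + s₅.idx (M + 1))
        rw [if_pos hω]
        convert this using 1
        rw [h5.r1, h5.r3, h4.r3]
        ring
      · simp [RamState.setIdx, hs₅, hs₄, RamState.write, h34]
    · refine ⟨_, Runs.cond_false ?_ (Runs.idxAdd _ _ _), ?_, ?_⟩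
      · simpa only [RamTest.Holds, hz _ h5.r0, hz' _ h5.r0, h5.zero, hr5] using hω
      · have := h5.setIdx3 (s₅.idx (M + 3) + s₅.idx M)
        rw [if_neg hω]
        convert this using 1
        rw [h5.r0, h5.r3, h4.r3]
        ring
      · simp [RamState.setIdx, hs₅, hs₄, RamState.write, h34]
  obtain ⟨s₆, hrun₆, h6, h64⟩ := c2
  refine ⟨_, ?_, h6.setIdx (a := M + 4) le_rfl (s₆.idx (M + 4) + s₆.idx (M + 4)), ?_⟩
  · exact Runs.seq (Runs.draw _) <| Runs.seq (Runs.idxAdd _ _ _) <| Runs.seq hrun₃ <|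
      Runs.seq (Runs.draw _) <| Runs.seq (Runs.idxAdd _ _ _) <| Runs.seq hrun₆ <|
      Runs.idxAdd _ _ _
  · simp [RamState.setIdx, h64]

/-- Initialization of the scratch registers and choice of the pair of rows. -/
def pickProg (M : ℕ) : RamProg :=
  -- Register M + 4 starts at 1 and is doubled in each round, so the loop stops after `Nat.clog 2 n`
  -- rounds, the least number of bits that covers all rows.
  .seq (.idxConst (M + 1) 1) <| .seq (.idxConst (M + 4) 1) <| .loop (.idxLt (M + 4) 0) (tossProg M)

theorem exists_runs_pick (hM : 2 ≤ M) (x : Data n p) :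
    ∃ s', Runs ω (pickProg M) (ramInit x) s' (16 * n + 5) ∧
      Good M n p (extend x) (pairIdx ω (Nat.clog 2 n)).1 (pairIdx ω (Nat.clog 2 n)).2
        (2 * Nat.clog 2 n) s' := by
  set K := Nat.clog 2 n with hK
  set s₂ := ((ramInit x).setIdx (M + 1) 1).setIdx (M + 4) 1 with hs₂
  have h0 : Good M n p (extend x) 0 0 0 s₂ := by
    constructor
    · intro a ha
      simp only [hs₂, RamState.setIdx, ramInit]
      rw [Function.update_of_ne (by omega), Function.update_of_ne (by omega)]
    · intro u v
      simp [hs₂, RamState.setIdx, ramInit, extend]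
    · intro a ha h0 u v
      simp only [hs₂, RamState.setIdx, ramInit]
      rw [dif_neg (by omega)]
    · simp only [hs₂, RamState.setIdx, ramInit]
      rw [Function.update_of_ne (by omega), Function.update_of_ne (by omega), if_neg (by omega),
        if_neg (by omega)]
    · simp only [hs₂, RamState.setIdx, ramInit]
      rw [Function.update_of_ne (by omega), Function.update_self]
    · simp only [hs₂, RamState.setIdx, ramInit]
      rw [Function.update_of_ne (by omega), Function.update_of_ne (by omega), if_neg (by omega),
        if_neg (by omega)]
    · simp only [hs₂, RamState.setIdx, ramInit]
      rw [Function.update_of_ne (by omega), Function.update_of_ne (by omega), if_neg (by omega),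
        if_neg (by omega)]
    · simp only [hs₂, RamState.setIdx, ramInit]
      rw [dif_neg (by omega)]
    · rfl
  have hstep : ∀ k < K, ∀ s, (Good M n p (extend x) (pairIdx ω k).1 (pairIdx ω k).2 (2 * k) s ∧
      s.idx (M + 4) = 2 ^ k) → (RamTest.idxLt (M + 4) 0).Holds s ∧
      ∃ s', Runs ω (tossProg M) s s' 15 ∧ (Good M n p (extend x) (pairIdx ω (k + 1)).1
        (pairIdx ω (k + 1)).2 (2 * (k + 1)) s' ∧ s'.idx (M + 4) = 2 ^ (k + 1)) := by
    intro k hk s ⟨hs, hs4⟩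
    refine ⟨?_, ?_⟩
    · simp only [RamTest.Holds]
      rw [hs4, hs.low 0 (by omega), if_pos rfl]
      exact (Nat.lt_clog_iff_pow_lt one_lt_two).1 hk
    · obtain ⟨s', h1, h2, h3⟩ := exists_runs_toss (ω := ω) hM hs
      refine ⟨s', h1, h2, ?_⟩
      rw [h3, hs4]
      ring
  have hend : ∀ s, (Good M n p (extend x) (pairIdx ω K).1 (pairIdx ω K).2 (2 * K) s ∧
      s.idx (M + 4) = 2 ^ K) → ¬ (RamTest.idxLt (M + 4) 0).Holds s := by
    intro s ⟨hs, hs4⟩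
    simp only [RamTest.Holds]
    rw [hs4, hs.low 0 (by omega), if_pos rfl, not_lt]
    exact Nat.le_pow_clog one_lt_two n
  obtain ⟨s', hrun, hs', -⟩ := Runs.loop_inv (ω := ω)
    (fun k s => Good M n p (extend x) (pairIdx ω k).1 (pairIdx ω k).2 (2 * k) s ∧
      s.idx (M + 4) = 2 ^ k) K hstep hend ⟨h0, by simp [hs₂, RamState.setIdx]⟩
  refine ⟨s', ?_, hs'⟩
  have hKn : K ≤ n := by
    rw [hK]
    exact Nat.clog_le_of_le_pow (Nat.lt_two_pow_self).le
  exact (Runs.seq (Runs.idxConst _ _) (Runs.seq (Runs.idxConst _ _) hrun)).mono (by omega)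

end

/-! ### Programs for the weights, the planted columns and the comparison of labels. -/

section
variable {ω : Seed} {s s' : RamState} {M n p i j q : ℕ} {f f' : ℕ → ℕ → ℝ}

theorem Good.congr (h : Good M n p f i j q s) (hf : ∀ u v, f u v = f' u v) :
    Good M n p f' i j q s :=
  ⟨h.low, fun u v => (h.arr u v).trans (hf u v), h.mem, h.r0, h.r1, h.r2, h.r3, h.zero, h.pos⟩

/-- Weights of signal and noise for the row in the register `row`. -/
def coefProg (M row : ℕ) (c d : ℝ) : RamProg :=
  .seq (.realConst ⟨M + 5, M, M⟩ c) <|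
  .seq (.realMul ⟨M + 2, row, M⟩ ⟨M + 5, M, M⟩ ⟨M + 4, M, M⟩) <|
  .seq (.realMul ⟨M + 6, M, M⟩ ⟨M + 2, row, M⟩ ⟨M + 2, row, M⟩) <|
  .seq (.realConst ⟨M + 5, M, M⟩ d) <|
  .seq (.realMul ⟨M + 6, M, M⟩ ⟨M + 5, M, M⟩ ⟨M + 6, M, M⟩) <|
  .seq (.realConst ⟨M + 5, M, M⟩ 1) <|
  .seq (.realSub ⟨M + 6, M, M⟩ ⟨M + 5, M, M⟩ ⟨M + 6, M, M⟩) <|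
  .realSqrt ⟨M + 3, row, M⟩ ⟨M + 6, M, M⟩

theorem exists_runs_coef (hM : 2 ≤ M) (h : Good M n p f i j q s) (row : ℕ) (c d : ℝ) :
    ∃ s', Runs ω (coefProg M row c d) s s' 15 ∧ Good M n p f i j q s' ∧ s'.idx = s.idx ∧
      s'.mem (M + 4) = s.mem (M + 4) ∧
      (∀ u, s'.mem (M + 2) u 0 =
        if u = s.idx row then c * s.mem (M + 4) 0 0 else s.mem (M + 2) u 0) ∧
      ∀ u, s'.mem (M + 3) u 0 =
        if u = s.idx row then √(1 - d * (c * s.mem (M + 4) 0 0 * (c * s.mem (M + 4) 0 0)))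
        else s.mem (M + 3) u 0 := by
  have h1 : 1 ≤ M := by omega
  refine ⟨_, Runs.seq (Runs.realConst _ _) <| Runs.seq (Runs.realMul _ _ _) <|
    Runs.seq (Runs.realMul _ _ _) <| Runs.seq (Runs.realConst _ _) <|
    Runs.seq (Runs.realMul _ _ _) <| Runs.seq (Runs.realConst _ _) <|
    Runs.seq (Runs.realSub _ _ _) <| Runs.realSqrt _ _, ?_, rfl, ?_, ?_, ?_⟩
  · exact (((((((h.write h1 (by simp) (by simp) _).write h1 (by simp) (by simp) _).write h1
      (by simp) (by simp) _).write h1 (by simp) (by simp) _).write h1 (by simp) (by simp) _).write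
      h1 (by simp) (by simp) _).write h1 (by simp) (by simp) _).write h1 (by simp) (by simp) _
  · funext u v
    simp [RamState.write]
  · intro u
    simp [RamState.write, RamState.read, h.r0]
  · intro u
    simp [RamState.write, RamState.read, h.r0]

/-- The scaling factor, by repeated square roots. -/
def sqrtProg (M : ℕ) : ℕ → RamProg
  | 0 => .seq (.realConst ⟨M + 5, M, M⟩ 1) <|
      .realDiv ⟨M + 4, M, M⟩ ⟨M + 5, M, M⟩ ⟨M + 4, M, M⟩
  | κ + 1 => .seq (.realSqrt ⟨M + 4, M, M⟩ ⟨M + 4, M, M⟩) (sqrtProg M κ)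

theorem exists_runs_sqrt (hM : 2 ≤ M) (κ : ℕ) (h : Good M n p f i j q s) :
    ∃ s', Runs ω (sqrtProg M κ) s s' (2 * κ + 3) ∧ Good M n p f i j q s' ∧
      s'.mem (M + 4) 0 0 = 1 / Real.sqrt^[κ] (s.mem (M + 4) 0 0) := by
  have h1 : 1 ≤ M := by omega
  induction κ generalizing s with
  | zero =>
    refine ⟨_, Runs.seq (Runs.realConst _ _) (Runs.realDiv _ _ _),
      (h.write h1 (by simp) (by simp) _).write h1 (by simp) (by simp) _, ?_⟩
    simp [RamState.write, RamState.read, h.r0]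
  | succ κ ih =>
    obtain ⟨s', h2, h3, h4⟩ := ih (h.write h1 (x := ⟨M + 4, M, M⟩) (by simp) (by simp)
      (√(s.read ⟨M + 4, M, M⟩)))
    refine ⟨s', (Runs.seq (Runs.realSqrt _ _) h2).mono (by omega), h3, ?_⟩
    rw [h4, Function.iterate_succ_apply]
    simp [RamState.write, RamState.read, h.r0]

/-- All weights. -/
def coefsProg (M κ : ℕ) (t u : ℝ) : RamProg :=
  .seq (.realOfIdx ⟨M + 4, M, M⟩ 1) <| .seq (sqrtProg M κ) <| .seq (.idxAdd (M + 5) M M) <|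
  .seq (.loop (.idxLt (M + 5) 0)
    (.seq (coefProg M (M + 5) 1 1) (.idxAdd (M + 5) (M + 5) (M + 1)))) <|
  -- The loop gives every row the default weights; rows i and j are overwritten afterwards, row j
  -- last, which matches the priority of the case k = j in `rowCoef`.
  .seq (coefProg M (M + 2) t 2) (coefProg M (M + 3) u 2)

/-- The arrays of weights hold the weights for planted rows. -/
def HasCoefs (M n i j : ℕ) (t u a : ℝ) (s : RamState) : Prop :=
  ∀ k < n, s.mem (M + 2) k 0 = rowCoef i j t u a k ∧ s.mem (M + 3) k 0 = rowNoise i j t u a k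

theorem exists_runs_coefs (hM : 2 ≤ M) (κ : ℕ) (t u : ℝ) (h : Good M n p f i j q s) :
    ∃ s', Runs ω (coefsProg M κ t u) s s' (18 * n + 2 * κ + 45) ∧ Good M n p f i j q s' ∧
      HasCoefs M n i j t u (scaleFactor κ p) s' := by
  have h1 : 1 ≤ M := by omega
  set a := scaleFactor κ p with ha
  obtain ⟨s₂, hr₂, hs₂, ha₂⟩ := exists_runs_sqrt (ω := ω) hM κ
    (h.write h1 (x := ⟨M + 4, M, M⟩) (by simp) (by simp) (s.idx 1))
  have ha₂' : s₂.mem (M + 4) 0 0 = a := by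
    rw [ha₂, ha, scaleFactor]
    simp [RamState.write, h.r0, h.low 1 (by omega)]
  have hs₃ := hs₂.setIdx (a := M + 5) (by omega) (s₂.idx M + s₂.idx M)
  have hstep : ∀ k < n, ∀ s, (Good M n p f i j q s ∧ s.idx (M + 5) = k ∧
      s.mem (M + 4) 0 0 = a ∧ ∀ v < k, s.mem (M + 2) v 0 = 1 * a ∧
        s.mem (M + 3) v 0 = √(1 - 1 * (1 * a * (1 * a)))) →
      (RamTest.idxLt (M + 5) 0).Holds s ∧
      ∃ s', Runs ω (.seq (coefProg M (M + 5) 1 1) (.idxAdd (M + 5) (M + 5) (M + 1))) s s' 17 ∧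
      (Good M n p f i j q s' ∧ s'.idx (M + 5) = k + 1 ∧
      s'.mem (M + 4) 0 0 = a ∧ ∀ v < k + 1, s'.mem (M + 2) v 0 = 1 * a ∧
        s'.mem (M + 3) v 0 = √(1 - 1 * (1 * a * (1 * a)))) := by
    intro k hk s ⟨hs, hk', hsa, hc⟩
    refine ⟨?_, ?_⟩
    · simp only [RamTest.Holds]
      rw [hk', hs.low 0 (by omega), if_pos rfl]
      exact hk
    · obtain ⟨s', hr, hs', hidx, h4, h2, h3⟩ := exists_runs_coef (ω := ω) hM hs (M + 5) 1 1
      refine ⟨_, Runs.seq hr (Runs.idxAdd _ _ _), hs'.setIdx (by omega) _, ?_, ?_, ?_⟩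
      · simp [RamState.setIdx, hidx, hk', hs.r1]
      · simp [RamState.setIdx, h4, hsa]
      · intro v hv
        simp only [RamState.setIdx, h2, h3, hk', hsa]
        split_ifs with hvk
        · exact ⟨rfl, rfl⟩
        · exact hc v (by omega)
  have hend : ∀ s, (Good M n p f i j q s ∧ s.idx (M + 5) = n ∧
      s.mem (M + 4) 0 0 = a ∧ ∀ v < n, s.mem (M + 2) v 0 = 1 * a ∧
        s.mem (M + 3) v 0 = √(1 - 1 * (1 * a * (1 * a)))) →
      ¬ (RamTest.idxLt (M + 5) 0).Holds s := by
    intro s ⟨hs, hk', _⟩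
    simp only [RamTest.Holds]
    rw [hk', hs.low 0 (by omega), if_pos rfl]
    exact lt_irrefl n
  obtain ⟨s₄, hr₄, hs₄, -, ha₄, hc₄⟩ := Runs.loop_inv (ω := ω) (fun k s => Good M n p f i j q s ∧
    s.idx (M + 5) = k ∧ s.mem (M + 4) 0 0 = a ∧ ∀ v < k, s.mem (M + 2) v 0 = 1 * a ∧
        s.mem (M + 3) v 0 = √(1 - 1 * (1 * a * (1 * a)))) n hstep hend
    ⟨hs₃, by simp [RamState.setIdx, hs₂.r0], ha₂', by simp⟩
  obtain ⟨s₅, hr₅, hs₅, hidx₅, h45, h25, h35⟩ := exists_runs_coef (ω := ω) hM hs₄ (M + 2) t 2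
  obtain ⟨s₆, hr₆, hs₆, hidx₆, h46, h26, h36⟩ := exists_runs_coef (ω := ω) hM hs₅ (M + 3) u 2
  refine ⟨s₆, ?_, hs₆, ?_⟩
  · exact (Runs.seq (Runs.realOfIdx _ _) <| Runs.seq hr₂ <| Runs.seq (Runs.idxAdd _ _ _) <|
      Runs.seq hr₄ <| Runs.seq hr₅ hr₆).mono (by omega)
  · intro k hk
    have hck := hc₄ k hk
    rw [h26, h36, h25, h35, hs₅.r3, hs₄.r2, h45, ha₄, hck.1, hck.2, rowCoef, rowNoise]
    simp only [one_mul]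
    trivial

/-- The new entry in row `R` of the current column. -/
def entryProg (M : ℕ) : RamProg :=
  .seq (.draw ⟨M, M, M⟩) <|
  .seq (.realMul ⟨0, M + 5, M + 6⟩ ⟨M + 2, M + 5, M⟩ ⟨0, M + 5, M + 6⟩) <|
  .seq (.realMul ⟨M + 5, M, M⟩ ⟨M + 3, M + 5, M⟩ ⟨M, M, M⟩) <|
  .seq (.realAdd ⟨0, M + 5, M + 6⟩ ⟨0, M + 5, M + 6⟩ ⟨M + 5, M, M⟩) <|
  .idxAdd (M + 5) (M + 5) (M + 1)

theorem exists_runs_entry (hM : 2 ≤ M) {t u a : ℝ} (h : Good M n p f i j q s)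
    (hc : HasCoefs M n i j t u a s) {k l : ℕ} (hk : k < n) (hk' : s.idx (M + 5) = k)
    (hl : s.idx (M + 6) = l) :
    ∃ s', Runs ω (entryProg M) s s' 9 ∧
      Good M n p (fun v w => if v = k ∧ w = l then
        rowCoef i j t u a k * f k l + rowNoise i j t u a k * ω q else f v w) i j (q + 1) s' ∧
      HasCoefs M n i j t u a s' ∧ s'.idx (M + 5) = k + 1 ∧ s'.idx (M + 6) = l := by
  have h1 : 1 ≤ M := by omega
  refine ⟨_, Runs.seq (Runs.draw _) <| Runs.seq (Runs.realMul _ _ _) <|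
    Runs.seq (Runs.realMul _ _ _) <| Runs.seq (Runs.realAdd _ _ _) <| Runs.idxAdd _ _ _,
    ?_, ?_, ?_, ?_⟩
  · refine ((((((h.draw h1 (x := ⟨M, M, M⟩) le_rfl (by simp) ω).write_arr h1 (M + 5) (M + 6) _).write
      h1 (x := ⟨M + 5, M, M⟩) (by simp) (by simp) _).write_arr h1 (M + 5) (M + 6) _).setIdx
      (by omega) _).congr fun v w => ?_)
    have hM0 : ¬ (M = 0) := by omega
    have hM0' : ¬ (0 = M) := by omega
    by_cases hvw : v = k ∧ w = l
    · obtain ⟨rfl, rfl⟩ := hvw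
      simp [RamState.write, RamState.read, h.r0, hk', hl, (hc _ hk).1, (hc _ hk).2, h.pos, h.arr,
        hM0, hM0']
    · simp [RamState.write, hk', hl, hvw]
  · intro v hv
    simp [RamState.write, RamState.setIdx, hc v hv]
  · simp [RamState.write, RamState.setIdx, hk', h.r1]
  · simp [RamState.write, RamState.setIdx, hl]

/-- The new column with index in register `C`. -/
def columnProg (M : ℕ) : RamProg :=
  .seq (.draw ⟨M + 5, M, M⟩) <|
  -- Row j is written first because it needs the old entry of row i.
  .seq (.realSub ⟨0, M + 3, M + 6⟩ ⟨0, M + 2, M + 6⟩ ⟨M + 5, M, M⟩) <|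
  .seq (.realAdd ⟨0, M + 2, M + 6⟩ ⟨0, M + 2, M + 6⟩ ⟨M + 5, M, M⟩) <|
  .seq (.idxAdd (M + 5) M M) <| .seq (.loop (.idxLt (M + 5) 0) (entryProg M)) <|
  .idxAdd (M + 6) (M + 6) (M + 1)

theorem exists_runs_column (hM : 2 ≤ M) {t u a : ℝ} {x y : ℕ → ℕ → ℝ} {l : ℕ} (hij : i < j)
    (hjn : j < n)
    (hy : ∀ k, y k l = if k < n then rowCoef i j t u a k * splitRow i j x (fun _ => ω q) k l +
      rowNoise i j t u a k * ω (q + 1 + k) else x k l)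
    (h : Good M n p (fun k v => if v < l then y k v else x k v) i j q s)
    (hc : HasCoefs M n i j t u a s) (hl : s.idx (M + 6) = l) :
    ∃ s', Runs ω (columnProg M) s s' (10 * n + 11) ∧
      Good M n p (fun k v => if v < l + 1 then y k v else x k v) i j (q + (n + 1)) s' ∧
      HasCoefs M n i j t u a s' ∧ s'.idx (M + 6) = l + 1 := by
  have h1 : 1 ≤ M := by omega
  have hM0 : ¬ (M = 0) := by omega
  have hM0' : ¬ (0 = M) := by omega
  set s₁ : RamState := { s.write ⟨M + 5, M, M⟩ (ω s.pos) with pos := s.pos + 1 } with hs₁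
  have g₁ : Good M n p (fun k v => if v < l then y k v else x k v) i j (q + 1) s₁ :=
    h.draw h1 (x := ⟨M + 5, M, M⟩) (by simp) (by simp) ω
  set s₂ := s₁.write ⟨0, M + 3, M + 6⟩ (s₁.read ⟨0, M + 2, M + 6⟩ - s₁.read ⟨M + 5, M, M⟩) with hs₂
  have g₂ : Good M n p (fun k v => if k = s₁.idx (M + 3) ∧ v = s₁.idx (M + 6) then
      s₁.read ⟨0, M + 2, M + 6⟩ - s₁.read ⟨M + 5, M, M⟩ else
      if v < l then y k v else x k v) i j (q + 1) s₂ := g₁.write_arr h1 (M + 3) (M + 6) _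
  set s₃ := s₂.write ⟨0, M + 2, M + 6⟩ (s₂.read ⟨0, M + 2, M + 6⟩ + s₂.read ⟨M + 5, M, M⟩) with hs₃
  have g₃ : Good M n p (fun k v => if k = s₂.idx (M + 2) ∧ v = s₂.idx (M + 6) then
      s₂.read ⟨0, M + 2, M + 6⟩ + s₂.read ⟨M + 5, M, M⟩ else
      if k = s₁.idx (M + 3) ∧ v = s₁.idx (M + 6) then
      s₁.read ⟨0, M + 2, M + 6⟩ - s₁.read ⟨M + 5, M, M⟩ else
      if v < l then y k v else x k v) i j (q + 1) s₃ := g₂.write_arr h1 (M + 2) (M + 6) _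
  have g₄ := g₃.setIdx (a := M + 5) (by omega) (s₃.idx M + s₃.idx M)
  set s₄ := s₃.setIdx (M + 5) (s₃.idx M + s₃.idx M) with hs₄
  -- The loop invariant: columns before l are final and later ones untouched; in column l the first
  -- m rows are final and the others hold the split column.
  set F : ℕ → ℕ → ℕ → ℝ := fun m k v => if v < l then y k v else if v = l then
    (if k < m then y k l else splitRow i j x (fun _ => ω q) k l) else x k v with hF
  have hij' : ¬ (i = j) := hij.ne
  have g₄' : Good M n p (F 0) i j (q + 1) s₄ := by
    refine g₄.congr fun k v => ?_
    have e1 : s₁.idx (M + 6) = l := hl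
    have e2 : s₂.idx (M + 6) = l := hl
    have e4 : s₂.idx (M + 2) = i := h.r2
    have e5 : s₁.idx (M + 3) = j := h.r3
    have e6 : s₁.read ⟨0, M + 2, M + 6⟩ = x i l := by
      simp [RamState.read, hs₁, RamState.write, h.r2, hl, h.arr]
    have e7 : s₁.read ⟨M + 5, M, M⟩ = ω q := by
      simp [RamState.read, hs₁, RamState.write, h.r0, h.pos]
    have e8 : s₂.read ⟨0, M + 2, M + 6⟩ = x i l := by
      simp [RamState.read, hs₂, hs₁, RamState.write, h.r2, h.r3, hl, h.arr, hij']
    have e9 : s₂.read ⟨M + 5, M, M⟩ = ω q := by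
      simp [RamState.read, hs₂, hs₁, RamState.write, h.r0, h.pos]
    simp only [e1, e2, e4, e5, e6, e7, e8, e9, hF]
    by_cases hv : v = l
    · subst hv
      simp only [and_true, lt_irrefl, if_false, if_true, Nat.not_lt_zero, splitRow]
      by_cases hkj : k = j
      · subst hkj
        rw [if_neg (by omega), if_pos rfl, if_pos rfl]
      · by_cases hki : k = i
        · subst hki
          rw [if_pos rfl, if_neg hkj, if_pos rfl]
        · rw [if_neg hki, if_neg hkj, if_neg hkj, if_neg hki]
    · simp [hv]
  have hc₄ : HasCoefs M n i j t u a s₄ := by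
    intro k hk
    simp [hs₄, hs₃, hs₂, hs₁, RamState.write, RamState.setIdx, hc k hk]
  have hstep : ∀ k < n, ∀ s, (Good M n p (F k) i j (q + 1 + k) s ∧ HasCoefs M n i j t u a s ∧
      s.idx (M + 5) = k ∧ s.idx (M + 6) = l) → (RamTest.idxLt (M + 5) 0).Holds s ∧
      ∃ s', Runs ω (entryProg M) s s' 9 ∧ (Good M n p (F (k + 1)) i j (q + 1 + (k + 1)) s' ∧
        HasCoefs M n i j t u a s' ∧ s'.idx (M + 5) = k + 1 ∧ s'.idx (M + 6) = l) := by
    intro k hk s ⟨hs, hcs, hk', hl'⟩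
    refine ⟨?_, ?_⟩
    · simp only [RamTest.Holds]
      rw [hk', hs.low 0 (by omega), if_pos rfl]
      exact hk
    · obtain ⟨s', hr, hs', hcs', hk'', hl''⟩ := exists_runs_entry (ω := ω) hM hs hcs hk hk' hl'
      refine ⟨s', hr, hs'.congr fun v w => ?_, hcs', hk'', hl''⟩
      simp only [hF, lt_irrefl, if_false, if_true]
      have hyk := hy k
      rw [if_pos hk] at hyk
      by_cases hw : w = l
      · subst hw
        by_cases hv : v = k
        · subst hv
          simp [hyk]
        · have : v < k + 1 ↔ v < k := by omega
          simp [hv, this]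
      · simp [hw]
  have hend : ∀ s, (Good M n p (F n) i j (q + 1 + n) s ∧ HasCoefs M n i j t u a s ∧
      s.idx (M + 5) = n ∧ s.idx (M + 6) = l) → ¬ (RamTest.idxLt (M + 5) 0).Holds s := by
    intro s ⟨hs, _, hk', _⟩
    simp only [RamTest.Holds]
    rw [hk', hs.low 0 (by omega), if_pos rfl]
    exact lt_irrefl n
  obtain ⟨s₅, hr₅, g₅, hc₅, -, hl₅⟩ := Runs.loop_inv (ω := ω)
    (fun k s => Good M n p (F k) i j (q + 1 + k) s ∧ HasCoefs M n i j t u a s ∧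
      s.idx (M + 5) = k ∧ s.idx (M + 6) = l) n hstep hend
    ⟨g₄', hc₄, by simp [hs₄, hs₃, hs₂, hs₁, RamState.write, RamState.setIdx, h.r0],
      by simp [hs₄, hs₃, hs₂, hs₁, RamState.write, RamState.setIdx, hl]⟩
  refine ⟨_, (Runs.seq (Runs.draw _) <| Runs.seq (Runs.realSub _ _ _) <|
    Runs.seq (Runs.realAdd _ _ _) <| Runs.seq (Runs.idxAdd _ _ _) <| Runs.seq hr₅ <|
    Runs.idxAdd _ _ _).mono (by omega), ?_, ?_, ?_⟩
  · have g₆ := g₅.setIdx (a := M + 6) (by omega) (s₅.idx (M + 6) + s₅.idx (M + 1))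
    rw [show q + 1 + n = q + (n + 1) by ring] at g₆
    refine g₆.congr fun k v => ?_
    simp only [hF]
    by_cases hv : v = l
    · subst hv
      simp only [lt_irrefl, if_false, if_true, lt_add_iff_pos_right, one_pos]
      split_ifs with hk
      · rfl
      · rw [hy k, if_neg hk, splitRow, if_neg (by omega), if_neg (by omega)]
    · have : v < l + 1 ↔ v < l := by omega
      simp [hv, this]
  · exact hc₅
  · simp [RamState.setIdx, hl₅, g₅.r1]

/-- All new columns. -/
def columnsProg (M : ℕ) : RamProg :=
  .seq (.idxAdd (M + 6) M M) (.loop (.idxLt (M + 6) 1) (columnProg M))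

theorem exists_runs_columns (hM : 2 ≤ M) {t u a : ℝ} {x : Data n p} (hij : i < j) (hjn : j < n)
    (h : Good M n p (extend x) i j q s) (hc : HasCoefs M n i j t u a s) :
    ∃ s', Runs ω (columnsProg M) s s' (p * (10 * n + 12) + 3) ∧
      Good M n p (extend (plantSeed i j t u a x fun m => ω (q + m))) i j (q + p * (n + 1)) s' := by
  set y : ℕ → ℕ → ℝ := fun k v => if k < n then
    plant i j t u a (extend x) (fun l => ω (q + l * (n + 1)))
      (fun k l => ω (q + (l * (n + 1) + 1 + k))) k v else extend x k v with hy
  have hstep : ∀ l < p, ∀ s, (Good M n p (fun k v => if v < l then y k v else extend x k v) i j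
      (q + l * (n + 1)) s ∧ HasCoefs M n i j t u a s ∧ s.idx (M + 6) = l) →
      (RamTest.idxLt (M + 6) 1).Holds s ∧ ∃ s', Runs ω (columnProg M) s s' (10 * n + 11) ∧
      (Good M n p (fun k v => if v < l + 1 then y k v else extend x k v) i j
        (q + (l + 1) * (n + 1)) s' ∧ HasCoefs M n i j t u a s' ∧ s'.idx (M + 6) = l + 1) := by
    intro l hl s ⟨hs, hcs, hl'⟩
    refine ⟨?_, ?_⟩
    · simp only [RamTest.Holds]
      rw [hl', hs.low 1 (by omega), if_neg one_ne_zero, if_pos rfl]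
      exact hl
    · have hyl : ∀ k, y k l = if k < n then rowCoef i j t u a k *
          splitRow i j (extend x) (fun _ => ω (q + l * (n + 1))) k l +
          rowNoise i j t u a k * ω (q + l * (n + 1) + 1 + k) else extend x k l := by
        intro k
        simp only [hy, plant, splitRow, add_assoc]
      obtain ⟨s', hr, hs', hcs', hl''⟩ := exists_runs_column (ω := ω) hM hij hjn hyl hs hcs hl'
      refine ⟨s', hr, ?_, hcs', hl''⟩
      rwa [show q + (l + 1) * (n + 1) = q + l * (n + 1) + (n + 1) by ring]
  have hend : ∀ s, (Good M n p (fun k v => if v < p then y k v else extend x k v) i j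
      (q + p * (n + 1)) s ∧ HasCoefs M n i j t u a s ∧ s.idx (M + 6) = p) →
      ¬ (RamTest.idxLt (M + 6) 1).Holds s := by
    intro s ⟨hs, _, hl'⟩
    simp only [RamTest.Holds]
    rw [hl', hs.low 1 (by omega), if_neg one_ne_zero, if_pos rfl]
    exact lt_irrefl p
  obtain ⟨s', hr, hs', -⟩ := Runs.loop_inv (ω := ω)
    (fun l s => Good M n p (fun k v => if v < l then y k v else extend x k v) i j
      (q + l * (n + 1)) s ∧ HasCoefs M n i j t u a s ∧ s.idx (M + 6) = l) p hstep hend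
    (s := s.setIdx (M + 6) (s.idx M + s.idx M))
    ⟨by simpa using h.setIdx (a := M + 6) (by omega) (s.idx M + s.idx M), hc,
      by simp [RamState.setIdx, h.r0]⟩
  refine ⟨s', (Runs.seq (Runs.idxAdd _ _ _) hr).mono (by ring_nf; omega),
    hs'.congr fun k v => ?_⟩
  by_cases hkv : k < n ∧ v < p
  · have e : extend (plantSeed i j t u a x fun m => ω (q + m)) k v =
        plantSeed i j t u a x (fun m => ω (q + m)) ⟨k, hkv.1⟩ ⟨v, hkv.2⟩ := by
      rw [extend, dif_pos hkv]
    rw [e, plantSeed, if_pos hkv.2]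
    simp only [hy]
    rw [if_pos hkv.1]
  · have e : extend (plantSeed i j t u a x fun m => ω (q + m)) k v = 0 := by
      rw [extend, dif_neg hkv]
    have e' : extend x k v = 0 := by rw [extend, dif_neg hkv]
    rw [e]
    split_ifs with hv
    · simp only [hy]
      rw [if_neg (fun hk => hkv ⟨hk, hv⟩), e']
    · exact e'

/-- Comparison of the two labels. -/
def outputProg (M : ℕ) : RamProg :=
  -- The zero is written anew, because `Agree` says nothing about arrays with names from M on.
  .seq (.realConst ⟨M + 1, M, M⟩ 0) <|
  .cond (.realLt ⟨M + 1, M, M⟩ ⟨1, M + 2, M⟩)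
    (.cond (.realLt ⟨M + 1, M, M⟩ ⟨1, M + 3, M⟩) (.realConst ⟨1, M, M⟩ 1) (.realConst ⟨1, M, M⟩ 0))
    (.cond (.realLt ⟨M + 1, M, M⟩ ⟨1, M + 3, M⟩) (.realConst ⟨1, M, M⟩ 0) (.realConst ⟨1, M, M⟩ 1))

theorem exists_runs_output (hM : 2 ≤ M) (h0 : s.idx M = 0) (h2 : s.idx (M + 2) = i)
    (h3 : s.idx (M + 3) = j) :
    ∃ s', Runs ω (outputProg M) s s' 5 ∧
      (0 < s'.mem 1 0 0 ↔ (0 < s.mem 1 i 0 ↔ 0 < s.mem 1 j 0)) := by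
  have hM1 : ¬ (1 = M + 1) := by omega
  have e : ∀ row, (s.write ⟨M + 1, M, M⟩ 0).read ⟨1, row, M⟩ = s.mem 1 (s.idx row) 0 := by
    intro row
    simp only [RamState.read, RamState.write]
    rw [if_neg (by omega), h0]
  have e0 : (s.write ⟨M + 1, M, M⟩ 0).read ⟨M + 1, M, M⟩ = 0 := by
    simp [RamState.read, RamState.write]
  have ew : ∀ r : ℝ, ((s.write ⟨M + 1, M, M⟩ 0).write ⟨1, M, M⟩ r).mem 1 0 0 = r := by
    intro r
    simp [RamState.write, h0]
  have hI : (RamTest.realLt ⟨M + 1, M, M⟩ ⟨1, M + 2, M⟩).Holds (s.write ⟨M + 1, M, M⟩ 0) ↔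
      0 < s.mem 1 i 0 := by
    simp only [RamTest.Holds, e, e0, h2]
  have hJ : (RamTest.realLt ⟨M + 1, M, M⟩ ⟨1, M + 3, M⟩).Holds (s.write ⟨M + 1, M, M⟩ 0) ↔
      0 < s.mem 1 j 0 := by
    simp only [RamTest.Holds, e, e0, h3]
  by_cases hi : 0 < s.mem 1 i 0 <;> by_cases hj : 0 < s.mem 1 j 0
  · exact ⟨_, Runs.seq (Runs.realConst _ _) (Runs.cond_true (hI.2 hi)
      (Runs.cond_true (hJ.2 hj) (Runs.realConst _ _))), by simp [ew, hi, hj]⟩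
  · exact ⟨_, Runs.seq (Runs.realConst _ _) (Runs.cond_true (hI.2 hi)
      (Runs.cond_false (mt hJ.1 hj) (Runs.realConst _ _))), by simp [ew, hi, hj]⟩
  · exact ⟨_, Runs.seq (Runs.realConst _ _) (Runs.cond_false (mt hI.1 hi)
      (Runs.cond_true (hJ.2 hj) (Runs.realConst _ _))), by simp [ew, hi, hj]⟩
  · exact ⟨_, Runs.seq (Runs.realConst _ _) (Runs.cond_false (mt hI.1 hi)
      (Runs.cond_false (mt hJ.1 hj) (Runs.realConst _ _))), by simp [ew, hi, hj]⟩

end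

/-- The test, for a clustering procedure computed by the program `c`. -/
def testProg (M κ : ℕ) (t u : ℝ) (c : RamProg) : RamProg :=
  .seq (pickProg M) <|
  .cond (.idxLt (M + 2) (M + 3))
    (.cond (.idxLt (M + 3) 0)
      (.seq (coefsProg M κ t u) <| .seq (columnsProg M) <| .seq c <| outputProg M)
      -- For an unusable pair a harmless instruction suffices: the array 1 is still zero, so the
      -- test accepts.
      (.idxConst (M + 4) 0))
    (.idxConst (M + 4) 0)

/-- Planting takes a number of steps of order n p. After it, the clustering program cannot
distinguish the memory from its own initial memory on the planted data, with the seed advanced by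
the numbers already drawn; so it halts in time and its labels can be compared. -/
theorem polyTimeTest_plantTest {n : ℕ → ℕ} {ell : (p : ℕ) → Clustering (n p) p}
    (h : PolyTimeClustering n ell) (κ : ℕ) (t u : ℝ) :
    PolyTimeTest n fun p => plantTest (ell p) κ t u := by
  classical
  obtain ⟨c, C, e, h⟩ := h
  -- From M on all names are foreign to c; the summand 2 keeps the input and output names 0 and 1
  -- below M.
  set M := c.bound + 2 with hM
  have hM2 : 2 ≤ M := by omega
  refine ⟨testProg M κ t u c, C + 2 * κ + 100, e + 2, fun p x ω => ?_⟩
  set B := (n p) + p + 1 with hB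
  obtain ⟨s₁, hr₁, g₁⟩ := exists_runs_pick (ω := ω) hM2 x
  set i := (pairIdx ω (Nat.clog 2 (n p))).1 with hi
  set j := (pairIdx ω (Nat.clog 2 (n p))).2 with hj
  set q := 2 * Nat.clog 2 (n p) with hq
  have hB1 : 1 ≤ B := by omega
  have hBe : 1 ≤ B ^ e := Nat.one_le_pow _ _ hB1
  have hpow : B ^ (e + 2) = B ^ e * (B * B) := by ring
  have hbound : ∀ T, T ≤ C * B ^ e + (2 * κ + 100) * (B * B) →
      T ≤ (C + 2 * κ + 100) * B ^ (e + 2) := by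
    intro T hT
    refine hT.trans ?_
    rw [hpow]
    have h1 : B ^ e ≤ B ^ e * (B * B) := Nat.le_mul_of_pos_right _ (by positivity)
    have h2 : B * B ≤ B ^ e * (B * B) := Nat.le_mul_of_pos_left _ (by positivity)
    calc C * B ^ e + (2 * κ + 100) * (B * B)
        ≤ C * (B ^ e * (B * B)) + (2 * κ + 100) * (B ^ e * (B * B)) := by gcongr
      _ = _ := by ring
  have hBB : 1 * B ≤ B * B := Nat.mul_le_mul_right _ hB1
  have hκ : 2 * κ * 1 ≤ 2 * κ * (B * B) := Nat.mul_le_mul_left _ (by nlinarith)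
  suffices hs : ∃ s' T, Runs ω (testProg M κ t u c) (ramInit x) s' T ∧
      T ≤ C * B ^ e + (2 * κ + 100) * (B * B) ∧
      ((x, ω) ∈ plantTest (ell p) κ t u ↔ 0 < s'.mem 1 0 0) by
    obtain ⟨s', T, hrun, hT, hiff⟩ := hs
    have := (hrun.mono (hbound T hT)).iterate_eq
    rw [ramRun, this]
    exact ⟨rfl, hiff⟩
  by_cases hij : i < j
  swap
  · refine ⟨_, _, Runs.seq hr₁ (Runs.cond_false ?_ (Runs.idxConst _ _)), ?_, ?_⟩
    · simpa only [RamTest.Holds, g₁.r2, g₁.r3] using hij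
    · nlinarith
    · have : s₁.mem 1 0 0 = 0 := g₁.mem 1 (by omega) one_ne_zero 0 0
      simp only [RamState.setIdx, this, lt_irrefl, iff_false]
      rintro ⟨hlt, -⟩
      exact hij hlt
  by_cases hjn : j < (n p)
  swap
  · refine ⟨_, _, Runs.seq hr₁ (Runs.cond_true ?_ (Runs.cond_false ?_ (Runs.idxConst _ _))),
      ?_, ?_⟩
    · simpa only [RamTest.Holds, g₁.r2, g₁.r3] using hij
    · simpa only [RamTest.Holds, g₁.r3, g₁.low 0 (by omega), if_true] using hjn
    · nlinarith
    · have : s₁.mem 1 0 0 = 0 := g₁.mem 1 (by omega) one_ne_zero 0 0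
      simp only [RamState.setIdx, this, lt_irrefl, iff_false]
      rintro ⟨hlt, hn, -⟩
      exact hjn hn
  obtain ⟨s₂, hr₂, g₂, hc₂⟩ := exists_runs_coefs (ω := ω) hM2 κ t u g₁
  obtain ⟨s₃, hr₃, g₃⟩ := exists_runs_columns (ω := ω) hM2 hij hjn g₂ hc₂
  set y := plantSeed i j t u (scaleFactor κ p) x fun m => ω (q + m) with hy
  -- The registers from M on, which hold i and j, enter as the frame and so survive the run of c.
  have hag : Agree M (q + p * ((n p) + 1)) s₃.idx (ramInit y) s₃ := by
    refine ⟨fun a ha => ?_, fun a ha u v => ?_, ?_, fun a _ => rfl⟩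
    · rw [g₃.low a ha]
      rfl
    · by_cases ha0 : a = 0
      · subst ha0
        rw [g₃.arr]
        simp [ramInit, extend]
      · rw [g₃.mem a ha ha0]
        simp [ramInit, ha0]
    · rw [g₃.pos]
      rfl
  obtain ⟨hhalt, hlab⟩ := h p y fun m => ω (q + p * ((n p) + 1) + m)
  obtain ⟨s₄, hr₄, hag₄⟩ := hag.exists_runs (RamProg.below_of_bound_le (by omega)) hhalt
  obtain ⟨s₅, hr₅, hout⟩ := exists_runs_output (ω := ω) hM2
    ((hag₄.frame M le_rfl).trans g₃.r0) ((hag₄.frame (M + 2) (by omega)).trans g₃.r2)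
    ((hag₄.frame (M + 3) (by omega)).trans g₃.r3)
  refine ⟨s₅, _, Runs.seq hr₁ (Runs.cond_true ?_ (Runs.cond_true ?_
    (Runs.seq hr₂ (Runs.seq hr₃ (Runs.seq hr₄ hr₅))))), ?_, ?_⟩
  · simpa only [RamTest.Holds, g₁.r2, g₁.r3] using hij
  · simpa only [RamTest.Holds, g₁.r3, g₁.low 0 (by omega), if_true] using hjn
  · have e1 : p * (10 * n p + 12) = 10 * (p * n p) + 12 * p := by ring
    have e2 : B * B = n p * n p + p * p + 2 * (p * n p) + 2 * n p + 2 * p + 1 := by rw [hB]; ring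
    rw [← hB, e1]
    have e3 : (2 * κ + 100) * (B * B) = 2 * κ * (B * B) + 100 * (B * B) := by ring
    rw [e3]
    nlinarith
  · have hmem : ∀ k, s₄.mem 1 k 0 =
        (ramRun c y (fun m => ω (q + p * ((n p) + 1) + m)) (C * (n p + p + 1) ^ e)).2.mem 1 k 0 :=
      fun k => hag₄.mem 1 (by omega) k 0
    rw [hout, hmem, hmem]
    have hi' := hlab ⟨i, hij.trans hjn⟩
    have hj' := hlab ⟨j, hjn⟩
    simp only at hi' hj'
    have hmemt : (x, ω) ∈ plantTest (ell p) κ t u ↔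
        ell p y (fun m => ω (q + p * ((n p) + 1) + m)) ⟨i, hij.trans hjn⟩ =
        ell p y (fun m => ω (q + p * ((n p) + 1) + m)) ⟨j, hjn⟩ := by
      constructor
      · rintro ⟨h1, h2, h3⟩
        exact h3
      · intro h3
        exact ⟨hij, hjn, h3⟩
    rw [hmemt, hi', hj']
    split_ifs with h1 h2 h2 <;> simp [h1, h2]

/-! # Splitting the seed -/

/-- The sequence that starts with `ξ` and goes on with `ω`. -/
def seedGlue {Q : ℕ} (ξ : Fin Q → ℝ) (ω : Seed) : Seed :=
  fun m => if h : m < Q then ξ ⟨m, h⟩ else ω (m - Q)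

theorem measurable_seedGlue (Q : ℕ) :
    Measurable fun w : (Fin Q → ℝ) × Seed => seedGlue w.1 w.2 := by
  refine measurable_pi_iff.2 fun m => ?_
  unfold seedGlue
  by_cases h : m < Q
  · simp only [h, dif_pos]; fun_prop
  · simp only [h, dif_neg, not_false_iff]; fun_prop

/-- An infinite product measure is determined by finite boxes, and the preimage of a box is a box
for the first Q numbers times a shifted box for the rest. -/
theorem map_seedGlue (Q : ℕ) :
    ((Measure.pi fun _ : Fin Q => gaussianReal 0 1).prod seedLaw).map
      (fun w => seedGlue w.1 w.2) = seedLaw := by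
  classical
  refine Measure.eq_infinitePi _ fun s t ht => ?_
  rw [Measure.map_apply (measurable_seedGlue Q) (MeasurableSet.pi s.countable_toSet fun m _ => ht m)]
  have hpre : (fun w : (Fin Q → ℝ) × Seed => seedGlue w.1 w.2) ⁻¹' (Set.pi s t) =
      (Set.univ.pi fun k : Fin Q => if (k : ℕ) ∈ s then t k else Set.univ) ×ˢ
      (Set.pi ((s.filter fun m => ¬ m < Q).image fun m => m - Q) fun m => t (m + Q)) := by
    ext w
    simp only [Set.mem_preimage, Set.mem_pi, Set.mem_prod, Finset.mem_coe, Set.mem_univ,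
      true_implies, Finset.mem_image, Finset.mem_filter, seedGlue]
    constructor
    · intro h
      refine ⟨fun k => ?_, ?_⟩
      · split_ifs with hk
        · simpa [k.2] using h k hk
        · trivial
      · rintro _ ⟨m, ⟨hm, hmQ⟩, rfl⟩
        have := h m hm
        rw [dif_neg hmQ] at this
        rwa [Nat.sub_add_cancel (not_lt.1 hmQ)]
    · rintro ⟨h1, h2⟩ m hm
      split_ifs with hmQ
      · have := h1 ⟨m, hmQ⟩
        rwa [if_pos hm] at this
      · have := h2 (m - Q) ⟨m, ⟨hm, hmQ⟩, rfl⟩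
        rwa [Nat.sub_add_cancel (not_lt.1 hmQ)] at this
  rw [hpre, Measure.prod_prod, Measure.pi_pi, seedLaw, Measure.infinitePi_pi _ fun m _ => ht _,
    ← Finset.prod_filter_mul_prod_filter_not s (fun m => m < Q)]
  congr 1
  · have e : ∀ k : Fin Q, gaussianReal 0 1 (if (k : ℕ) ∈ s then t k else Set.univ) =
        (fun m : ℕ => if m ∈ s then gaussianReal 0 1 (t m) else 1) k := by
      intro k
      simp only
      split_ifs
      · rfl
      · exact measure_univ
    simp only [e]
    rw [Fin.prod_univ_eq_prod_range (fun m : ℕ => if m ∈ s then gaussianReal 0 1 (t m) else 1) Q,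
      ← Finset.prod_filter]
    refine Finset.prod_congr ?_ fun _ _ => rfl
    ext m
    simp [and_comm]
  · rw [Finset.prod_image]
    · refine Finset.prod_congr rfl fun m hm => ?_
      rw [Nat.sub_add_cancel (not_lt.1 (Finset.mem_filter.1 hm).2)]
    · intro a ha b hb hab
      have h1 := not_lt.1 (Finset.mem_filter.1 (Finset.mem_coe.1 ha)).2
      have h2 := not_lt.1 (Finset.mem_filter.1 (Finset.mem_coe.1 hb)).2
      simp only at hab
      omega

/-- The head and the tail of the seed are independent, and the tail is distributed as the seed. -/
theorem measurePreserving_seed_split (Q : ℕ) :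
    MeasurePreserving (fun ω : Seed => ((fun k : Fin Q => ω k), fun m => ω (Q + m))) seedLaw
      ((Measure.pi fun _ : Fin Q => gaussianReal 0 1).prod seedLaw) := by
  have hm : Measurable fun ω : Seed => ((fun k : Fin Q => ω k), fun m => ω (Q + m)) := by fun_prop
  refine ⟨hm, ?_⟩
  conv_lhs => rw [← map_seedGlue Q]
  rw [Measure.map_map hm (measurable_seedGlue Q)]
  convert Measure.map_id
  funext w
  simp only [Function.comp, id]
  ext k
  · simp [seedGlue]
  · simp [seedGlue]

theorem gaussianReal_Ioi_zero : gaussianReal 0 1 (Set.Ioi 0) = 2⁻¹ := by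
  have h := nullSingletonClass_gaussianReal (μ := 0) (v := 1) one_ne_zero
  have h1 : gaussianReal 0 1 (Set.Iio 0) = gaussianReal 0 1 (Set.Ioi 0) := by
    have := gaussianReal_map_neg (μ := 0) (v := 1)
    rw [neg_zero] at this
    conv_lhs => rw [← this]
    rw [Measure.map_apply measurable_neg measurableSet_Iio]
    congr 1
    ext x
    simp
  have h2 : gaussianReal 0 1 (Set.Iic 0) = gaussianReal 0 1 (Set.Iio 0) :=
    measure_congr Iio_ae_eq_Iic.symm
  have h3 := prob_add_prob_compl (μ := gaussianReal 0 1) (measurableSet_Ioi (a := (0 : ℝ)))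
  rw [Set.compl_Ioi, h2, h1, ← two_mul] at h3
  rw [← ENNReal.eq_inv_of_mul_eq_one_left (by rw [mul_comm]; exact h3)]

theorem gaussianReal_toss (b : Prop) : gaussianReal 0 1 {x | 0 < x ↔ b} = 2⁻¹ := by
  by_cases hb : b
  · simp only [hb, iff_true]
    exact gaussianReal_Ioi_zero
  · simp only [hb, iff_false]
    have : {x : ℝ | ¬ 0 < x} = (Set.Ioi 0)ᶜ := rfl
    rw [this, prob_compl_eq_one_sub measurableSet_Ioi, gaussianReal_Ioi_zero,
      ENNReal.one_sub_inv_two]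

theorem measurable_seed_tail (Q : ℕ) : Measurable fun (ω : Seed) m => ω (Q + m) := by fun_prop

theorem seedLaw_head_mem {T : Set ℝ} (hT : MeasurableSet T) {B : Set Seed} (hB : MeasurableSet B) :
    seedLaw {ω | ω 0 ∈ T ∧ (fun m => ω (1 + m)) ∈ B} = gaussianReal 0 1 T * seedLaw B := by
  have h := (measurePreserving_seed_split 1).measure_preimage
    (s := (Set.univ.pi fun _ => T) ×ˢ B) ((MeasurableSet.univ_pi fun _ => hT).prod hB).nullMeasurableSet
  rw [Measure.prod_prod, Measure.pi_pi] at h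
  simp only [Finset.univ_unique, Finset.prod_const, Finset.card_singleton, pow_one] at h
  rw [← h]
  congr 1
  ext ω
  simp

theorem seedLaw_two_tosses (b b' : Prop) {B : Set Seed} (hB : MeasurableSet B) :
    seedLaw {ω | (0 < ω 0 ↔ b) ∧ (0 < ω 1 ↔ b') ∧ (fun m => ω (2 + m)) ∈ B} =
      4⁻¹ * seedLaw B := by
  have hT : ∀ b : Prop, MeasurableSet {x : ℝ | 0 < x ↔ b} := by
    intro b
    by_cases hb : b
    · simp only [hb, iff_true]; exact measurableSet_Ioi
    · simp only [hb, iff_false]; exact measurableSet_Ioi.compl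
  have hB' : MeasurableSet {ω : Seed | ω 0 ∈ {x : ℝ | 0 < x ↔ b'} ∧ (fun m => ω (1 + m)) ∈ B} :=
    ((measurable_pi_apply (X := fun _ : ℕ => ℝ) 0) (hT b')).inter (measurable_seed_tail 1 hB)
  have := seedLaw_head_mem (hT b) hB'
  rw [seedLaw_head_mem (hT b') hB, gaussianReal_toss, gaussianReal_toss, ← mul_assoc,
    ← ENNReal.mul_inv (by simp) (by simp)] at this
  norm_num at this
  rw [← this]
  congr 1
  ext ω
  simp only [Set.mem_ofPred_eq]
  have e : (fun m => ω (2 + m)) = fun m => ω (1 + (1 + m)) := by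
    funext m; congr 1; ring
  rw [e]

/-- The random pair is uniform, and independent of the tail of the seed. -/
theorem seedLaw_pairIdx (K : ℕ) {i j : ℕ} (hi : i < 2 ^ K) (hj : j < 2 ^ K) {B : Set Seed}
    (hB : MeasurableSet B) :
    seedLaw {ω | pairIdx ω K = (i, j) ∧ (fun m => ω (2 * K + m)) ∈ B} = 4⁻¹ ^ K * seedLaw B := by
  induction K generalizing i j B with
  | zero =>
    obtain rfl : i = 0 := by simpa using hi
    obtain rfl : j = 0 := by simpa using hj
    have : {ω : Seed | pairIdx ω 0 = (0, 0) ∧ (fun m => ω (2 * 0 + m)) ∈ B} = B := by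
      ext ω
      simp [pairIdx]
    rw [this, pow_zero, one_mul]
  | succ K ih =>
    have hpow : 2 ^ (K + 1) = 2 * 2 ^ K := by ring
    -- The last round of tosses decides the lowest bits of i and j, and the earlier rounds must
    -- produce i/2 and j/2. The last two tosses thus become part of the event for the tail.
    set B' : Set Seed := {ω | (0 < ω 0 ↔ i % 2 = 1) ∧ (0 < ω 1 ↔ j % 2 = 1) ∧
      (fun m => ω (2 + m)) ∈ B} with hB'
    have hT : ∀ (m : ℕ) (b : Prop), MeasurableSet {ω : Seed | 0 < ω m ↔ b} := by
      intro m b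
      have h : MeasurableSet {ω : Seed | 0 < ω m} := (measurable_pi_apply m) measurableSet_Ioi
      by_cases hb : b
      · simpa only [hb, iff_true] using h
      · simp only [hb, iff_false]
        exact h.compl
    have hmB' : MeasurableSet B' := (hT 0 _).inter ((hT 1 _).inter
      (measurable_seed_tail 2 hB))
    have := ih (i := i / 2) (j := j / 2) (B := B') (by omega) (by omega) hmB'
    rw [seedLaw_two_tosses _ _ hB, ← mul_assoc, ← pow_succ] at this
    rw [← this]
    congr 1
    ext ω
    simp only [Set.mem_ofPred_eq, pairIdx, hB', Prod.ext_iff]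
    have e : (fun m => ω (2 * (K + 1) + m)) = fun m => ω (2 * K + (2 + m)) := by
      funext m; congr 1; ring
    rw [e, add_zero]
    have bit : ∀ (c : ℕ) (b : Prop) [Decidable b] (a : ℕ),
        2 * a + (if b then 1 else 0) = c ↔ a = c / 2 ∧ (b ↔ c % 2 = 1) := by
      intro c b _ a
      split_ifs with h
      · simp only [h, true_iff]; omega
      · simp only [h, false_iff]; omega
    rw [bit, bit]
    tauto

/-! # The law of planted data -/

theorem sum_eq_add_add_sum_erase {ι : Type*} [Fintype ι] [DecidableEq ι] {i j : ι} (h : i ≠ j)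
    (f : ι → ℝ) :
    ∑ k, f k = f i + f j + ∑ k ∈ (Finset.univ.erase i).erase j, f k := by
  rw [← Finset.add_sum_erase _ f (Finset.mem_univ i), ← Finset.add_sum_erase _ f
    (Finset.mem_erase.2 ⟨h.symm, Finset.mem_univ j⟩), add_assoc]

theorem charFunDual_gaussianReal (L : StrongDual ℝ ℝ) :
    charFunDual (gaussianReal 0 1) L = Complex.exp (-((L 1) ^ 2 : ℝ) / 2) := by
  rw [charFunDual_eq_charFun_map_one, gaussianReal_map_continuousLinearMap, charFun_gaussianReal]
  simp [max_eq_left (sq_nonneg (L 1))]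
  ring_nf

theorem charFunDual_pi_gaussianReal {ι : Type*} [Fintype ι] [DecidableEq ι]
    (L : StrongDual ℝ (ι → ℝ)) :
    charFunDual (Measure.pi fun _ : ι => gaussianReal 0 1) L =
      Complex.exp (-((∑ k, (L (Pi.single k 1)) ^ 2 : ℝ) : ℂ) / 2) := by
  rw [charFunDual_pi]
  simp only [charFunDual_gaussianReal]
  rw [← Complex.exp_sum]
  congr 1
  push_cast
  rw [← Finset.sum_neg_distrib, Finset.sum_div]
  rfl

theorem charFunDual_nullLaw {n p : ℕ} (L : StrongDual ℝ (Data n p)) :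
    charFunDual (nullLaw n p) L =
      Complex.exp (-((∑ i, ∑ k, (L (Pi.single i (Pi.single k 1))) ^ 2 : ℝ) : ℂ) / 2) := by
  unfold nullLaw gaussianVec
  rw [charFunDual_pi]
  simp only [Pi.zero_apply, charFunDual_pi_gaussianReal]
  rw [← Complex.exp_sum]
  congr 1
  push_cast
  rw [← Finset.sum_neg_distrib, Finset.sum_div]
  rfl

section
variable {n p : ℕ} {i j : Fin n} {t u a : ℝ}

/-- The sum of squares in a column is invariant under planting. -/
theorem sum_sq_plant (hij : i ≠ j) (ht : 2 * (t * a * (t * a)) ≤ 1)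
    (hu : 2 * (u * a * (u * a)) ≤ 1) (ha : a * a ≤ 1) (c : Fin n → ℝ) :
    ∑ i' : Fin n, (∑ k : Fin n, if (if k = j then i else k) = i' then
        rowCoef i j t u a k * c k else 0) ^ 2 +
      (∑ k : Fin n, rowCoef i j t u a k * (if k = j then -1 else if k = i then 1 else 0) * c k) ^ 2
      + ∑ k : Fin n, (rowNoise i j t u a k * c k) ^ 2 = ∑ k, c k ^ 2 := by
  have hij' : ¬ ((i : ℕ) = j) := fun h => hij (Fin.ext h)
  have r1 : rowCoef i j t u a i = t * a := by rw [rowCoef, if_neg hij', if_pos rfl]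
  have r2 : rowCoef i j t u a j = u * a := by rw [rowCoef, if_pos rfl]
  have n1 : rowNoise i j t u a i ^ 2 = 1 - 2 * (t * a * (t * a)) := by
    rw [rowNoise, if_neg hij', if_pos rfl, Real.sq_sqrt (by linarith)]
  have n2 : rowNoise i j t u a j ^ 2 = 1 - 2 * (u * a * (u * a)) := by
    rw [rowNoise, if_pos rfl, Real.sq_sqrt (by linarith)]
  have hk : ∀ k ∈ (Finset.univ.erase i).erase j, k ≠ j ∧ k ≠ i := by
    intro k hk
    exact ⟨(Finset.mem_erase.1 hk).1, (Finset.mem_erase.1 (Finset.mem_erase.1 hk).2).1⟩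
  have r3 : ∀ k ∈ (Finset.univ.erase i).erase j, rowCoef i j t u a k = a := by
    intro k h
    rw [rowCoef, if_neg fun e => (hk k h).1 (Fin.ext e), if_neg fun e => (hk k h).2 (Fin.ext e)]
  have n3 : ∀ k ∈ (Finset.univ.erase i).erase j, rowNoise i j t u a k ^ 2 = 1 - 1 * (a * a) := by
    intro k h
    rw [rowNoise, if_neg fun e => (hk k h).1 (Fin.ext e), if_neg fun e => (hk k h).2 (Fin.ext e),
      Real.sq_sqrt (by linarith)]
  have s1 : (∑ k : Fin n, if (if k = j then i else k) = i then rowCoef i j t u a k * c k else 0) =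
      t * a * c i + u * a * c j := by
    rw [sum_eq_add_add_sum_erase hij, Finset.sum_eq_zero fun k h => ?_]
    · simp [hij, r1, r2]
    · simp [hk k h]
  have s2 : (∑ k : Fin n, if (if k = j then i else k) = j then rowCoef i j t u a k * c k else 0) =
      0 := by
    rw [sum_eq_add_add_sum_erase hij, Finset.sum_eq_zero fun k h => ?_]
    · simp [hij]
    · simp [hk k h]
  have s3 : ∀ i' ∈ (Finset.univ.erase i).erase j,
      (∑ k : Fin n, if (if k = j then i else k) = i' then rowCoef i j t u a k * c k else 0) =
      a * c i' := by
    intro i' h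
    rw [Finset.sum_eq_single i']
    · simp [hk i' h, r3 i' h]
    · intro b _ hb
      refine if_neg fun e => ?_
      split_ifs at e with h1
      · exact (hk i' h).2 e.symm
      · exact hb e
    · exact fun h => absurd (Finset.mem_univ _) h
  -- The squares of (ta c_i + ua c_j) and (ta c_i - ua c_j) add up to 2(ta c_i)² + 2(ua c_j)². The
  -- cancelling cross terms express the independence of the two noisy copies; the weights `n1` and
  -- `n2` supply the missing variance.
  have s4 : (∑ k : Fin n, rowCoef i j t u a k *
      (if k = j then -1 else if k = i then 1 else 0) * c k) = t * a * c i - u * a * c j := by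
    rw [sum_eq_add_add_sum_erase hij, Finset.sum_eq_zero fun k h => ?_]
    · simp [hij, r1, r2]; ring
    · simp [hk k h]
  rw [sum_eq_add_add_sum_erase hij, s1, s2, s4, sum_eq_add_add_sum_erase hij
    (fun k => (rowNoise i j t u a k * c k) ^ 2), sum_eq_add_add_sum_erase hij (fun k => c k ^ 2),
    Finset.sum_congr rfl fun k h => by rw [s3 k h]]
  have hrest : ∑ k ∈ (Finset.univ.erase i).erase j, (a * c k) ^ 2 +
      ∑ k ∈ (Finset.univ.erase i).erase j, (rowNoise i j t u a k * c k) ^ 2 =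
      ∑ k ∈ (Finset.univ.erase i).erase j, c k ^ 2 := by
    rw [← Finset.sum_add_distrib]
    refine Finset.sum_congr rfl fun k h => ?_
    rw [mul_pow (rowNoise _ _ _ _ _ _), n3 k h]
    ring
  rw [mul_pow (rowNoise _ _ _ _ _ _), mul_pow (rowNoise _ _ _ _ _ _), n1, n2, ← hrest]
  ring

theorem plantSeed_apply (hij : i ≠ j) (x : Data n p) (ω : Seed) (k : Fin n) (l : Fin p) :
    plantSeed i j t u a x ω k l = rowCoef i j t u a k * (x (if k = j then i else k) l +
      (if k = j then -1 else if k = i then 1 else 0) * ω (l * (n + 1))) +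
      rowNoise i j t u a k * ω (l * (n + 1) + 1 + k) := by
  have hext : ∀ k : Fin n, extend x k l = x k l := fun k => by
    rw [extend, dif_pos ⟨k.2, l.2⟩]
  rw [plantSeed, plant, splitRow]
  congr 2
  by_cases h1 : k = j
  · subst h1
    simp [hext]; ring
  · have h1' : ¬ ((k : ℕ) = j) := fun e => h1 (Fin.ext e)
    by_cases h2 : k = i
    · subst h2
      simp [hext, h1, h1']
    · have h2' : ¬ ((k : ℕ) = i) := fun e => h2 (Fin.ext e)
      simp [hext, h1, h1', h2, h2']

theorem noise_index_lt {k l : ℕ} (hl : l < p) (hk : k < n + 1) :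
    l * (n + 1) + k < p * (n + 1) := by
  calc l * (n + 1) + k < l * (n + 1) + (n + 1) := by omega
    _ = (l + 1) * (n + 1) := by ring
    _ ≤ p * (n + 1) := Nat.mul_le_mul_right _ hl

/-- Planting uses only the head of the seed. -/
theorem plantSeed_congr (hij : i ≠ j) (x : Data n p) {ω ω' : Seed}
    (h : ∀ m < p * (n + 1), ω m = ω' m) : plantSeed i j t u a x ω = plantSeed i j t u a x ω' := by
  funext k l
  rw [plantSeed_apply hij, plantSeed_apply hij,
    h (l * (n + 1)) (noise_index_lt (n := n) (k := 0) l.2 (by omega)),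
    h _ (by rw [add_assoc]; exact noise_index_lt l.2 (by omega))]

/-- Planting, as a linear map. -/
def plantLin (hij : i ≠ j) (t u a : ℝ) (p : ℕ) :
    (Data n p × (Fin (p * (n + 1)) → ℝ)) →L[ℝ] Data n p :=
  LinearMap.toContinuousLinearMap
    { toFun := fun w => plantSeed i j t u a w.1 (seedGlue w.2 0)
      map_add' := fun w w' => by
        have hg : ∀ m, seedGlue (w + w').2 0 m = seedGlue w.2 0 m + seedGlue w'.2 0 m := by
          intro m
          simp only [seedGlue]
          split_ifs <;> simp
        funext k l
        rw [Pi.add_apply, Pi.add_apply, plantSeed_apply hij, plantSeed_apply hij,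
          plantSeed_apply hij, hg, hg, Prod.fst_add, Pi.add_apply, Pi.add_apply]
        ring
      map_smul' := fun c w => by
        have hg : ∀ m, seedGlue (c • w).2 0 m = c * seedGlue w.2 0 m := by
          intro m
          simp only [seedGlue]
          split_ifs <;> simp
        funext k l
        rw [RingHom.id_apply, Pi.smul_apply, Pi.smul_apply, plantSeed_apply hij,
          plantSeed_apply hij, hg, hg, Prod.smul_fst, Pi.smul_apply, Pi.smul_apply]
        simp only [smul_eq_mul]
        ring }

theorem plantLin_apply (hij : i ≠ j) (w : Data n p × (Fin (p * (n + 1)) → ℝ)) :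
    plantLin hij t u a p w = plantSeed i j t u a w.1 (seedGlue w.2 0) := rfl

theorem strongDual_apply (M : StrongDual ℝ (Data n p)) (y : Data n p) :
    M y = ∑ k, ∑ l, y k l * M (Pi.single k (Pi.single l 1)) := by
  have h : y = ∑ k, ∑ l, y k l • (Pi.single k (Pi.single l 1) : Data n p) := by
    funext k l
    simp only [Finset.sum_apply, Pi.smul_apply, smul_eq_mul]
    rw [Finset.sum_eq_single k, Finset.sum_eq_single l]
    · simp
    · intro b _ hb
      simp [hb.symm]
    · simp
    · intro b _ hb
      simp [hb.symm]
    · simp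
  conv_lhs => rw [h]
  simp only [map_sum, map_smul, smul_eq_mul]

/-- Planting is linear in data and noise, so it produces a centred Gaussian law, and the
characteristic function only involves a quadratic form. Columns do not interact, and within a column
the identity is `sum_sq_plant`. -/
theorem map_plantLin (hij : i ≠ j) (ht : 2 * (t * a * (t * a)) ≤ 1)
    (hu : 2 * (u * a * (u * a)) ≤ 1) (ha : a * a ≤ 1) :
    ((nullLaw n p).prod (Measure.pi fun _ : Fin (p * (n + 1)) => gaussianReal 0 1)).map
      (plantLin hij t u a p) = nullLaw n p := by
  have : IsProbabilityMeasure (((nullLaw n p).prod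
      (Measure.pi fun _ : Fin (p * (n + 1)) => gaussianReal 0 1)).map (plantLin hij t u a p)) :=
    Measure.isProbabilityMeasure_map (plantLin hij t u a p).continuous.aemeasurable
  refine Measure.ext_of_charFunDual (funext fun M => ?_)
  rw [charFunDual_map, charFunDual_prod, charFunDual_nullLaw, charFunDual_pi_gaussianReal,
    charFunDual_nullLaw, ← Complex.exp_add]
  congr 1
  rw [← add_div, ← neg_add, ← Complex.ofReal_add]
  congr 3
  simp only [ContinuousLinearMap.comp_apply, ContinuousLinearMap.inl_apply,
    ContinuousLinearMap.inr_apply, plantLin_apply]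
  set c : Fin n → Fin p → ℝ := fun k l => M (Pi.single k (Pi.single l 1)) with hc
  have hz : ∀ m, seedGlue (0 : Fin (p * (n + 1)) → ℝ) 0 m = 0 := by
    intro m
    simp only [seedGlue]
    split_ifs <;> rfl
  have e1 : ∀ (i' : Fin n) (l' : Fin p),
      M (plantSeed i j t u a (Pi.single i' (Pi.single l' 1)) (seedGlue (0 : Fin (p * (n + 1)) → ℝ) 0)) =
      ∑ k : Fin n, if (if k = j then i else k) = i' then rowCoef i j t u a k * c k l' else 0 := by
    intro i' l'
    rw [strongDual_apply]
    refine Finset.sum_congr rfl fun k _ => ?_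
    simp only [plantSeed_apply hij, hz, mul_zero, add_zero]
    rw [Finset.sum_eq_single l']
    · by_cases h : (if k = j then i else k) = i'
      · rw [if_pos h, h]; simp [hc]
      · rw [if_neg h]; simp [h]
    · intro l _ hl
      by_cases h : (if k = j then i else k) = i'
      · rw [h]; simp [hl]
      · simp [h]
    · simp
  have hs : ∀ (m : Fin (p * (n + 1))) (q : ℕ), seedGlue (Pi.single m 1) 0 q =
      if q = m then 1 else 0 := by
    intro m q
    rw [seedGlue]
    by_cases h1 : q < p * (n + 1)
    · rw [dif_pos h1, Pi.single_apply]
      simp only [Fin.ext_iff]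
    · have h2 : ¬ (q = m) := fun e => h1 (e ▸ m.2)
      rw [dif_neg h1, if_neg h2]
      rfl
  -- Positions in the head of the seed as pairs: (l, 0) is the splitting noise of column l, and (l,
  -- k + 1) is the fresh noise of its entry in row k.
  have idx : ∀ (l : Fin p) (r : ℕ) (hr : r < n + 1) (l' : Fin p) (r' : Fin (n + 1)),
      (l : ℕ) * (n + 1) + r = (finProdFinEquiv (l', r') : ℕ) ↔ l = l' ∧ r = r' := by
    intro l r hr l' r'
    have h1 : (finProdFinEquiv (l, (⟨r, hr⟩ : Fin (n + 1))) : ℕ) = l * (n + 1) + r := by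
      simp [finProdFinEquiv]; ring
    rw [← h1, ← Fin.ext_iff, finProdFinEquiv.injective.eq_iff, Prod.ext_iff, Fin.ext_iff (a := _)]
    simp [Fin.ext_iff]
  have e2 : ∀ l' : Fin p,
      M (plantSeed i j t u a 0 (seedGlue (Pi.single (finProdFinEquiv (l', (0 : Fin (n + 1)))) 1) 0)) =
      ∑ k : Fin n, rowCoef i j t u a k * (if k = j then -1 else if k = i then 1 else 0) *
        c k l' := by
    intro l'
    rw [strongDual_apply]
    refine Finset.sum_congr rfl fun k _ => ?_
    simp only [plantSeed_apply hij, hs, Pi.zero_apply, zero_add]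
    have i1 : ∀ l : Fin p, ((l : ℕ) * (n + 1) = (finProdFinEquiv (l', (0 : Fin (n + 1))) : ℕ)) ↔
        l = l' := fun l => by simpa using idx l 0 (by omega) l' 0
    have i2 : ∀ l : Fin p, ¬ ((l : ℕ) * (n + 1) + 1 + k =
        (finProdFinEquiv (l', (0 : Fin (n + 1))) : ℕ)) := fun l => by
      rw [add_assoc, idx l (1 + k) (by omega) l' 0]
      simp
    simp only [i1, i2, if_false, mul_zero, add_zero]
    rw [Finset.sum_eq_single l']
    · simp [hc]
    · intro l _ hl
      simp [hl]
    · simp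
  have e3 : ∀ (l' : Fin p) (m : Fin n),
      M (plantSeed i j t u a 0 (seedGlue (Pi.single (finProdFinEquiv (l', m.succ)) 1) 0)) =
      rowNoise i j t u a m * c m l' := by
    intro l' m
    rw [strongDual_apply]
    have i1 : ∀ l : Fin p, ¬ ((l : ℕ) * (n + 1) = (finProdFinEquiv (l', m.succ) : ℕ)) :=
      fun l => by
        have := idx l 0 (by omega) l' m.succ
        rw [add_zero] at this
        rw [this]
        simp
    have i2 : ∀ (l : Fin p) (k : Fin n), ((l : ℕ) * (n + 1) + 1 + k =
        (finProdFinEquiv (l', m.succ) : ℕ)) ↔ l = l' ∧ k = m := fun l k => by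
      rw [add_assoc, idx l (1 + k) (by omega) l' m.succ, Fin.val_succ, add_comm 1, Fin.ext_iff,
        Fin.ext_iff, add_left_inj]
    simp only [plantSeed_apply hij, hs, Pi.zero_apply, zero_add, i1, i2, if_false, mul_zero]
    rw [Finset.sum_eq_single m, Finset.sum_eq_single l']
    · simp [hc]
    · intro l _ hl
      simp [hl]
    · simp
    · intro k _ hk
      simp [hk]
    · simp
  simp only [e1]
  rw [← finProdFinEquiv.sum_comp, Fintype.sum_prod_type]
  simp only [Fin.sum_univ_succ (n := n), e2, e3]
  rw [Finset.sum_comm, ← Finset.sum_add_distrib, Finset.sum_comm (s := Finset.univ (α := Fin n))]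
  refine Finset.sum_congr rfl fun l _ => ?_
  rw [← add_assoc]
  exact sum_sq_plant hij ht hu ha fun k => c k l

theorem measurable_plantSeed (i j : ℕ) (t u a : ℝ) :
    Measurable fun w : Data n p × Seed => plantSeed i j t u a w.1 w.2 := by
  have hext : ∀ k l : ℕ, Measurable fun w : Data n p × Seed => extend w.1 k l := by
    intro k l
    unfold extend
    by_cases h : k < n ∧ l < p
    · simp only [h, dif_pos, and_self]; fun_prop
    · simp only [h, dif_neg, not_false_iff]; fun_prop
  have hω : ∀ m : ℕ, Measurable fun w : Data n p × Seed => w.2 m := fun m => by fun_prop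
  refine measurable_pi_iff.2 fun k => measurable_pi_iff.2 fun l => ?_
  unfold plantSeed plant splitRow
  refine Measurable.add (Measurable.const_mul ?_ _) (Measurable.const_mul (hω _) _)
  split_ifs
  · exact (hext _ _).sub (hω _)
  · exact (hext _ _).add (hω _)
  · exact hext _ _

/-- The law of planted data, jointly with the rest of the seed. -/
theorem map_plantSeed (hij : i ≠ j) (ht : 2 * (t * a * (t * a)) ≤ 1)
    (hu : 2 * (u * a * (u * a)) ≤ 1) (ha : a * a ≤ 1) (v : Data n p) :
    (obsLaw v).map (fun w => (plantSeed i j t u a w.1 w.2, fun m => w.2 (p * (n + 1) + m))) =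
      obsLaw (plantSeed i j t u a v 0) := by
  set Q := p * (n + 1) with hQ
  set γ : Measure (Fin Q → ℝ) := Measure.pi fun _ => gaussianReal 0 1 with hγ
  have hL : Measurable (plantLin hij t u a p) := (plantLin hij t u a p).continuous.measurable
  -- the seed is split
  have h1 : MeasurePreserving (fun w : Data n p × Seed =>
      (w.1, ((fun k : Fin Q => w.2 k), fun m => w.2 (Q + m)))) ((nullLaw n p).prod seedLaw)
      ((nullLaw n p).prod (γ.prod seedLaw)) :=
    (MeasurePreserving.id _).prod (measurePreserving_seed_split Q)
  have h2 : MeasurePreserving (fun w : Data n p × ((Fin Q → ℝ) × Seed) => ((w.1, w.2.1), w.2.2))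
      ((nullLaw n p).prod (γ.prod seedLaw)) (((nullLaw n p).prod γ).prod seedLaw) :=
    (measurePreserving_prodAssoc (nullLaw n p) γ seedLaw).symm MeasurableEquiv.prodAssoc
  have h3 : MeasurePreserving (fun w : (Data n p × (Fin Q → ℝ)) × Seed =>
      (plantLin hij t u a p w.1, w.2)) (((nullLaw n p).prod γ).prod seedLaw)
      ((nullLaw n p).prod seedLaw) :=
    MeasurePreserving.prod ⟨hL, map_plantLin hij ht hu ha⟩ (MeasurePreserving.id _)
  have h4 := (h3.comp h2).comp h1
  have hshift : ∀ v : Data n p, ((nullLaw n p).prod seedLaw).map (fun w => (v + w.1, w.2)) =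
      obsLaw v := by
    intro v
    have := Measure.map_prod_map (nullLaw n p) seedLaw (f := fun Z => v + Z) (g := id)
      (by fun_prop) measurable_id
    rw [Measure.map_id, ← shiftLaw_zero, map_add_shiftLaw, add_zero] at this
    exact this.symm
  have hm : Measurable fun w : Data n p × Seed =>
      (plantSeed i j t u a w.1 w.2, fun m => w.2 (Q + m)) :=
    (measurable_plantSeed _ _ _ _ _).prodMk ((measurable_seed_tail Q).comp measurable_snd)
  -- The data are v plus noise and planting is linear, so the means are planted without noise while
  -- the noise part keeps its law.
  rw [← hshift v, Measure.map_map hm (by fun_prop), ← hshift (plantSeed i j t u a v 0)]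
  conv_rhs => rw [← h4.map_eq]
  rw [Measure.map_map (by fun_prop) h4.measurable]
  congr 1
  funext w
  simp only [Function.comp, Prod.mk.injEq, and_true]
  rw [plantLin_apply]
  have hc : plantSeed i j t u a w.1 (seedGlue (fun k : Fin Q => w.2 k) 0) =
      plantSeed i j t u a w.1 w.2 := by
    refine plantSeed_congr hij _ fun m hm => ?_
    rw [seedGlue, dif_pos hm]
  rw [hc]
  funext k l
  rw [Pi.add_apply, Pi.add_apply, plantSeed_apply hij, plantSeed_apply hij, plantSeed_apply hij]
  simp only [Pi.add_apply, Pi.zero_apply]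
  ring

end

/-! # The rejection probability of the test -/

/-- The pairs `i < j`. -/
def orderedPairs (n : ℕ) : Finset (Fin n × Fin n) := Finset.univ.filter fun q => q.1 < q.2

/-- The probability that the procedure assigns the same label to two observations. -/
def agreeProb {n p : ℕ} (ell : Clustering n p) (q : Fin n × Fin n) (v : Data n p) : ℝ :=
  (obsLaw v).real {z | ell z.1 z.2 q.1 = ell z.1 z.2 q.2}

section
variable {n p : ℕ} {ell : Clustering n p}

theorem measurable_pairIdx (K : ℕ) : Measurable fun ω : Seed => pairIdx ω K := by
  induction K with
  | zero => exact measurable_const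
  | succ K ih =>
    have hT : ∀ m : ℕ, Measurable fun ω : Seed => if 0 < ω m then 1 else 0 := fun m =>
      Measurable.ite ((measurable_pi_apply (X := fun _ : ℕ => ℝ) m) measurableSet_Ioi)
        measurable_const measurable_const
    exact ((ih.fst.const_mul 2).add (hT _)).prodMk ((ih.snd.const_mul 2).add (hT _))

theorem measurableSet_agree
    (hell : Measurable fun w : Data n p × Seed => ell w.1 w.2) (q : Fin n × Fin n) :
    MeasurableSet {z : Data n p × Seed | ell z.1 z.2 q.1 = ell z.1 z.2 q.2} :=
  measurableSet_eq_fun ((measurable_pi_apply q.1).comp hell) ((measurable_pi_apply q.2).comp hell)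

theorem obsLaw_pairIdx (v : Data n p) (K : ℕ) {i j : ℕ} (hi : i < 2 ^ K) (hj : j < 2 ^ K)
    {G : Set (Data n p × Seed)} (hG : MeasurableSet G) :
    obsLaw v {w | pairIdx w.2 K = (i, j) ∧ (w.1, fun m => w.2 (2 * K + m)) ∈ G} =
      4⁻¹ ^ K * obsLaw v G := by
  have hm : MeasurableSet {w : Data n p × Seed |
      pairIdx w.2 K = (i, j) ∧ (w.1, fun m => w.2 (2 * K + m)) ∈ G} :=
    (((measurable_pairIdx K).comp measurable_snd) (measurableSet_singleton (i, j))).inter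
      ((measurable_fst.prodMk ((measurable_seed_tail (2 * K)).comp measurable_snd)) hG)
  rw [obsLaw, Measure.prod_apply hm, Measure.prod_apply hG,
    ← lintegral_const_mul _ (measurable_measure_prodMk_left hG)]
  refine lintegral_congr fun x => ?_
  exact seedLaw_pairIdx K hi hj (B := Prod.mk x ⁻¹' G) (measurable_prodMk_left hG)

/-- The event that the pair `q` is drawn and that its two members get the same label. -/
def drawnAgree (ell : Clustering n p) (κ : ℕ) (t u : ℝ) (q : Fin n × Fin n) :
    Set (Data n p × Seed) :=
  {w | pairIdx w.2 (Nat.clog 2 n) = ((q.1 : ℕ), (q.2 : ℕ)) ∧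
    (w.1, fun m => w.2 (2 * Nat.clog 2 n + m)) ∈ {z : Data n p × Seed |
      ell (plantSeed q.1 q.2 t u (scaleFactor κ p) z.1 z.2) (fun m => z.2 (p * (n + 1) + m)) q.1 =
      ell (plantSeed q.1 q.2 t u (scaleFactor κ p) z.1 z.2) (fun m => z.2 (p * (n + 1) + m)) q.2}}

theorem measurable_plantSeed_prod (κ : ℕ) (t u : ℝ) (q : Fin n × Fin n) :
    Measurable fun z : Data n p × Seed =>
      (plantSeed q.1 q.2 t u (scaleFactor κ p) z.1 z.2, fun m => z.2 (p * (n + 1) + m)) :=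
  (measurable_plantSeed _ _ _ _ _).prodMk ((measurable_seed_tail _).comp measurable_snd)

theorem measurableSet_drawnAgree (hell : Measurable fun w : Data n p × Seed => ell w.1 w.2)
    (κ : ℕ) (t u : ℝ) (q : Fin n × Fin n) : MeasurableSet (drawnAgree ell κ t u q) :=
  (((measurable_pairIdx _).comp measurable_snd) (measurableSet_singleton _)).inter
    ((measurable_fst.prodMk ((measurable_seed_tail _).comp measurable_snd))
      (measurable_plantSeed_prod κ t u q (measurableSet_agree hell q)))

theorem plantTest_eq_iUnion (ell : Clustering n p) (κ : ℕ) (t u : ℝ) :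
    plantTest ell κ t u = ⋃ q ∈ orderedPairs n, drawnAgree ell κ t u q := by
  ext w
  simp only [Set.mem_iUnion, exists_prop, orderedPairs, Finset.mem_filter, Finset.mem_univ,
    true_and]
  constructor
  · rintro ⟨h1, h2, h3⟩
    exact ⟨(⟨_, h1.trans h2⟩, ⟨_, h2⟩), h1, rfl, by simpa only [Set.mem_ofPred_eq, add_assoc] using h3⟩
  · rintro ⟨q, hq, hp, hg⟩
    have e1 : (pairIdx w.2 (Nat.clog 2 n)).1 = q.1 := by rw [hp]
    have e2 : (pairIdx w.2 (Nat.clog 2 n)).2 = q.2 := by rw [hp]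
    have h1 : (pairIdx w.2 (Nat.clog 2 n)).1 < (pairIdx w.2 (Nat.clog 2 n)).2 := by rw [e1, e2]; exact hq
    have h2 : (pairIdx w.2 (Nat.clog 2 n)).2 < n := by rw [e2]; exact q.2.2
    refine ⟨h1, h2, ?_⟩
    have f1 : (⟨_, h1.trans h2⟩ : Fin n) = q.1 := Fin.ext e1
    have f2 : (⟨_, h2⟩ : Fin n) = q.2 := Fin.ext e2
    rw [f1, f2]
    simp only [e1, e2, add_assoc]
    simpa only [Set.mem_ofPred_eq, add_assoc] using hg

theorem measurableSet_plantTest (hell : Measurable fun w : Data n p × Seed => ell w.1 w.2)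
    (κ : ℕ) (t u : ℝ) : MeasurableSet (plantTest ell κ t u) := by
  rw [plantTest_eq_iUnion]
  exact Finset.measurableSet_biUnion _ fun q _ => measurableSet_drawnAgree hell κ t u q

/-- Every pair of rows is drawn with probability 4^(-K), K = `Nat.clog 2 n`, independently of the
data and of the later seed. Given the pair, `map_plantSeed` says that the procedure faces data with
planted means and a fresh seed. -/
theorem real_obsLaw_plantTest (hell : Measurable fun w : Data n p × Seed => ell w.1 w.2)
    {κ : ℕ} {t u : ℝ} (ht : 2 * (t * scaleFactor κ p * (t * scaleFactor κ p)) ≤ 1)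
    (hu : 2 * (u * scaleFactor κ p * (u * scaleFactor κ p)) ≤ 1)
    (ha : scaleFactor κ p * scaleFactor κ p ≤ 1) (v : Data n p) :
    (obsLaw v).real (plantTest ell κ t u) = (4⁻¹ : ℝ) ^ Nat.clog 2 n *
      ∑ q ∈ orderedPairs n, agreeProb ell q (plantSeed q.1 q.2 t u (scaleFactor κ p) v 0) := by
  set K := Nat.clog 2 n with hK
  set a := scaleFactor κ p with hadef
  set G : Fin n × Fin n → Set (Data n p × Seed) := fun q => {z |
    ell (plantSeed q.1 q.2 t u a z.1 z.2) (fun m => z.2 (p * (n + 1) + m)) q.1 =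
    ell (plantSeed q.1 q.2 t u a z.1 z.2) (fun m => z.2 (p * (n + 1) + m)) q.2} with hG
  have hGm : ∀ q, MeasurableSet (G q) := fun q =>
    measurable_plantSeed_prod κ t u q (measurableSet_agree hell q)
  have hlt : ∀ k : Fin n, (k : ℕ) < 2 ^ K := fun k =>
    k.2.trans_le (Nat.le_pow_clog one_lt_two n)
  have hdisj : Set.PairwiseDisjoint (↑(orderedPairs n)) (drawnAgree ell κ t u) := by
    intro q _ q' _ hqq'
    refine Set.disjoint_left.2 fun w hw hw' => hqq' ?_
    have := hw.1.symm.trans hw'.1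
    rw [Prod.mk.injEq] at this
    exact Prod.ext (Fin.ext this.1) (Fin.ext this.2)
  rw [plantTest_eq_iUnion, measureReal_biUnion_finset hdisj fun q _ =>
    measurableSet_drawnAgree hell κ t u q, Finset.mul_sum]
  refine Finset.sum_congr rfl fun q hq => ?_
  have hne : q.1 ≠ q.2 := (Finset.mem_filter.1 hq).2.ne
  have hGv : obsLaw v (G q) = obsLaw (plantSeed q.1 q.2 t u a v 0)
      {z | ell z.1 z.2 q.1 = ell z.1 z.2 q.2} := by
    rw [← map_plantSeed hne ht hu ha v, Measure.map_apply (measurable_plantSeed_prod κ t u q)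
      (measurableSet_agree hell q)]
    rfl
  rw [measureReal_def, drawnAgree, obsLaw_pairIdx v K (hlt _) (hlt _) (hGm q), hGv, ENNReal.toReal_mul,
    ENNReal.toReal_pow, ENNReal.toReal_inv]
  rfl

theorem agreeProb_mem_Icc (ell : Clustering n p) (q : Fin n × Fin n) (v : Data n p) :
    agreeProb ell q v ∈ Set.Icc (0 : ℝ) 1 :=
  ⟨measureReal_nonneg, measureReal_le_one⟩

/-- The machine gets powers of p from repeated square roots only. The exponents 2^(-κ) become
arbitrarily small, so the loss of signal strength can be fitted into any slack in r. -/
theorem scaleFactor_eq_rpow (κ p : ℕ) :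
    scaleFactor κ p = (p : ℝ) ^ (-((1 / 2 : ℝ) ^ κ)) := by
  have h : ∀ κ : ℕ, ∀ x : ℝ, 0 ≤ x → Real.sqrt^[κ] x = x ^ ((1 / 2 : ℝ) ^ κ) := by
    intro κ
    induction κ with
    | zero => intro x _; simp
    | succ κ ih =>
      intro x hx
      rw [Function.iterate_succ_apply, ih _ (Real.sqrt_nonneg x), Real.sqrt_eq_rpow,
        ← Real.rpow_mul hx, pow_succ']
  rw [scaleFactor, h κ _ (Nat.cast_nonneg p), Real.rpow_neg (Nat.cast_nonneg p), one_div]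

/-- Planting a rank-one signal. -/
theorem plantSeed_outer {i j : Fin n} (hij : i ≠ j) (t u a : ℝ) (c : Fin n → ℝ) (μ : Fin p → ℝ) :
    plantSeed i j t u a (outer c μ) 0 =
      outer (Function.update (Function.update c i (t * c i)) j (u * c i)) (a • μ) := by
  funext k l
  rw [plantSeed_apply hij]
  simp only [outer, Pi.zero_apply, mul_zero, add_zero, Pi.smul_apply, smul_eq_mul]
  by_cases h1 : k = j
  · subst h1
    rw [if_pos rfl, Function.update_self, rowCoef, if_pos rfl]
    ring
  · have h1' : ¬ ((k : ℕ) = j) := fun e => h1 (Fin.ext e)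
    rw [if_neg h1, Function.update_of_ne h1]
    by_cases h2 : k = i
    · subst h2
      rw [Function.update_self, rowCoef, if_neg h1', if_pos rfl]
      ring
    · have h2' : ¬ ((k : ℕ) = i) := fun e => h2 (Fin.ext e)
      rw [Function.update_of_ne h2, rowCoef, if_neg h1', if_neg h2']
      ring

end

/-! # Resampling of labels -/

section
variable {n p : ℕ} {ϖ : ℝ} {ell : Clustering n p} {ρ : ℕ → ℝ} {α β r : ℝ}

theorem labelsWeight_update_mul (ϖ : ℝ) (l : Fin n → ℤˣ) (i : Fin n) (a : ℤˣ) :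
    labelWeight ϖ (l i) * labelsWeight ϖ (Function.update l i a) =
      labelWeight ϖ a * labelsWeight ϖ l := by
  rw [labelsWeight, labelsWeight, ← Finset.mul_prod_erase _ _ (Finset.mem_univ i),
    ← Finset.mul_prod_erase _ (fun k => labelWeight ϖ (l k)) (Finset.mem_univ i),
    Function.update_self, Finset.prod_congr rfl fun k hk => by
      rw [Function.update_of_ne (Finset.ne_of_mem_erase hk)]]
  ring

/-- Resampling one label does not change the law of the labels. -/
theorem sum_labelsWeight_resample (hϖ : 0 < ϖ) (i : Fin n) (h : (Fin n → ℤˣ) → ℝ) :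
    ∑ l, labelsWeight ϖ l * h l =
      ∑ a, labelWeight ϖ a * ∑ l, labelsWeight ϖ l * h (Function.update l i a) := by
  -- Swapping a fresh label with the label of row i preserves the product weight.
  have hinv : Function.Involutive fun z : ℤˣ × (Fin n → ℤˣ) =>
      (z.2 i, Function.update z.2 i z.1) := by
    intro z
    simp
  have h1 : ∑ z : ℤˣ × (Fin n → ℤˣ), labelWeight ϖ z.1 * (labelsWeight ϖ z.2 *
      h (Function.update z.2 i z.1)) =
      ∑ z : ℤˣ × (Fin n → ℤˣ), labelWeight ϖ z.1 * (labelsWeight ϖ z.2 * h z.2) := by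
    refine Fintype.sum_equiv hinv.toPerm _ _ fun z => ?_
    simp only [Function.Involutive.coe_toPerm]
    rw [← mul_assoc, ← mul_assoc, labelsWeight_update_mul]
  rw [Fintype.sum_prod_type, Fintype.sum_prod_type] at h1
  simp only [← Finset.mul_sum] at h1
  rw [h1, ← Finset.sum_mul, sum_labelWeight hϖ, one_mul]

/-- The probability that the procedure assigns the same label to the observations `q.1` and `q.2`,
with means `s μ` and `t μ`. -/
def pairAgree (ϖ : ℝ) (ell : Clustering n p) (q : Fin n × Fin n) (s t : ℝ) (μ : Fin p → ℝ) : ℝ :=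
  ∑ l, labelsWeight ϖ l * agreeProb ell q
    (outer (Function.update (Function.update (fun i => genLabel ϖ (l i)) q.1 s) q.2 t) μ)

/-- The average excess of the agreement probability over the null model. -/
def excess (ρ : ℕ → ℝ) (α β r ϖ : ℝ) (ell : Clustering n p) (s t : ℝ) : ℝ :=
  ((n : ℝ)⁻¹) ^ 2 * ∑ q ∈ orderedPairs n, (((signalSet ρ α β r p).card : ℝ)⁻¹ *
    ∑ μ ∈ signalSet ρ α β r p, pairAgree ϖ ell q s t μ - agreeProb ell q 0)

theorem two_mul_card_orderedPairs_add (n : ℕ) : 2 * (orderedPairs n).card + n = n ^ 2 := by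
  have h := Finset.card_filter_add_card_filter_not (s := (Finset.univ : Finset (Fin n × Fin n)))
    (fun q => q.1 < q.2)
  have h2 := Finset.card_filter_add_card_filter_not
    (s := (Finset.univ : Finset (Fin n × Fin n)).filter fun q => ¬ q.1 < q.2) (fun q => q.2 < q.1)
  have h3 : (((Finset.univ : Finset (Fin n × Fin n)).filter fun q => ¬ q.1 < q.2).filter
      fun q => q.2 < q.1).card = (orderedPairs n).card := by
    refine Finset.card_bij (fun q _ => (q.2, q.1)) ?_ ?_ ?_
    · intro q hq
      simp only [Finset.mem_filter, orderedPairs, Finset.mem_univ, true_and] at hq ⊢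
      exact hq.2
    · intro q _ q' _ h
      simp only [Prod.mk.injEq] at h
      exact Prod.ext h.2 h.1
    · intro q hq
      simp only [Finset.mem_filter, orderedPairs, Finset.mem_univ, true_and] at hq
      exact ⟨(q.2, q.1), by simp [hq, hq.le], rfl⟩
  have h4 : (((Finset.univ : Finset (Fin n × Fin n)).filter fun q => ¬ q.1 < q.2).filter
      fun q => ¬ q.2 < q.1).card = n := by
    rw [show (((Finset.univ : Finset (Fin n × Fin n)).filter fun q => ¬ q.1 < q.2).filter
      fun q => ¬ q.2 < q.1) = Finset.univ.image fun i : Fin n => (i, i) from ?_,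
      Finset.card_image_of_injective _ fun i j h => (Prod.mk.injEq _ _ _ _ ▸ h).1]
    · simp
    · ext q
      simp only [Finset.mem_filter, Finset.mem_univ, true_and, Finset.mem_image, not_lt]
      constructor
      · rintro ⟨h1, h2⟩
        exact ⟨q.1, Prod.ext rfl (le_antisymm h2 h1)⟩
      · rintro ⟨i, rfl⟩
        exact ⟨le_rfl, le_rfl⟩
  have h5 : (Finset.univ : Finset (Fin n × Fin n)).card = n ^ 2 := by
    simp [sq]
  have h6 : ((Finset.univ : Finset (Fin n × Fin n)).filter fun q => q.1 < q.2).card =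
    (orderedPairs n).card := rfl
  omega

theorem abs_excess_le (hϖ : 0 < ϖ) (ell : Clustering n p) (s t : ℝ) :
    |excess ρ α β r ϖ ell s t| ≤ 1 := by
  have hpa : ∀ q μ, pairAgree ϖ ell q s t μ ∈ Set.Icc (0 : ℝ) 1 := by
    intro q μ
    refine ⟨Finset.sum_nonneg fun l _ => mul_nonneg (labelsWeight_nonneg hϖ l)
      (agreeProb_mem_Icc _ _ _).1, ?_⟩
    rw [← sum_labelsWeight (n := n) hϖ]
    exact Finset.sum_le_sum fun l _ => mul_le_of_le_one_right (labelsWeight_nonneg hϖ l)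
      (agreeProb_mem_Icc _ _ _).2
  have havg : ∀ q, ((signalSet ρ α β r p).card : ℝ)⁻¹ *
      ∑ μ ∈ signalSet ρ α β r p, pairAgree ϖ ell q s t μ ∈ Set.Icc (0 : ℝ) 1 := by
    intro q
    refine ⟨mul_nonneg (by positivity) (Finset.sum_nonneg fun μ _ => (hpa q μ).1), ?_⟩
    have h := Finset.sum_le_sum fun μ (_ : μ ∈ signalSet ρ α β r p) => (hpa q μ).2
    rw [Finset.sum_const, nsmul_eq_mul, mul_one] at h
    exact (mul_le_mul_of_nonneg_left h (by positivity)).trans (inv_mul_le_one)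
  rw [excess, abs_mul, abs_of_nonneg (by positivity)]
  have h1 : |∑ q ∈ orderedPairs n, (((signalSet ρ α β r p).card : ℝ)⁻¹ *
      ∑ μ ∈ signalSet ρ α β r p, pairAgree ϖ ell q s t μ - agreeProb ell q 0)| ≤
      (orderedPairs n).card := by
    refine (Finset.abs_sum_le_sum_abs _ _).trans ?_
    have := Finset.sum_le_card_nsmul (orderedPairs n) (fun q =>
      |((signalSet ρ α β r p).card : ℝ)⁻¹ *
        ∑ μ ∈ signalSet ρ α β r p, pairAgree ϖ ell q s t μ - agreeProb ell q 0|) 1 fun q _ => by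
          have h1 := havg q
          have h2 := agreeProb_mem_Icc ell q 0
          rw [abs_le]
          constructor <;> linarith [h1.1, h1.2, h2.1, h2.2]
    simpa using this
  have h2 : ((orderedPairs n).card : ℝ) ≤ (n : ℝ) ^ 2 := by
    have := two_mul_card_orderedPairs_add n
    exact_mod_cast (by omega : (orderedPairs n).card ≤ n ^ 2)
  calc ((n : ℝ)⁻¹) ^ 2 * _ ≤ ((n : ℝ)⁻¹) ^ 2 * (n : ℝ) ^ 2 := by gcongr; exact h1.trans h2
    _ = ((n : ℝ)⁻¹ * n) ^ 2 := by ring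
    _ ≤ 1 := pow_le_one₀ (by positivity) inv_mul_le_one

/-- Power minus size of the test. -/
theorem power_sub_size_plantTest (hϖ : 0 < ϖ)
    (hell : Measurable fun w : Data n p × Seed => ell w.1 w.2) (hn : 0 < n) (hp : 0 < p)
    {κ : ℕ} {t u : ℝ} (ht : 2 * (t * scaleFactor κ p * (t * scaleFactor κ p)) ≤ 1)
    (hu : 2 * (u * scaleFactor κ p * (u * scaleFactor κ p)) ≤ 1)
    (ha : scaleFactor κ p * scaleFactor κ p ≤ 1) {r' : ℝ} (hr : r' = r - (1 / 2 : ℝ) ^ κ) :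
    ((altLaw n p ρ α β r' ϖ).prod seedLaw).real (plantTest ell κ t u) -
      ((nullLaw n p).prod seedLaw).real (plantTest ell κ t u) =
      (4⁻¹ : ℝ) ^ Nat.clog 2 n * n ^ 2 *
        ∑ a, labelWeight ϖ a * excess ρ α β r ϖ ell (t * genLabel ϖ a) (u * genLabel ϖ a) := by
  set K := Nat.clog 2 n with hK
  set S := signalSet ρ α β r p with hS
  -- The scaling turns the class of strength p^(-r') into the class of strength p^(-r).
  have hscale : scaleFactor κ p = (p : ℝ) ^ (r' - r) := by
    rw [scaleFactor_eq_rpow, hr]; congr 1; ring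
  have h0 : ((nullLaw n p).prod seedLaw).real (plantTest ell κ t u) =
      (4⁻¹ : ℝ) ^ K * ∑ q ∈ orderedPairs n, agreeProb ell q 0 := by
    have := real_obsLaw_plantTest hell ht hu ha (0 : Data n p)
    rw [obsLaw, shiftLaw_zero] at this
    rw [this]
    congr 1
    refine Finset.sum_congr rfl fun q hq => ?_
    congr 1
    funext k l
    rw [plantSeed_apply (Finset.mem_filter.1 hq).2.ne]
    simp
  have hq : ∀ q ∈ orderedPairs n, ∀ ν : Fin p → ℝ, ∑ l, labelsWeight ϖ l * agreeProb ell q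
      (plantSeed q.1 q.2 t u (scaleFactor κ p) (outer (fun i => genLabel ϖ (l i)) ν) 0) =
      ∑ a, labelWeight ϖ a * pairAgree ϖ ell q (t * genLabel ϖ a) (u * genLabel ϖ a)
        (scaleFactor κ p • ν) := by
    intro q hq ν
    have hne : q.1 ≠ q.2 := (Finset.mem_filter.1 hq).2.ne
    simp only [plantSeed_outer hne]
    -- Both planted rows inherit the label of row `q.1`, which is resampled as a; the original label
    -- of row `q.2` is overwritten and plays no role.
    rw [sum_labelsWeight_resample hϖ q.1]
    refine Finset.sum_congr rfl fun a _ => ?_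
    congr 1
    refine Finset.sum_congr rfl fun l _ => ?_
    congr 3
    rw [Function.update_self]
    congr 1
    funext k
    by_cases hk : k = q.1
    · subst hk
      simp
    · rw [Function.update_of_ne hk, Function.update_of_ne hk, Function.update_of_ne hk]
  have h1 : ((altLaw n p ρ α β r' ϖ).prod seedLaw).real (plantTest ell κ t u) =
      (4⁻¹ : ℝ) ^ K * ∑ q ∈ orderedPairs n, ∑ a, labelWeight ϖ a * ((S.card : ℝ)⁻¹ *
        ∑ μ ∈ S, pairAgree ϖ ell q (t * genLabel ϖ a) (u * genLabel ϖ a) μ) := by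
    rw [real_altLaw_prod_seedLaw hϖ]
    rw [sum_altIndex]
    have e1 : ∀ μ : Fin p → ℝ, ∑ l : Fin n → ℤˣ, labelsWeight ϖ l *
        (obsLaw (altShift ϖ (μ, l) : Data n p)).real (plantTest ell κ t u) =
        (4⁻¹ : ℝ) ^ K * ∑ q ∈ orderedPairs n, ∑ a, labelWeight ϖ a *
          pairAgree ϖ ell q (t * genLabel ϖ a) (u * genLabel ϖ a) ((p : ℝ) ^ (r' - r) • μ) := by
      intro μ
      simp only [altShift, real_obsLaw_plantTest hell ht hu ha]
      rw [← hscale, Finset.sum_congr rfl fun q h => (hq q h μ).symm, Finset.mul_sum]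
      simp only [Finset.mul_sum]
      rw [Finset.sum_comm]
      refine Finset.sum_congr rfl fun q _ => Finset.sum_congr rfl fun l _ => by ring
    simp only [e1]
    rw [sum_signalSet_smul hp fun μ => (4⁻¹ : ℝ) ^ K * ∑ q ∈ orderedPairs n, ∑ a,
      labelWeight ϖ a * pairAgree ϖ ell q (t * genLabel ϖ a) (u * genLabel ϖ a) μ,
      card_signalSet_eq r r' hp, ← Finset.mul_sum, mul_left_comm, Finset.sum_comm, Finset.mul_sum]
    congr 1
    refine Finset.sum_congr rfl fun q _ => ?_
    rw [Finset.sum_comm, Finset.mul_sum]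
    refine Finset.sum_congr rfl fun a _ => ?_
    rw [← Finset.mul_sum]
    ring
  rw [h1, h0, ← mul_sub, mul_assoc, ← Finset.sum_sub_distrib]
  congr 1
  have hn' : (n : ℝ) ≠ 0 := Nat.cast_ne_zero.2 hn.ne'
  have e2 : ∀ s t : ℝ, (n : ℝ) ^ 2 * excess ρ α β r ϖ ell s t = ∑ q ∈ orderedPairs n,
      ((S.card : ℝ)⁻¹ * ∑ μ ∈ S, pairAgree ϖ ell q s t μ - agreeProb ell q 0) := by
    intro s t
    rw [excess, ← mul_assoc, ← mul_pow, mul_inv_cancel₀ hn', one_pow, one_mul]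
  rw [Finset.mul_sum]
  simp only [mul_left_comm ((n : ℝ) ^ 2), e2, Finset.mul_sum (s := orderedPairs n)]
  rw [Finset.sum_comm]
  refine Finset.sum_congr rfl fun q _ => ?_
  simp only [mul_sub, Finset.sum_sub_distrib, ← Finset.sum_mul, sum_labelWeight hϖ, one_mul]

/-- The least power of 2 that is at least n is at most 2n. Hence the drawn indices are usable with
probability bounded below, and this factor can be divided out of power minus size. -/
theorem one_le_four_inv_pow_clog (hn : 0 < n) : 1 ≤ 4 * ((4⁻¹ : ℝ) ^ Nat.clog 2 n * n ^ 2) := by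
  have h : 2 ^ Nat.clog 2 n ≤ 2 * n := by
    rcases Nat.lt_or_ge 1 n with h1 | h1
    · have h2 := Nat.pow_pred_clog_lt_self one_lt_two h1
      have h3 : 0 < Nat.clog 2 n := Nat.clog_pos one_lt_two h1
      have h4 : 2 ^ Nat.clog 2 n = 2 * 2 ^ (Nat.clog 2 n).pred := by
        rw [← pow_succ', ← Nat.succ_eq_add_one, Nat.succ_pred h3.ne']
      omega
    · obtain rfl : n = 1 := by omega
      simp
  have h' : (2 : ℝ) ^ Nat.clog 2 n ≤ 2 * n := by exact_mod_cast h
  have h4 : (4 : ℝ) ^ Nat.clog 2 n ≤ 4 * n ^ 2 := by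
    calc (4 : ℝ) ^ Nat.clog 2 n = ((2 : ℝ) ^ Nat.clog 2 n) ^ 2 := by
          rw [← pow_mul, mul_comm, pow_mul]; norm_num
      _ ≤ (2 * n) ^ 2 := by gcongr
      _ = 4 * n ^ 2 := by ring
  rw [inv_pow, mul_left_comm, inv_mul_eq_div, le_div_iff₀ (by positivity)]
  linarith

end

/-! # The risk and the alignment of a procedure with the labels -/

/-- The real number `± 1`. -/
def signOf (a : ℤˣ) : ℝ := ((a : ℤ) : ℝ)

theorem signOf_one : signOf 1 = 1 := by simp [signOf]

theorem signOf_neg_one : signOf (-1) = -1 := by simp [signOf]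

theorem signOf_mul_self (a : ℤˣ) : signOf a * signOf a = 1 := by
  rcases Int.units_eq_one_or a with rfl | rfl <;> simp [signOf]

theorem abs_signOf (a : ℤˣ) : |signOf a| = 1 := by
  rcases Int.units_eq_one_or a with rfl | rfl <;> simp [signOf]

theorem measurable_signOf : Measurable signOf := measurable_of_countable _

/-- The mean of a label. -/
theorem sum_labelWeight_mul_signOf {ϖ : ℝ} :
    ∑ a, labelWeight ϖ a * signOf a = (ϖ - 1) / (1 + ϖ) := by
  rw [sum_intUnits, labelWeight_one, labelWeight_neg_one, signOf_one, signOf_neg_one]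
  ring

section
variable {n p : ℕ} {ϖ : ℝ} {ell : Clustering n p} {ρ : ℕ → ℝ} {α β r : ℝ}

/-- The mean of the products of the assigned labels with the labels, averaged over the sample. -/
def alignment (ϖ : ℝ) (ell : Clustering n p) (μ : Fin p → ℝ) : ℝ :=
  ∑ l, labelsWeight ϖ l * ∫ z, (n : ℝ)⁻¹ * ∑ i, signOf (ell z.1 z.2 i) * signOf (l i)
    ∂obsLaw (outer (fun i => genLabel ϖ (l i)) μ)

theorem measurable_signOf_ell (hell : Measurable fun w : Data n p × Seed => ell w.1 w.2)
    (i : Fin n) : Measurable fun z : Data n p × Seed => signOf (ell z.1 z.2 i) :=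
  measurable_signOf.comp ((measurable_pi_apply i).comp hell)

theorem measurable_average (hell : Measurable fun w : Data n p × Seed => ell w.1 w.2)
    (l : Fin n → ℤˣ) : Measurable fun z : Data n p × Seed =>
      (n : ℝ)⁻¹ * ∑ i, signOf (ell z.1 z.2 i) * signOf (l i) :=
  (Finset.measurable_sum _ fun i _ => (measurable_signOf_ell hell i).mul_const _).const_mul _

theorem abs_average_le (e l : Fin n → ℤˣ) : |(n : ℝ)⁻¹ * ∑ i, signOf (e i) * signOf (l i)| ≤ 1 := by
  rw [abs_mul, abs_of_nonneg (by positivity)]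
  have h : |∑ i, signOf (e i) * signOf (l i)| ≤ n := by
    refine (Finset.abs_sum_le_sum_abs _ _).trans ?_
    simp [abs_mul, abs_signOf]
  exact (mul_le_mul_of_nonneg_left h (by positivity)).trans inv_mul_le_one

/-- For signs, the indicator of e ≠ s l is (1 - s e l)/2, so the number of errors is affine in the
sum of the products of assigned and true labels. -/
theorem hammClu_inner_eq (hϖ : 0 < ϖ) (hn : 0 < n)
    (hell : Measurable fun w : Data n p × Seed => ell w.1 w.2) (μ : Fin p → ℝ) (s : ℤˣ) :
    (n : ℝ)⁻¹ * ∫ w, ((Finset.univ.filter fun i : Fin n =>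
      ell (observe ϖ μ w.1.1 w.1.2) w.2 i ≠ s * w.1.1 i).card : ℝ) ∂(modelLaw n p ϖ) =
      (1 - signOf s * alignment ϖ ell μ) / 2 := by
  have hn' : (n : ℝ) ≠ 0 := Nat.cast_ne_zero.2 hn.ne'
  have hcard : ∀ e l : Fin n → ℤˣ, ((Finset.univ.filter fun i : Fin n => e i ≠ s * l i).card : ℝ) =
      n / 2 * (1 - signOf s * ((n : ℝ)⁻¹ * ∑ i, signOf (e i) * signOf (l i))) := by
    intro e l
    have h1 : ∀ i, (if e i ≠ s * l i then (1 : ℝ) else 0) =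
        (1 - signOf s * (signOf (e i) * signOf (l i))) / 2 := by
      intro i
      rcases Int.units_eq_one_or s with h | h <;> rcases Int.units_eq_one_or (e i) with h' | h' <;>
        rcases Int.units_eq_one_or (l i) with h'' | h'' <;> rw [h, h', h''] <;>
        norm_num [signOf]
    rw [Finset.card_filter]
    push_cast
    simp only [h1]
    rw [← Finset.sum_div, Finset.sum_sub_distrib, ← Finset.mul_sum]
    simp only [Finset.sum_const, Finset.card_univ, Fintype.card_fin, nsmul_eq_mul, mul_one]
    field_simp
  simp only [hcard]
  set g : (Fin n → ℤˣ) → Data n p × Seed → ℝ := fun l z =>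
    n / 2 * (1 - signOf s * ((n : ℝ)⁻¹ * ∑ i, signOf (ell z.1 z.2 i) * signOf (l i))) with hg
  have hgm : ∀ l, Measurable (g l) := fun l =>
    (measurable_const.sub ((measurable_average hell l).const_mul _)).const_mul _
  have hgC : ∀ l z, |g l z| ≤ n := by
    intro l z
    have h := abs_average_le (ell z.1 z.2) l
    rw [hg]
    simp only
    rw [abs_mul, abs_of_nonneg (by positivity)]
    have h2 : |1 - signOf s * ((n : ℝ)⁻¹ * ∑ i, signOf (ell z.1 z.2 i) * signOf (l i))| ≤ 2 := by
      refine (abs_sub _ _).trans ?_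
      rw [abs_mul, abs_signOf, abs_one, one_mul]
      linarith
    calc (n : ℝ) / 2 * _ ≤ n / 2 * 2 := by gcongr
      _ = n := by ring
  have := integral_modelLaw hϖ μ g hgm hgC
  simp only [hg] at this
  rw [this]
  have hint : ∀ l : Fin n → ℤˣ, ∫ z : Data n p × Seed,
      n / 2 * (1 - signOf s * ((n : ℝ)⁻¹ * ∑ i, signOf (ell z.1 z.2 i) * signOf (l i)))
        ∂obsLaw (outer (fun i => genLabel ϖ (l i)) μ) =
      n / 2 * (1 - signOf s * ∫ z, (n : ℝ)⁻¹ * ∑ i, signOf (ell z.1 z.2 i) * signOf (l i)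
        ∂obsLaw (outer (fun i => genLabel ϖ (l i)) μ)) := by
    intro l
    have hI : Integrable (fun z : Data n p × Seed =>
        (n : ℝ)⁻¹ * ∑ i, signOf (ell z.1 z.2 i) * signOf (l i))
        (obsLaw (outer (fun i => genLabel ϖ (l i)) μ)) :=
      Integrable.of_bound (measurable_average hell l).aestronglyMeasurable 1
        (ae_of_all _ fun z => abs_average_le _ _)
    rw [integral_const_mul, integral_sub (integrable_const _) (hI.const_mul _),
      integral_const_mul (signOf s)]
    simp
  have e : ∀ (l : Fin n → ℤˣ) (x : ℝ), labelsWeight ϖ l * (n / 2 * (1 - signOf s * x)) =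
      n / 2 * labelsWeight ϖ l - n / 2 * signOf s * (labelsWeight ϖ l * x) := by
    intro l x; ring
  simp only [hint, e]
  rw [Finset.sum_sub_distrib, ← Finset.mul_sum, ← Finset.mul_sum, sum_labelsWeight hϖ, alignment]
  field_simp

theorem le_hammClu (hϖ : 0 < ϖ) (hn : 0 < n)
    (hell : Measurable fun w : Data n p × Seed => ell w.1 w.2) (μ : Fin p → ℝ) :
    (1 - |alignment ϖ ell μ|) / 2 ≤ hammClu ϖ μ ell := by
  rw [hammClu]
  simp only [hammClu_inner_eq hϖ hn hell]
  refine le_ciInf fun s => ?_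
  have : signOf s * alignment ϖ ell μ ≤ |alignment ϖ ell μ| := by
    refine (le_abs_self _).trans ?_
    rw [abs_mul, abs_signOf, one_mul]
  linarith

theorem abs_alignment_le (hϖ : 0 < ϖ)
    (ell : Clustering n p) (μ : Fin p → ℝ) : |alignment ϖ ell μ| ≤ 1 := by
  refine (Finset.abs_sum_le_sum_abs _ _).trans ?_
  rw [← sum_labelsWeight (n := n) hϖ]
  refine Finset.sum_le_sum fun l _ => ?_
  rw [abs_mul, abs_of_nonneg (labelsWeight_nonneg hϖ l)]
  refine mul_le_of_le_one_right (labelsWeight_nonneg hϖ l) ?_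
  have := norm_integral_le_of_norm_le_const (μ := obsLaw (outer (fun i => genLabel ϖ (l i)) μ))
    (f := fun z => (n : ℝ)⁻¹ * ∑ i, signOf (ell z.1 z.2 i) * signOf (l i)) (C := 1)
    (ae_of_all _ fun z => abs_average_le _ _)
  simpa using this

theorem hammClu_le_one (hϖ : 0 < ϖ) (hn : 0 < n)
    (hell : Measurable fun w : Data n p × Seed => ell w.1 w.2) (μ : Fin p → ℝ) :
    hammClu ϖ μ ell ≤ 1 := by
  rw [hammClu]
  simp only [hammClu_inner_eq hϖ hn hell]
  refine (ciInf_le (Set.finite_range _).bddBelow 1).trans ?_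
  have := abs_le.1 (abs_alignment_le hϖ ell μ)
  rw [signOf_one]
  linarith [this.1]

theorem hammClu_le_worstRisk (hϖ : 0 < ϖ) (hn : 0 < n)
    (hell : Measurable fun w : Data n p × Seed => ell w.1 w.2) {μ : Fin p → ℝ}
    (hμ : μ ∈ signalSet ρ α β r p) : hammClu ϖ μ ell ≤ worstRisk ρ α β r ϖ ell :=
  le_ciSup (f := fun μ : signalClass ρ α β r p => hammClu ϖ μ.1 ell)
    ⟨1, by rintro _ ⟨μ, rfl⟩; exact hammClu_le_one hϖ hn hell _⟩ ⟨μ, mem_signalSet.1 hμ⟩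

theorem worstRisk_le_one (hϖ : 0 < ϖ) (hn : 0 < n)
    (hell : Measurable fun w : Data n p × Seed => ell w.1 w.2) :
    worstRisk ρ α β r ϖ ell ≤ 1 :=
  Real.iSup_le (fun _ => hammClu_le_one hϖ hn hell _) zero_le_one

/-- The correlation of two assigned labels. -/
theorem integral_signOf_mul_signOf (hell : Measurable fun w : Data n p × Seed => ell w.1 w.2)
    (q : Fin n × Fin n) (v : Data n p) :
    ∫ z, signOf (ell z.1 z.2 q.1) * signOf (ell z.1 z.2 q.2) ∂obsLaw v =
      2 * agreeProb ell q v - 1 := by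
  have hA := measurableSet_agree hell q
  have h : ∀ z : Data n p × Seed, signOf (ell z.1 z.2 q.1) * signOf (ell z.1 z.2 q.2) =
      2 * {z : Data n p × Seed | ell z.1 z.2 q.1 = ell z.1 z.2 q.2}.indicator 1 z - 1 := by
    intro z
    by_cases hz : ell z.1 z.2 q.1 = ell z.1 z.2 q.2
    · rw [Set.indicator_of_mem (by exact hz), hz, signOf_mul_self, Pi.one_apply]
      norm_num
    · rw [Set.indicator_of_notMem (by exact hz)]
      rcases Int.units_eq_one_or (ell z.1 z.2 q.1) with h1 | h1 <;>
        rcases Int.units_eq_one_or (ell z.1 z.2 q.2) with h2 | h2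
      · exact absurd (h1.trans h2.symm) hz
      · rw [h1, h2, signOf_one, signOf_neg_one]; norm_num
      · rw [h1, h2, signOf_one, signOf_neg_one]; norm_num
      · exact absurd (h1.trans h2.symm) hz
  simp only [h]
  have hI : Integrable ({z : Data n p × Seed | ell z.1 z.2 q.1 = ell z.1 z.2 q.2}.indicator
      (1 : Data n p × Seed → ℝ)) (obsLaw v) := (integrable_const 1).indicator hA
  rw [integral_sub (hI.const_mul 2) (integrable_const _), integral_const_mul,
    integral_indicator_one hA]
  simp [agreeProb]

theorem sum_sum_eq_two_mul_orderedPairs (f : Fin n → Fin n → ℝ) (hf : ∀ i j, f i j = f j i) :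
    ∑ i, ∑ j, f i j = ∑ i, f i i + 2 * ∑ q ∈ orderedPairs n, f q.1 q.2 := by
  rw [← Fintype.sum_prod_type', ← Finset.sum_filter_add_sum_filter_not Finset.univ
    (fun q : Fin n × Fin n => q.1 < q.2), ← Finset.sum_filter_add_sum_filter_not
    (Finset.univ.filter fun q : Fin n × Fin n => ¬ q.1 < q.2) (fun q => q.2 < q.1)]
  have h1 : ∑ q ∈ (Finset.univ.filter fun q : Fin n × Fin n => ¬ q.1 < q.2).filter
      (fun q => q.2 < q.1), f q.1 q.2 = ∑ q ∈ orderedPairs n, f q.1 q.2 := by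
    refine Finset.sum_bij' (fun q _ => (q.2, q.1)) (fun q _ => (q.2, q.1)) ?_ ?_ ?_ ?_ ?_
    · intro q hq
      simp only [Finset.mem_filter, orderedPairs, Finset.mem_univ, true_and] at hq ⊢
      exact hq.2
    · intro q hq
      simp only [Finset.mem_filter, orderedPairs, Finset.mem_univ, true_and] at hq ⊢
      exact ⟨hq.le.not_gt, hq⟩
    · intro q _; rfl
    · intro q _; rfl
    · intro q _; exact hf _ _
  have h2 : ∑ q ∈ (Finset.univ.filter fun q : Fin n × Fin n => ¬ q.1 < q.2).filter
      (fun q => ¬ q.2 < q.1), f q.1 q.2 = ∑ i, f i i := by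
    refine Finset.sum_bij' (fun q _ => q.1) (fun i _ => (i, i)) ?_ ?_ ?_ ?_ ?_
    · intro q _; exact Finset.mem_univ _
    · intro i _; simp
    · intro q hq
      simp only [Finset.mem_filter, Finset.mem_univ, true_and, not_lt] at hq
      exact Prod.ext rfl (le_antisymm hq.2 hq.1)
    · intro i _; rfl
    · intro q hq
      simp only [Finset.mem_filter, Finset.mem_univ, true_and, not_lt] at hq
      simp only [le_antisymm hq.2 hq.1]
  rw [h1, h2, orderedPairs]
  ring

theorem sum_labelsWeight_affine (hϖ : 0 < ϖ) (c : ℝ) (x : (Fin n → ℤˣ) → ℝ) :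
    ∑ l, labelsWeight ϖ l * (c * (2 * x l - 1)) = c * (2 * ∑ l, labelsWeight ϖ l * x l - 1) := by
  have e : ∀ l, labelsWeight ϖ l * (c * (2 * x l - 1)) =
      2 * c * (labelsWeight ϖ l * x l) - c * labelsWeight ϖ l := fun l => by ring
  simp only [e, Finset.sum_sub_distrib, ← Finset.mul_sum, sum_labelsWeight hϖ]
  ring

/-- The squared alignment is at most the mean of the pairwise products. -/
theorem sq_alignment_le (hϖ : 0 < ϖ) (hn : 0 < n)
    (hell : Measurable fun w : Data n p × Seed => ell w.1 w.2) (μ : Fin p → ℝ) :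
    alignment ϖ ell μ ^ 2 ≤ (n : ℝ)⁻¹ + 2 * ((n : ℝ)⁻¹) ^ 2 * ∑ q ∈ orderedPairs n,
      ∑ a, labelWeight ϖ a * ∑ b, labelWeight ϖ b * (signOf a * signOf b *
        (2 * pairAgree ϖ ell q (genLabel ϖ a) (genLabel ϖ b) μ - 1)) := by
  have hn' : (n : ℝ) ≠ 0 := Nat.cast_ne_zero.2 hn.ne'
  set v : (Fin n → ℤˣ) → Data n p := fun l => outer (fun i => genLabel ϖ (l i)) μ with hv
  set g : (Fin n → ℤˣ) → Data n p × Seed → ℝ := fun l z =>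
    (n : ℝ)⁻¹ * ∑ i, signOf (ell z.1 z.2 i) * signOf (l i) with hg
  set A := alignment ϖ ell μ with hA
  have hgI : ∀ l, Integrable (g l) (obsLaw (v l)) := fun l =>
    Integrable.of_bound (measurable_average hell l).aestronglyMeasurable 1
      (ae_of_all _ fun z => abs_average_le _ _)
  have hgI2 : ∀ l, Integrable (fun z => g l z ^ 2) (obsLaw (v l)) := fun l =>
    Integrable.of_bound ((measurable_average hell l).pow_const 2).aestronglyMeasurable 1
      (ae_of_all _ fun z => by
        rw [Real.norm_eq_abs, abs_of_nonneg (sq_nonneg _), sq_le_one_iff_abs_le_one]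
        exact abs_average_le _ _)
  -- The alignment is the mean of g, so nonnegativity of the variance bounds its square by the mean
  -- of g², which is a double sum over observations; the diagonal contributes 1/n.
  have hvar : 0 ≤ ∑ l, labelsWeight ϖ l * ∫ z, (g l z - A) ^ 2 ∂obsLaw (v l) :=
    Finset.sum_nonneg fun l _ => mul_nonneg (labelsWeight_nonneg hϖ l)
      (integral_nonneg fun z => sq_nonneg _)
  have hexp : ∀ l z, (g l z - A) ^ 2 = g l z ^ 2 - 2 * A * g l z + A ^ 2 := fun l z => by ring
  simp only [hexp] at hvar
  have hAsum : ∑ l, labelsWeight ϖ l * ∫ z, g l z ∂obsLaw (v l) = A := rfl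
  have h1 : A ^ 2 ≤ ∑ l, labelsWeight ϖ l * ∫ z, g l z ^ 2 ∂obsLaw (v l) := by
    have e : ∀ l, labelsWeight ϖ l * ∫ z, (g l z ^ 2 - 2 * A * g l z + A ^ 2) ∂obsLaw (v l) =
        labelsWeight ϖ l * ∫ z, g l z ^ 2 ∂obsLaw (v l) -
          2 * A * (labelsWeight ϖ l * ∫ z, g l z ∂obsLaw (v l)) + labelsWeight ϖ l * A ^ 2 := by
      intro l
      rw [integral_sub_const_mul_add_const (hgI2 l) (hgI l)]
      ring
    simp only [e, Finset.sum_add_distrib, Finset.sum_sub_distrib, ← Finset.mul_sum,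
      ← Finset.sum_mul, hAsum, sum_labelsWeight hϖ] at hvar
    nlinarith
  refine h1.trans (le_of_eq ?_)
  have h2 : ∀ l, ∫ z, g l z ^ 2 ∂obsLaw (v l) = (n : ℝ)⁻¹ + 2 * ((n : ℝ)⁻¹) ^ 2 *
      ∑ q ∈ orderedPairs n, signOf (l q.1) * signOf (l q.2) *
        (2 * agreeProb ell q (v l) - 1) := by
    intro l
    have e : ∀ z, g l z ^ 2 = ((n : ℝ)⁻¹) ^ 2 * (n + 2 * ∑ q ∈ orderedPairs n,
        signOf (l q.1) * signOf (l q.2) *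
          (signOf (ell z.1 z.2 q.1) * signOf (ell z.1 z.2 q.2))) := by
      intro z
      simp only [hg]
      rw [mul_pow, sq (∑ i, signOf (ell z.1 z.2 i) * signOf (l i)), Finset.sum_mul_sum,
        sum_sum_eq_two_mul_orderedPairs _ fun i j => by ring]
      congr 2
      · have : ∀ i, signOf (ell z.1 z.2 i) * signOf (l i) *
            (signOf (ell z.1 z.2 i) * signOf (l i)) = 1 := by
          intro i
          rw [mul_mul_mul_comm, signOf_mul_self, signOf_mul_self, one_mul]
        simp [this]
      · congr 1
        exact Finset.sum_congr rfl fun q _ => by ring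
    have hqI : ∀ q : Fin n × Fin n, Integrable (fun z : Data n p × Seed =>
        signOf (ell z.1 z.2 q.1) * signOf (ell z.1 z.2 q.2)) (obsLaw (v l)) := fun q =>
      Integrable.of_bound ((measurable_signOf_ell hell q.1).mul
        (measurable_signOf_ell hell q.2)).aestronglyMeasurable 1 (ae_of_all _ fun z => by
          rw [Real.norm_eq_abs, abs_mul, abs_signOf, abs_signOf, one_mul])
    simp only [e]
    rw [integral_const_mul, integral_add (integrable_const _) ((integrable_finsetSum _
      fun q _ => (hqI q).const_mul _).const_mul 2), integral_const_mul,
      integral_finsetSum _ fun q _ => (hqI q).const_mul _]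
    simp only [integral_const_mul, integral_signOf_mul_signOf hell]
    simp only [integral_const, probReal_univ, smul_eq_mul]
    field_simp
  simp only [h2, mul_add, Finset.sum_add_distrib, ← Finset.sum_mul, sum_labelsWeight hϖ, one_mul]
  congr 1
  simp only [mul_left_comm (labelsWeight ϖ _), ← Finset.mul_sum]
  congr 1
  simp only [Finset.mul_sum (s := orderedPairs n)]
  rw [Finset.sum_comm]
  refine Finset.sum_congr rfl fun q hq => ?_
  have hne : q.1 ≠ q.2 := (Finset.mem_filter.1 hq).2.ne
  -- Resampling the two labels of the pair pulls their signs out of the expectation and fixes the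
  -- means of the two rows.
  rw [sum_labelsWeight_resample hϖ q.1]
  refine Finset.sum_congr rfl fun a _ => ?_
  congr 1
  rw [sum_labelsWeight_resample hϖ q.2]
  refine Finset.sum_congr rfl fun b _ => ?_
  congr 1
  rw [pairAgree, ← sum_labelsWeight_affine hϖ]
  refine Finset.sum_congr rfl fun l _ => ?_
  have hv' : v (Function.update (Function.update l q.2 b) q.1 a) =
      outer (Function.update (Function.update (fun i => genLabel ϖ (l i)) q.1 (genLabel ϖ a)) q.2
        (genLabel ϖ b)) μ := by
    simp only [hv]
    congr 1
    funext k
    by_cases hk1 : k = q.1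
    · subst hk1
      rw [Function.update_self, Function.update_of_ne hne, Function.update_self]
    · rw [Function.update_of_ne hk1]
      by_cases hk2 : k = q.2
      · subst hk2
        simp
      · simp [hk1, hk2]
  rw [hv', Function.update_self, Function.update_of_ne hne.symm, Function.update_self]

/-- Some signal is poorly aligned. -/
theorem exists_sq_alignment_le (hϖ : 0 < ϖ) (hn : 0 < n)
    (hell : Measurable fun w : Data n p × Seed => ell w.1 w.2)
    (hS : (signalSet ρ α β r p).Nonempty) :
    ∃ μ ∈ signalSet ρ α β r p, alignment ϖ ell μ ^ 2 ≤ (n : ℝ)⁻¹ + ((ϖ - 1) / (1 + ϖ)) ^ 2 +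
      4 * ∑ a, labelWeight ϖ a * ∑ b, labelWeight ϖ b * (signOf a * signOf b *
        excess ρ α β r ϖ ell (genLabel ϖ a) (genLabel ϖ b)) := by
  have hn' : (n : ℝ) ≠ 0 := Nat.cast_ne_zero.2 hn.ne'
  set S := signalSet ρ α β r p with hSdef
  have hc : (0 : ℝ) < S.card := Nat.cast_pos.2 (Finset.card_pos.2 hS)
  set X := (n : ℝ)⁻¹ + ((ϖ - 1) / (1 + ϖ)) ^ 2 +
      4 * ∑ a, labelWeight ϖ a * ∑ b, labelWeight ϖ b * (signOf a * signOf b *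
        excess ρ α β r ϖ ell (genLabel ϖ a) (genLabel ϖ b)) with hX
  -- If the bound failed for all signals, it would fail for their average; so averaging over the
  -- class is enough.
  by_contra! hcon
  have hlt : ∑ μ ∈ S, X < ∑ μ ∈ S, alignment ϖ ell μ ^ 2 :=
    Finset.sum_lt_sum_of_nonempty hS hcon
  rw [Finset.sum_const, nsmul_eq_mul] at hlt
  refine hlt.not_ge ?_
  refine (Finset.sum_le_sum fun μ _ => sq_alignment_le hϖ hn hell μ).trans ?_
  set avg : Fin n × Fin n → ℝ → ℝ → ℝ := fun q s t =>
    (S.card : ℝ)⁻¹ * ∑ μ ∈ S, pairAgree ϖ ell q s t μ with havg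
  have hpa : ∀ q s t, ∑ μ ∈ S, pairAgree ϖ ell q s t μ = S.card * avg q s t := by
    intro q s t
    rw [havg]
    simp only
    rw [← mul_assoc, mul_inv_cancel₀ hc.ne', one_mul]
  have hsum : ∑ μ ∈ S, ((n : ℝ)⁻¹ + 2 * ((n : ℝ)⁻¹) ^ 2 * ∑ q ∈ orderedPairs n,
      ∑ a, labelWeight ϖ a * ∑ b, labelWeight ϖ b * (signOf a * signOf b *
        (2 * pairAgree ϖ ell q (genLabel ϖ a) (genLabel ϖ b) μ - 1))) =
      S.card * ((n : ℝ)⁻¹ + 2 * ((n : ℝ)⁻¹) ^ 2 * ∑ q ∈ orderedPairs n,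
      ∑ a, labelWeight ϖ a * ∑ b, labelWeight ϖ b * (signOf a * signOf b *
        (2 * avg q (genLabel ϖ a) (genLabel ϖ b) - 1))) := by
    rw [Finset.sum_add_distrib, Finset.sum_const, nsmul_eq_mul, mul_add, ← Finset.mul_sum,
      mul_left_comm (S.card : ℝ)]
    congr 2
    simp only [Finset.mul_sum]
    rw [Finset.sum_comm]
    refine Finset.sum_congr rfl fun q _ => ?_
    rw [Finset.sum_comm]
    refine Finset.sum_congr rfl fun a _ => ?_
    rw [Finset.sum_comm]
    refine Finset.sum_congr rfl fun b _ => ?_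
    have e : ∀ μ, labelWeight ϖ a * (labelWeight ϖ b * (signOf a * signOf b *
        (2 * pairAgree ϖ ell q (genLabel ϖ a) (genLabel ϖ b) μ - 1))) =
        2 * labelWeight ϖ a * labelWeight ϖ b * signOf a * signOf b *
          pairAgree ϖ ell q (genLabel ϖ a) (genLabel ϖ b) μ -
        labelWeight ϖ a * labelWeight ϖ b * signOf a * signOf b := fun μ => by ring
    simp only [e, Finset.sum_sub_distrib, ← Finset.mul_sum, hpa, Finset.sum_const, nsmul_eq_mul]
    ring
  rw [hsum]
  refine mul_le_mul_of_nonneg_left ?_ hc.le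
  -- The null agreement probability is subtracted and added back. It does not depend on the labels,
  -- so its contribution is a factor at most 1, after averaging over pairs, times the squared mean
  -- label.
  have hq : ∀ q : Fin n × Fin n, ∑ a, labelWeight ϖ a * ∑ b, labelWeight ϖ b *
      (signOf a * signOf b * (2 * avg q (genLabel ϖ a) (genLabel ϖ b) - 1)) =
      2 * (∑ a, labelWeight ϖ a * ∑ b, labelWeight ϖ b * (signOf a * signOf b *
        (avg q (genLabel ϖ a) (genLabel ϖ b) - agreeProb ell q 0))) +
      (2 * agreeProb ell q 0 - 1) * ((ϖ - 1) / (1 + ϖ)) ^ 2 := by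
    intro q
    rw [← sum_labelWeight_mul_signOf, sq, Finset.sum_mul_sum, Finset.mul_sum, Finset.mul_sum,
      ← Finset.sum_add_distrib]
    refine Finset.sum_congr rfl fun a _ => ?_
    rw [Finset.mul_sum, Finset.mul_sum, Finset.mul_sum, Finset.mul_sum, ← Finset.sum_add_distrib]
    exact Finset.sum_congr rfl fun b _ => by ring
  simp only [hq]
  rw [Finset.sum_add_distrib, ← Finset.mul_sum, ← Finset.sum_mul, mul_add]
  have hF : ((n : ℝ)⁻¹) ^ 2 * ∑ q ∈ orderedPairs n, ∑ a, labelWeight ϖ a *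
      ∑ b, labelWeight ϖ b * (signOf a * signOf b *
        (avg q (genLabel ϖ a) (genLabel ϖ b) - agreeProb ell q 0)) =
      ∑ a, labelWeight ϖ a * ∑ b, labelWeight ϖ b * (signOf a * signOf b *
        excess ρ α β r ϖ ell (genLabel ϖ a) (genLabel ϖ b)) := by
    have hexc : ∀ s t, excess ρ α β r ϖ ell s t =
        ((n : ℝ)⁻¹) ^ 2 * ∑ q ∈ orderedPairs n, (avg q s t - agreeProb ell q 0) := fun s t => rfl
    simp only [hexc, Finset.mul_sum]
    rw [Finset.sum_comm]
    refine Finset.sum_congr rfl fun a _ => ?_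
    rw [Finset.sum_comm]
    refine Finset.sum_congr rfl fun b _ => Finset.sum_congr rfl fun q _ => ?_
    ring
  have hcard : 2 * ((n : ℝ)⁻¹) ^ 2 * (∑ q ∈ orderedPairs n, (2 * agreeProb ell q 0 - 1)) ≤ 1 := by
    have h1 : ∑ q ∈ orderedPairs n, (2 * agreeProb ell q 0 - 1) ≤ (orderedPairs n).card := by
      have := Finset.sum_le_card_nsmul (orderedPairs n) (fun q => 2 * agreeProb ell q 0 - 1) 1
        fun q _ => by linarith [(agreeProb_mem_Icc ell q 0).2]
      simpa using this
    have h2 : 2 * ((orderedPairs n).card : ℝ) ≤ (n : ℝ) ^ 2 := by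
      have := two_mul_card_orderedPairs_add n
      exact_mod_cast (by omega : 2 * (orderedPairs n).card ≤ n ^ 2)
    calc 2 * ((n : ℝ)⁻¹) ^ 2 * (∑ q ∈ orderedPairs n, (2 * agreeProb ell q 0 - 1))
        ≤ 2 * ((n : ℝ)⁻¹) ^ 2 * (orderedPairs n).card := by gcongr
      _ = ((n : ℝ)⁻¹) ^ 2 * (2 * (orderedPairs n).card) := by ring
      _ ≤ ((n : ℝ)⁻¹) ^ 2 * (n : ℝ) ^ 2 := by gcongr
      _ = 1 := by rw [← mul_pow, inv_mul_cancel₀ hn', one_pow]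
  have hm := mul_le_mul_of_nonneg_right hcard (sq_nonneg ((ϖ - 1) / (1 + ϖ)))
  rw [hX, ← hF]
  linarith

end

/-! # From indistinguishability to the risk -/

/-- Iterating k times gives F(t, u) = c^k F(m^k t, m^k u) + o(1) for each fixed k. Boundedness of F
then leaves at most |c|^k, however large the arguments become. -/
theorem tendsto_zero_of_scaling {F : ℕ → ℝ → ℝ → ℝ} (hF : ∀ p s t, |F p s t| ≤ 1) {c m : ℝ}
    (hc : |c| < 1) (h : ∀ t u, Tendsto (fun p => F p t u - c * F p (m * t) (m * u)) atTop (𝓝 0))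
    (t u : ℝ) : Tendsto (fun p => F p t u) atTop (𝓝 0) := by
  have hk : ∀ k : ℕ, ∀ t u, Tendsto (fun p => F p t u - c ^ k * F p (m ^ k * t) (m ^ k * u))
      atTop (𝓝 0) := by
    intro k
    induction k with
    | zero => intro t u; simp
    | succ k ih =>
      intro t u
      have h1 := (h t u).add ((ih (m * t) (m * u)).const_mul c)
      rw [mul_zero, add_zero] at h1
      refine h1.congr fun p => ?_
      rw [pow_succ, pow_succ, mul_assoc, mul_assoc]
      ring_nf
  rw [Metric.tendsto_atTop]
  intro ε hε
  obtain ⟨k, hk'⟩ := exists_pow_lt_of_lt_one (half_pos hε) hc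
  obtain ⟨N, hN⟩ := Metric.tendsto_atTop.1 (hk k t u) (ε / 2) (half_pos hε)
  refine ⟨N, fun p hp => ?_⟩
  have h1 := hN p hp
  rw [Real.dist_eq, sub_zero] at h1 ⊢
  have h2 : |c ^ k * F p (m ^ k * t) (m ^ k * u)| ≤ |c| ^ k := by
    rw [abs_mul, abs_pow]
    exact mul_le_of_le_one_right (by positivity) (hF _ _ _)
  calc |F p t u| = |(F p t u - c ^ k * F p (m ^ k * t) (m ^ k * u)) +
        c ^ k * F p (m ^ k * t) (m ^ k * u)| := by ring_nf
    _ ≤ _ := abs_add_le _ _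
    _ < ε := by linarith

/-- The assumption reads ϖ F(t, u) + F(-ϖt, -ϖu) → 0. For ϖ < 1 it is solved for the second term,
with contraction factor ϖ, and for ϖ > 1 for the first, with factor 1/ϖ; in both cases every F(t, u)
tends to 0. For ϖ = 1 nothing contracts, but the signed sum is one quarter of the relation at (1, 1)
minus the relation at (1, -1). -/
theorem tendsto_sum_signOf_mul {ϖ : ℝ} (hϖ : 0 < ϖ) {F : ℕ → ℝ → ℝ → ℝ}
    (hF : ∀ p s t, |F p s t| ≤ 1)
    (h : ∀ t u, Tendsto (fun p => ∑ a, labelWeight ϖ a * F p (t * genLabel ϖ a) (u * genLabel ϖ a))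
      atTop (𝓝 0)) :
    Tendsto (fun p => ∑ a, labelWeight ϖ a * ∑ b, labelWeight ϖ b *
      (signOf a * signOf b * F p (genLabel ϖ a) (genLabel ϖ b))) atTop (𝓝 0) := by
  have hϖ1 : (1 + ϖ) ≠ 0 := by positivity
  have h' : ∀ t u, Tendsto (fun p => ϖ * F p t u + F p (-ϖ * t) (-ϖ * u)) atTop (𝓝 0) := by
    intro t u
    have := (h t u).const_mul (1 + ϖ)
    rw [mul_zero] at this
    refine this.congr fun p => ?_
    rw [sum_intUnits, labelWeight_one, labelWeight_neg_one, genLabel_one, genLabel_neg_one,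
      mul_one, mul_one, mul_comm t, mul_comm u]
    field_simp
  simp only [sum_intUnits, labelWeight_one, labelWeight_neg_one, genLabel_one, genLabel_neg_one,
    signOf_one, signOf_neg_one]
  rcases lt_trichotomy ϖ 1 with hlt | rfl | hgt
  · have hz : ∀ t u, Tendsto (fun p => F p t u) atTop (𝓝 0) := by
      have hc : |-ϖ| < 1 := by rwa [abs_neg, abs_of_pos hϖ]
      refine tendsto_zero_of_scaling hF (m := -ϖ⁻¹) hc fun t u => ?_
      refine (h' (-ϖ⁻¹ * t) (-ϖ⁻¹ * u)).congr fun p => ?_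
      have e : ∀ x : ℝ, -ϖ * (-ϖ⁻¹ * x) = x := fun x => by field_simp
      rw [e, e]
      ring
    have := (((hz 1 1).const_mul (ϖ / (1 + ϖ) * (ϖ / (1 + ϖ)))).sub
      ((hz 1 (-ϖ)).const_mul (ϖ / (1 + ϖ) * (1 / (1 + ϖ))))).sub
      (((hz (-ϖ) 1).const_mul (1 / (1 + ϖ) * (ϖ / (1 + ϖ)))).sub
      ((hz (-ϖ) (-ϖ)).const_mul (1 / (1 + ϖ) * (1 / (1 + ϖ)))))
    simp only [mul_zero, sub_zero] at this
    exact this.congr fun p => by ring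
  · have h11 := (h' 1 1)
    have h12 := (h' 1 (-1))
    have := (h11.sub h12).const_mul (1 / 4)
    simp only [sub_zero, mul_zero] at this
    refine this.congr fun p => ?_
    norm_num
    ring_nf
  · have hz : ∀ t u, Tendsto (fun p => F p t u) atTop (𝓝 0) := by
      have hc : |-ϖ⁻¹| < 1 := by
        rw [abs_neg, abs_of_pos (by positivity)]
        exact inv_lt_one_of_one_lt₀ hgt
      refine tendsto_zero_of_scaling hF (m := -ϖ) hc fun t u => ?_
      have := (h' t u).const_mul ϖ⁻¹
      rw [mul_zero] at this
      refine this.congr fun p => ?_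
      rw [mul_add, inv_mul_cancel_left₀ hϖ.ne']
      ring
    have := (((hz 1 1).const_mul (ϖ / (1 + ϖ) * (ϖ / (1 + ϖ)))).sub
      ((hz 1 (-ϖ)).const_mul (ϖ / (1 + ϖ) * (1 / (1 + ϖ))))).sub
      (((hz (-ϖ) 1).const_mul (1 / (1 + ϖ) * (ϖ / (1 + ϖ)))).sub
      ((hz (-ϖ) (-ϖ)).const_mul (1 / (1 + ϖ) * (1 / (1 + ϖ)))))
    simp only [mul_zero, sub_zero] at this
    exact this.congr fun p => by ring

section
variable {θ α β r ϖ : ℝ} {ρ : ℕ → ℝ} {ell : (p : ℕ) → Clustering (sampleSize θ p) p}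

theorem le_liminf_worstRisk_of_alignment (hθ : 0 < θ) (hϖ : 0 < ϖ)
    (hell : ∀ p, Measurable fun w : Data (sampleSize θ p) p × Seed => ell p w.1 w.2)
    (h : ∀ ε > 0, ∀ᶠ p : ℕ in atTop, ∃ μ ∈ signalSet ρ α β r p,
      |alignment ϖ (ell p) μ| ≤ |(ϖ - 1) / (1 + ϖ)| + ε) :
    min 1 ϖ / (1 + ϖ) ≤ liminf (fun p : ℕ => worstRisk ρ α β r ϖ (ell p)) atTop := by
  have hϖ1 : 0 < 1 + ϖ := by positivity
  -- The bound is the error of always guessing the more likely label; in terms of the mean label it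
  -- is half of one minus its absolute value.
  have hmin : min 1 ϖ / (1 + ϖ) = (1 - |(ϖ - 1) / (1 + ϖ)|) / 2 := by
    rw [abs_div, abs_of_pos hϖ1]
    rcases le_total 1 ϖ with h1 | h1
    · rw [min_eq_left h1, abs_of_nonneg (by linarith)]; field_simp; ring
    · rw [min_eq_right h1, abs_of_nonpos (by linarith)]; field_simp; ring
  have hpos : ∀ᶠ p : ℕ in atTop, 0 < sampleSize θ p := by
    filter_upwards [eventually_gt_atTop 0] with p hp
    exact sampleSize_pos hθ hp
  refine le_of_forall_pos_le_add fun ε hε => ?_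
  have hlow : min 1 ϖ / (1 + ϖ) - ε ≤
      liminf (fun p : ℕ => worstRisk ρ α β r ϖ (ell p)) atTop := by
    refine le_liminf_of_le ?_ ?_
    · refine IsBoundedUnder.isCoboundedUnder_ge ⟨1, ?_⟩
      rw [eventually_map]
      filter_upwards [hpos] with p hp
      exact worstRisk_le_one hϖ hp (hell p)
    · filter_upwards [hpos, h (2 * ε) (by positivity)] with p hp ⟨μ, hμ, hμ'⟩
      refine le_trans ?_ ((le_hammClu hϖ hp (hell p) μ).trans
        (hammClu_le_worstRisk hϖ hp (hell p) hμ))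
      rw [hmin]
      linarith
  linarith

theorem tendsto_scaleFactor (κ : ℕ) : Tendsto (fun p => scaleFactor κ p) atTop (𝓝 0) := by
  simp only [scaleFactor_eq_rpow]
  exact (tendsto_rpow_neg_atTop (by positivity)).comp tendsto_natCast_atTop_atTop

/-- The tests are needed for all t and u, not only for values that occur as generalized labels,
because `tendsto_sum_signOf_mul` iterates the scaling of the arguments. -/
theorem le_liminf_worstRisk_of_tests (hα : 0 < α) (hβ : 0 < β) (hβα : β < 1 - α) (hθ : 0 < θ)
    (hϖ : 0 < ϖ) (hρ : ∃ a b : ℝ, 0 < a ∧ ∀ g, a ≤ ρ g ∧ ρ g ≤ b)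
    (hell : ∀ p, Measurable fun w : Data (sampleSize θ p) p × Seed => ell p w.1 w.2) {κ : ℕ}
    (h : ∀ t u, Tendsto (fun p =>
      ((altLaw (sampleSize θ p) p ρ α β (r - (1 / 2 : ℝ) ^ κ) ϖ).prod seedLaw).real
        (plantTest (ell p) κ t u) -
      ((nullLaw (sampleSize θ p) p).prod seedLaw).real (plantTest (ell p) κ t u)) atTop (𝓝 0)) :
    min 1 ϖ / (1 + ϖ) ≤ liminf (fun p : ℕ => worstRisk ρ α β r ϖ (ell p)) atTop := by
  obtain ⟨a, b, ha, hab⟩ := hρ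
  have hpos : ∀ᶠ p : ℕ in atTop, 0 < sampleSize θ p := by
    filter_upwards [eventually_gt_atTop 0] with p hp
    exact sampleSize_pos hθ hp
  set F : ℕ → ℝ → ℝ → ℝ := fun p s t => excess ρ α β r ϖ (ell p) s t with hFdef
  have hF : ∀ p s t, |F p s t| ≤ 1 := fun p s t => abs_excess_le hϖ (ell p) s t
  -- The scaling factor tends to 0, so for fixed t and u the noise weights are eventually square
  -- roots of nonnegative numbers.
  have hsmall : ∀ c : ℝ, ∀ᶠ p : ℕ in atTop, c * scaleFactor κ p * (c * scaleFactor κ p) < 1 / 2 := by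
    intro c
    have h1 := (tendsto_scaleFactor κ).const_mul c
    have h2 := h1.mul h1
    simp only [mul_zero] at h2
    exact h2.eventually (gt_mem_nhds (by norm_num))
  have hFt : ∀ t u, Tendsto (fun p => ∑ a, labelWeight ϖ a *
      F p (t * genLabel ϖ a) (u * genLabel ϖ a)) atTop (𝓝 0) := by
    intro t u
    have h4 := ((h t u).abs).const_mul 4
    rw [abs_zero, mul_zero] at h4
    refine squeeze_zero_norm' ?_ h4
    filter_upwards [hpos, eventually_gt_atTop 0, hsmall t, hsmall u, hsmall 1] with p hn hp ht hu h1
    rw [power_sub_size_plantTest hϖ (hell p) hn hp (by linarith) (by linarith)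
      (by simp only [one_mul] at h1; linarith) rfl, Real.norm_eq_abs, abs_mul, ← mul_assoc,
      abs_of_nonneg (a := (4⁻¹ : ℝ) ^ _ * _) (by positivity)]
    exact le_mul_of_one_le_left (abs_nonneg _) (one_le_four_inv_pow_clog hn)
  have hlim := tendsto_sum_signOf_mul hϖ hF hFt
  have hninv : Tendsto (fun p : ℕ => ((sampleSize θ p : ℕ) : ℝ)⁻¹) atTop (𝓝 0) := by
    refine tendsto_inv_atTop_zero.comp ?_
    have : Tendsto (fun p : ℕ => sampleSize θ p) atTop atTop :=
      tendsto_nat_floor_atTop.comp ((tendsto_rpow_atTop hθ).comp tendsto_natCast_atTop_atTop)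
    exact tendsto_natCast_atTop_atTop.comp this
  refine le_liminf_worstRisk_of_alignment hθ hϖ hell fun ε hε => ?_
  set m := |(ϖ - 1) / (1 + ϖ)| with hm
  have hm0 : 0 ≤ m := abs_nonneg _
  have hrhs := hninv.add (hlim.const_mul 4)
  simp only [mul_zero, add_zero] at hrhs
  filter_upwards [hpos, hrhs.eventually (gt_mem_nhds (show (0 : ℝ) < ε ^ 2 by positivity)),
    eventually_signalSet_nonempty hα hβ hβα ha hab r] with p hn hlt hS
  obtain ⟨μ, hμ, hμ'⟩ := exists_sq_alignment_le hϖ hn (hell p) hS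
  refine ⟨μ, hμ, abs_le_of_sq_le_sq ?_ (by positivity)⟩
  rw [← sq_abs ((ϖ - 1) / (1 + ϖ)), ← hm] at hμ'
  simp only [hFdef] at hlt
  nlinarith

end

/-! # Weak signals -/

/-- A bound for the difference of the expectations of a bounded statistic of data and seed. -/
theorem abs_sum_integral_obsLaw_sub_le {n p : ℕ} {κ : Type*} (T : Finset κ) (c : κ → ℝ)
    (v : κ → Data n p) (hc1 : ∑ k ∈ T, c k = 1) {f : Data n p × Seed → ℝ} (hf : Measurable f)
    (hf1 : ∀ z, |f z| ≤ 1) {δ : ℝ}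
    (hδ : ∑ k ∈ T, ∑ l ∈ T, c k * c l * Real.exp (dataInner (v k) (v l)) ≤ 1 + δ ^ 2)
    (hδ0 : 0 ≤ δ) :
    |∑ k ∈ T, c k * ∫ z, f z ∂obsLaw (v k) - ∫ z, f z ∂obsLaw (0 : Data n p)| ≤ δ := by
  have hint : ∀ w : Data n p, ∫ z, f z ∂obsLaw w = ∫ x, ∫ ω, f (x, ω) ∂seedLaw ∂shiftLaw w := by
    intro w
    exact integral_prod _ (Integrable.of_bound hf.aestronglyMeasurable 1 (ae_of_all _ hf1))
  simp only [hint]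
  rw [shiftLaw_zero]
  refine abs_sum_integral_shiftLaw_sub_le T c v hc1 (f := fun x => ∫ ω, f (x, ω) ∂seedLaw)
    hf.stronglyMeasurable.integral_prod_right'.measurable (fun x => ?_) hδ hδ0
  have := norm_integral_le_of_norm_le_const (μ := seedLaw) (f := fun ω => f (x, ω)) (C := 1)
    (ae_of_all _ fun ω => hf1 _)
  simpa using this

section
variable {n p : ℕ} {ϖ : ℝ} {ell : Clustering n p} {ρ : ℕ → ℝ} {α β r : ℝ}

theorem IsBlockSignal.sum_sq_le {m : ℕ} {len : Fin m → ℕ} {gap τ : ℝ} {μ : Fin p → ℝ}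
    (h : IsBlockSignal m len gap τ μ) : ∑ k, μ k ^ 2 ≤ τ ^ 2 * ∑ g, (len g : ℝ) := by
  obtain ⟨j, t, h1, h2, h3, h4, h5⟩ := h
  have hk : ∀ k, μ k ^ 2 ≤ ∑ g, if j g ≤ k ∧ (k : ℕ) < j g + len g then τ ^ 2 else 0 := by
    intro k
    by_cases hk : ∃ g, j g ≤ k ∧ (k : ℕ) < j g + len g
    · obtain ⟨g, hg⟩ := hk
      refine le_trans ?_ (Finset.single_le_sum (fun g _ => ?_) (Finset.mem_univ g))
      · rw [if_pos hg, h4 g k hg.1 hg.2, ← h3 g, sq_abs]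
      · split_ifs <;> positivity
    · push Not at hk
      rw [h5 k fun g hg => absurd hg.2 (not_lt.2 (hk g hg.1))]
      refine le_trans (by norm_num) (Finset.sum_nonneg fun g _ => ?_)
      split_ifs <;> positivity
  refine (Finset.sum_le_sum fun k _ => hk k).trans ?_
  rw [Finset.sum_comm, Finset.mul_sum]
  refine Finset.sum_le_sum fun g _ => ?_
  rw [← Finset.sum_filter, Finset.sum_const, nsmul_eq_mul, mul_comm]
  refine mul_le_mul_of_nonneg_left ?_ (sq_nonneg τ)
  have hc : (Finset.univ.filter fun k : Fin p =>
      j g ≤ k ∧ (k : ℕ) < j g + len g).card ≤ (Finset.Ico (j g) (j g + len g)).card := by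
    refine Finset.card_le_card_of_injOn (fun k => (k : ℕ)) ?_ ?_
    · intro k hk
      simpa using hk
    · exact fun a _ b _ h => Fin.ext h
  rw [Nat.card_Ico, Nat.add_sub_cancel_left] at hc
  exact_mod_cast hc

/-- The squared norm of a signal. -/
theorem sum_sq_le_of_mem_signalSet {b : ℝ} (hb0 : 0 ≤ b) (hb : ∀ g, ρ g ≤ b) (hp : 0 < p)
    {μ : Fin p → ℝ} (hμ : μ ∈ signalSet ρ α β r p) :
    ∑ k, μ k ^ 2 ≤ b * (p : ℝ) ^ (1 - β - 2 * r) := by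
  have hp' : (0 : ℝ) < p := Nat.cast_pos.2 hp
  have h := IsBlockSignal.sum_sq_le (mem_signalSet.1 hμ)
  refine h.trans ?_
  have hlen : ∀ g : Fin ⌊(p : ℝ) ^ (1 - α - β)⌋₊,
      ((⌊ρ ((g : ℕ) + 1) * (p : ℝ) ^ α⌋₊ : ℕ) : ℝ) ≤ b * (p : ℝ) ^ α := by
    intro g
    refine (Nat.cast_le.2 (Nat.floor_le_floor
      (mul_le_mul_of_nonneg_right (hb _) (by positivity)))).trans (Nat.floor_le (by positivity))
  have hsum := Finset.sum_le_card_nsmul Finset.univ _ _ fun g _ => hlen g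
  rw [Finset.card_univ, Fintype.card_fin, nsmul_eq_mul] at hsum
  have hm : ((⌊(p : ℝ) ^ (1 - α - β)⌋₊ : ℕ) : ℝ) ≤ (p : ℝ) ^ (1 - α - β) :=
    Nat.floor_le (by positivity)
  calc _ ≤ ((p : ℝ) ^ (-r)) ^ 2 * ((p : ℝ) ^ (1 - α - β) * (b * (p : ℝ) ^ α)) := by
        refine mul_le_mul_of_nonneg_left (hsum.trans ?_) (sq_nonneg _)
        exact mul_le_mul_of_nonneg_right hm (by positivity)
    _ = b * ((p : ℝ) ^ (-r) * (p : ℝ) ^ (-r) * (p : ℝ) ^ (1 - α - β) * (p : ℝ) ^ α) := by ring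
    _ = b * (p : ℝ) ^ (1 - β - 2 * r) := by
        rw [← Real.rpow_add hp', ← Real.rpow_add hp', ← Real.rpow_add hp']
        congr 2
        ring

theorem map_obsLaw_add (u v : Data n p) :
    (obsLaw v).map (fun z => (u + z.1, z.2)) = obsLaw (u + v) := by
  have := Measure.map_prod_map (shiftLaw v) seedLaw (f := fun x => u + x) (g := id) (by fun_prop)
    measurable_id
  rw [Measure.map_id, map_add_shiftLaw] at this
  exact this.symm

/-- The expectation of a bounded statistic changes little under a small change of the means. -/
theorem abs_integral_obsLaw_add_sub_le (u v : Data n p) {f : Data n p × Seed → ℝ}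
    (hf : Measurable f) (hf1 : ∀ z, |f z| ≤ 1) {δ : ℝ} (hδ0 : 0 ≤ δ)
    (hδ : Real.exp (dataInner v v) ≤ 1 + δ ^ 2) :
    |∫ z, f z ∂obsLaw (u + v) - ∫ z, f z ∂obsLaw u| ≤ δ := by
  have hm : Measurable fun z : Data n p × Seed => (u + z.1, z.2) := by fun_prop
  -- After translating the statistic by u, this is the comparison of the single shift v with the
  -- null law.
  have h := abs_sum_integral_obsLaw_sub_le (Finset.univ : Finset Unit) (fun _ => 1) (fun _ => v)
    (by simp) (f := fun z => f (u + z.1, z.2)) (hf.comp hm) (fun z => hf1 _) (δ := δ)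
    (by simpa using hδ) hδ0
  have e : ∀ w : Data n p, ∫ z, f (u + z.1, z.2) ∂obsLaw w = ∫ z, f z ∂obsLaw (u + w) := by
    intro w
    rw [← map_obsLaw_add, integral_map hm.aemeasurable hf.aestronglyMeasurable]
  simpa [e] using h

/-- For each i the mean of row i is replaced by 0, at a cost of δ because its norm is at most (1+ϖ)
times that of μ. Then the assigned label is independent of the true label of i, and the mean of
their product is the mean label times a number of modulus at most 1. -/
theorem abs_alignment_le_of_sum_sq (hϖ : 0 < ϖ) (hn : 0 < n)
    (hell : Measurable fun w : Data n p × Seed => ell w.1 w.2) (μ : Fin p → ℝ) {δ : ℝ}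
    (hδ0 : 0 ≤ δ) (hδ : Real.exp ((1 + ϖ) ^ 2 * ∑ k, μ k ^ 2) ≤ 1 + δ ^ 2) :
    |alignment ϖ ell μ| ≤ |(ϖ - 1) / (1 + ϖ)| + δ := by
  have hn' : (0 : ℝ) < n := Nat.cast_pos.2 hn
  set v : (Fin n → ℤˣ) → Data n p := fun l => outer (fun i => genLabel ϖ (l i)) μ with hv
  have hI : ∀ (i : Fin n) (w : Data n p), Integrable (fun z => signOf (ell z.1 z.2 i)) (obsLaw w) :=
    fun i w => Integrable.of_bound (measurable_signOf_ell hell i).aestronglyMeasurable 1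
      (ae_of_all _ fun z => (abs_signOf _).le)
  set e : Fin n → Data n p → ℝ := fun i w => ∫ z, signOf (ell z.1 z.2 i) ∂obsLaw w with he
  have he1 : ∀ i w, |e i w| ≤ 1 := by
    intro i w
    have := norm_integral_le_of_norm_le_const (μ := obsLaw w)
      (f := fun z => signOf (ell z.1 z.2 i)) (C := 1) (ae_of_all _ fun z => (abs_signOf _).le)
    simpa using this
  have h1 : alignment ϖ ell μ = (n : ℝ)⁻¹ * ∑ i, ∑ a, labelWeight ϖ a * (signOf a *
      ∑ l, labelsWeight ϖ l * e i (v (Function.update l i a))) := by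
    have h2 : ∀ l : Fin n → ℤˣ, ∫ z, (n : ℝ)⁻¹ * ∑ i, signOf (ell z.1 z.2 i) * signOf (l i)
        ∂obsLaw (v l) = (n : ℝ)⁻¹ * ∑ i, e i (v l) * signOf (l i) := by
      intro l
      rw [integral_const_mul, integral_finsetSum _ fun i _ => (hI i _).mul_const _]
      simp only [integral_mul_const, he]
    have h3 : alignment ϖ ell μ = ∑ l, labelsWeight ϖ l *
        ((n : ℝ)⁻¹ * ∑ i, e i (v l) * signOf (l i)) :=
      Finset.sum_congr rfl fun l _ => by rw [← h2]
    have h4 : ∀ l, labelsWeight ϖ l * ((n : ℝ)⁻¹ * ∑ i, e i (v l) * signOf (l i)) =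
        (n : ℝ)⁻¹ * ∑ i, labelsWeight ϖ l * (e i (v l) * signOf (l i)) := fun l => by
      rw [mul_left_comm, Finset.mul_sum]
    rw [h3, Finset.sum_congr rfl fun l _ => h4 l, ← Finset.mul_sum, Finset.sum_comm]
    congr 1
    refine Finset.sum_congr rfl fun i _ => ?_
    rw [sum_labelsWeight_resample hϖ i]
    refine Finset.sum_congr rfl fun a _ => ?_
    congr 1
    rw [Finset.mul_sum]
    refine Finset.sum_congr rfl fun l _ => ?_
    rw [Function.update_self]
    ring
  have hi : ∀ i, |∑ a, labelWeight ϖ a * (signOf a *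
      ∑ l, labelsWeight ϖ l * e i (v (Function.update l i a)))| ≤ |(ϖ - 1) / (1 + ϖ)| + δ := by
    intro i
    -- These are the means with row i erased, which no longer depend on the label of i.
    set u : (Fin n → ℤˣ) → Data n p := fun l =>
      outer (Function.update (fun j => genLabel ϖ (l j)) i 0) μ with hu
    set G : ℝ := ∑ l, labelsWeight ϖ l * e i (u l) with hG
    have hG1 : |G| ≤ 1 := by
      refine (Finset.abs_sum_le_sum_abs _ _).trans ?_
      rw [← sum_labelsWeight (n := n) hϖ]
      refine Finset.sum_le_sum fun l _ => ?_
      rw [abs_mul, abs_of_nonneg (labelsWeight_nonneg hϖ l)]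
      exact mul_le_of_le_one_right (labelsWeight_nonneg hϖ l) (he1 _ _)
    have hd : ∀ a, |∑ l, labelsWeight ϖ l * e i (v (Function.update l i a)) - G| ≤ δ := by
      intro a
      rw [hG, ← Finset.sum_sub_distrib]
      refine (Finset.abs_sum_le_sum_abs _ _).trans ?_
      rw [← one_mul δ, ← sum_labelsWeight (n := n) hϖ, Finset.sum_mul]
      refine Finset.sum_le_sum fun l _ => ?_
      rw [← mul_sub, abs_mul, abs_of_nonneg (labelsWeight_nonneg hϖ l)]
      refine mul_le_mul_of_nonneg_left ?_ (labelsWeight_nonneg hϖ l)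
      have hadd : v (Function.update l i a) = u l + outer (Pi.single i (genLabel ϖ a)) μ := by
        funext j k
        simp only [hv, hu, outer, Pi.add_apply]
        by_cases hj : j = i
        · subst hj; simp
        · simp [hj]
      rw [hadd]
      refine abs_integral_obsLaw_add_sub_le _ _ (measurable_signOf_ell hell i)
        (fun z => (abs_signOf _).le) hδ0 (le_trans (Real.exp_le_exp.2 ?_) hδ)
      rw [dataInner_outer, Finset.sum_eq_single i (fun j _ hj => by simp [hj]) (by simp),
        Pi.single_eq_same]
      simp only [← sq]
      refine mul_le_mul_of_nonneg_right ?_ (Finset.sum_nonneg fun k _ => sq_nonneg _)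
      rcases Int.units_eq_one_or a with rfl | rfl
      · rw [genLabel_one]; nlinarith
      · rw [genLabel_neg_one]; nlinarith
    have hsplit : ∑ a, labelWeight ϖ a * (signOf a *
        ∑ l, labelsWeight ϖ l * e i (v (Function.update l i a))) =
        (ϖ - 1) / (1 + ϖ) * G + ∑ a, labelWeight ϖ a * (signOf a *
          (∑ l, labelsWeight ϖ l * e i (v (Function.update l i a)) - G)) := by
      rw [← sum_labelWeight_mul_signOf, Finset.sum_mul, ← Finset.sum_add_distrib]
      exact Finset.sum_congr rfl fun a _ => by ring
    rw [hsplit]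
    refine (abs_add_le _ _).trans (add_le_add ?_ ?_)
    · rw [abs_mul]
      exact mul_le_of_le_one_right (abs_nonneg _) hG1
    · refine (Finset.abs_sum_le_sum_abs _ _).trans ?_
      rw [← one_mul δ, ← sum_labelWeight hϖ, Finset.sum_mul]
      refine Finset.sum_le_sum fun a _ => ?_
      rw [abs_mul, abs_mul, abs_signOf, one_mul, abs_of_nonneg (labelWeight_nonneg hϖ a)]
      exact mul_le_mul_of_nonneg_left (hd a) (labelWeight_nonneg hϖ a)
  rw [h1, abs_mul, abs_of_nonneg (by positivity)]
  have hsum : |∑ i, ∑ a, labelWeight ϖ a * (signOf a *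
      ∑ l, labelsWeight ϖ l * e i (v (Function.update l i a)))| ≤
      n * (|(ϖ - 1) / (1 + ϖ)| + δ) := by
    refine (Finset.abs_sum_le_sum_abs _ _).trans
      ((Finset.sum_le_card_nsmul _ _ _ fun i _ => hi i).trans ?_)
    rw [Finset.card_univ, Fintype.card_fin, nsmul_eq_mul]
  calc _ ≤ (n : ℝ)⁻¹ * (n * (|(ϖ - 1) / (1 + ϖ)| + δ)) :=
        mul_le_mul_of_nonneg_left hsum (by positivity)
    _ = _ := by field_simp

end

/-- Signals whose norm vanishes give no information on the labels. -/
theorem le_liminf_worstRisk_of_weak {θ α β r ϖ : ℝ} {ρ : ℕ → ℝ}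
    {ell : (p : ℕ) → Clustering (sampleSize θ p) p} (hα : 0 < α) (hβ : 0 < β) (hβα : β < 1 - α)
    (hθ : 0 < θ) (hϖ : 0 < ϖ) (hρ : ∃ a b : ℝ, 0 < a ∧ ∀ g, a ≤ ρ g ∧ ρ g ≤ b)
    (hell : ∀ p, Measurable fun w : Data (sampleSize θ p) p × Seed => ell p w.1 w.2)
    (hr : (1 - β) / 2 < r) :
    min 1 ϖ / (1 + ϖ) ≤ liminf (fun p : ℕ => worstRisk ρ α β r ϖ (ell p)) atTop := by
  obtain ⟨a, b, ha, hab⟩ := hρ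
  have hb : 0 ≤ b := ha.le.trans ((hab 0).1.trans (hab 0).2)
  refine le_liminf_worstRisk_of_alignment hθ hϖ hell fun ε hε => ?_
  have hlim : Tendsto (fun p : ℕ => Real.exp ((1 + ϖ) ^ 2 * (b * (p : ℝ) ^ (1 - β - 2 * r))))
      atTop (𝓝 1) := by
    have h1 := ((tendsto_natCast_rpow_neg (c := 1 - β - 2 * r) (by linarith)).const_mul b).const_mul
      ((1 + ϖ) ^ 2)
    simp only [mul_zero] at h1
    have := (Real.continuous_exp.tendsto 0).comp h1
    rwa [Real.exp_zero] at this
  filter_upwards [hlim.eventually (ge_mem_nhds (show (1 : ℝ) < 1 + ε ^ 2 by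
      have := sq_pos_of_pos hε; linarith)), eventually_gt_atTop 0,
    eventually_signalSet_nonempty hα hβ hβα ha hab r] with p hexp hp ⟨μ, hμ⟩
  refine ⟨μ, hμ, abs_alignment_le_of_sum_sq hϖ (sampleSize_pos hθ hp) (hell p) μ hε.le
    (le_trans (Real.exp_le_exp.2 ?_) hexp)⟩
  exact mul_le_mul_of_nonneg_left (sum_sq_le_of_mem_signalSet hb (fun g => (hab g).2) hp hμ)
    (sq_nonneg _)

/-! # The second moment of the likelihood ratio -/

section
variable {n p : ℕ} {ϖ : ℝ} {ρ : ℕ → ℝ} {α β r : ℝ}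

theorem sum_altWeight_mul_pow (d : ℕ) :
    ∑ k ∈ altIndex ρ α β r n p, ∑ k' ∈ altIndex ρ α β r n p,
      altWeight ρ α β r ϖ k * altWeight ρ α β r ϖ k' *
        dataInner (altShift ϖ k : Data n p) (altShift ϖ k') ^ d =
      labelMoment ϖ n d * signalMoment (signalSet ρ α β r p) d := by
  rw [sum_altWeight_mul_exp (fun x => x ^ d), signalMoment, mul_left_comm]
  congr 1
  rw [Finset.mul_sum]
  refine Finset.sum_congr rfl fun μ _ => ?_
  rw [mul_left_comm]
  congr 1
  rw [Finset.mul_sum]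
  refine Finset.sum_congr rfl fun ν _ => ?_
  rw [labelMoment, Finset.sum_mul]
  refine Finset.sum_congr rfl fun l _ => ?_
  rw [Finset.sum_mul]
  refine Finset.sum_congr rfl fun l' _ => ?_
  rw [mul_pow]
  simp only [mul_comm (ν _)]
  ring

/-- The partial sums of the second moment of the likelihood ratio. -/
theorem sum_chiTerm_eq (N : ℕ) :
    ∑ d ∈ Finset.range N, chiTerm ϖ n (signalSet ρ α β r p) d =
      ∑ k ∈ altIndex ρ α β r n p, ∑ k' ∈ altIndex ρ α β r n p,
        altWeight ρ α β r ϖ k * altWeight ρ α β r ϖ k' * ∑ d ∈ Finset.range N,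
          dataInner (altShift ϖ k : Data n p) (altShift ϖ k') ^ d / (d.factorial : ℝ) := by
  have e : ∀ d, chiTerm ϖ n (signalSet ρ α β r p) d = ∑ k ∈ altIndex ρ α β r n p,
      ∑ k' ∈ altIndex ρ α β r n p, altWeight ρ α β r ϖ k * altWeight ρ α β r ϖ k' *
        (dataInner (altShift ϖ k : Data n p) (altShift ϖ k') ^ d / (d.factorial : ℝ)) := by
    intro d
    rw [chiTerm, ← sum_altWeight_mul_pow, Finset.sum_div]
    simp only [Finset.sum_div, mul_div_assoc]
  simp only [e, Finset.mul_sum]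
  rw [Finset.sum_comm]
  exact Finset.sum_congr rfl fun k _ => Finset.sum_comm

/-- Bounds for the Taylor polynomials of the second moment bound the second moment. -/
theorem sum_altWeight_mul_exp_le {B : ℝ}
    (hB : ∀ N : ℕ, 0 < N → ∑ d ∈ Finset.range N, chiTerm ϖ n (signalSet ρ α β r p) d ≤ B) :
    ∑ k ∈ altIndex ρ α β r n p, ∑ k' ∈ altIndex ρ α β r n p,
      altWeight ρ α β r ϖ k * altWeight ρ α β r ϖ k' *
        Real.exp (dataInner (altShift ϖ k : Data n p) (altShift ϖ k')) ≤ B := by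
  have hexp : ∀ x : ℝ, Tendsto (fun N => ∑ d ∈ Finset.range N, x ^ d / (d.factorial : ℝ)) atTop
      (𝓝 (Real.exp x)) := by
    intro x
    rw [Real.exp_eq_exp_ℝ]
    exact (NormedSpace.expSeries_div_hasSum_exp x).tendsto_sum_nat
  have hlim : Tendsto (fun N => ∑ k ∈ altIndex ρ α β r n p, ∑ k' ∈ altIndex ρ α β r n p,
      altWeight ρ α β r ϖ k * altWeight ρ α β r ϖ k' * ∑ d ∈ Finset.range N,
        dataInner (altShift ϖ k : Data n p) (altShift ϖ k') ^ d / (d.factorial : ℝ)) atTop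
      (𝓝 (∑ k ∈ altIndex ρ α β r n p, ∑ k' ∈ altIndex ρ α β r n p,
        altWeight ρ α β r ϖ k * altWeight ρ α β r ϖ k' *
        Real.exp (dataInner (altShift ϖ k : Data n p) (altShift ϖ k')))) :=
    tendsto_finsetSum _ fun k _ => tendsto_finsetSum _ fun k' _ => (hexp _).const_mul _
  refine le_of_tendsto hlim ?_
  filter_upwards [eventually_gt_atTop 0] with N hN
  exact (sum_chiTerm_eq N).symm.le.trans (hB N hN)

end

/-- Above the statistical threshold no test does better than a trivial one. -/
theorem tendsto_power_sub_size {θ α β r ϖ : ℝ} {ρ : ℕ → ℝ} (hα : 0 < α) (hβ : 0 < β)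
    (hβα : β < 1 - α) (hθ : 0 < θ) (hϖ : 0 < ϖ) (hρ : ∃ a b : ℝ, 0 < a ∧ ∀ g, a ≤ ρ g ∧ ρ g ≤ b)
    (hr : (1 + θ + α - 2 * β) / 4 < r) (hr' : (θ + α) / 2 < r)
    {R : (p : ℕ) → Set (Data (sampleSize θ p) p × Seed)} (hR : ∀ p, MeasurableSet (R p)) :
    Tendsto (fun p => ((altLaw (sampleSize θ p) p ρ α β r ϖ).prod seedLaw).real (R p) -
      ((nullLaw (sampleSize θ p) p).prod seedLaw).real (R p)) atTop (𝓝 0) := by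
  obtain ⟨a, b, ha, hab⟩ := hρ
  -- Without a bound on the degree, min(k, n) is bounded by p^θ. The resulting exponent 2θ + 2α - 4r
  -- is negative because r > (θ + α)/2.
  have hw : Tendsto (fun p : ℕ => (p : ℝ) ^ (θ + 2 * α - 4 * r) * (p : ℝ) ^ θ) atTop (𝓝 0) := by
    refine (tendsto_natCast_rpow_neg (c := θ + 2 * α - 4 * r + θ) (by linarith)).congr' ?_
    filter_upwards [eventually_gt_atTop 0] with p hp
    exact Real.rpow_add (Nat.cast_pos.2 hp) _ _
  rw [Metric.tendsto_atTop]
  intro ε hε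
  have hev := eventually_sum_chiTerm hα hβ hβα ha hab hθ hϖ hr
    (fun p : ℕ => Real.rpow_nonneg (Nat.cast_nonneg p) θ) hw (ε := (ε / 2) ^ 2) (by positivity)
  obtain ⟨N, hN⟩ := eventually_atTop.1
    (hev.and (eventually_signalSet_nonempty hα hβ hβα ha hab r))
  refine ⟨N, fun p hp => ?_⟩
  obtain ⟨h1, hS⟩ := hN p hp
  rw [Real.dist_eq, sub_zero]
  have hreal : ∀ v : Data (sampleSize θ p) p, (obsLaw v).real (R p) =
      ∫ z, (R p).indicator (1 : Data (sampleSize θ p) p × Seed → ℝ) z ∂obsLaw v := fun v =>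
    (integral_indicator_one (hR p)).symm
  have h0 : ((nullLaw (sampleSize θ p) p).prod seedLaw).real (R p) =
      (obsLaw (0 : Data (sampleSize θ p) p)).real (R p) := rfl
  rw [real_altLaw_prod_seedLaw hϖ, h0]
  simp only [hreal]
  refine lt_of_le_of_lt (abs_sum_integral_obsLaw_sub_le _ _ _ (sum_altWeight hϖ hS)
    (measurable_one.indicator (hR p)) (fun z => ?_) (δ := ε / 2)
    (sum_altWeight_mul_exp_le fun N hN => (h1 N hN fun k _ => ?_).2) (by positivity))
    (half_lt_self hε)
  · by_cases hz : z ∈ R p <;> simp [hz]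
  · exact le_trans (Nat.cast_le.2 (min_le_right _ _)) (sampleSize_le θ p)

/-! # Gaussian integration by parts for polynomials -/

/-- The recursion for the moments of the standard normal distribution. -/
theorem integral_pow_succ_gaussianReal (k : ℕ) :
    ∫ x, x ^ (k + 1) ∂gaussianReal 0 1 = k * ∫ x, x ^ (k - 1) ∂gaussianReal 0 1 := by
  have h0 : (0 : ℝ) ∈ interior (integrableExpSet (fun x : ℝ => x) (gaussianReal 0 1)) := by simp
  set M : ℝ → ℝ := mgf (fun x : ℝ => x) (gaussianReal 0 1) with hM
  have hmom : ∀ k, ∫ x, x ^ k ∂gaussianReal 0 1 = iteratedDeriv k M 0 := fun k =>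
    (iteratedDeriv_mgf_zero h0 k).symm
  have hMe : M = fun t => Real.exp (t ^ 2 / 2) := by
    rw [hM, mgf_fun_id_gaussianReal]
    simp
  have hd : deriv M = fun t => t * M t := by
    rw [hMe]
    funext t
    have h : HasDerivAt (fun t : ℝ => Real.exp (t ^ 2 / 2)) (Real.exp (t ^ 2 / 2) * t) t := by
      have := ((hasDerivAt_pow 2 t).div_const 2).exp
      convert! this using 1
      ring
    rw [h.deriv]
    ring
  have hsm : ContDiff ℝ (k : ℕ∞) M := by
    rw [hMe]
    fun_prop
  -- In the Leibniz rule for t · M t at 0 only the term with one derivative on the factor t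
  -- survives. For k = 0 the truncated k - 1 is harmless, as it is multiplied by 0.
  rw [hmom, hmom, iteratedDeriv_succ', hd,
    iteratedDeriv_fun_mul contDiffAt_fun_id (by exact_mod_cast hsm.contDiffAt)]
  simp only [iteratedDeriv_fun_id_zero]
  rcases Nat.eq_zero_or_pos k with rfl | hk
  · simp
  · rw [Finset.sum_eq_single 1]
    · simp
    · intro i _ hi
      simp [hi]
    · intro h
      exact absurd (Finset.mem_range.2 (by omega)) h

theorem integrable_pow_gaussianReal (k : ℕ) :
    Integrable (fun x : ℝ => x ^ k) (gaussianReal 0 1) :=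
  integrable_pow_of_mem_interior_integrableExpSet (X := fun x : ℝ => x) (by simp) k

section
variable {n p : ℕ}

theorem polyEval_monomial (x : Data n p) (s : (Fin n × Fin p) →₀ ℕ) (c : ℝ) :
    polyEval x (MvPolynomial.monomial s c) = c * ∏ i, ∏ k, x i k ^ s (i, k) := by
  rw [polyEval, MvPolynomial.eval_monomial, Finsupp.prod_fintype _ _ (fun a => pow_zero _),
    Fintype.prod_prod_type]

theorem polyEval_add (x : Data n p) (f g : MvPolynomial (Fin n × Fin p) ℝ) :
    polyEval x (f + g) = polyEval x f + polyEval x g := map_add _ _ _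

theorem polyEval_sub (x : Data n p) (f g : MvPolynomial (Fin n × Fin p) ℝ) :
    polyEval x (f - g) = polyEval x f - polyEval x g := map_sub _ _ _

theorem polyEval_mul (x : Data n p) (f g : MvPolynomial (Fin n × Fin p) ℝ) :
    polyEval x (f * g) = polyEval x f * polyEval x g := map_mul _ _ _

theorem polyEval_C (x : Data n p) (c : ℝ) : polyEval x (MvPolynomial.C c) = c :=
  MvPolynomial.eval_C c

theorem polyEval_X (x : Data n p) (a : Fin n × Fin p) :
    polyEval x (MvPolynomial.X a) = x a.1 a.2 := MvPolynomial.eval_X a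

theorem polyEval_sum {κ : Type*} (x : Data n p) (T : Finset κ)
    (f : κ → MvPolynomial (Fin n × Fin p) ℝ) :
    polyEval x (∑ k ∈ T, f k) = ∑ k ∈ T, polyEval x (f k) := map_sum _ _ _

theorem integrable_polyEval (f : MvPolynomial (Fin n × Fin p) ℝ) :
    Integrable (fun x : Data n p => polyEval x f) (nullLaw n p) := by
  induction f using MvPolynomial.induction_on' with
  | monomial s c =>
    simp only [polyEval_monomial]
    refine Integrable.const_mul ?_ c
    unfold nullLaw gaussianVec
    exact Integrable.fintype_prod (f := fun i (y : Fin p → ℝ) => ∏ k, y k ^ s (i, k)) fun i =>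
      Integrable.fintype_prod (f := fun k (z : ℝ) => z ^ s (i, k)) fun k =>
        integrable_pow_gaussianReal _
  | add f g hf hg =>
    simp only [polyEval_add]
    exact hf.add hg

/-- The expectation of a polynomial under the null law. -/
def nullMean (f : MvPolynomial (Fin n × Fin p) ℝ) : ℝ := ∫ x, polyEval x f ∂nullLaw n p

theorem nullMean_add (f g : MvPolynomial (Fin n × Fin p) ℝ) :
    nullMean (f + g) = nullMean f + nullMean g := by
  simp only [nullMean, polyEval_add]
  exact integral_add (integrable_polyEval f) (integrable_polyEval g)

theorem nullMean_sub (f g : MvPolynomial (Fin n × Fin p) ℝ) :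
    nullMean (f - g) = nullMean f - nullMean g := by
  simp only [nullMean, polyEval_sub]
  exact integral_sub (integrable_polyEval f) (integrable_polyEval g)

theorem nullMean_C_mul (c : ℝ) (f : MvPolynomial (Fin n × Fin p) ℝ) :
    nullMean (MvPolynomial.C c * f) = c * nullMean f := by
  simp only [nullMean, polyEval_mul, polyEval_C]
  exact integral_const_mul _ _

theorem nullMean_sum {κ : Type*} (T : Finset κ) (f : κ → MvPolynomial (Fin n × Fin p) ℝ) :
    nullMean (∑ k ∈ T, f k) = ∑ k ∈ T, nullMean (f k) := by
  simp only [nullMean, polyEval_sum]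
  exact integral_finsetSum _ fun k _ => integrable_polyEval _

theorem nullMean_one : nullMean (1 : MvPolynomial (Fin n × Fin p) ℝ) = 1 := by
  simp [nullMean, polyEval]

theorem nullMean_zero : nullMean (0 : MvPolynomial (Fin n × Fin p) ℝ) = 0 := by
  simp [nullMean, polyEval]

theorem nullMean_monomial (s : (Fin n × Fin p) →₀ ℕ) (c : ℝ) :
    nullMean (MvPolynomial.monomial s c) = c * ∏ a, ∫ x, x ^ s a ∂gaussianReal 0 1 := by
  simp only [nullMean, polyEval_monomial]
  rw [integral_const_mul, Fintype.prod_prod_type]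
  congr 1
  unfold nullLaw gaussianVec
  rw [integral_fintype_prod_eq_prod fun i (y : Fin p → ℝ) => ∏ k, y k ^ s (i, k)]
  refine Finset.prod_congr rfl fun i _ => ?_
  exact integral_fintype_prod_eq_prod fun k (z : ℝ) => z ^ s (i, k)

/-- Gaussian integration by parts. -/
theorem nullMean_X_mul (a : Fin n × Fin p) (f : MvPolynomial (Fin n × Fin p) ℝ) :
    nullMean (MvPolynomial.X a * f) = nullMean (MvPolynomial.pderiv a f) := by
  induction f using MvPolynomial.induction_on' with
  | monomial s c =>
    rw [MvPolynomial.X, MvPolynomial.monomial_mul, one_mul, MvPolynomial.pderiv_monomial,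
      nullMean_monomial, nullMean_monomial, mul_assoc]
    congr 1
    rw [← Finset.mul_prod_erase _ _ (Finset.mem_univ a),
      ← Finset.mul_prod_erase _ (fun b => ∫ x, x ^ (s - Finsupp.single a 1 : (Fin n × Fin p) →₀ ℕ) b ∂gaussianReal 0 1)
        (Finset.mem_univ a), ← mul_assoc]
    congr 1
    · rw [Finsupp.add_apply, Finsupp.tsub_apply, Finsupp.single_eq_same, add_comm,
        integral_pow_succ_gaussianReal]
    · refine Finset.prod_congr rfl fun b hb => ?_
      have hne : b ≠ a := Finset.ne_of_mem_erase hb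
      rw [Finsupp.add_apply, Finsupp.tsub_apply, Finsupp.single_eq_of_ne hne, zero_add, tsub_zero]
  | add f g hf hg => rw [mul_add, nullMean_add, hf, hg, map_add, nullMean_add]

/-! # Directional derivatives -/

/-- The linear form `x ↦ ⟨v, x⟩`. -/
def linForm (v : Data n p) : MvPolynomial (Fin n × Fin p) ℝ :=
  ∑ a, MvPolynomial.C (v a.1 a.2) * MvPolynomial.X a

/-- The derivative in the direction `v`. -/
def dirDeriv (v : Data n p) :
    Derivation ℝ (MvPolynomial (Fin n × Fin p) ℝ) (MvPolynomial (Fin n × Fin p) ℝ) :=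
  MvPolynomial.mkDerivation ℝ fun a => MvPolynomial.C (v a.1 a.2)

theorem dirDeriv_X (v : Data n p) (a : Fin n × Fin p) :
    dirDeriv v (MvPolynomial.X a) = MvPolynomial.C (v a.1 a.2) :=
  MvPolynomial.mkDerivation_X ℝ (fun a : Fin n × Fin p => MvPolynomial.C (v a.1 a.2)) a

theorem dirDeriv_C_mul (v : Data n p) (c : ℝ) (f : MvPolynomial (Fin n × Fin p) ℝ) :
    dirDeriv v (MvPolynomial.C c * f) = MvPolynomial.C c * dirDeriv v f := by
  rw [MvPolynomial.C_mul', MvPolynomial.C_mul', Derivation.map_smul]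

theorem dirDeriv_mul (v : Data n p) (f g : MvPolynomial (Fin n × Fin p) ℝ) :
    dirDeriv v (f * g) = f * dirDeriv v g + g * dirDeriv v f := by
  rw [Derivation.leibniz, smul_eq_mul, smul_eq_mul]

theorem dirDeriv_eq_sum (v : Data n p) (f : MvPolynomial (Fin n × Fin p) ℝ) :
    dirDeriv v f = ∑ a, MvPolynomial.C (v a.1 a.2) * MvPolynomial.pderiv a f := by
  induction f using MvPolynomial.induction_on with
  | C c => simp
  | add f g hf hg => simp only [map_add, hf, hg, mul_add, Finset.sum_add_distrib]
  | mul_X f b hf =>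
    classical
    rw [dirDeriv_mul, hf, dirDeriv_X]
    simp only [MvPolynomial.pderiv_mul, MvPolynomial.pderiv_X, mul_add, Finset.sum_add_distrib,
      Finset.mul_sum]
    rw [add_comm]
    congr 1
    · exact Finset.sum_congr rfl fun a _ => by ring
    · rw [Finset.sum_eq_single b]
      · simp [mul_comm]
      · intro a _ hab
        simp [Pi.single_eq_of_ne hab.symm]
      · simp

theorem dirDeriv_linForm (u v : Data n p) :
    dirDeriv u (linForm v) = MvPolynomial.C (dataInner u v) := by
  rw [linForm, map_sum, dataInner, ← Fintype.sum_prod_type', map_sum]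
  refine Finset.sum_congr rfl fun a _ => ?_
  rw [dirDeriv_C_mul, dirDeriv_X, ← map_mul, mul_comm]

/-- Gaussian integration by parts in the direction `v`. -/
theorem nullMean_linForm_mul (v : Data n p) (f : MvPolynomial (Fin n × Fin p) ℝ) :
    nullMean (linForm v * f) = nullMean (dirDeriv v f) := by
  rw [linForm, Finset.sum_mul, dirDeriv_eq_sum, nullMean_sum, nullMean_sum]
  refine Finset.sum_congr rfl fun a _ => ?_
  rw [mul_assoc, nullMean_C_mul, nullMean_C_mul, nullMean_X_mul]

theorem iterate_dirDeriv_X_mul (v : Data n p) (a : Fin n × Fin p)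
    (f : MvPolynomial (Fin n × Fin p) ℝ) (d : ℕ) :
    (dirDeriv v)^[d + 1] (MvPolynomial.X a * f) = MvPolynomial.X a * (dirDeriv v)^[d + 1] f +
      MvPolynomial.C ((d + 1 : ℝ) * v a.1 a.2) * (dirDeriv v)^[d] f := by
  induction d with
  | zero =>
    simp only [zero_add, Function.iterate_one, Function.iterate_zero, id]
    rw [dirDeriv_mul, dirDeriv_X]
    simp [mul_comm]
  | succ d ih =>
    rw [Function.iterate_succ_apply', ih, map_add, dirDeriv_mul, dirDeriv_X, dirDeriv_C_mul,
      ← Function.iterate_succ_apply' (dirDeriv v), ← Function.iterate_succ_apply' (dirDeriv v)]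
    push_cast
    simp only [map_mul, map_add, map_one]
    ring

/-! ### Taylor's formula for polynomials. -/

/-- The Taylor polynomial of order `N` in the direction `v`. -/
def taylorSum (v : Data n p) (N : ℕ) (f : MvPolynomial (Fin n × Fin p) ℝ) :
    MvPolynomial (Fin n × Fin p) ℝ :=
  ∑ d ∈ Finset.range (N + 1), MvPolynomial.C ((d.factorial : ℝ)⁻¹) * (dirDeriv v)^[d] f

theorem iterate_dirDeriv_add (v : Data n p) (f g : MvPolynomial (Fin n × Fin p) ℝ) (d : ℕ) :
    (dirDeriv v)^[d] (f + g) = (dirDeriv v)^[d] f + (dirDeriv v)^[d] g :=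
  iterate_map_add (dirDeriv v) d f g

theorem iterate_dirDeriv_C_mul (v : Data n p) (c : ℝ) (f : MvPolynomial (Fin n × Fin p) ℝ)
    (d : ℕ) : (dirDeriv v)^[d] (MvPolynomial.C c * f) =
      MvPolynomial.C c * (dirDeriv v)^[d] f := by
  induction d with
  | zero => rfl
  | succ d ih => rw [Function.iterate_succ_apply', ih, dirDeriv_C_mul,
      ← Function.iterate_succ_apply' (dirDeriv v)]

theorem taylorSum_add (v : Data n p) (N : ℕ) (f g : MvPolynomial (Fin n × Fin p) ℝ) :
    taylorSum v N (f + g) = taylorSum v N f + taylorSum v N g := by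
  simp only [taylorSum, iterate_dirDeriv_add, mul_add, Finset.sum_add_distrib]

/-- By the Leibniz rule, since the second derivative of a variable vanishes. It mirrors the
factorization of a shifted monomial by x_a + v_a. -/
theorem taylorSum_X_mul (v : Data n p) (N : ℕ) (a : Fin n × Fin p)
    (f : MvPolynomial (Fin n × Fin p) ℝ) :
    taylorSum v (N + 1) (MvPolynomial.X a * f) =
      MvPolynomial.X a * taylorSum v (N + 1) f + MvPolynomial.C (v a.1 a.2) * taylorSum v N f := by
  rw [taylorSum, Finset.sum_range_succ', taylorSum, Finset.sum_range_succ' _ (N + 1), taylorSum]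
  simp only [iterate_dirDeriv_X_mul]
  simp only [Function.iterate_zero, id, mul_add, Finset.sum_add_distrib, Finset.mul_sum]
  have e : ∀ d : ℕ, MvPolynomial.C (((d + 1).factorial : ℝ)⁻¹) *
      (MvPolynomial.C ((d + 1 : ℝ) * v a.1 a.2) * (dirDeriv v)^[d] f) =
      MvPolynomial.C (v a.1 a.2) * (MvPolynomial.C ((d.factorial : ℝ)⁻¹) * (dirDeriv v)^[d] f) := by
    intro d
    rw [← mul_assoc, ← mul_assoc, ← map_mul, ← map_mul]
    congr 2
    rw [Nat.factorial_succ]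
    have : (d.factorial : ℝ) ≠ 0 := Nat.cast_ne_zero.2 d.factorial_ne_zero
    have : (d : ℝ) + 1 ≠ 0 := by positivity
    push_cast
    field_simp
  simp only [e]
  have e2 : ∀ d : ℕ, MvPolynomial.C (((d + 1).factorial : ℝ)⁻¹) *
      (MvPolynomial.X a * (dirDeriv v)^[d + 1] f) = MvPolynomial.X a *
        (MvPolynomial.C (((d + 1).factorial : ℝ)⁻¹) * (dirDeriv v)^[d + 1] f) := fun d => by ring
  simp only [e2]
  ring

theorem taylorSum_C (v : Data n p) (N : ℕ) (c : ℝ) :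
    taylorSum v N (MvPolynomial.C c) = MvPolynomial.C c := by
  rw [taylorSum, Finset.sum_range_succ', Finset.sum_eq_zero]
  · simp
  · intro d _
    rw [Function.iterate_succ_apply, MvPolynomial.derivation_C, iterate_map_zero, mul_zero]

/-- Induction on the degree, taking out one variable. The order M is left free above the degree,
since `taylorSum_X_mul` calls for two consecutive orders. -/
theorem polyEval_add_monomial (v x : Data n p) (N : ℕ) : ∀ M : ℕ, N ≤ M →
    ∀ (s : (Fin n × Fin p) →₀ ℕ) (c : ℝ), s.degree ≤ N →
      polyEval (v + x) (MvPolynomial.monomial s c) =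
        polyEval x (taylorSum v M (MvPolynomial.monomial s c)) := by
  have hz : ∀ (M : ℕ) (c : ℝ), polyEval (v + x) (MvPolynomial.monomial 0 c) =
      polyEval x (taylorSum v M (MvPolynomial.monomial 0 c)) := by
    intro M c
    rw [← MvPolynomial.C_apply, taylorSum_C, polyEval_C, polyEval_C]
  induction N with
  | zero =>
    intro M _ s c hs
    have : s = 0 := (Finsupp.degree_eq_zero_iff s).1 (Nat.le_zero.1 hs)
    subst this
    exact hz M c
  | succ N ih =>
    intro M hM s c hs
    obtain ⟨M, rfl⟩ : ∃ M', M = M' + 1 := ⟨M - 1, by omega⟩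
    by_cases h0 : s = 0
    · subst h0
      exact hz _ c
    · obtain ⟨a, ha⟩ := Finsupp.ne_iff.1 h0
      have hs' : s = Finsupp.single a 1 + (s - Finsupp.single a 1) := by
        rw [add_tsub_cancel_of_le]
        exact Finsupp.single_le_iff.2 (Nat.one_le_iff_ne_zero.2 ha)
      have hdeg : (s - Finsupp.single a 1).degree ≤ N := by
        have := congrArg Finsupp.degree hs'
        rw [map_add, Finsupp.degree_single] at this
        omega
      have hm : MvPolynomial.monomial s c =
          MvPolynomial.X a * MvPolynomial.monomial (s - Finsupp.single a 1) c := by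
        rw [MvPolynomial.X, MvPolynomial.monomial_mul, one_mul, ← hs']
      rw [hm, taylorSum_X_mul, polyEval_add, polyEval_mul, polyEval_mul, polyEval_mul, polyEval_X,
        polyEval_X, polyEval_C, ← ih M (by omega) _ c hdeg, ← ih (M + 1) (by omega) _ c hdeg]
      simp only [Pi.add_apply]
      ring

/-- Taylor's formula for polynomials. -/
theorem polyEval_add_eq_taylorSum (v x : Data n p) {N : ℕ} {f : MvPolynomial (Fin n × Fin p) ℝ}
    (hf : f.totalDegree ≤ N) : polyEval (v + x) f = polyEval x (taylorSum v N f) := by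
  have hT : taylorSum v N f = ∑ s ∈ f.support,
      taylorSum v N (MvPolynomial.monomial s (f.coeff s)) := by
    conv_lhs => rw [f.as_sum]
    exact map_sum (AddMonoidHom.mk' (taylorSum v N) (taylorSum_add v N)) _ _
  rw [hT, polyEval_sum]
  conv_lhs => rw [f.as_sum, polyEval_sum]
  refine Finset.sum_congr rfl fun s hs => polyEval_add_monomial v x N N le_rfl s _ ?_
  exact (MvPolynomial.le_totalDegree hs).trans hf

end

/-! # Directional Hermite polynomials -/

section
variable {n p : ℕ}

/-- The coefficient of `s ^ d` in `exp (s ⟨v, x⟩ - s² |v|² / 2)`, as a polynomial in `x`. -/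
def hermiteDir (v : Data n p) : ℕ → MvPolynomial (Fin n × Fin p) ℝ
  | 0 => 1
  | 1 => linForm v
  | d + 2 => MvPolynomial.C ((d + 2 : ℝ)⁻¹) * (linForm v * hermiteDir v (d + 1) -
      MvPolynomial.C (dataInner v v) * hermiteDir v d)

theorem C_mul_hermiteDir (v : Data n p) (d : ℕ) :
    MvPolynomial.C (d + 2 : ℝ) * hermiteDir v (d + 2) = linForm v * hermiteDir v (d + 1) -
      MvPolynomial.C (dataInner v v) * hermiteDir v d := by
  rw [hermiteDir, ← mul_assoc, ← map_mul, mul_inv_cancel₀ (by positivity), map_one, one_mul]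

theorem C_mul_cancel {c : ℝ} (hc : c ≠ 0) {f g : MvPolynomial (Fin n × Fin p) ℝ}
    (h : MvPolynomial.C c * f = MvPolynomial.C c * g) : f = g :=
  mul_left_cancel₀ (MvPolynomial.C_ne_zero.2 hc) h

/-- Differentiating the generating function in direction u multiplies it by s ⟨u, v⟩; for the
coefficients this is a shift of the index. The proof gets it from the three-term recursion,
multiplied by its denominator. -/
theorem dirDeriv_hermiteDir (u v : Data n p) (d : ℕ) :
    dirDeriv u (hermiteDir v (d + 1)) =
      MvPolynomial.C (dataInner u v) * hermiteDir v d := by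
  induction d using Nat.twoStepInduction with
  | zero => rw [hermiteDir, hermiteDir, mul_one, dirDeriv_linForm]
  | one =>
    refine C_mul_cancel (c := ((0 : ℕ) + 2 : ℝ)) (by norm_num) ?_
    rw [← dirDeriv_C_mul, C_mul_hermiteDir, map_sub, dirDeriv_mul, dirDeriv_C_mul, hermiteDir,
      hermiteDir, dirDeriv_linForm, Derivation.map_one_eq_zero]
    simp only [Nat.cast_zero, zero_add, mul_zero, sub_zero]
    rw [show (2 : ℝ) = 1 + 1 by norm_num, map_add, map_one]
    ring
  | more d ih1 ih2 =>
    refine C_mul_cancel (c := ((d + 1 : ℕ) + 2 : ℝ)) (by positivity) ?_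
    rw [← dirDeriv_C_mul, C_mul_hermiteDir, map_sub, dirDeriv_mul, dirDeriv_C_mul, ih1, ih2,
      dirDeriv_linForm]
    have h := C_mul_hermiteDir v d
    have e : MvPolynomial.C ((d + 1 : ℕ) + 2 : ℝ) = MvPolynomial.C (d + 2 : ℝ) +
        (1 : MvPolynomial (Fin n × Fin p) ℝ) := by
      rw [← map_one MvPolynomial.C, ← map_add]
      push_cast
      ring_nf
    rw [e]
    linear_combination (- MvPolynomial.C (dataInner u v)) * h

/-- Integrating by parts in ⟨v, x⟩ times the polynomial of degree d + 1, the derivative of that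
polynomial cancels the second term of the recursion. What remains moves one derivative onto f. -/
theorem nullMean_hermiteDir_mul (v : Data n p) (d : ℕ) :
    ∀ f, nullMean (hermiteDir v d * f) = (d.factorial : ℝ)⁻¹ * nullMean ((dirDeriv v)^[d] f) := by
  induction d using Nat.twoStepInduction with
  | zero => intro f; simp [hermiteDir]
  | one => intro f; simp [hermiteDir, nullMean_linForm_mul]
  | more d ih1 ih2 =>
    intro f
    have h2 : (d + 2 : ℝ) ≠ 0 := by positivity
    have h1 : (d + 2 : ℝ) * nullMean (hermiteDir v (d + 2) * f) =
        nullMean (hermiteDir v (d + 1) * dirDeriv v f) := by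
      rw [← nullMean_C_mul, ← mul_assoc, C_mul_hermiteDir, sub_mul, nullMean_sub, mul_assoc,
        nullMean_linForm_mul, dirDeriv_mul, dirDeriv_hermiteDir, nullMean_add]
      have : f * (MvPolynomial.C (dataInner v v) * hermiteDir v d) =
          MvPolynomial.C (dataInner v v) * hermiteDir v d * f := by ring
      rw [this]
      ring
    rw [ih2, ← Function.iterate_succ_apply] at h1
    have hf : ((d + 2).factorial : ℝ) = (d + 2) * ((d + 1).factorial : ℝ) := by
      rw [Nat.factorial_succ]; push_cast; ring
    rw [hf, mul_inv, mul_assoc, ← h1, inv_mul_cancel_left₀ h2]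

theorem iterate_dirDeriv_hermiteDir (u v : Data n p) (d k : ℕ) :
    (dirDeriv u)^[d] (hermiteDir v (k + d)) =
      MvPolynomial.C (dataInner u v ^ d) * hermiteDir v k := by
  induction d with
  | zero => simp
  | succ d ih =>
    rw [Function.iterate_succ_apply, ← add_assoc, dirDeriv_hermiteDir, iterate_dirDeriv_C_mul, ih,
      ← mul_assoc, ← map_mul, pow_succ']

theorem iterate_dirDeriv_hermiteDir_of_lt (u v : Data n p) {d e : ℕ} (h : e < d) :
    (dirDeriv u)^[d] (hermiteDir v e) = 0 := by
  obtain ⟨k, rfl⟩ := Nat.exists_eq_add_of_lt h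
  have h0 := iterate_dirDeriv_hermiteDir u v e 0
  rw [zero_add] at h0
  rw [show e + k + 1 = k + (1 + e) by ring, Function.iterate_add_apply,
    Function.iterate_add_apply, h0, Function.iterate_one, dirDeriv_C_mul, hermiteDir,
    Derivation.map_one_eq_zero, mul_zero, iterate_map_zero]

theorem nullMean_hermiteDir (v : Data n p) (d : ℕ) :
    nullMean (hermiteDir v d) = if d = 0 then 1 else 0 := by
  split_ifs with h
  · rw [h, hermiteDir, nullMean_one]
  · have := nullMean_hermiteDir_mul v d 1
    obtain ⟨k, rfl⟩ := Nat.exists_eq_succ_of_ne_zero h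
    rwa [mul_one, Nat.succ_eq_add_one, Function.iterate_succ_apply, Derivation.map_one_eq_zero,
      iterate_map_zero, nullMean_zero, mul_zero] at this

/-- Orthogonality relations. -/
theorem nullMean_hermiteDir_mul_hermiteDir (u v : Data n p) (d e : ℕ) :
    nullMean (hermiteDir u d * hermiteDir v e) =
      if d = e then dataInner u v ^ d / (d.factorial : ℝ) else 0 := by
  rcases lt_trichotomy e d with h | rfl | h
  · rw [if_neg h.ne', nullMean_hermiteDir_mul, iterate_dirDeriv_hermiteDir_of_lt u v h,
      nullMean_zero, mul_zero]
  · have h0 := iterate_dirDeriv_hermiteDir u v e 0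
    rw [zero_add] at h0
    rw [if_pos rfl, nullMean_hermiteDir_mul, h0, nullMean_C_mul, nullMean_hermiteDir, if_pos rfl]
    ring
  · obtain ⟨k, rfl⟩ := Nat.exists_eq_add_of_lt h
    rw [if_neg h.ne, nullMean_hermiteDir_mul, show d + k + 1 = (k + 1) + d by ring,
      iterate_dirDeriv_hermiteDir, nullMean_C_mul, nullMean_hermiteDir, if_neg (by omega)]
    ring

theorem totalDegree_linForm_le (v : Data n p) : (linForm v).totalDegree ≤ 1 := by
  refine MvPolynomial.totalDegree_finsetSum_le fun a _ => ?_
  refine (MvPolynomial.totalDegree_mul _ _).trans ?_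
  rw [MvPolynomial.totalDegree_C, MvPolynomial.totalDegree_X]

theorem totalDegree_C_mul_le (c : ℝ) (f : MvPolynomial (Fin n × Fin p) ℝ) :
    (MvPolynomial.C c * f).totalDegree ≤ f.totalDegree := by
  refine (MvPolynomial.totalDegree_mul _ _).trans ?_
  rw [MvPolynomial.totalDegree_C, zero_add]

theorem totalDegree_hermiteDir_le (v : Data n p) (d : ℕ) : (hermiteDir v d).totalDegree ≤ d := by
  induction d using Nat.twoStepInduction with
  | zero => simp [hermiteDir]
  | one => exact totalDegree_linForm_le v
  | more d ih1 ih2 =>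
    rw [hermiteDir]
    refine (totalDegree_C_mul_le _ _).trans ((MvPolynomial.totalDegree_sub _ _).trans
      (max_le ?_ ?_))
    · have := MvPolynomial.totalDegree_mul (linForm v) (hermiteDir v (d + 1))
      have := totalDegree_linForm_le v
      omega
    · exact (totalDegree_C_mul_le _ _).trans (by omega)

/-- The truncated likelihood ratio. -/
def truncRatio (v : Data n p) (N : ℕ) : MvPolynomial (Fin n × Fin p) ℝ :=
  ∑ d ∈ Finset.range (N + 1), hermiteDir v d

theorem totalDegree_truncRatio_le (v : Data n p) (N : ℕ) : (truncRatio v N).totalDegree ≤ N :=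
  MvPolynomial.totalDegree_finsetSum_le fun d hd =>
    (totalDegree_hermiteDir_le v d).trans (Nat.lt_succ_iff.1 (Finset.mem_range.1 hd))

theorem nullMean_truncRatio_mul (v : Data n p) (N : ℕ) (f : MvPolynomial (Fin n × Fin p) ℝ) :
    nullMean (truncRatio v N * f) = nullMean (taylorSum v N f) := by
  rw [truncRatio, taylorSum, Finset.sum_mul, nullMean_sum, nullMean_sum]
  exact Finset.sum_congr rfl fun d _ => by rw [nullMean_hermiteDir_mul, nullMean_C_mul]

theorem nullMean_truncRatio_mul_truncRatio (u v : Data n p) (N : ℕ) :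
    nullMean (truncRatio u N * truncRatio v N) =
      ∑ d ∈ Finset.range (N + 1), dataInner u v ^ d / (d.factorial : ℝ) := by
  rw [truncRatio, truncRatio, Finset.sum_mul_sum, nullMean_sum]
  refine Finset.sum_congr rfl fun d hd => ?_
  rw [nullMean_sum]
  simp only [nullMean_hermiteDir_mul_hermiteDir]
  rw [Finset.sum_ite_eq, if_pos hd]

theorem measurable_polyEval (f : MvPolynomial (Fin n × Fin p) ℝ) :
    Measurable fun x : Data n p => polyEval x f := by
  have h : Continuous fun (x : Data n p) (a : Fin n × Fin p) => x a.1 a.2 := by fun_prop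
  exact ((MvPolynomial.continuous_eval f).comp h).measurable

theorem integrable_shiftRatio_mul_polyEval (v : Data n p) (f : MvPolynomial (Fin n × Fin p) ℝ) :
    Integrable (fun x => shiftRatio v x * polyEval x f) (nullLaw n p) := by
  rw [← integrable_shiftLaw_iff, ← add_zero v, ← map_add_shiftLaw, shiftLaw_zero]
  have hm : Measurable fun x : Data n p => v + x := by fun_prop
  rw [integrable_map_measure (measurable_polyEval f).aestronglyMeasurable hm.aemeasurable]
  simp only [Function.comp_def, polyEval_add_eq_taylorSum v _ le_rfl]
  exact integrable_polyEval _

/-- The truncated likelihood ratio represents the shifted law on polynomials of low degree. -/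
theorem integral_shiftRatio_mul_polyEval (v : Data n p) {N : ℕ}
    {f : MvPolynomial (Fin n × Fin p) ℝ} (hf : f.totalDegree ≤ N) :
    ∫ x, shiftRatio v x * polyEval x f ∂nullLaw n p = nullMean (truncRatio v N * f) := by
  have hm : Measurable fun x : Data n p => v + x := by fun_prop
  rw [← integral_shiftLaw, ← add_zero v, ← map_add_shiftLaw, shiftLaw_zero,
    integral_map hm.aemeasurable (measurable_polyEval f).aestronglyMeasurable, add_zero,
    nullMean_truncRatio_mul]
  simp only [polyEval_add_eq_taylorSum v _ hf]
  rfl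

end

/-! ### The low-degree part of the likelihood ratio. -/

section
variable {n p : ℕ} {ϖ : ℝ} {ρ : ℕ → ℝ} {α β r : ℝ}

/-- The low-degree part of the likelihood ratio of the alternative. -/
def altTruncRatio (ρ : ℕ → ℝ) (α β r ϖ : ℝ) (n p N : ℕ) : MvPolynomial (Fin n × Fin p) ℝ :=
  ∑ k ∈ altIndex ρ α β r n p, MvPolynomial.C (altWeight ρ α β r ϖ k) * truncRatio (altShift ϖ k) N

theorem totalDegree_altTruncRatio_le (N : ℕ) :
    (altTruncRatio ρ α β r ϖ n p N).totalDegree ≤ N :=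
  MvPolynomial.totalDegree_finsetSum_le fun _ _ =>
    (totalDegree_C_mul_le _ _).trans (totalDegree_truncRatio_le _ N)

/-- By Taylor's formula each truncated ratio integrates polynomials of degree at most ⌊D⌋ exactly
like its shift. The mixture inherits this, which is the required orthogonality; the degree is an
integer, so D may be rounded down. -/
theorem isLowDegreeProjection_altTruncRatio (hϖ : 0 < ϖ) {D : ℝ} (hD : 0 ≤ D) :
    IsLowDegreeProjection (nullLaw n p)
      (fun x => ((altLaw n p ρ α β r ϖ).rnDeriv (nullLaw n p) x).toReal) D
      (altTruncRatio ρ α β r ϖ n p ⌊D⌋₊) := by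
  refine ⟨(Nat.cast_le.2 (totalDegree_altTruncRatio_le _)).trans (Nat.floor_le hD),
    fun f hf => ?_⟩
  have hf' : f.totalDegree ≤ ⌊D⌋₊ := Nat.le_floor hf
  have hae : (fun x => (((altLaw n p ρ α β r ϖ).rnDeriv (nullLaw n p) x).toReal -
      polyEval x (altTruncRatio ρ α β r ϖ n p ⌊D⌋₊)) * polyEval x f) =ᵐ[nullLaw n p]
      fun x => ∑ k ∈ altIndex ρ α β r n p,
        altWeight ρ α β r ϖ k * (shiftRatio (altShift ϖ k) x * polyEval x f) -
        polyEval x (altTruncRatio ρ α β r ϖ n p ⌊D⌋₊ * f) := by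
    filter_upwards [rnDeriv_altLaw (n := n) (p := p) (ρ := ρ) (α := α) (β := β) (r := r) hϖ]
      with x hx
    rw [hx, polyEval_mul, sub_mul, Finset.sum_mul]
    simp only [mul_assoc]
  have hI : ∀ k ∈ altIndex ρ α β r n p, Integrable (fun x => altWeight ρ α β r ϖ k *
      (shiftRatio (altShift ϖ k) x * polyEval x f)) (nullLaw n p) := fun k _ =>
    (integrable_shiftRatio_mul_polyEval _ f).const_mul _
  rw [integral_congr_ae hae, integral_sub (integrable_finsetSum _ hI) (integrable_polyEval _),
    integral_finsetSum _ hI]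
  simp only [integral_const_mul, integral_shiftRatio_mul_polyEval _ hf']
  have : ∫ x, polyEval x (altTruncRatio ρ α β r ϖ n p ⌊D⌋₊ * f) ∂nullLaw n p =
      nullMean (altTruncRatio ρ α β r ϖ n p ⌊D⌋₊ * f) := rfl
  rw [this, altTruncRatio, Finset.sum_mul, nullMean_sum]
  simp only [mul_assoc, nullMean_C_mul, sub_self]

/-- By orthogonality of Hermite polynomials of different degrees, truncating the likelihood ratio
truncates the exponential series of each e^⟨u,v⟩ in its second moment. -/
theorem integral_sq_altTruncRatio (N : ℕ) :
    ∫ x, polyEval x (altTruncRatio ρ α β r ϖ n p N) ^ 2 ∂nullLaw n p =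
      ∑ d ∈ Finset.range (N + 1), chiTerm ϖ n (signalSet ρ α β r p) d := by
  have h1 : ∫ x, polyEval x (altTruncRatio ρ α β r ϖ n p N) ^ 2 ∂nullLaw n p =
      nullMean (altTruncRatio ρ α β r ϖ n p N * altTruncRatio ρ α β r ϖ n p N) := by
    simp only [nullMean, polyEval_mul, sq]
  rw [h1, sum_chiTerm_eq, altTruncRatio, Finset.sum_mul_sum, nullMean_sum]
  refine Finset.sum_congr rfl fun k _ => ?_
  rw [nullMean_sum]
  refine Finset.sum_congr rfl fun k' _ => ?_
  rw [← nullMean_truncRatio_mul_truncRatio, ← nullMean_C_mul]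
  congr 1
  rw [map_mul]
  ring

end

/-- Above the computational threshold the low-degree norm of the likelihood ratio tends to one. -/
theorem lowDegreeNormTendsToOne {θ α β r ϖ : ℝ} {ρ : ℕ → ℝ} (hα : 0 < α) (hβ : 0 < β)
    (hβα : β < 1 - α) (hθ : 0 < θ) (hϖ : 0 < ϖ) (hρ : ∃ a b : ℝ, 0 < a ∧ ∀ g, a ≤ ρ g ∧ ρ g ≤ b)
    (hr : (1 + θ + α - 2 * β) / 4 < r) (hr' : θ / 4 + α / 2 < r) :
    LowDegreeNormTendsToOne (sampleSize θ) (fun p => nullLaw (sampleSize θ p) p)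
      (fun p => altLaw (sampleSize θ p) p ρ α β r ϖ) := by
  obtain ⟨a, b, ha, hab⟩ := hρ
  have hD : ∀ p : ℕ, 0 ≤ Real.log p ^ (1.01 : ℝ) := fun p =>
    Real.rpow_nonneg (Real.log_natCast_nonneg p) _
  refine ⟨fun p => altTruncRatio ρ α β r ϖ (sampleSize θ p) p ⌊Real.log p ^ (1.01 : ℝ)⌋₊,
    fun p => isLowDegreeProjection_altTruncRatio hϖ (hD p), ?_⟩
  simp only [integral_sq_altTruncRatio]
  rw [Metric.tendsto_atTop]
  intro ε hε
  obtain ⟨N, hN⟩ := eventually_atTop.1 (eventually_sum_chiTerm hα hβ hβα ha hab hθ hϖ hr hD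
    (tendsto_natCast_rpow_mul_log (by linarith) _) (ε := ε / 2) (by positivity))
  refine ⟨N, fun p hp => ?_⟩
  -- The sum runs over degrees up to ⌊D⌋, and 2k ≤ ⌊D⌋ gives k ≤ D, so the logarithmic bound serves
  -- as w.
  obtain ⟨h1, h2⟩ := hN p hp (⌊Real.log p ^ (1.01 : ℝ)⌋₊ + 1) (Nat.succ_pos _) fun k hk =>
    le_trans (Nat.cast_le.2 ((min_le_left _ _).trans (by omega))) (Nat.floor_le (hD p))
  rw [Real.dist_eq, abs_of_nonneg (by linarith)]
  linarith

/-! # The thresholds -/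

/-- The first two branches together form the maximum of the two numbers, with the switch at β =
(1-θ-α)/2. The third branch contradicts r ≤ (1-β)/2. -/
theorem lt_of_etaClu_lt {θ α β r : ℝ} (h : etaClu θ α β < r) (hr : r ≤ (1 - β) / 2) :
    (1 + θ + α - 2 * β) / 4 < r ∧ (θ + α) / 2 < r := by
  unfold etaClu at h
  split_ifs at h <;> constructor <;> linarith

theorem lt_of_etaCluComp_lt {θ α β r : ℝ} (h : etaCluComp θ α β < r) (hr : r ≤ (1 - β) / 2) :
    (1 + θ + α - 2 * β) / 4 < r ∧ θ / 4 + α / 2 < r := by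
  unfold etaCluComp at h
  split_ifs at h <;> constructor <;> linarith

/-- Strict inequalities leave room for the loss of signal strength in planting. -/
theorem exists_half_pow_lt {r a b : ℝ} (ha : a < r) (hb : b < r) :
    ∃ κ : ℕ, a < r - (1 / 2 : ℝ) ^ κ ∧ b < r - (1 / 2 : ℝ) ^ κ := by
  obtain ⟨κ, hκ⟩ := exists_pow_lt_of_lt_one (lt_min (sub_pos.2 ha) (sub_pos.2 hb))
    (show (1 / 2 : ℝ) < 1 by norm_num)
  have h1 := hκ.trans_le (min_le_left _ _)
  have h2 := hκ.trans_le (min_le_right _ _)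
  exact ⟨κ, by linarith, by linarith⟩

end BlockClustering

end

theorem theorem5 (θ α β r ϖ : ℝ) (ρ : ℕ → ℝ)
    (hα : 0 < α) (hθ : 0 < θ) (hθα : θ < 1 - α) (hβ : 0 < β) (hβα : β < 1 - α) (hϖ : 0 < ϖ)
    (hρ : ∃ a b : ℝ, 0 < a ∧ ∀ g, a ≤ ρ g ∧ ρ g ≤ b) :
    (BlockClustering.etaClu θ α β < r →
      ∀ ell : (p : ℕ) → BlockClustering.Clustering (BlockClustering.sampleSize θ p) p,
        (∀ p, Measurable fun w : BlockClustering.Data (BlockClustering.sampleSize θ p) p ×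
          BlockClustering.Seed => ell p w.1 w.2) →
        min 1 ϖ / (1 + ϖ) ≤
          liminf (fun p : ℕ => BlockClustering.worstRisk ρ α β r ϖ (ell p)) atTop) ∧
    (BlockClustering.LowDegreeConjecture → BlockClustering.etaCluComp θ α β < r →
      ∀ ell : (p : ℕ) → BlockClustering.Clustering (BlockClustering.sampleSize θ p) p,
        BlockClustering.PolyTimeClustering (BlockClustering.sampleSize θ) ell →
        min 1 ϖ / (1 + ϖ) ≤
          liminf (fun p : ℕ => BlockClustering.worstRisk ρ α β r ϖ (ell p)) atTop) := by
  refine ⟨fun h ell hell => ?_, fun hconj h ell hpoly => ?_⟩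
  -- Above (1-β)/2 the norm of the signal vanishes and the direct argument applies; below it the
  -- tests are used.
  · rcases lt_or_ge ((1 - β) / 2) r with hr | hr
    · exact BlockClustering.le_liminf_worstRisk_of_weak hα hβ hβα hθ hϖ hρ hell hr
    · obtain ⟨h1, h2⟩ := BlockClustering.lt_of_etaClu_lt h hr
      obtain ⟨κ, h1, h2⟩ := BlockClustering.exists_half_pow_lt h1 h2
      exact BlockClustering.le_liminf_worstRisk_of_tests hα hβ hβα hθ hϖ hρ hell fun t u =>
        BlockClustering.tendsto_power_sub_size hα hβ hβα hθ hϖ hρ h1 h2 fun p =>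
          BlockClustering.measurableSet_plantTest (hell p) κ t u
  · have hell := hpoly.measurable
    rcases lt_or_ge ((1 - β) / 2) r with hr | hr
    · exact BlockClustering.le_liminf_worstRisk_of_weak hα hβ hβα hθ hϖ hρ hell hr
    · obtain ⟨h1, h2⟩ := BlockClustering.lt_of_etaCluComp_lt h hr
      obtain ⟨κ, h1, h2⟩ := BlockClustering.exists_half_pow_lt h1 h2
      have hκ : (0 : ℝ) < (1 / 2 : ℝ) ^ κ := by positivity
      exact BlockClustering.le_liminf_worstRisk_of_tests hα hβ hβα hθ hϖ hρ hell fun t u =>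
        -- The conjecture is applied at the stronger signal. Its exponent exceeds θ/4 + α/2 > 0 and
        -- stays below (1-β)/2 < 1, as the conjecture demands.
        hconj θ α β (r - (1 / 2 : ℝ) ^ κ) ϖ ρ hα hθ hθα hβ hβα (by linarith) (by linarith) hϖ hρ
          (BlockClustering.lowDegreeNormTendsToOne hα hβ hβα hθ hϖ hρ h1 h2) _
          (BlockClustering.polyTimeTest_plantTest hpoly κ t u)
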